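/- **Setting.** Let $\Gamma^A$ ($N$ even and $N$ odd coordinates, of parity $\epsilon_A$) be local coordinates, with even coordinates ranging over an open set $U\subseteq\mathbb R^N$, on a supermanifold with a non-degenerate antisymplectic bivector $E^{AB}$ (parity $\epsilon_A+\epsilon_B+1$, $E^{BA}=-(-1)^{(\epsilon_A+1)(\epsilon_B+1)}E^{AB}$, Jacobi identity for $(f,g)=(f\overleftarrow{\partial}_A)E^{AB}(\overrightarrow{\partial}_Bg)$) and an invertible even density $\rho$ such that $\Delta_\rho=\frac{(-1)^{\epsilon_A}}{2\rho}\partial_A\rho E^{AB}\partial_B$ satisfies $\Delta_\rho^2=0$. Superfunctions are smooth and complex-valued. The zeroth-level $\hbar$ is a fixed parameter and is suppressed. Adjoin, as formal variables, $\lambda^{\alpha_0},\lambda^*_{\alpha_0}$ ($\alpha_0=1,\dots,N_0$; parities $\epsilon_{\alpha_0},\epsilon_{\alpha_0}+1$; Planck numbers $1,-1$) and $c^{\alpha_1},c^*_{\alpha_1}$ ($\alpha_1=1,\dots,N_1$; parities $\epsilon_{\alpha_1}+1,\epsilon_{\alpha_1}$; Planck numbers $2,-2$), and put $$\Delta_{[1]\min}=\Delta_\rho+(-1)^{\epsilon_{\alpha_0}}\partial_{\lambda^{\alpha_0}}\partial_{\lambda^*_{\alpha_0}}+(-1)^{\epsilon_{\alpha_1}+1}\partial_{c^{\alpha_1}}\partial_{c^*_{\alpha_1}}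 .$$ Let $X_{\min}=\sum_{n\ge0}(i\hbar_{(1)})^nX_n$ be an even action in $\{\Gamma;\lambda,\lambda^*;c,c^*\}$ of total Planck number $1$, where $\hbar_{(1)}$ has Planck number $1$ and $\Gamma$ Planck number $0$. Define $G_{\alpha_0},H,Z^{\alpha_0}{}_{\alpha_1}$ (functions of $\Gamma$) as coefficients of the terms $$X_{\min}=G_{\alpha_0}\lambda^{\alpha_0}+i\hbar_{(1)}H+\lambda^*_{\alpha_0}Z^{\alpha_0}{}_{\alpha_1}c^{\alpha_1}+\dots .$$ The bodies of the $G_{\alpha_0}$ are real-valued. Let $\omega^{\alpha_1}{}_{\alpha_0}(\Gamma)$, of parity $\epsilon_{\alpha_0}+\epsilon_{\alpha_1}$, be such that the Faddeev–Popov matrix $\Delta^{\alpha_1}{}_{\beta_1}=\omega^{\alpha_1}{}_{\alpha_0}Z^{\alpha_0}{}_{\beta_1}$ is invertible. Introduce $\pi_{\alpha_1},\pi^{*\alpha_1}$ of parities $\epsilon_{\alpha_1},\epsilon_{\alpha_1}+1$, the extended space $\Gamma_{\rm ext}=\{\Gamma;\pi,\pi^*\}$ with the extended bracket $$(f,g)_{\rm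 ext}=(f,g)+(f\overleftarrow{\partial}_{\pi_{\alpha_1}})(\overrightarrow{\partial}_{\pi^{*\alpha_1}}g)-(f\overleftarrow{\partial}_{\pi^{*\alpha_1}})(\overrightarrow{\partial}_{\pi_{\alpha_1}}g),$$ and the deformed constraints $G_{\omega,\alpha_0}=G_{\alpha_0}+\pi_{\alpha_1}\omega^{\alpha_1}{}_{\alpha_0}$. Let $F^{\alpha_0}_{\bar\omega}(\Gamma_{\rm ext})$, of parity $\epsilon_{\alpha_0}+1$ and expanded in powers of $\pi,\pi^*$, be any functions such that $\Gamma_{\rm ext}\to\{F_{\bar\omega};G_\omega\}$ is a coordinate transformation, i.e. has an invertible (right-derivative) Jacobian supermatrix, with superdeterminant $J_{\omega,\bar\omega}$ (defined up to a sign by the ordering of the coordinates; in particular both coordinate systems have the same numbers of even and odd members). **Theorem.** If the Quantum Master Equation $\Delta_{[1]\min}\exp\big(\tfrac{i}{\hbar_{(1)}}X_{\min}\big)=0$ holds, then, up to an additive integration constant, $$H=-\ln\sqrt{\frac{J_{\omega,\bar\omega}\;{\rm sdet}(F^{\alpha_0}_{\bar\omega},G_{\omega,\beta_0})_{\rm ext}}{\rho\;{\rm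 sdet}(\Delta^{\alpha_1}{}_{\beta_1})^2}}\Bigg|_{\pi=\pi^*=0}+{\cal O}(G).$$ Precisely: for every connected subset $T$ of the constraint surface $\{x\in U:\ \text{the bodies of all }G_{\alpha_0}\text{ vanish at }x\}$ there is $c\in\mathbb C$ such that near every point of $T$ there are an even superfunction $L(\Gamma)$ with $e^{2L}$ equal to the fraction above at $\pi=\pi^*=0$, and superfunctions $k^{\alpha_0}(\Gamma)$ of parity $\epsilon_{\alpha_0}$, with $H=c-L+G_{\alpha_0}k^{\alpha_0}$. -/

import Mathlib

namespace BV

noncomputable section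

/-! ### Superfunctions

`n` is the number of real (smooth) even coordinates; `W` is the type of all the other variables,
with Grassmann parity `p`.  Odd variables generate a Grassmann algebra; the even ones of `W` are
formal power series variables.  A superfunction assigns to every point of `ℝⁿ` a power series in the
even variables of `W` with coefficients in the Grassmann algebra of the odd variables of `W`.
Everything is considered on an open set `U` only; values outside `U` are irrelevant. -/

/-- The Grassmann algebra over `ℂ` generated by the odd variables. -/
abbrev Grass {W : Type} (p : W → ZMod 2) : Type :=
  ExteriorAlgebra ℂ ({w : W // p w = 1} → ℂ)

/-- Power series in the even variables of `W` with coefficients in the Grassmann algebra. -/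
abbrev Ser {W : Type} (p : W → ZMod 2) : Type :=
  MvPowerSeries {w : W // p w = 0} (Grass p)

abbrev SFun (n : ℕ) {W : Type} (p : W → ZMod 2) : Type :=
  (Fin n → ℝ) → Ser p

/-- The sign `(-1)^e`. -/
def sg (e : ZMod 2) : ℂ := if e = 0 then 1 else -1

section Superfunctions

variable {n : ℕ} {W : Type} [Fintype W] [DecidableEq W] {p : W → ZMod 2}

/-- The power series with the given coefficients. -/
def ofCoeff {W : Type} {p : W → ZMod 2} (a : ({w : W // p w = 0} →₀ ℕ) → Grass p) : Ser p := a

@[simp]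
theorem coeff_ofCoeff {W : Type} {p : W → ZMod 2} (a : ({w : W // p w = 0} →₀ ℕ) → Grass p)
    (m : {w : W // p w = 0} →₀ ℕ) : MvPowerSeries.coeff m (ofCoeff a) = a m := rfl

open Classical in
/-- The basis of monomials in the odd variables. -/
def grassBasis (p : W → ZMod 2) : Module.Basis (Finset {w : W // p w = 1}) ℂ (Grass p) :=
  letI : LinearOrder {w : W // p w = 1} := linearOrderOfSTO WellOrderingRel
  (Pi.basisFun ℂ {w : W // p w = 1}).ExteriorAlgebra

/-- The body: set all odd variables and all formal even variables to zero. -/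
def body (s : Ser p) : ℂ :=
  ExteriorAlgebra.algebraMapInv (MvPowerSeries.coeff 0 s)

/-- All component functions are smooth on `U`. -/
def IsSmooth (U : Set (Fin n → ℝ)) (f : SFun n p) : Prop :=
  ∀ (m : {w : W // p w = 0} →₀ ℕ) (l : Grass p →ₗ[ℂ] ℂ),
    ContDiffOn ℝ ((⊤ : ℕ∞) : WithTop ℕ∞) (fun x => l (MvPowerSeries.coeff m (f x))) U

/-- `f` has Grassmann parity `e` on `U`. -/
def HasParity (U : Set (Fin n → ℝ)) (e : ZMod 2) (f : SFun n p) : Prop :=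
  ∀ x ∈ U, ∀ m, CliffordAlgebra.involute (MvPowerSeries.coeff m (f x)) =
    sg e • MvPowerSeries.coeff m (f x)

/-- The coordinate functions. -/
def coord (p : W → ZMod 2) : Fin n ⊕ W → SFun n p
  | .inl i => fun x => algebraMap ℂ (Ser p) (x i)
  | .inr w => fun _ =>
      if h : p w = 0 then MvPowerSeries.X ⟨w, h⟩
      else if h : p w = 1 then
        MvPowerSeries.C (ExteriorAlgebra.ι ℂ (Pi.single (⟨w, h⟩ : {w : W // p w = 1}) (1 : ℂ)))
      else 0

/-- Partial derivative along a real coordinate, componentwise. -/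
def realD (i : Fin n) (f : SFun n p) : SFun n p := fun x =>
  ofCoeff fun m => ∑ K : Finset {w : W // p w = 1},
    (fderiv ℝ (fun y => (grassBasis p).repr (MvPowerSeries.coeff m (f y)) K) x
      (Pi.single i 1)) • grassBasis p K

/-- Partial derivative along a formal even variable. -/
def formalD (w : {w : W // p w = 0}) (f : SFun n p) : SFun n p := fun x =>
  ofCoeff fun m => ((m w + 1 : ℕ) : ℂ) • MvPowerSeries.coeff (m + Finsupp.single w 1) (f x)

/-- The left derivative `∂→f/∂v`. -/
def lD : Fin n ⊕ W → SFun n p → SFun n p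
  | .inl i, f => realD i f
  | .inr w, f =>
      if h : p w = 0 then formalD ⟨w, h⟩ f
      else if h : p w = 1 then fun x =>
        ofCoeff fun m => CliffordAlgebra.contractLeft (LinearMap.proj ⟨w, h⟩)
          (MvPowerSeries.coeff m (f x))
      else 0

/-- The right derivative `f ∂←/∂v`. -/
def rD : Fin n ⊕ W → SFun n p → SFun n p
  | .inl i, f => realD i f
  | .inr w, f =>
      if h : p w = 0 then formalD ⟨w, h⟩ f
      else if h : p w = 1 then fun x =>
        ofCoeff fun m => CliffordAlgebra.contractRight (MvPowerSeries.coeff m (f x))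
          (LinearMap.proj ⟨w, h⟩)
      else 0

/-- `f` is a smooth superfunction on `U` of parity `e`, depending, besides the real coordinates, only
on the variables in `T`. -/
structure IsFn (U : Set (Fin n → ℝ)) (T : Set W) (e : ZMod 2) (f : SFun n p) : Prop where
  smooth : IsSmooth U f
  parity : HasParity U e f
  indep : ∀ w ∉ T, ∀ x ∈ U, lD (.inr w) f x = 0

open Classical in
/-- Set the variables in `T` to zero. -/
def setZero (T : Set W) (s : Ser p) : Ser p := ofCoeff fun m =>
  if ∀ w ∈ m.support, (w : W) ∉ T then
    ExteriorAlgebra.map (LinearMap.pi fun w : {w : W // p w = 1} =>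
      if (w : W) ∈ T then 0 else LinearMap.proj w) (MvPowerSeries.coeff m s)
  else 0

/-- The exponential `e^s = e^b ∑ₖ (s - b)ᵏ / k!` with `b` the body of `s`; in each coefficient only
finitely many terms of the sum are nonzero. -/
def sexp (s : Ser p) : Ser p := ofCoeff fun m =>
  Complex.exp (body s) • ∑ᶠ k : ℕ, ((k.factorial : ℂ)⁻¹) •
    MvPowerSeries.coeff m ((s - algebraMap ℂ (Ser p) (body s)) ^ k)

end Superfunctions

/-! ### Superdeterminants -/

open Classical in
/-- Even elements are central; determinants of matrices of even elements are computed in the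
(commutative) center. -/
def toCenter {R : Type} [Ring R] (a : R) : Subring.center R :=
  if h : a ∈ Subring.center R then ⟨a, h⟩ else 0

/-- The superdeterminant `det (A - B D⁻¹ C) / det D` of an even supermatrix with blocks `A, B, C, D`,
where the index `i` has parity `e i`. -/
def sdet {R ι : Type} [Ring R] [Fintype ι] [DecidableEq ι] (e : ι → ZMod 2) (M : Matrix ι ι R) : R :=
  let A : Matrix {i // e i = 0} {i // e i = 0} R := M.submatrix Subtype.val Subtype.val
  let B : Matrix {i // e i = 0} {i // e i = 1} R := M.submatrix Subtype.val Subtype.val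
  let C : Matrix {i // e i = 1} {i // e i = 0} R := M.submatrix Subtype.val Subtype.val
  let D : Matrix {i // e i = 1} {i // e i = 1} (Subring.center R) :=
    (M.submatrix Subtype.val Subtype.val).map toCenter
  let S : Matrix {i // e i = 0} {i // e i = 0} (Subring.center R) :=
    (A - B * D⁻¹.map Subtype.val * C).map toCenter
  ((S.det * Ring.inverse D.det : Subring.center R) : R)

/-! ### The variables -/

/-- The variables other than the even zeroth-level coordinates `x^i`: the odd zeroth-level
coordinates `θ^i`, the Lagrange multipliers `λ`, the ghosts `c`, the auxiliary fields `π`, and the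
antifields of the last three. -/
inductive Fld (N N₀ N₁ : ℕ) : Type
  | th (i : Fin N)
  | lam (α : Fin N₀)
  | lamS (α : Fin N₀)
  | c (a : Fin N₁)
  | cS (a : Fin N₁)
  | pi (a : Fin N₁)
  | piS (a : Fin N₁)
  deriving DecidableEq, Fintype

section Fields

variable {N N₀ N₁ : ℕ}

/-- Grassmann parities. -/
def par (ε₀ : Fin N₀ → ZMod 2) (ε₁ : Fin N₁ → ZMod 2) : Fld N N₀ N₁ → ZMod 2
  | .th _ => 1
  | .lam α => ε₀ α
  | .lamS α => ε₀ α + 1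
  | .c a => ε₁ a + 1
  | .cS a => ε₁ a
  | .pi a => ε₁ a
  | .piS a => ε₁ a + 1

/-- Planck numbers. -/
def planck : Fld N N₀ N₁ → ℤ
  | .th _ => 0
  | .lam _ => 1
  | .lamS _ => -1
  | .c _ => 2
  | .cS _ => -2
  | .pi _ => 0
  | .piS _ => 0

/-- The variables of the zeroth-level phase space `Γ`. -/
def gammaVars : Set (Fld N N₀ N₁) := {w | ∃ i, w = .th i}

/-- The variables of the extended space `Γ_ext = {Γ; π, π*}`. -/
def extVars : Set (Fld N N₀ N₁) :=
  gammaVars ∪ {w | ∃ a, w = .pi a ∨ w = .piS a}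

/-- The variables `λ, λ*, c, c*`. -/
def levelOneVars : Set (Fld N N₀ N₁) :=
  {w | ∃ α, w = .lam α ∨ w = .lamS α} ∪ {w | ∃ a, w = .c a ∨ w = .cS a}

/-- The auxiliary variables `π, π*`. -/
def piVars : Set (Fld N N₀ N₁) := {w | ∃ a, w = .pi a ∨ w = .piS a}

/-- The zeroth-level coordinates `Γ^A`: `N` even ones and `N` odd ones. -/
def gVar : Fin N ⊕ Fin N → Fin N ⊕ Fld N N₀ N₁
  | .inl i => .inl i
  | .inr i => .inr (.th i)

def gPar : Fin N ⊕ Fin N → ZMod 2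
  | .inl _ => 0
  | .inr _ => 1

/-- The coordinates of `Γ_ext`. -/
def extVar : (Fin N ⊕ Fin N) ⊕ (Fin N₁ ⊕ Fin N₁) → Fin N ⊕ Fld N N₀ N₁
  | .inl A => gVar A
  | .inr (.inl a) => .inr (.pi a)
  | .inr (.inr a) => .inr (.piS a)

def extPar (ε₁ : Fin N₁ → ZMod 2) : (Fin N ⊕ Fin N) ⊕ (Fin N₁ ⊕ Fin N₁) → ZMod 2
  | .inl A => gPar A
  | .inr (.inl a) => ε₁ a
  | .inr (.inr a) => ε₁ a + 1

/-- The parities of the new coordinates `{F^{α₀}; G_{ω,α₀}}`. -/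
def newPar (ε₀ : Fin N₀ → ZMod 2) : Fin N₀ ⊕ Fin N₀ → ZMod 2
  | .inl α => ε₀ α + 1
  | .inr α => ε₀ α

variable {ε₀ : Fin N₀ → ZMod 2} {ε₁ : Fin N₁ → ZMod 2}

/-- Superfunctions of all variables of the theory. -/
abbrev Fun (N : ℕ) {N₀ N₁ : ℕ} (ε₀ : Fin N₀ → ZMod 2) (ε₁ : Fin N₁ → ZMod 2) : Type :=
  SFun N (par (N := N) ε₀ ε₁)

/-! ### Antisymplectic geometry -/

/-- The antibracket `(f, g) = (f ∂←_A) E^{AB} (∂→_B g)` on `Γ`. -/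
def bracket (E : Fin N ⊕ Fin N → Fin N ⊕ Fin N → Fun N ε₀ ε₁) (f g : Fun N ε₀ ε₁) : Fun N ε₀ ε₁ :=
  ∑ A, ∑ B, rD (gVar A) f * E A B * lD (gVar B) g

/-- The antibracket `(f, g)_ext` on `Γ_ext`, with `π, π*` canonical. -/
def bracketExt (E : Fin N ⊕ Fin N → Fin N ⊕ Fin N → Fun N ε₀ ε₁) (f g : Fun N ε₀ ε₁) :
    Fun N ε₀ ε₁ :=
  bracket E f g + ∑ a, (rD (.inr (.pi a)) f * lD (.inr (.piS a)) g -
    rD (.inr (.piS a)) f * lD (.inr (.pi a)) g)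

/-- The odd Laplacian `Δ_ρ f = (-1)^{ε_A} / (2ρ) ∂_A (ρ E^{AB} ∂_B f)` on `Γ`. -/
def lap (E : Fin N ⊕ Fin N → Fin N ⊕ Fin N → Fun N ε₀ ε₁) (ρ f : Fun N ε₀ ε₁) : Fun N ε₀ ε₁ :=
  fun x => ∑ A, ∑ B, (sg (gPar A) / 2) •
    (Ring.inverse (ρ x) * lD (gVar A) (ρ * E A B * lD (gVar B) f) x)

/-- The odd Laplacian on the minimal first-level phase space `{Γ; λ, λ*; c, c*}`. -/
def lapMin (E : Fin N ⊕ Fin N → Fin N ⊕ Fin N → Fun N ε₀ ε₁) (ρ f : Fun N ε₀ ε₁) : Fun N ε₀ ε₁ :=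
  lap E ρ f + ∑ α, sg (ε₀ α) • lD (.inr (.lam α)) (lD (.inr (.lamS α)) f) +
    ∑ a, sg (ε₁ a + 1) • lD (.inr (.c a)) (lD (.inr (.cS a)) f)

/-- `E^{AB}` is a non-degenerate antisymplectic bivector on `U`, `ρ` is a measure density, and they
are compatible, i.e. the odd Laplacian is nilpotent. -/
structure IsCompatible (U : Set (Fin N → ℝ))
    (E : Fin N ⊕ Fin N → Fin N ⊕ Fin N → Fun N ε₀ ε₁) (ρ : Fun N ε₀ ε₁) : Prop where
  isFn : ∀ A B, IsFn U gammaVars (gPar A + gPar B + 1) (E A B)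
  skew : ∀ A B, ∀ x ∈ U, E B A x = -(sg ((gPar A + 1) * (gPar B + 1)) • E A B x)
  jacobi : ∀ (e₁ e₂ e₃ : ZMod 2) (f g h : Fun N ε₀ ε₁),
    IsFn U gammaVars e₁ f → IsFn U gammaVars e₂ g → IsFn U gammaVars e₃ h → ∀ x ∈ U,
      sg ((e₁ + 1) * (e₃ + 1)) • bracket E f (bracket E g h) x +
      sg ((e₂ + 1) * (e₁ + 1)) • bracket E g (bracket E h f) x +
      sg ((e₃ + 1) * (e₂ + 1)) • bracket E h (bracket E f g) x = 0
  nondegenerate : ∀ x ∈ U, IsUnit (Matrix.of fun A B => E A B x)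
  density : IsFn U gammaVars 0 ρ
  density_isUnit : ∀ x ∈ U, IsUnit (ρ x)
  nilpotent : ∀ (e : ZMod 2) (f : Fun N ε₀ ε₁), IsFn U gammaVars e f →
    ∀ x ∈ U, lap E ρ (lap E ρ f) x = 0

/-! ### The gauge-fixing action

The action `X_min = ∑ₙ (iħ₁)ⁿ Xₙ` is given by its expansion coefficients in the first-level Planck
constant `ħ₁`; they are superfunctions of `{Γ; λ, λ*; c, c*}`. -/

/-- Each `Xₙ` is an even function of the minimal variables, and `X_min` has Planck number one (`ħ₁`
itself having Planck number one), so that `X_min / ħ₁` has Planck number zero. -/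
structure IsMinAction (U : Set (Fin N → ℝ)) (X : ℕ → Fun N ε₀ ε₁) : Prop where
  isFn : ∀ n, IsFn U (gammaVars ∪ levelOneVars) 0 (X n)
  planck_eq : ∀ n, ∀ x ∈ U,
    ∑ w, (planck w : ℂ) • (coord _ (.inr w) x * lD (.inr w) (X n) x) = (1 - (n : ℂ)) • X n x

/-- The value `∑ₙ (iħ)ⁿ Xₙ` of the action at `ħ₁ = ħ`; because of the Planck number condition only
finitely many `n` contribute to each coefficient. -/
def actionAt (X : ℕ → Fun N ε₀ ε₁) (ħ : ℝ) : Fun N ε₀ ε₁ := fun x =>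
  ofCoeff fun m => ∑ᶠ n : ℕ, (Complex.I * ħ) ^ n • MvPowerSeries.coeff m (X n x)

/-- The Quantum Master Equation `Δ_{[1]min} exp((i/ħ₁) X_min) = 0`. -/
def QuantumMasterEquation (U : Set (Fin N → ℝ))
    (E : Fin N ⊕ Fin N → Fin N ⊕ Fin N → Fun N ε₀ ε₁) (ρ : Fun N ε₀ ε₁)
    (X : ℕ → Fun N ε₀ ε₁) : Prop :=
  ∀ ħ : ℝ, ħ ≠ 0 → ∀ x ∈ U,
    lapMin E ρ (fun y => sexp ((Complex.I / (ħ : ℂ)) • actionAt X ħ y)) x = 0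

/-- The constraints `G_α`, from the term `G_α λ^α` of `X_min`. -/
def constraint (X : ℕ → Fun N ε₀ ε₁) (α : Fin N₀) : Fun N ε₀ ε₁ :=
  fun x => setZero levelOneVars (rD (.inr (.lam α)) (X 0) x)

/-- The quantum correction `H`, from the term `iħ₁ H` of `X_min`. -/
def quantumCorrection (X : ℕ → Fun N ε₀ ε₁) : Fun N ε₀ ε₁ :=
  fun x => setZero levelOneVars (X 1 x)

/-- The reducibility matrix `Z^α_a`, from the term `λ*_α Z^α_a c^a` of `X_min`. -/
def reducibility (X : ℕ → Fun N ε₀ ε₁) (α : Fin N₀) (a : Fin N₁) : Fun N ε₀ ε₁ :=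
  fun x => setZero levelOneVars (lD (.inr (.lamS α)) (rD (.inr (.c a)) (X 0)) x)

/-- The Faddeev–Popov matrix `Δ^a_b = ω^a_α Z^α_b`. -/
def faddeevPopov (X : ℕ → Fun N ε₀ ε₁) (ω : Fin N₁ → Fin N₀ → Fun N ε₀ ε₁) (x : Fin N → ℝ) :
    Matrix (Fin N₁) (Fin N₁) (Ser (par (N := N) ε₀ ε₁)) :=
  Matrix.of fun a b => ∑ α, ω a α x * reducibility X α b x

/-- The deformed constraints `G_{ω,α} = G_α + π_a ω^a_α`. -/
def deformed (X : ℕ → Fun N ε₀ ε₁) (ω : Fin N₁ → Fin N₀ → Fun N ε₀ ε₁) (α : Fin N₀) :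
    Fun N ε₀ ε₁ :=
  constraint X α + ∑ a, coord _ (.inr (.pi a)) * ω a α

/-- The functions `{F^α; G_{ω,α}}`. -/
def newCoord (X : ℕ → Fun N ε₀ ε₁) (ω : Fin N₁ → Fin N₀ → Fun N ε₀ ε₁)
    (F : Fin N₀ → Fun N ε₀ ε₁) : Fin N₀ ⊕ Fin N₀ → Fun N ε₀ ε₁
  | .inl α => F α
  | .inr α => deformed X ω α

/-- The Jacobian matrix `∂{F; G_ω}/∂Γ_ext` (right derivatives), the old coordinates being labelled
through the bijection `e` by the same indices as the new ones. -/
def jacobian (X : ℕ → Fun N ε₀ ε₁) (ω : Fin N₁ → Fin N₀ → Fun N ε₀ ε₁)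
    (F : Fin N₀ → Fun N ε₀ ε₁)
    (e : Fin N₀ ⊕ Fin N₀ ≃ (Fin N ⊕ Fin N) ⊕ (Fin N₁ ⊕ Fin N₁)) (x : Fin N → ℝ) :
    Matrix (Fin N₀ ⊕ Fin N₀) (Fin N₀ ⊕ Fin N₀) (Ser (par (N := N) ε₀ ε₁)) :=
  Matrix.of fun r s => rD (extVar (e s)) (newCoord X ω F r) x

/-- The matrix `(F^α, G_{ω,β})_ext`. -/
def bracketMatrix (E : Fin N ⊕ Fin N → Fin N ⊕ Fin N → Fun N ε₀ ε₁)
    (X : ℕ → Fun N ε₀ ε₁) (ω : Fin N₁ → Fin N₀ → Fun N ε₀ ε₁)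
    (F : Fin N₀ → Fun N ε₀ ε₁) (x : Fin N → ℝ) :
    Matrix (Fin N₀) (Fin N₀) (Ser (par (N := N) ε₀ ε₁)) :=
  Matrix.of fun α β => bracketExt E (F α) (deformed X ω β) x

/-- The expression under the square root,
`J sdet(F, G_ω)_ext / (ρ sdet(Δ)²)` at `π = π* = 0`. -/
def radicand (E : Fin N ⊕ Fin N → Fin N ⊕ Fin N → Fun N ε₀ ε₁) (ρ : Fun N ε₀ ε₁)
    (X : ℕ → Fun N ε₀ ε₁) (ω : Fin N₁ → Fin N₀ → Fun N ε₀ ε₁) (F : Fin N₀ → Fun N ε₀ ε₁)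
    (e : Fin N₀ ⊕ Fin N₀ ≃ (Fin N ⊕ Fin N) ⊕ (Fin N₁ ⊕ Fin N₁)) : Fun N ε₀ ε₁ := fun x =>
  setZero piVars (sdet (newPar ε₀) (jacobian X ω F e x) * sdet ε₀ (bracketMatrix E X ω F x) *
    Ring.inverse (ρ x * sdet ε₁ (faddeevPopov X ω x) ^ 2))

/-- The points of `U` on the constraint surface `G_α = 0`. -/
def onShell (U : Set (Fin N → ℝ)) (X : ℕ → Fun N ε₀ ε₁) : Set (Fin N → ℝ) :=
  {x | x ∈ U ∧ ∀ α, body (constraint X α x) = 0}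

end Fields

end

end BV

namespace BV

noncomputable section

/-! ### Signs -/

theorem sg_zero : sg 0 = 1 := by simp [sg]

theorem sg_one : sg 1 = -1 := by simp [sg]

theorem zmod2_cases (e : ZMod 2) : e = 0 ∨ e = 1 := by revert e; decide

theorem sg_add (e f : ZMod 2) : sg (e + f) = sg e * sg f := by
  have h : (1 : ZMod 2) + 1 = 0 := by decide
  rcases zmod2_cases e with rfl | rfl <;> rcases zmod2_cases f with rfl | rfl <;>
    simp [sg, h]

theorem sg_mul_self (e : ZMod 2) : sg e * sg e = 1 := by
  rcases zmod2_cases e with rfl | rfl <;> simp [sg]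

theorem sg_ne_zero (e : ZMod 2) : sg e ≠ 0 := by
  rcases zmod2_cases e with rfl | rfl <;> simp [sg]

theorem sg_smul_sg_smul {M : Type*} [AddCommGroup M] [Module ℂ M] (e : ZMod 2) (a : M) :
    sg e • sg e • a = a := by
  rw [smul_smul, sg_mul_self, one_smul]

/-! ### Supercommutative algebras -/

/-- A supercommutative algebra over `ℂ`; the grading is given by the parity involution. -/
class SuperAlgebra (R : Type*) [Ring R] [Algebra ℂ R] where
  invol : R →ₐ[ℂ] R
  invol_invol : ∀ a, invol (invol a) = a
  comm_even : ∀ a b, invol a = a → a * b = b * a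
  comm_odd : ∀ a b, invol a = -a → a * b = invol b * a

open SuperAlgebra (invol)

section SuperAlgebra

variable {R : Type*} [Ring R] [Algebra ℂ R] [SuperAlgebra R]

/-- The power of the parity involution with exponent `e`. -/
def twist (e : ZMod 2) : R →ₐ[ℂ] R := if e = 0 then AlgHom.id ℂ R else invol

@[simp]
theorem twist_zero (a : R) : twist 0 a = a := by simp [twist]

@[simp]
theorem twist_one (a : R) : twist 1 a = invol a := by simp [twist]

/-- `a` is homogeneous of parity `e`. -/
def IsHomog (e : ZMod 2) (a : R) : Prop := invol a = sg e • a

theorem isHomog_zero_iff {a : R} : IsHomog 0 a ↔ invol a = a := by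
  rw [IsHomog, sg_zero, one_smul]

theorem isHomog_one_iff {a : R} : IsHomog 1 a ↔ invol a = -a := by
  rw [IsHomog, sg_one, neg_smul, one_smul]

theorem twist_twist (e f : ZMod 2) (a : R) : twist e (twist f a) = twist (e + f) a := by
  have h : (1 : ZMod 2) + 1 = 0 := by decide
  rcases zmod2_cases e with rfl | rfl <;> rcases zmod2_cases f with rfl | rfl <;>
    simp [h, SuperAlgebra.invol_invol]

theorem twist_twist_self (e : ZMod 2) (a : R) : twist e (twist e a) = a := by
  rw [twist_twist, CharTwo.add_self_eq_zero, twist_zero]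

theorem IsHomog.twist_eq {e : ZMod 2} {a : R} (h : IsHomog e a) (f : ZMod 2) :
    twist f a = sg (f * e) • a := by
  rcases zmod2_cases f with rfl | rfl
  · simp [sg_zero]
  · rw [twist_one, one_mul]
    exact h

theorem IsHomog.mul_comm' {e : ZMod 2} {a : R} (h : IsHomog e a) (b : R) :
    a * b = twist e b * a := by
  rcases zmod2_cases e with rfl | rfl
  · rw [twist_zero]; exact SuperAlgebra.comm_even a b (isHomog_zero_iff.1 h)
  · rw [twist_one]; exact SuperAlgebra.comm_odd a b (isHomog_one_iff.1 h)

theorem IsHomog.mul_comm {e f : ZMod 2} {a b : R} (ha : IsHomog e a) (hb : IsHomog f b) :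
    a * b = sg (e * f) • (b * a) := by
  rw [ha.mul_comm', hb.twist_eq, smul_mul_assoc]

theorem IsHomog.mul {e f : ZMod 2} {a b : R} (ha : IsHomog e a) (hb : IsHomog f b) :
    IsHomog (e + f) (a * b) := by
  unfold IsHomog at *
  rw [map_mul, ha, hb, sg_add, smul_mul_smul_comm]

theorem IsHomog.mul_of_eq {e f g : ZMod 2} {a b : R} (ha : IsHomog e a) (hb : IsHomog f b)
    (h : e + f = g) : IsHomog g (a * b) := h ▸ ha.mul hb

theorem IsHomog.add {e : ZMod 2} {a b : R} (ha : IsHomog e a) (hb : IsHomog e b) :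
    IsHomog e (a + b) := by
  unfold IsHomog at *
  rw [map_add, ha, hb, smul_add]

theorem IsHomog.zero (e : ZMod 2) : IsHomog e (0 : R) := by
  unfold IsHomog
  rw [map_zero, smul_zero]

theorem IsHomog.neg {e : ZMod 2} {a : R} (ha : IsHomog e a) : IsHomog e (-a) := by
  unfold IsHomog at *
  rw [map_neg, ha, smul_neg]

theorem IsHomog.sub {e : ZMod 2} {a b : R} (ha : IsHomog e a) (hb : IsHomog e b) :
    IsHomog e (a - b) := by
  rw [sub_eq_add_neg]
  exact ha.add hb.neg

theorem IsHomog.smul {e : ZMod 2} {a : R} (ha : IsHomog e a) (c : ℂ) : IsHomog e (c • a) := by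
  unfold IsHomog at *
  rw [map_smul, ha, smul_comm]

theorem IsHomog.sum {κ : Type*} {s : Finset κ} {e : ZMod 2} {a : κ → R}
    (ha : ∀ i ∈ s, IsHomog e (a i)) : IsHomog e (∑ i ∈ s, a i) := by
  unfold IsHomog at *
  rw [map_sum, Finset.smul_sum, Finset.sum_congr rfl ha]

theorem IsHomog.one : IsHomog 0 (1 : R) := by
  rw [isHomog_zero_iff, map_one]

theorem IsHomog.algebraMap (c : ℂ) : IsHomog 0 (algebraMap ℂ R c) := by
  rw [isHomog_zero_iff, AlgHom.commutes]

theorem IsHomog.twist {e : ZMod 2} {a : R} (ha : IsHomog e a) (f : ZMod 2) :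
    IsHomog e (twist f a) := by
  rw [ha.twist_eq]
  exact ha.smul _

/-- The projection to the component of parity `e`. -/
def homogPart (e : ZMod 2) (a : R) : R := (1 / 2 : ℂ) • (a + sg e • invol a)

theorem isHomog_homogPart (e : ZMod 2) (a : R) : IsHomog e (homogPart e a) := by
  unfold IsHomog homogPart
  rw [map_smul, map_add, map_smul, SuperAlgebra.invol_invol, smul_comm (sg e), smul_add (sg e),
    sg_smul_sg_smul, add_comm]

theorem IsHomog.homogPart_eq {e : ZMod 2} {a : R} (ha : IsHomog e a) : homogPart e a = a := by
  unfold homogPart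
  rw [show invol a = sg e • a from ha, sg_smul_sg_smul, ← two_smul ℂ a, smul_smul]
  norm_num

theorem homogPart_sum {κ : Type*} (s : Finset κ) (e : ZMod 2) (a : κ → R) :
    homogPart e (∑ i ∈ s, a i) = ∑ i ∈ s, homogPart e (a i) := by
  simp only [homogPart, map_sum, Finset.smul_sum, ← Finset.sum_add_distrib]

theorem homogPart_mul {f : ZMod 2} {a : R} (ha : IsHomog f a) (e : ZMod 2) (b : R) :
    homogPart e (a * b) = a * homogPart (e + f) b := by
  simp only [homogPart, map_mul, show invol a = sg f • a from ha, sg_add, mul_smul_comm, mul_add,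
    smul_mul_assoc, smul_smul]

theorem homogPart_zero_add_one (a : R) : homogPart 0 a + homogPart 1 a = a := by
  simp only [homogPart, sg_zero, sg_one, one_smul, neg_smul, ← smul_add]
  rw [add_add_add_comm, add_neg_cancel, add_zero, ← two_smul ℂ a, smul_smul]
  norm_num

end SuperAlgebra

/-! ### Superderivations -/

/-- A family of supercommuting left derivations `D v` of parity `q v`. -/
structure SuperCalculus (R : Type*) [Ring R] [Algebra ℂ R] [SuperAlgebra R] {V : Type*}
    (q : V → ZMod 2) where
  D : V → R →ₗ[ℂ] R
  D_mul : ∀ v a b, D v (a * b) = D v a * b + twist (q v) a * D v b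
  D_invol : ∀ v a, D v (invol a) = sg (q v) • invol (D v a)
  D_comm : ∀ v w a, D v (D w a) = sg (q v * q w) • D w (D v a)

namespace SuperCalculus

variable {R : Type*} [Ring R] [Algebra ℂ R] [SuperAlgebra R] {V : Type*} {q : V → ZMod 2}
  (𝒟 : SuperCalculus R q)

/-- The right derivative. -/
def DR (v : V) : R →ₗ[ℂ] R := (twist (q v)).toLinearMap ∘ₗ 𝒟.D v

theorem DR_apply (v : V) (a : R) : 𝒟.DR v a = twist (q v) (𝒟.D v a) := rfl

theorem D_twist (v : V) (e : ZMod 2) (a : R) :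
    𝒟.D v (twist e a) = sg (q v * e) • twist e (𝒟.D v a) := by
  rcases zmod2_cases e with rfl | rfl
  · simp [sg_zero]
  · simpa using 𝒟.D_invol v a

theorem DR_mul (v : V) (a b : R) :
    𝒟.DR v (a * b) = a * 𝒟.DR v b + 𝒟.DR v a * twist (q v) b := by
  simp only [DR_apply, D_mul, map_add, map_mul, twist_twist_self]
  rw [add_comm]

theorem DR_twist (v : V) (e : ZMod 2) (a : R) :
    𝒟.DR v (twist e a) = sg (q v * e) • twist e (𝒟.DR v a) := by
  rw [DR_apply, D_twist, map_smul, twist_twist, add_comm, ← twist_twist, DR_apply]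

theorem isHomog_D {e : ZMod 2} {a : R} (h : IsHomog e a) (v : V) :
    IsHomog (e + q v) (𝒟.D v a) := by
  have h1 := 𝒟.D_invol v a
  unfold IsHomog at *
  rw [h, map_smul] at h1
  rw [sg_add, mul_comm, mul_smul, h1, smul_smul, sg_mul_self, one_smul]

theorem isHomog_DR {e : ZMod 2} {a : R} (h : IsHomog e a) (v : V) :
    IsHomog (e + q v) (𝒟.DR v a) := (𝒟.isHomog_D h v).twist _

theorem DR_eq {e : ZMod 2} {a : R} (h : IsHomog e a) (v : V) :
    𝒟.DR v a = sg (q v * (e + q v)) • 𝒟.D v a := (𝒟.isHomog_D h v).twist_eq _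

theorem D_DR (v w : V) (a : R) : 𝒟.D v (𝒟.DR w a) = 𝒟.DR w (𝒟.D v a) := by
  rw [DR_apply, D_twist, D_comm, DR_apply, map_smul, sg_smul_sg_smul]

theorem DR_comm (v w : V) (a : R) : 𝒟.DR v (𝒟.DR w a) = sg (q v * q w) • 𝒟.DR w (𝒟.DR v a) := by
  simp only [DR_apply, D_twist, map_smul]
  rw [D_comm, map_smul, map_smul, twist_twist, twist_twist, add_comm, smul_smul, smul_smul,
    mul_comm (q w)]

end SuperCalculus

set_option linter.unusedSectionVars false

open TopologicalSpace (Opens)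
open Finset (sum_congr sum_eq_zero sum_mul sum_add_distrib smul_sum mul_sum sum_neg_distrib
  sum_const_zero sum_comm sum_eq_single)
open Matrix (of_apply map_apply submatrix_apply mulVec_mulVec mulVec vecMul)
open MvPowerSeries (coeff coeff_mul)
open ExteriorAlgebra (ι algebraMapInv)
open CliffordAlgebra (involute involute_ι contractLeft_ι_mul contractLeft_algebraMap)

/-! ### Exterior algebras and power series are supercommutative -/

section Exterior

variable {M : Type*} [AddCommGroup M] [Module ℂ M]

theorem ι_mul_eq_involute_mul (v : M) (a : ExteriorAlgebra ℂ M) :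
    ι ℂ v * a = involute a * ι ℂ v := by
  induction a using CliffordAlgebra.left_induction with
  | algebraMap r => rw [AlgHom.commutes]; exact (Algebra.commutes r _).symm
  | add x y hx hy => rw [mul_add, hx, hy, map_add, add_mul]
  | ι_mul x m hx =>
    rw [map_mul, involute_ι, mul_assoc, ← hx, ← mul_assoc, ← mul_assoc, neg_mul]
    congr 1
    exact eq_neg_of_add_eq_zero_left (ExteriorAlgebra.ι_add_mul_swap v m)

theorem exterior_comm_aux (c : ℂ) (f : ExteriorAlgebra ℂ M →ₐ[ℂ] ExteriorAlgebra ℂ M)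
    (hf : ∀ v : M, f (ι ℂ v) = c • ι ℂ v) (hc : c * c = 1)
    (a : ExteriorAlgebra ℂ M) (ha : involute a = c • a)
    (b : ExteriorAlgebra ℂ M) : a * b = f b * a := by
  induction b using ExteriorAlgebra.induction with
  | algebraMap r => rw [AlgHom.commutes]; exact (Algebra.commutes r _).symm
  | ι v =>
    rw [hf, smul_mul_assoc, ι_mul_eq_involute_mul, ha, smul_mul_assoc, smul_smul, hc, one_smul]
  | mul x y hx hy => rw [map_mul, ← mul_assoc, hx, mul_assoc, hy, mul_assoc]
  | add x y hx hy => rw [map_add, mul_add, add_mul, hx, hy]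

instance : SuperAlgebra (ExteriorAlgebra ℂ M) where
  invol := involute
  invol_invol := CliffordAlgebra.involute_involute
  comm_even a b ha := exterior_comm_aux 1 (AlgHom.id ℂ _) (fun v => (one_smul ℂ _).symm)
    (mul_one 1) a (by rw [one_smul]; exact ha) b
  comm_odd a b ha := exterior_comm_aux (-1) involute
    (fun v => by rw [neg_smul, one_smul]; exact involute_ι v) (by norm_num)
    a (by rw [neg_smul, one_smul]; exact ha) b

theorem exterior_invol (a : ExteriorAlgebra ℂ M) : invol a = involute a := rfl

theorem contractLeft_mul (d : Module.Dual ℂ M) (a b : ExteriorAlgebra ℂ M) :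
    CliffordAlgebra.contractLeft d (a * b) =
      CliffordAlgebra.contractLeft d a * b + invol a * CliffordAlgebra.contractLeft d b := by
  induction a using CliffordAlgebra.left_induction generalizing b with
  | algebraMap r =>
    rw [CliffordAlgebra.contractLeft_algebraMap_mul, contractLeft_algebraMap,
      AlgHom.commutes, zero_mul, zero_add]
  | add x y hx hy => rw [add_mul, map_add, hx, hy, map_add, map_add, add_mul, add_mul]; abel
  | ι_mul x m hx =>
    rw [mul_assoc, contractLeft_ι_mul, hx, contractLeft_ι_mul,
      map_mul, exterior_invol (CliffordAlgebra.ι _ m), involute_ι, sub_mul,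
      smul_mul_assoc, mul_add]
    simp only [neg_mul, mul_assoc]
    abel

theorem contractLeft_invol (d : Module.Dual ℂ M) (a : ExteriorAlgebra ℂ M) :
    CliffordAlgebra.contractLeft d (invol a) = -invol (CliffordAlgebra.contractLeft d a) := by
  induction a using CliffordAlgebra.left_induction with
  | algebraMap r =>
    rw [contractLeft_algebraMap, map_zero, neg_zero]
    exact (congrArg _ (AlgHom.commutes _ _)).trans (contractLeft_algebraMap _ _ _)
  | add x y hx hy => rw [map_add, map_add, hx, hy, map_add, map_add, neg_add]
  | ι_mul x m hx =>
    rw [map_mul, exterior_invol (CliffordAlgebra.ι _ m), involute_ι, neg_mul,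
      map_neg, contractLeft_ι_mul, hx, contractLeft_ι_mul,
      map_sub, map_mul, map_smul, exterior_invol (CliffordAlgebra.ι _ m),
      involute_ι]
    simp

theorem contractRight_eq_invol (d : Module.Dual ℂ M) (a : ExteriorAlgebra ℂ M) :
    CliffordAlgebra.contractRight a d = invol (CliffordAlgebra.contractLeft d a) := by
  induction a using CliffordAlgebra.right_induction with
  | algebraMap r =>
    rw [contractLeft_algebraMap, CliffordAlgebra.contractRight_algebraMap, map_zero]
  | add x y hx hy => rw [map_add, map_add, LinearMap.add_apply, hx, hy, map_add]
  | mul_ι m x hx =>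
    rw [CliffordAlgebra.contractRight_mul_ι, hx, contractLeft_mul, CliffordAlgebra.contractLeft_ι,
      map_add, map_mul, map_mul, SuperAlgebra.invol_invol,
      exterior_invol (CliffordAlgebra.ι _ m), involute_ι,
      exterior_invol (algebraMap _ _ _), AlgHom.commutes, ← Algebra.commutes, ← Algebra.smul_def]
    simp [sub_eq_add_neg, add_comm]

end Exterior

section PowerSeries

variable {τ R : Type*} [Ring R] [Algebra ℂ R]

theorem coeff_csmul (m : τ →₀ ℕ) (c : ℂ) (s : MvPowerSeries τ R) :
    coeff m (c • s) = c • coeff m s := rfl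

variable [SuperAlgebra R]

instance : SuperAlgebra (MvPowerSeries τ R) where
  invol := MvPowerSeries.mapAlgHom invol
  invol_invol a := by
    ext m
    exact SuperAlgebra.invol_invol _
  comm_even a b ha := by
    classical
    ext m
    rw [coeff_mul, coeff_mul]
    refine Finset.sum_equiv (Equiv.prodComm _ _) (by simp [add_comm]) fun x _ => ?_
    refine SuperAlgebra.comm_even _ _ ?_
    exact congrArg (coeff x.1) ha
  comm_odd a b ha := by
    classical
    ext m
    rw [coeff_mul, coeff_mul]
    refine Finset.sum_equiv (Equiv.prodComm _ _) (by simp [add_comm]) fun x _ => ?_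
    refine SuperAlgebra.comm_odd _ _ ?_
    exact (congrArg (coeff x.1) ha).trans (map_neg _ _)

theorem coeff_invol (m : τ →₀ ℕ) (s : MvPowerSeries τ R) :
    coeff m (invol s) = invol (coeff m s) := rfl

theorem coeff_twist (e : ZMod 2) (m : τ →₀ ℕ) (s : MvPowerSeries τ R) :
    coeff m (twist e s) = twist e (coeff m s) := by
  rcases zmod2_cases e with rfl | rfl
  · simp
  · simp [coeff_invol]

end PowerSeries

/-! ### Derivatives along the formal variables -/

section Ser

theorem sum_antidiagonal_add_single {τ M : Type*} [DecidableEq τ] [AddCommGroup M] [Module ℂ M]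
    (m : τ →₀ ℕ) (w : τ) (g : (τ →₀ ℕ) × (τ →₀ ℕ) → M) :
    ∑ x ∈ (Finset.HasAntidiagonal.antidiagonal (m + Finsupp.single w 1) :
        Finset ((τ →₀ ℕ) × (τ →₀ ℕ))), (x.1 w : ℂ) • g x =
      ∑ x ∈ Finset.HasAntidiagonal.antidiagonal m, ((x.1 w + 1 : ℕ) : ℂ) • g (x.1 + Finsupp.single w 1, x.2) := by
  symm
  refine Finset.sum_of_injOn (fun x => (x.1 + Finsupp.single w 1, x.2)) ?_ ?_ ?_ ?_
  · rintro ⟨a, b⟩ _ ⟨a', b'⟩ _ h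
    simpa using h
  · rintro ⟨a, b⟩ h
    simp only [Finset.mem_coe, Finset.HasAntidiagonal.mem_antidiagonal] at h ⊢
    rw [← h]; abel
  · rintro ⟨a, b⟩ h h'
    have : a w = 0 := by
      by_contra h0
      refine h' ⟨(a - Finsupp.single w 1, b), ?_, ?_⟩
      · simp only [Finset.mem_coe, Finset.HasAntidiagonal.mem_antidiagonal] at h ⊢
        have h1 : a - Finsupp.single w 1 + Finsupp.single w 1 = a :=
          tsub_add_cancel_of_le (by simpa using Nat.one_le_iff_ne_zero.2 h0)
        refine add_right_cancel (b := Finsupp.single w 1) ?_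
        rw [← h, add_right_comm, h1]
      · have h1 : a - Finsupp.single w 1 + Finsupp.single w 1 = a :=
          tsub_add_cancel_of_le (by simpa using Nat.one_le_iff_ne_zero.2 h0)
        simp [h1]
    simp [this]
  · rintro ⟨a, b⟩ _
    simp

theorem sum_antidiagonal_swap' {τ M : Type*} [DecidableEq τ] [AddCommMonoid M] (m : τ →₀ ℕ)
    (g : (τ →₀ ℕ) × (τ →₀ ℕ) → M) :
    ∑ x ∈ Finset.HasAntidiagonal.antidiagonal m, g x.swap =
      ∑ x ∈ Finset.HasAntidiagonal.antidiagonal m, g x :=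
  Finset.sum_equiv (Equiv.prodComm _ _) (by simp [add_comm]) fun x _ => rfl

variable {W : Type} {p : W → ZMod 2}

/-- Apply a linear map to every coefficient. -/
def coeffMap (T : Grass p →ₗ[ℂ] Grass p) : Ser p →ₗ[ℂ] Ser p where
  toFun s := ofCoeff fun m => T (coeff m s)
  map_add' a b := by ext m; simp
  map_smul' c a := by ext m; simp

@[simp]
theorem coeff_coeffMap (T : Grass p →ₗ[ℂ] Grass p) (m) (s : Ser p) :
    coeff m (coeffMap T s) = T (coeff m s) := rfl

/-- The partial derivative along an even formal variable. -/
def evenDer (w : {w : W // p w = 0}) : Ser p →ₗ[ℂ] Ser p where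
  toFun s := ofCoeff fun m => ((m w + 1 : ℕ) : ℂ) • coeff (m + Finsupp.single w 1) s
  map_add' a b := by ext m; simp
  map_smul' c a := by
    ext m
    simp only [coeff_ofCoeff, coeff_csmul, RingHom.id_apply]
    rw [smul_comm]

@[simp]
theorem coeff_evenDer (w : {w : W // p w = 0}) (m) (s : Ser p) :
    coeff m (evenDer w s) =
      ((m w + 1 : ℕ) : ℂ) • coeff (m + Finsupp.single w 1) s := rfl

theorem evenDer_mul (w : {w : W // p w = 0}) (a b : Ser p) :
    evenDer w (a * b) = evenDer w a * b + a * evenDer w b := by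
  classical
  ext m
  rw [coeff_evenDer, coeff_mul, smul_sum, map_add, coeff_mul,
    coeff_mul]
  have key : ∀ x ∈ Finset.HasAntidiagonal.antidiagonal (m + Finsupp.single w 1),
      ((m w + 1 : ℕ) : ℂ) • (coeff x.1 a * coeff x.2 b) =
      (x.1 w : ℂ) • (coeff x.1 a * coeff x.2 b) +
      (x.2 w : ℂ) • (coeff x.1 a * coeff x.2 b) := by
    intro x hx
    rw [← add_smul]
    have := congrArg (fun f => f w) (Finset.HasAntidiagonal.mem_antidiagonal.1 hx)
    simp only [Finsupp.add_apply, Finsupp.single_eq_same] at this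
    rw [← this]
    push_cast
    rfl
  rw [sum_congr rfl key, sum_add_distrib]
  congr 1
  · rw [sum_antidiagonal_add_single m w
      (fun x => coeff x.1 a * coeff x.2 b)]
    simp only [coeff_evenDer, smul_mul_assoc]
  · rw [← sum_antidiagonal_swap']
    simp only [Prod.fst_swap, Prod.snd_swap]
    rw [sum_antidiagonal_add_single m w
      (fun x => coeff x.2 a * coeff x.1 b),
      ← sum_antidiagonal_swap']
    simp only [coeff_evenDer, mul_smul_comm, Prod.fst_swap, Prod.snd_swap]

/-- The left derivative along an odd variable. -/
def oddDer [DecidableEq W] (w : {w : W // p w = 1}) : Ser p →ₗ[ℂ] Ser p :=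
  coeffMap (CliffordAlgebra.contractLeft (LinearMap.proj w))

/-- The left derivative along a formal variable. -/
def serD [DecidableEq W] (w : W) : Ser p →ₗ[ℂ] Ser p :=
  if h : p w = 0 then evenDer ⟨w, h⟩
  else if h : p w = 1 then oddDer ⟨w, h⟩ else 0

theorem serD_even [DecidableEq W] (w : {w : W // p w = 0}) : serD (p := p) w.1 = evenDer w := by
  rw [serD, dif_pos w.2]

theorem serD_odd [DecidableEq W] (w : {w : W // p w = 1}) : serD (p := p) w.1 = oddDer w := by
  rw [serD, dif_neg (by rw [w.2]; decide), dif_pos w.2]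

theorem oddDer_mul [DecidableEq W] (w : {w : W // p w = 1}) (a b : Ser p) :
    oddDer w (a * b) = oddDer w a * b + invol a * oddDer w b := by
  classical
  ext m
  simp only [oddDer, coeff_coeffMap, map_add, coeff_mul, map_sum, contractLeft_mul,
    sum_add_distrib, coeff_invol]

/-- The derivatives along the formal variables. -/
def serCalculus [DecidableEq W] (p : W → ZMod 2) : SuperCalculus (Ser p) p where
  D w := serD w
  D_mul w a b := by
    rcases zmod2_cases (p w) with h | h
    · rw [serD_even ⟨w, h⟩, evenDer_mul, h, twist_zero]
    · rw [serD_odd ⟨w, h⟩, oddDer_mul, h, twist_one]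
  D_invol w a := by
    ext m
    rcases zmod2_cases (p w) with h | h
    · rw [serD_even ⟨w, h⟩, h, sg_zero, one_smul]
      simp [coeff_invol]
    · rw [serD_odd ⟨w, h⟩, h, sg_one, neg_smul, one_smul]
      simp [coeff_invol, oddDer, contractLeft_invol]
  D_comm v w a := by
    ext m
    rcases zmod2_cases (p v) with h | h <;> rcases zmod2_cases (p w) with h' | h'
    · rw [serD_even ⟨v, h⟩, serD_even ⟨w, h'⟩, h, h', mul_zero, sg_zero, one_smul]
      simp only [coeff_evenDer, smul_smul, Finsupp.add_apply]
      rw [add_right_comm m]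
      congr 1
      by_cases hvw : v = w
      · subst hvw
        simp
      · rw [Finsupp.single_eq_of_ne (by simpa using fun h => hvw h.symm),
          Finsupp.single_eq_of_ne (by simpa using hvw)]
        push_cast; ring
    · rw [serD_even ⟨v, h⟩, serD_odd ⟨w, h'⟩, h, zero_mul, sg_zero, one_smul]
      simp [oddDer]
    · rw [serD_odd ⟨v, h⟩, serD_even ⟨w, h'⟩, h', mul_zero, sg_zero, one_smul]
      simp [oddDer]
    · rw [serD_odd ⟨v, h⟩, serD_odd ⟨w, h'⟩, h, h', mul_one, sg_one, neg_smul, one_smul]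
      simp only [oddDer, coeff_coeffMap, map_neg]
      exact CliffordAlgebra.contractLeft_comm _ _ _

variable {n : ℕ} [Fintype W] [DecidableEq W]

theorem lD_inr (w : W) (f : SFun n p) : lD (.inr w) f = fun x => serD w (f x) := by
  funext x
  rcases zmod2_cases (p w) with h | h
  · rw [serD_even ⟨w, h⟩]
    simp only [lD, dif_pos h]
    rfl
  · rw [serD_odd ⟨w, h⟩]
    have h0 : ¬ p w = 0 := by rw [h]; decide
    simp only [lD, dif_neg h0, dif_pos h]
    rfl

theorem rD_inr (w : W) (f : SFun n p) : rD (.inr w) f = fun x => (serCalculus p).DR w (f x) := by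
  funext x
  rw [SuperCalculus.DR_apply]
  change _ = twist (p w) (serD w (f x))
  rcases zmod2_cases (p w) with h | h
  · rw [serD_even ⟨w, h⟩, h, twist_zero]
    simp only [rD, dif_pos h]
    rfl
  · rw [serD_odd ⟨w, h⟩, h, twist_one]
    have h0 : ¬ p w = 0 := by rw [h]; decide
    simp only [rD, dif_neg h0, dif_pos h]
    ext m
    rw [coeff_ofCoeff, contractRight_eq_invol, coeff_invol]
    rfl

end Ser

/-! ### Setting variables to zero -/

section SetZero

theorem contractLeft_map {M N : Type*} [AddCommGroup M] [Module ℂ M] [AddCommGroup N] [Module ℂ N]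
    (f : M →ₗ[ℂ] N) (d : Module.Dual ℂ N) (a : ExteriorAlgebra ℂ M) :
    CliffordAlgebra.contractLeft d (ExteriorAlgebra.map f a) =
      ExteriorAlgebra.map f (CliffordAlgebra.contractLeft (d ∘ₗ f) a) := by
  induction a using CliffordAlgebra.left_induction with
  | algebraMap r =>
    rw [contractLeft_algebraMap, map_zero]
    exact (congrArg _ (AlgHom.commutes _ _)).trans (contractLeft_algebraMap _ _ _)
  | add x y hx hy => simp only [map_add, hx, hy]
  | ι_mul x m hx =>
    have h : ExteriorAlgebra.map f (CliffordAlgebra.ι 0 m) = CliffordAlgebra.ι 0 (f m) :=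
      ExteriorAlgebra.map_apply_ι f m
    rw [map_mul, h, contractLeft_ι_mul, contractLeft_ι_mul, hx,
      map_sub, map_mul, h, map_smul]
    rfl

theorem involute_map {M N : Type*} [AddCommGroup M] [Module ℂ M] [AddCommGroup N] [Module ℂ N]
    (f : M →ₗ[ℂ] N) (a : ExteriorAlgebra ℂ M) :
    invol (ExteriorAlgebra.map f a) = ExteriorAlgebra.map f (invol a) := by
  induction a using ExteriorAlgebra.induction with
  | algebraMap r => simp only [AlgHom.commutes]
  | ι v =>
    rw [ExteriorAlgebra.map_apply_ι,
      show invol (ι ℂ (f v)) = -ι ℂ (f v) from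
        involute_ι _,
      show invol (ι ℂ v) = -ι ℂ v from
        involute_ι _, map_neg, ExteriorAlgebra.map_apply_ι]
  | mul x y hx hy => simp only [map_mul, hx, hy]
  | add x y hx hy => simp only [map_add, hx, hy]

variable {W : Type} [Fintype W] [DecidableEq W] {p : W → ZMod 2}

open Classical in
/-- The projection killing the odd variables in `T`. -/
def oddProj (p : W → ZMod 2) (T : Set W) :
    ({w : W // p w = 1} → ℂ) →ₗ[ℂ] ({w : W // p w = 1} → ℂ) :=
  LinearMap.pi fun w => if (w : W) ∈ T then 0 else LinearMap.proj w

theorem oddProj_apply_of_mem {T : Set W} {w : {w : W // p w = 1}} (h : (w : W) ∈ T) (v) :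
    oddProj p T v w = 0 := by
  simp [oddProj, h]

theorem oddProj_apply_of_notMem {T : Set W} {w : {w : W // p w = 1}} (h : (w : W) ∉ T) (v) :
    oddProj p T v w = v w := by
  simp [oddProj, h]

theorem oddProj_oddProj (T T' : Set W) :
    oddProj p T ∘ₗ oddProj p T' = oddProj p (T ∪ T') := by
  refine LinearMap.ext fun v => ?_
  funext w
  by_cases h : (w : W) ∈ T <;> by_cases h' : (w : W) ∈ T' <;>
    simp [oddProj, h, h']

/-- The monomial with exponent `m` does not contain variables of `T`. -/
def Avoids (T : Set W) (m : {w : W // p w = 0} →₀ ℕ) : Prop := ∀ w ∈ m.support, (w : W) ∉ T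

theorem avoids_add {T : Set W} {m m' : {w : W // p w = 0} →₀ ℕ} :
    Avoids T (m + m') ↔ Avoids T m ∧ Avoids T m' := by
  simp only [Avoids, Finsupp.mem_support_iff, Finsupp.add_apply, ne_eq, Nat.add_eq_zero_iff,
    not_and_or, or_imp, forall_and]

theorem avoids_union {T T' : Set W} {m : {w : W // p w = 0} →₀ ℕ} :
    Avoids (T ∪ T') m ↔ Avoids T m ∧ Avoids T' m := by
  simp only [Avoids, Set.mem_union, not_or, ← forall_and]

theorem avoids_zero (T : Set W) : Avoids (p := p) T 0 := by simp [Avoids]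

open Classical in
theorem coeff_setZero (T : Set W) (s : Ser p) (m) :
    coeff m (setZero T s) =
      if Avoids T m then ExteriorAlgebra.map (oddProj p T) (coeff m s) else 0 := by
  rw [setZero, coeff_ofCoeff]
  by_cases h : Avoids T m
  · rw [if_pos h]; exact if_pos h
  · rw [if_neg h]; exact if_neg h

theorem coeff_setZero_of_avoids {T : Set W} {m} (h : Avoids T m) (s : Ser p) :
    coeff m (setZero T s) =
      ExteriorAlgebra.map (oddProj p T) (coeff m s) := by
  rw [coeff_setZero, if_pos h]

theorem coeff_setZero_of_not_avoids {T : Set W} {m} (h : ¬ Avoids T m) (s : Ser p) :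
    coeff m (setZero T s) = 0 := by
  rw [coeff_setZero, if_neg h]

/-- Setting variables to zero is a homomorphism of algebras. -/
def setZeroHom (T : Set W) : Ser p →ₐ[ℂ] Ser p where
  toFun := setZero T
  map_one' := by
    classical
    ext m
    by_cases h : Avoids T m
    · rw [coeff_setZero_of_avoids h, MvPowerSeries.coeff_one]
      split_ifs <;> simp
    · rw [coeff_setZero_of_not_avoids h, MvPowerSeries.coeff_one, if_neg]
      rintro rfl
      exact h (avoids_zero T)
  map_mul' a b := by
    classical
    ext m
    rw [coeff_mul]
    by_cases h : Avoids T m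
    · rw [coeff_setZero_of_avoids h, coeff_mul, map_sum]
      refine sum_congr rfl fun x hx => ?_
      rw [← Finset.HasAntidiagonal.mem_antidiagonal.1 hx, avoids_add] at h
      rw [map_mul, coeff_setZero_of_avoids h.1, coeff_setZero_of_avoids h.2]
    · rw [coeff_setZero_of_not_avoids h]
      symm
      refine sum_eq_zero fun x hx => ?_
      rw [← Finset.HasAntidiagonal.mem_antidiagonal.1 hx, avoids_add, not_and_or] at h
      rcases h with h | h
      · rw [coeff_setZero_of_not_avoids h, zero_mul]
      · rw [coeff_setZero_of_not_avoids h, mul_zero]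
  map_zero' := by
    ext m
    classical
    rw [coeff_setZero]
    split_ifs <;> simp
  map_add' a b := by
    ext m
    classical
    rw [map_add]
    simp only [coeff_setZero]
    split_ifs <;> simp
  commutes' c := by
    classical
    ext m
    rw [coeff_setZero, MvPowerSeries.algebraMap_apply, MvPowerSeries.coeff_C]
    by_cases h : m = 0
    · subst h
      rw [if_pos (avoids_zero T), if_pos rfl, AlgHom.commutes]
    · rw [if_neg h, map_zero, ite_self]

theorem setZeroHom_apply (T : Set W) (s : Ser p) : setZeroHom T s = setZero T s := rfl

theorem setZero_setZero (T T' : Set W) (s : Ser p) :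
    setZero T (setZero T' s) = setZero (T ∪ T') s := by
  ext m
  by_cases h : Avoids T m
  · by_cases h' : Avoids T' m
    · rw [coeff_setZero_of_avoids h, coeff_setZero_of_avoids h',
        coeff_setZero_of_avoids (avoids_union.2 ⟨h, h'⟩), ← oddProj_oddProj,
        ← ExteriorAlgebra.map_comp_map]
      rfl
    · rw [coeff_setZero_of_avoids h, coeff_setZero_of_not_avoids h',
        coeff_setZero_of_not_avoids (fun hh => h' (avoids_union.1 hh).2), map_zero]
  · rw [coeff_setZero_of_not_avoids h,
      coeff_setZero_of_not_avoids (fun hh => h (avoids_union.1 hh).1)]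

theorem setZero_invol (T : Set W) (s : Ser p) : setZero T (invol s) = invol (setZero T s) := by
  ext m
  by_cases h : Avoids T m
  · rw [coeff_setZero_of_avoids h, coeff_invol, coeff_invol, coeff_setZero_of_avoids h,
      involute_map]
  · rw [coeff_setZero_of_not_avoids h, coeff_invol, coeff_setZero_of_not_avoids h, map_zero]

theorem setZero_twist (T : Set W) (e : ZMod 2) (s : Ser p) :
    setZero T (twist e s) = twist e (setZero T s) := by
  rcases zmod2_cases e with rfl | rfl
  · simp
  · simp [setZero_invol]

theorem avoids_single {T : Set W} {w : {w : W // p w = 0}} :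
    Avoids T (Finsupp.single w 1) ↔ (w : W) ∉ T := by
  simp [Avoids]

theorem serD_setZero_of_notMem {T : Set W} {w : W} (hw : w ∉ T) (s : Ser p) :
    serD w (setZero T s) = setZero T (serD w s) := by
  ext m
  rcases zmod2_cases (p w) with h | h
  · rw [serD_even ⟨w, h⟩, coeff_evenDer]
    by_cases hm : Avoids T m
    · rw [coeff_setZero_of_avoids hm, coeff_setZero_of_avoids
        (avoids_add.2 ⟨hm, avoids_single.2 hw⟩), coeff_evenDer, map_smul]
    · rw [coeff_setZero_of_not_avoids hm, coeff_setZero_of_not_avoids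
        (fun hh => hm (avoids_add.1 hh).1), smul_zero]
  · rw [serD_odd ⟨w, h⟩, oddDer, coeff_coeffMap]
    by_cases hm : Avoids T m
    · rw [coeff_setZero_of_avoids hm, coeff_setZero_of_avoids hm, coeff_coeffMap, contractLeft_map]
      congr 3
      refine LinearMap.ext fun v => ?_
      exact oddProj_apply_of_notMem (w := ⟨w, h⟩) hw v
    · rw [coeff_setZero_of_not_avoids hm, coeff_setZero_of_not_avoids hm, map_zero]

theorem serD_setZero_of_mem {T : Set W} {w : W} (hw : w ∈ T) (s : Ser p) :
    serD w (setZero T s) = 0 := by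
  ext m
  rcases zmod2_cases (p w) with h | h
  · rw [serD_even ⟨w, h⟩, coeff_evenDer, coeff_setZero_of_not_avoids
      (fun hh => avoids_single.1 (avoids_add.1 hh).2 hw), smul_zero, map_zero]
  · rw [serD_odd ⟨w, h⟩, oddDer, coeff_coeffMap]
    by_cases hm : Avoids T m
    · rw [coeff_setZero_of_avoids hm, contractLeft_map]
      have : (LinearMap.proj (⟨w, h⟩ : {w // p w = 1}) ∘ₗ oddProj p T) = 0 := by
        refine LinearMap.ext fun v => ?_
        exact oddProj_apply_of_mem (w := ⟨w, h⟩) hw v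
      rw [this]
      simp
    · rw [coeff_setZero_of_not_avoids hm, map_zero, map_zero]

theorem oddProj_singleton (w : {w : W // p w = 1}) (v : {w : W // p w = 1} → ℂ) :
    oddProj p {w.1} v = v - v w • Pi.single w 1 := by
  funext w'
  by_cases h : w' = w
  · subst h
    rw [oddProj_apply_of_mem (Set.mem_singleton _)]
    simp
  · rw [oddProj_apply_of_notMem (by simpa [Subtype.ext_iff] using h)]
    simp [h]

theorem map_oddProj_add (w : {w : W // p w = 1}) (a : Grass p) :
    ExteriorAlgebra.map (oddProj p {w.1}) a + ι ℂ (Pi.single w 1) *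
      CliffordAlgebra.contractLeft (LinearMap.proj w) a = a := by
  set e : Grass p := ι ℂ (Pi.single w 1) with he
  induction a using CliffordAlgebra.left_induction with
  | algebraMap r =>
    rw [contractLeft_algebraMap, mul_zero, add_zero]
    exact AlgHom.commutes _ _
  | add x y hx hy =>
    rw [map_add, map_add, mul_add, add_add_add_comm, hx, hy]
  | ι_mul x m hx =>
    have h : ExteriorAlgebra.map (oddProj p {w.1}) (CliffordAlgebra.ι 0 m) =
        ι ℂ m - m w • e :=
      (ExteriorAlgebra.map_apply_ι _ m).trans (by rw [oddProj_singleton, map_sub, map_smul])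
    rw [map_mul, h, contractLeft_ι_mul]
    set ψ := CliffordAlgebra.contractLeft (Q := (0 : QuadraticForm ℂ _)) (LinearMap.proj w) x
    have h1 : ExteriorAlgebra.map (oddProj p {w.1}) x = x - e * ψ := by
      rw [eq_sub_iff_add_eq]; exact hx
    have h2 : e * e = 0 := ExteriorAlgebra.ι_sq_zero _
    have h3 : e * ι ℂ m = -(ι ℂ m * e) :=
      eq_neg_of_add_eq_zero_left (ExteriorAlgebra.ι_add_mul_swap _ m)
    rw [h1]
    change (ι ℂ m - m w • e) * (x - e * ψ) +
      e * ((m w) • x - ι ℂ m * ψ) = ι ℂ m * x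
    rw [mul_sub e, ← mul_assoc e _ ψ, h3, sub_mul, mul_sub, mul_sub, smul_mul_assoc, smul_mul_assoc,
      ← mul_assoc e e, h2, mul_smul_comm, zero_mul, smul_zero, neg_mul, ← mul_assoc]
    abel

theorem setZero_singleton_eq_self {w : W} {s : Ser p} (h : serD w s = 0) :
    setZero {w} s = s := by
  ext m
  rcases zmod2_cases (p w) with hw | hw
  · rw [serD_even ⟨w, hw⟩] at h
    by_cases hm : Avoids {w} m
    · rw [coeff_setZero_of_avoids hm]
      have : oddProj p {w} = LinearMap.id := by
        refine LinearMap.ext fun v => ?_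
        funext w'
        refine oddProj_apply_of_notMem ?_ v
        rintro rfl
        rw [w'.2] at hw
        exact absurd hw (by decide)
      rw [this, ExteriorAlgebra.map_id]
      rfl
    · rw [coeff_setZero_of_not_avoids hm]
      have h0 : m ⟨w, hw⟩ ≠ 0 := by
        intro h0
        apply hm
        rintro w' hw' rfl
        exact (Finsupp.mem_support_iff.1 hw') h0
      have h1 : m - Finsupp.single ⟨w, hw⟩ 1 + Finsupp.single ⟨w, hw⟩ 1 = m :=
        tsub_add_cancel_of_le (by simpa using Nat.one_le_iff_ne_zero.2 h0)
      have h2 := congrArg (coeff (m - Finsupp.single ⟨w, hw⟩ 1)) h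
      rw [coeff_evenDer, h1, map_zero] at h2
      exact ((smul_eq_zero.1 h2).resolve_left (Nat.cast_ne_zero.2 (Nat.succ_ne_zero _))).symm
  · rw [serD_odd ⟨w, hw⟩] at h
    have hm : Avoids {w} m := by
      rintro w' _ rfl
      rw [w'.2] at hw
      exact absurd hw (by decide)
    have h2 := congrArg (coeff m) h
    rw [oddDer, coeff_coeffMap, map_zero] at h2
    have h3 := map_oddProj_add ⟨w, hw⟩ (coeff m s)
    rw [h2, mul_zero, add_zero] at h3
    rw [coeff_setZero_of_avoids hm, h3]

theorem setZero_empty (s : Ser p) : setZero ∅ s = s := by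
  ext m
  rw [coeff_setZero_of_avoids (by simp [Avoids])]
  have : oddProj p ∅ = LinearMap.id := by
    refine LinearMap.ext fun v => ?_
    funext w'
    exact oddProj_apply_of_notMem (by simp) v
  rw [this, ExteriorAlgebra.map_id]
  rfl

theorem setZero_eq_self {T : Set W} {s : Ser p} (h : ∀ w ∈ T, serD w s = 0) :
    setZero T s = s := by
  induction T, T.toFinite using Set.Finite.induction_on with
  | empty => exact setZero_empty s
  | @insert a T _ _ ih =>
    rw [Set.insert_eq, ← setZero_setZero, ih fun w hw => h w (Set.mem_insert_of_mem a hw),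
      setZero_singleton_eq_self (h a (Set.mem_insert a T))]

end SetZero

/-! ### The degree filtration of an exterior algebra -/

section Filtration

variable {M : Type*} [AddCommGroup M] [Module ℂ M]

/-- The elements of the exterior algebra of degree at least `k`. -/
def degGE (M : Type*) [AddCommGroup M] [Module ℂ M] (k : ℕ) :
    Submodule ℂ (ExteriorAlgebra ℂ M) :=
  ⨆ j : {j : ℕ // k ≤ j}, LinearMap.range (ι ℂ (M := M)) ^ (j : ℕ)

theorem pow_le_degGE {k j : ℕ} (h : k ≤ j) :
    LinearMap.range (ι ℂ (M := M)) ^ j ≤ degGE M k :=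
  le_iSup (fun j : {j : ℕ // k ≤ j} => LinearMap.range (ι ℂ (M := M)) ^ (j : ℕ))
    ⟨j, h⟩

theorem degGE_anti {k l : ℕ} (h : k ≤ l) : degGE M l ≤ degGE M k :=
  iSup_le fun j => pow_le_degGE (h.trans j.2)

theorem degGE_zero : degGE M 0 = ⊤ := by
  rw [eq_top_iff, ← CliffordAlgebra.iSup_ι_range_eq_top (0 : QuadraticForm ℂ M)]
  exact iSup_le fun j => pow_le_degGE (Nat.zero_le j)

theorem mem_degGE_zero (a : ExteriorAlgebra ℂ M) : a ∈ degGE M 0 := by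
  rw [degGE_zero]; trivial

theorem degGE_induction {k : ℕ} {P : ExteriorAlgebra ℂ M → Prop}
    (h : ∀ j, k ≤ j → ∀ a ∈ LinearMap.range (ι ℂ (M := M)) ^ j, P a)
    (h0 : P 0) (hadd : ∀ a b, P a → P b → P (a + b)) {a : ExteriorAlgebra ℂ M}
    (ha : a ∈ degGE M k) : P a :=
  Submodule.iSup_induction _ (motive := P) ha (fun j a ha => h j j.2 a ha) h0 hadd

theorem mul_mem_degGE {k l : ℕ} {a b : ExteriorAlgebra ℂ M} (ha : a ∈ degGE M k)
    (hb : b ∈ degGE M l) : a * b ∈ degGE M (k + l) := by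
  refine degGE_induction (P := fun a => a * b ∈ degGE M (k + l)) (fun j hj a ha => ?_)
    (by rw [zero_mul]; exact zero_mem _) (fun x y hx hy => by rw [add_mul]; exact add_mem hx hy) ha
  refine degGE_induction (P := fun b => a * b ∈ degGE M (k + l)) (fun i hi b hb => ?_)
    (by rw [mul_zero]; exact zero_mem _) (fun x y hx hy => by rw [mul_add]; exact add_mem hx hy) hb
  refine pow_le_degGE (add_le_add hj hi) ?_
  rw [pow_add]
  exact Submodule.mul_mem_mul ha hb

theorem ι_mem_degGE_one (v : M) : ι ℂ v ∈ degGE M 1 :=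
  pow_le_degGE le_rfl (by rw [pow_one]; exact LinearMap.mem_range_self _ v)

theorem degGE_eq_bot [FiniteDimensional ℂ M] {k : ℕ} (h : Module.finrank ℂ M < k) :
    degGE M k = ⊥ := by
  rw [eq_bot_iff]
  refine iSup_le fun j => ?_
  have h1 : Module.finrank ℂ (⋀[ℂ]^(j : ℕ) M) = 0 := by
    rw [exteriorPower.finrank_eq, Nat.choose_eq_zero_of_lt (h.trans_le j.2)]
  exact (Submodule.finrank_eq_zero.1 h1).le

theorem algebraMapInv_ι (v : M) :
    algebraMapInv (ι ℂ v) = 0 := by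
  simp [algebraMapInv]

theorem sub_algebraMapInv_mem (a : ExteriorAlgebra ℂ M) :
    a - algebraMap ℂ _ (algebraMapInv a) ∈ degGE M 1 := by
  induction a using ExteriorAlgebra.induction with
  | algebraMap r =>
    rw [AlgHom.commutes, Algebra.algebraMap_self_apply, sub_self]
    exact zero_mem _
  | ι v =>
    rw [algebraMapInv_ι, map_zero, sub_zero]
    exact ι_mem_degGE_one v
  | mul x y hx hy =>
    have h1 := mul_mem_degGE (mem_degGE_zero x) hy
    have h2 := mul_mem_degGE hx (mem_degGE_zero
      (algebraMap ℂ _ (algebraMapInv y)))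
    rw [zero_add, mul_sub] at h1
    rw [add_zero, sub_mul] at h2
    rw [map_mul, map_mul]
    convert add_mem h1 h2 using 1
    abel
  | add x y hx hy =>
    rw [map_add, map_add, add_sub_add_comm]
    exact add_mem hx hy

theorem algebraMapInv_of_mem {a : ExteriorAlgebra ℂ M} (ha : a ∈ degGE M 1) :
    algebraMapInv a = 0 := by
  refine degGE_induction (P := fun a => algebraMapInv a = 0)
    (fun j hj a ha => ?_) (map_zero _)
    (fun x y hx hy => by rw [map_add, hx, hy, add_zero]) ha
  obtain ⟨i, rfl⟩ : ∃ i, j = i + 1 := ⟨j - 1, by omega⟩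
  rw [pow_succ'] at ha
  refine Submodule.mul_induction_on ha ?_ (fun x y hx hy => by rw [map_add, hx, hy, add_zero])
  rintro _ ⟨v, rfl⟩ b -
  rw [map_mul, algebraMapInv_ι, zero_mul]

theorem algebraMapInv_invol (a : ExteriorAlgebra ℂ M) :
    algebraMapInv (invol a) = algebraMapInv a := by
  induction a using ExteriorAlgebra.induction with
  | algebraMap r => simp only [AlgHom.commutes]
  | ι v =>
    rw [show invol (ι ℂ v) = -ι ℂ v from
        involute_ι _, map_neg]
    simp [algebraMapInv]
  | mul x y hx hy => simp only [map_mul, hx, hy]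
  | add x y hx hy => simp only [map_add, hx, hy]

theorem contractLeft_mem_pow (d : Module.Dual ℂ M) {j : ℕ} {a : ExteriorAlgebra ℂ M}
    (ha : a ∈ LinearMap.range (ι ℂ (M := M)) ^ j) :
    CliffordAlgebra.contractLeft d a ∈ LinearMap.range (ι ℂ (M := M)) ^ (j - 1) ∧
      (j = 0 → CliffordAlgebra.contractLeft d a = 0) := by
  induction ha using Submodule.pow_induction_on_left' with
  | algebraMap r =>
    rw [show CliffordAlgebra.contractLeft d (algebraMap ℂ (ExteriorAlgebra ℂ M) r) = 0 from
      contractLeft_algebraMap _ _ _]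
    exact ⟨zero_mem _, fun _ => rfl⟩
  | add x y i hx hy h1 h2 =>
    rw [map_add]
    exact ⟨add_mem h1.1 h2.1, fun h => by rw [h1.2 h, h2.2 h, add_zero]⟩
  | mem_mul m hm i x hx h1 =>
    obtain ⟨v, rfl⟩ := hm
    refine ⟨?_, fun h => absurd h (Nat.succ_ne_zero i)⟩
    rw [show CliffordAlgebra.contractLeft d (ι ℂ v * x) = d v • x -
      ι ℂ v * CliffordAlgebra.contractLeft d x from
      contractLeft_ι_mul _ _ _]
    refine sub_mem (Submodule.smul_mem _ _ hx) ?_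
    rcases Nat.eq_zero_or_pos i with rfl | hi
    · rw [h1.2 rfl, mul_zero]; exact zero_mem _
    · have := Submodule.mul_mem_mul (LinearMap.mem_range_self (ι ℂ (M := M)) v) h1.1
      rwa [← pow_succ', Nat.sub_add_cancel hi] at this

theorem contractLeft_mem_degGE (d : Module.Dual ℂ M) {k : ℕ} {a : ExteriorAlgebra ℂ M}
    (ha : a ∈ degGE M k) : CliffordAlgebra.contractLeft d a ∈ degGE M (k - 1) :=
  degGE_induction (P := fun a => CliffordAlgebra.contractLeft d a ∈ degGE M (k - 1))
    (fun _ hj _ ha => pow_le_degGE (Nat.sub_le_sub_right hj 1) (contractLeft_mem_pow d ha).1)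
    (by rw [map_zero]; exact zero_mem _)
    (fun x y hx hy => by rw [map_add]; exact add_mem hx hy) ha

theorem sum_ι_mul_contractLeft_of_mem_pow {κ : Type*} [Fintype κ] [DecidableEq κ] {j : ℕ}
    {a : ExteriorAlgebra ℂ (κ → ℂ)}
    (ha : a ∈ LinearMap.range (ι ℂ (M := κ → ℂ)) ^ j) :
    ∑ w : κ, ι ℂ (Pi.single w (1 : ℂ)) *
      CliffordAlgebra.contractLeft (LinearMap.proj w) a = (j : ℂ) • a := by
  induction ha using Submodule.pow_induction_on_left' with
  | algebraMap r =>
    simp only [show ∀ d, CliffordAlgebra.contractLeft d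
      (algebraMap ℂ (ExteriorAlgebra ℂ (κ → ℂ)) r) = 0 from
      fun d => contractLeft_algebraMap _ _ _]
    simp
  | add x y i hx hy h1 h2 =>
    simp only [map_add, mul_add, sum_add_distrib, h1, h2, smul_add]
  | mem_mul m hm i x hx h1 =>
    obtain ⟨v, rfl⟩ := hm
    have h2 : ∀ w : κ, CliffordAlgebra.contractLeft (LinearMap.proj w)
        (ι ℂ v * x) = v w • x -
        ι ℂ v * CliffordAlgebra.contractLeft (LinearMap.proj w) x :=
      fun w => contractLeft_ι_mul _ _ _
    have h3 : ∀ w : κ, ι ℂ (Pi.single w (1 : ℂ)) * ι ℂ v =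
        -(ι ℂ v * ι ℂ (Pi.single w (1 : ℂ))) :=
      fun w => eq_neg_of_add_eq_zero_left (ExteriorAlgebra.ι_add_mul_swap _ v)
    have h4 : ∑ w : κ, v w • ι ℂ (Pi.single w (1 : ℂ)) = ι ℂ v := by
      rw [← sum_congr rfl fun w _ => map_smul (ι ℂ) (v w) _, ← map_sum]
      congr 1
      funext w
      simp [Finset.sum_apply, Pi.single_apply]
    calc _ = ∑ w : κ, ((v w • ι ℂ (Pi.single w (1 : ℂ))) * x +
          ι ℂ v * (ι ℂ (Pi.single w (1 : ℂ)) *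
            CliffordAlgebra.contractLeft (LinearMap.proj w) x)) := by
          refine sum_congr rfl fun w _ => ?_
          rw [h2, mul_sub, ← mul_assoc, h3, neg_mul, sub_neg_eq_add, mul_smul_comm, smul_mul_assoc,
            mul_assoc]
      _ = _ := by
          rw [sum_add_distrib, ← sum_mul, h4, ← mul_sum, h1, mul_smul_comm,
            Nat.cast_succ, add_smul, one_smul, add_comm]

/-- The Euler operator of the exterior algebra. -/
def oddEuler (κ : Type*) [Fintype κ] [DecidableEq κ] :
    ExteriorAlgebra ℂ (κ → ℂ) →ₗ[ℂ] ExteriorAlgebra ℂ (κ → ℂ) :=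
  ∑ w : κ, LinearMap.mulLeft ℂ (ι ℂ (Pi.single w (1 : ℂ))) ∘ₗ
    CliffordAlgebra.contractLeft (LinearMap.proj w)

theorem oddEuler_apply {κ : Type*} [Fintype κ] [DecidableEq κ] (a : ExteriorAlgebra ℂ (κ → ℂ)) :
    oddEuler κ a = ∑ w : κ, ι ℂ (Pi.single w (1 : ℂ)) *
      CliffordAlgebra.contractLeft (LinearMap.proj w) a := by
  rw [oddEuler, LinearMap.sum_apply]
  rfl

theorem oddEuler_sub_mem {κ : Type*} [Fintype κ] [DecidableEq κ] {k : ℕ}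
    {a : ExteriorAlgebra ℂ (κ → ℂ)} (ha : a ∈ degGE (κ → ℂ) k) :
    oddEuler κ a - (k : ℂ) • a ∈ degGE (κ → ℂ) (k + 1) := by
  refine degGE_induction (P := fun a => oddEuler κ a - (k : ℂ) • a ∈ degGE (κ → ℂ) (k + 1))
    (fun j hj a ha => ?_) ?_ (fun x y hx hy => ?_) ha
  · rw [oddEuler_apply, sum_ι_mul_contractLeft_of_mem_pow ha, ← sub_smul]
    rcases hj.eq_or_lt with rfl | hj
    · rw [sub_self, zero_smul]; exact zero_mem _
    · exact Submodule.smul_mem _ _ (pow_le_degGE hj ha)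
  · rw [map_zero, smul_zero, sub_zero]; exact zero_mem _
  · rw [map_add, smul_add, add_sub_add_comm]
    exact add_mem hx hy

end Filtration

/-! ### The body and the degree filtration of power series -/

section Body

variable {W : Type} [Fintype W] [DecidableEq W] {p : W → ZMod 2}

instance : FiniteDimensional ℂ (Grass p) := Module.Finite.of_basis (grassBasis p)

/-- The body as a homomorphism of algebras. -/
def bodyHom (p : W → ZMod 2) : Ser p →ₐ[ℂ] ℂ where
  toFun := body
  map_one' := by simp [body]
  map_mul' a b := by simp [body]
  map_zero' := by simp [body]
  map_add' a b := by simp [body]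
  commutes' c := by
    rw [body, MvPowerSeries.algebraMap_apply, MvPowerSeries.coeff_zero_C]
    exact AlgHom.commutes _ _

theorem bodyHom_apply (s : Ser p) : bodyHom p s = body s := rfl

theorem body_invol (s : Ser p) : body (invol s) = body s := by
  rw [body, coeff_invol, algebraMapInv_invol, body]

theorem IsHomog.body_eq_zero {s : Ser p} (h : IsHomog 1 s) : body s = 0 := by
  have h1 := body_invol s
  rw [isHomog_one_iff.1 h, ← bodyHom_apply, map_neg, bodyHom_apply] at h1
  exact self_eq_neg.1 h1.symm

/-- Power series of total degree at least `k`, in even and odd variables. -/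
def serGE (p : W → ZMod 2) (k : ℕ) : Submodule ℂ (Ser p) where
  carrier := {s | ∀ m, coeff m s ∈ degGE _ (k - Finsupp.degree m)}
  add_mem' ha hb m := by rw [map_add]; exact add_mem (ha m) (hb m)
  zero_mem' m := by rw [map_zero]; exact zero_mem _
  smul_mem' c a ha m := by rw [coeff_csmul]; exact Submodule.smul_mem _ _ (ha m)

theorem mul_mem_serGE {k l : ℕ} {a b : Ser p} (ha : a ∈ serGE p k) (hb : b ∈ serGE p l) :
    a * b ∈ serGE p (k + l) := by
  classical
  intro m
  rw [coeff_mul]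
  refine sum_mem fun x hx => ?_
  refine degGE_anti ?_ (mul_mem_degGE (ha x.1) (hb x.2))
  rw [← Finset.HasAntidiagonal.mem_antidiagonal.1 hx, map_add]
  omega

theorem pow_mem_serGE {a : Ser p} (ha : a ∈ serGE p 1) (k : ℕ) : a ^ k ∈ serGE p k := by
  induction k with
  | zero => intro m; rw [Nat.zero_sub]; exact mem_degGE_zero _
  | succ k ih => rw [pow_succ]; exact mul_mem_serGE ih ha

theorem mem_serGE_one_iff {a : Ser p} : a ∈ serGE p 1 ↔ body a = 0 := by
  constructor
  · intro h
    have := h 0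
    rw [map_zero, Nat.sub_zero] at this
    exact algebraMapInv_of_mem this
  · intro h m
    by_cases hm : m = 0
    · subst hm
      rw [map_zero, Nat.sub_zero]
      have := sub_algebraMapInv_mem (coeff 0 a)
      rwa [show algebraMapInv (coeff 0 a) = 0 from h, map_zero,
        sub_zero] at this
    · have h1 : 1 - Finsupp.degree m = 0 := by
        have := (Finsupp.degree_eq_zero_iff m).not.2 hm
        omega
      rw [h1]
      exact mem_degGE_zero _

/-- The number of odd variables. -/
abbrev oddCard (p : W → ZMod 2) : ℕ := Module.finrank ℂ ({w : W // p w = 1} → ℂ)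

theorem coeff_eq_zero_of_mem_serGE {a : Ser p} {k : ℕ} (ha : a ∈ serGE p k) {m}
    (h : Finsupp.degree m + oddCard p < k) : coeff m a = 0 := by
  have := ha m
  rwa [degGE_eq_bot (Nat.lt_sub_of_add_lt (by rwa [add_comm] at h)), Submodule.mem_bot] at this

theorem isUnit_of_body_ne_zero {s : Ser p} (h : body s ≠ 0) : IsUnit s := by
  rw [MvPowerSeries.isUnit_iff_constantCoeff]
  set a := MvPowerSeries.constantCoeff s with ha
  have h1 := sub_algebraMapInv_mem a
  set n := a - algebraMap ℂ _ (algebraMapInv a) with hn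
  have h2 : IsNilpotent n := by
    refine ⟨oddCard p + 1, ?_⟩
    have : ∀ k, n ^ k ∈ degGE _ k := by
      intro k
      induction k with
      | zero => exact mem_degGE_zero _
      | succ k ih => rw [pow_succ]; exact mul_mem_degGE ih h1
    have := this (oddCard p + 1)
    rwa [degGE_eq_bot (Nat.lt_succ_self _), Submodule.mem_bot] at this
  have h3 : a = algebraMap ℂ _ (algebraMapInv a) + n := by rw [hn]; abel
  rw [h3]
  refine IsNilpotent.isUnit_add_left_of_commute h2 ?_ (Algebra.commutes _ _).symm
  exact (ExteriorAlgebra.isUnit_algebraMap _ _).2 (IsUnit.mk0 _ h)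

end Body

variable {n : ℕ} {W : Type} [Fintype W] [DecidableEq W] {p : W → ZMod 2}

/-! ### Smooth superfunctions on an open set -/

section Local

open scoped ContDiff
/-- Every component of `T s` is a linear function of a single coefficient of `s`. -/
def IsLocal (T : Ser p →ₗ[ℂ] Ser p) : Prop :=
  ∀ m (l : Grass p →ₗ[ℂ] ℂ), ∃ m', ∃ l' : Grass p →ₗ[ℂ] ℂ, ∀ s,
    l (coeff m (T s)) = l' (coeff m' s)

theorem isLocal_coeffMap (T : Grass p →ₗ[ℂ] Grass p) : IsLocal (coeffMap T) :=
  fun m l => ⟨m, l ∘ₗ T, fun _ => rfl⟩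

theorem isLocal_serD (w : W) : IsLocal (serD (p := p) w) := by
  rcases zmod2_cases (p w) with h | h
  · rw [serD_even ⟨w, h⟩]
    exact fun m l => ⟨_, ((m ⟨w, h⟩ + 1 : ℕ) : ℂ) • l, fun s => by
      rw [coeff_evenDer, map_smul, LinearMap.smul_apply]⟩
  · rw [serD_odd ⟨w, h⟩]
    exact isLocal_coeffMap _

theorem isLocal_invol : IsLocal (invol (R := Ser p)).toLinearMap :=
  fun m l => ⟨m, l ∘ₗ (invol (R := Grass p)).toLinearMap, fun _ => rfl⟩

theorem isLocal_setZero (T : Set W) : IsLocal (setZeroHom (p := p) T).toLinearMap := by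
  intro m l
  by_cases h : Avoids T m
  · exact ⟨m, l ∘ₗ (ExteriorAlgebra.map (oddProj p T)).toLinearMap, fun s =>
      congrArg l (coeff_setZero_of_avoids h s)⟩
  · exact ⟨m, 0, fun s => (congrArg l (coeff_setZero_of_not_avoids h s)).trans (map_zero l)⟩

theorem grass_ext {a b : Grass p} (h : ∀ l : Grass p →ₗ[ℂ] ℂ, l a = l b) : a = b :=
  (grassBasis p).ext_elem fun K => h ((grassBasis p).coord K)

theorem ser_ext {a b : Ser p}
    (h : ∀ m, ∀ l : Grass p →ₗ[ℂ] ℂ, l (coeff m a) = l (coeff m b)) :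
    a = b :=
  MvPowerSeries.ext fun m => grass_ext (h m)

theorem functional_apply (l : Grass p →ₗ[ℂ] ℂ) (a : Grass p) :
    l a = ∑ K, (grassBasis p).repr a K * l (grassBasis p K) := by
  conv_lhs => rw [← (grassBasis p).sum_repr a, map_sum]
  exact sum_congr rfl fun K _ => by rw [map_smul, smul_eq_mul]

/-- A function with values in the Grassmann algebra is differentiable if its components are. -/
def GrassDiffAt (a : (Fin n → ℝ) → Grass p) (x : Fin n → ℝ) : Prop :=
  ∀ l : Grass p →ₗ[ℂ] ℂ, DifferentiableAt ℝ (fun y => l (a y)) x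

/-- The directional derivative of a function with values in the Grassmann algebra. -/
def grassDeriv (i : Fin n) (a : (Fin n → ℝ) → Grass p) (x : Fin n → ℝ) : Grass p :=
  ∑ K : Finset {w : W // p w = 1},
    (fderiv ℝ (fun y => (grassBasis p).repr (a y) K) x (Pi.single i 1)) • grassBasis p K

theorem GrassDiffAt.apply_grassDeriv {a : (Fin n → ℝ) → Grass p} {x : Fin n → ℝ}
    (h : GrassDiffAt a x) (i : Fin n) (l : Grass p →ₗ[ℂ] ℂ) :
    l (grassDeriv i a x) = fderiv ℝ (fun y => l (a y)) x (Pi.single i 1) := by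
  have h1 : (fun y => l (a y)) =
      fun y => ∑ K, (grassBasis p).repr (a y) K * l (grassBasis p K) :=
    funext fun y => functional_apply l (a y)
  have h2 : ∀ K, DifferentiableAt ℝ (fun y => (grassBasis p).repr (a y) K) x :=
    fun K => h ((grassBasis p).coord K)
  rw [h1, fderiv_fun_sum fun K _ => (h2 K).mul_const _, sum_apply, grassDeriv,
    map_sum]
  refine sum_congr rfl fun K _ => ?_
  rw [map_smul, fderiv_mul_const (h2 K), smul_apply, smul_eq_mul, smul_eq_mul,
    mul_comm]

theorem functional_mul (l : Grass p →ₗ[ℂ] ℂ) (a b : Grass p) :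
    l (a * b) = ∑ K, (grassBasis p).repr a K * l (grassBasis p K * b) := by
  conv_lhs => rw [← (grassBasis p).sum_repr a, sum_mul, map_sum]
  exact sum_congr rfl fun K _ => by rw [smul_mul_assoc, map_smul, smul_eq_mul]

theorem GrassDiffAt.mul {a b : (Fin n → ℝ) → Grass p} {x : Fin n → ℝ}
    (ha : GrassDiffAt a x) (hb : GrassDiffAt b x) : GrassDiffAt (fun y => a y * b y) x := by
  intro l
  rw [funext fun y => functional_mul l (a y) (b y)]
  exact DifferentiableAt.fun_sum fun K _ => (ha ((grassBasis p).coord K)).mul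
    (hb (l ∘ₗ LinearMap.mulLeft ℂ (grassBasis p K)))

theorem grassDeriv_mul {a b : (Fin n → ℝ) → Grass p} {x : Fin n → ℝ}
    (ha : GrassDiffAt a x) (hb : GrassDiffAt b x) (i : Fin n) :
    grassDeriv i (fun y => a y * b y) x = grassDeriv i a x * b x + a x * grassDeriv i b x := by
  refine grass_ext fun l => ?_
  have ha' : ∀ K, DifferentiableAt ℝ (fun y => (grassBasis p).repr (a y) K) x :=
    fun K => ha ((grassBasis p).coord K)
  have hb' : ∀ K, DifferentiableAt ℝ (fun y => l (grassBasis p K * b y)) x :=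
    fun K => hb (l ∘ₗ LinearMap.mulLeft ℂ (grassBasis p K))
  rw [(ha.mul hb).apply_grassDeriv, map_add, functional_mul l (grassDeriv i a x), functional_mul l (a x)]
  rw [funext fun y => functional_mul l (a y) (b y),
    fderiv_fun_sum fun K _ => (ha' K).fun_mul (hb' K), sum_apply,
    ← sum_add_distrib]
  refine sum_congr rfl fun K _ => ?_
  rw [fderiv_fun_mul (ha' K) (hb' K), add_apply, smul_apply,
    smul_apply, smul_eq_mul, smul_eq_mul]
  have h1 : (grassBasis p).repr (grassDeriv i a x) K =
      fderiv ℝ (fun y => (grassBasis p).repr (a y) K) x (Pi.single i 1) :=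
    ha.apply_grassDeriv i ((grassBasis p).coord K)
  have h2 : l (grassBasis p K * grassDeriv i b x) =
      fderiv ℝ (fun y => l (grassBasis p K * b y)) x (Pi.single i 1) :=
    hb.apply_grassDeriv i (l ∘ₗ LinearMap.mulLeft ℂ (grassBasis p K))
  rw [h1, h2]
  ring

variable {V : Set (Fin n → ℝ)}

theorem IsSmooth.grassDiffAt {f : SFun n p} (hf : IsSmooth V f) (hV : IsOpen V) {x : Fin n → ℝ}
    (hx : x ∈ V) (m) : GrassDiffAt (fun y => coeff m (f y)) x :=
  fun l => ((hf m l).contDiffAt (hV.mem_nhds hx)).differentiableAt (by simp)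

theorem coeff_realD (i : Fin n) (f : SFun n p) (x : Fin n → ℝ) (m) :
    coeff m (realD i f x) =
      grassDeriv i (fun y => coeff m (f y)) x := rfl

theorem IsSmooth.apply_realD {f : SFun n p} (hf : IsSmooth V f) (hV : IsOpen V) {x : Fin n → ℝ}
    (hx : x ∈ V) (i : Fin n) (m) (l : Grass p →ₗ[ℂ] ℂ) :
    l (coeff m (realD i f x)) =
      fderiv ℝ (fun y => l (coeff m (f y))) x (Pi.single i 1) :=
  (hf.grassDiffAt hV hx m).apply_grassDeriv i l

theorem IsSmooth.congr {f g : SFun n p} (hf : IsSmooth V f) (h : ∀ x ∈ V, g x = f x) :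
    IsSmooth V g :=
  fun m l => (hf m l).congr fun x hx => by rw [h x hx]

theorem IsSmooth.realD {f : SFun n p} (hf : IsSmooth V f) (hV : IsOpen V) (i : Fin n) :
    IsSmooth V (realD i f) := by
  intro m l
  have h1 : ContDiffOn ℝ ∞ (fun x => fderiv ℝ (fun y => l (coeff m (f y))) x
      (Pi.single i 1)) V :=
    ((hf m l).fderiv_of_isOpen hV le_rfl).clm_apply contDiffOn_const
  exact h1.congr fun x hx => hf.apply_realD hV hx i m l

theorem IsSmooth.mapLocal {f : SFun n p} (hf : IsSmooth V f) {T : Ser p →ₗ[ℂ] Ser p}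
    (hT : IsLocal T) : IsSmooth V (fun x => T (f x)) := by
  intro m l
  obtain ⟨m', l', h⟩ := hT m l
  simp only [h]
  exact hf m' l'

theorem realD_congr {f g : SFun n p} (hV : IsOpen V) (h : ∀ x ∈ V, f x = g x) (i : Fin n)
    {x : Fin n → ℝ} (hx : x ∈ V) : BV.realD i f x = BV.realD i g x := by
  ext m
  rw [coeff_realD, coeff_realD, grassDeriv, grassDeriv]
  refine sum_congr rfl fun K _ => ?_
  congr 2
  refine Filter.EventuallyEq.fderiv_eq ?_
  filter_upwards [hV.mem_nhds hx] with y hy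
  rw [h y hy]

theorem realD_mapLocal {f : SFun n p} (hf : IsSmooth V f) (hV : IsOpen V) {T : Ser p →ₗ[ℂ] Ser p}
    (hT : IsLocal T) (i : Fin n) {x : Fin n → ℝ} (hx : x ∈ V) :
    BV.realD i (fun y => T (f y)) x = T (BV.realD i f x) := by
  refine ser_ext fun m l => ?_
  rw [(hf.mapLocal hT).apply_realD hV hx]
  obtain ⟨m', l', h⟩ := hT m l
  simp only [h]
  rw [hf.apply_realD hV hx]

theorem IsSmooth.mul {f g : SFun n p} (hf : IsSmooth V f) (hg : IsSmooth V g) :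
    IsSmooth V (f * g) := by
  classical
  intro m l
  have h1 : (fun x => l (coeff m ((f * g) x))) = fun x =>
      ∑ y ∈ Finset.HasAntidiagonal.antidiagonal m, ∑ K,
        (grassBasis p).repr (coeff y.1 (f x)) K *
          l (grassBasis p K * coeff y.2 (g x)) := by
    funext x
    rw [Pi.mul_apply, coeff_mul, map_sum]
    exact sum_congr rfl fun y _ => functional_mul l _ _
  rw [h1]
  exact ContDiffOn.sum fun y _ => ContDiffOn.sum fun K _ =>
    (hf y.1 ((grassBasis p).coord K)).mul (hg y.2 (l ∘ₗ LinearMap.mulLeft ℂ (grassBasis p K)))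

theorem IsSmooth.add {f g : SFun n p} (hf : IsSmooth V f) (hg : IsSmooth V g) :
    IsSmooth V (f + g) := by
  intro m l
  simp only [Pi.add_apply, map_add]
  exact (hf m l).add (hg m l)

theorem isSmooth_const (s : Ser p) : IsSmooth V (fun _ : Fin n → ℝ => s) :=
  fun _ _ => contDiffOn_const

theorem grassDeriv_sum {κ : Type*} {s : Finset κ} {a : κ → (Fin n → ℝ) → Grass p}
    {x : Fin n → ℝ} (ha : ∀ k ∈ s, GrassDiffAt (a k) x) (i : Fin n) :
    grassDeriv i (fun y => ∑ k ∈ s, a k y) x = ∑ k ∈ s, grassDeriv i (a k) x := by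
  refine grass_ext fun l => ?_
  have h : GrassDiffAt (fun y => ∑ k ∈ s, a k y) x := by
    intro l
    simp only [map_sum]
    exact DifferentiableAt.fun_sum fun k hk => ha k hk l
  rw [h.apply_grassDeriv, map_sum]
  simp only [map_sum]
  rw [fderiv_fun_sum fun k hk => ha k hk l, sum_apply]
  exact sum_congr rfl fun k hk => ((ha k hk).apply_grassDeriv i l).symm

theorem realD_mul {f g : SFun n p} (hf : IsSmooth V f) (hg : IsSmooth V g) (hV : IsOpen V)
    (i : Fin n) {x : Fin n → ℝ} (hx : x ∈ V) :
    BV.realD i (f * g) x = BV.realD i f x * g x + f x * BV.realD i g x := by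
  classical
  ext m
  rw [coeff_realD, map_add, coeff_mul, coeff_mul]
  simp only [Pi.mul_apply, coeff_mul]
  rw [grassDeriv_sum fun y _ => (hf.grassDiffAt hV hx y.1).mul (hg.grassDiffAt hV hx y.2),
    ← sum_add_distrib]
  exact sum_congr rfl fun y _ =>
    grassDeriv_mul (hf.grassDiffAt hV hx y.1) (hg.grassDiffAt hV hx y.2) i

theorem realD_realD {f : SFun n p} (hf : IsSmooth V f) (hV : IsOpen V) (i j : Fin n)
    {x : Fin n → ℝ} (hx : x ∈ V) :
    BV.realD i (BV.realD j f) x = BV.realD j (BV.realD i f) x := by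
  refine ser_ext fun m l => ?_
  set h := fun y => l (coeff m (f y)) with hh
  have key : ∀ i j, l (coeff m (BV.realD i (BV.realD j f) x)) =
      fderiv ℝ (fderiv ℝ h) x (Pi.single i 1) (Pi.single j 1) := by
    intro i j
    rw [(hf.realD hV j).apply_realD hV hx]
    have h1 : (fun y => l (coeff m (BV.realD j f y))) =ᶠ[nhds x]
        fun y => fderiv ℝ h y (Pi.single j 1) := by
      filter_upwards [hV.mem_nhds hx] with y hy
      exact hf.apply_realD hV hy j m l
    rw [h1.fderiv_eq]
    have h2 : DifferentiableAt ℝ (fderiv ℝ h) x :=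
      (((hf m l).fderiv_of_isOpen (m := ∞) hV le_rfl).contDiffAt (hV.mem_nhds hx)).differentiableAt
        (by simp)
    have h3 := fderiv_clm_apply h2 (differentiableAt_const (Pi.single j (1 : ℝ)))
    rw [h3]
    simp
  rw [key, key]
  have h4 : ContDiffAt ℝ ∞ h x := (hf m l).contDiffAt (hV.mem_nhds hx)
  exact h4.isSymmSndFDerivAt (by
    rw [minSmoothness_of_isRCLikeNormedField]
    exact WithTop.coe_le_coe.2 (le_top : (2 : ℕ∞) ≤ ⊤)) _ _

end Local

/-! ### The algebra of smooth superfunctions -/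

section SuperFun

open scoped ContDiff
variable {V : Opens (Fin n → ℝ)}

open Classical in
/-- Extension by zero. -/
def extendFun (V : Opens (Fin n → ℝ)) (f : V → Ser p) : SFun n p :=
  fun x => if h : x ∈ V then f ⟨x, h⟩ else 0

theorem extendFun_apply {f : V → Ser p} {x : Fin n → ℝ} (hx : x ∈ V) :
    extendFun V f x = f ⟨x, hx⟩ := dif_pos hx

/-- The algebra of smooth superfunctions on `V`. -/
def superFunSub (V : Opens (Fin n → ℝ)) (p : W → ZMod 2) : Subalgebra ℂ (V → Ser p) where
  carrier := {f | IsSmooth (V : Set (Fin n → ℝ)) (extendFun V f)}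
  mul_mem' ha hb := (IsSmooth.mul ha hb).congr fun x hx => by
    rw [Pi.mul_apply, extendFun_apply hx, extendFun_apply hx, extendFun_apply hx]; rfl
  add_mem' ha hb := (IsSmooth.add ha hb).congr fun x hx => by
    rw [Pi.add_apply, extendFun_apply hx, extendFun_apply hx, extendFun_apply hx]; rfl
  algebraMap_mem' c := (isSmooth_const (algebraMap ℂ (Ser p) c)).congr fun x hx => by
    rw [extendFun_apply hx]; rfl

/-- The type of smooth superfunctions on `V`. -/
abbrev SuperFun (V : Opens (Fin n → ℝ)) (p : W → ZMod 2) : Type := ↥(superFunSub V p)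

/-- The superfunction as a function on the whole space. -/
def SuperFun.ext' (f : SuperFun V p) : SFun n p := extendFun V f.1

theorem SuperFun.smooth (f : SuperFun V p) : IsSmooth (V : Set (Fin n → ℝ)) f.ext' := f.2

theorem SuperFun.ext'_apply (f : SuperFun V p) (x : V) : f.ext' x = f.1 x := extendFun_apply x.2

/-- The restriction of a function to `V`. -/
def sRestrict (V : Opens (Fin n → ℝ)) (f : SFun n p)
    (hf : IsSmooth (V : Set (Fin n → ℝ)) f) : SuperFun V p :=
  ⟨fun x => f x, hf.congr fun _ hx => extendFun_apply hx⟩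

theorem SuperFun.ext_iff' {f g : SuperFun V p} : f = g ↔ ∀ x, f.1 x = g.1 x :=
  ⟨fun h _ => h ▸ rfl, fun h => Subtype.ext (funext h)⟩

theorem SuperFun.ext {f g : SuperFun V p} (h : ∀ x, f.1 x = g.1 x) : f = g :=
  SuperFun.ext_iff'.2 h

/-- Evaluation at a point. -/
def SuperFun.eval (x : V) : SuperFun V p →ₐ[ℂ] Ser p :=
  (Pi.evalAlgHom ℂ (fun _ : V => Ser p) x).comp (superFunSub V p).val

@[simp]
theorem SuperFun.eval_apply (x : V) (f : SuperFun V p) : SuperFun.eval x f = f.1 x := rfl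

/-- The action of a local operator on superfunctions. -/
def mapLocal (T : Ser p →ₗ[ℂ] Ser p) (hT : IsLocal T) : SuperFun V p →ₗ[ℂ] SuperFun V p where
  toFun f := ⟨fun x => T (f.1 x), (f.smooth.mapLocal hT).congr fun x hx => by
    rw [extendFun_apply hx, f.ext'_apply ⟨x, hx⟩]⟩
  map_add' f g := SuperFun.ext fun x => map_add T _ _
  map_smul' c f := SuperFun.ext fun x => map_smul T c _

@[simp]
theorem mapLocal_val (T : Ser p →ₗ[ℂ] Ser p) (hT : IsLocal T) (f : SuperFun V p) (x : V) :
    (mapLocal T hT f).1 x = T (f.1 x) := rfl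

/-- The parity involution of superfunctions. -/
def superInvol : SuperFun V p →ₐ[ℂ] SuperFun V p :=
  AlgHom.ofLinearMap (mapLocal _ isLocal_invol) (SuperFun.ext fun _ => map_one (invol (R := Ser p)))
    fun f g => SuperFun.ext fun x => map_mul (invol (R := Ser p)) (f.1 x) (g.1 x)

instance : SuperAlgebra (SuperFun V p) where
  invol := superInvol
  invol_invol f := SuperFun.ext fun x => SuperAlgebra.invol_invol (f.1 x)
  comm_even f g h := SuperFun.ext fun x =>
    SuperAlgebra.comm_even (f.1 x) (g.1 x) (SuperFun.ext_iff'.1 h x)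
  comm_odd f g h := SuperFun.ext fun x =>
    SuperAlgebra.comm_odd (f.1 x) (g.1 x) (SuperFun.ext_iff'.1 h x)

@[simp]
theorem invol_val (f : SuperFun V p) (x : V) : (invol f).1 x = invol (f.1 x) := rfl

@[simp]
theorem twist_val (e : ZMod 2) (f : SuperFun V p) (x : V) :
    (twist e f).1 x = twist e (f.1 x) := by
  rcases zmod2_cases e with rfl | rfl
  · rw [twist_zero, twist_zero]
  · rw [twist_one, twist_one, invol_val]

theorem isHomog_iff_val {e : ZMod 2} {f : SuperFun V p} :
    IsHomog e f ↔ ∀ x, IsHomog e (f.1 x) := SuperFun.ext_iff'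

/-- The partial derivative along a real coordinate. -/
def superRealD (i : Fin n) : SuperFun V p →ₗ[ℂ] SuperFun V p where
  toFun f := sRestrict V (realD i f.ext') (f.smooth.realD V.isOpen i)
  map_add' f g := SuperFun.ext fun x => by
    refine ser_ext fun m l => ?_
    change l (coeff m (realD i (f + g).ext' x)) =
      l (coeff m (realD i f.ext' x + realD i g.ext' x))
    rw [map_add, map_add, (f + g).smooth.apply_realD V.isOpen x.2,
      f.smooth.apply_realD V.isOpen x.2, g.smooth.apply_realD V.isOpen x.2,
      ← add_apply, ← fderiv_fun_add]
    · congr 1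
      refine Filter.EventuallyEq.fderiv_eq ?_
      filter_upwards [V.isOpen.mem_nhds x.2] with y hy
      rw [(f + g).ext'_apply ⟨y, hy⟩, f.ext'_apply ⟨y, hy⟩, g.ext'_apply ⟨y, hy⟩, ← map_add,
        ← map_add]
      rfl
    · exact f.smooth.grassDiffAt V.isOpen x.2 m l
    · exact g.smooth.grassDiffAt V.isOpen x.2 m l
  map_smul' c f := SuperFun.ext fun x => by
    refine ser_ext fun m l => ?_
    change l (coeff m (realD i (c • f).ext' x)) =
      l (coeff m (c • realD i f.ext' x))
    rw [coeff_csmul, map_smul, (c • f).smooth.apply_realD V.isOpen x.2,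
      f.smooth.apply_realD V.isOpen x.2, smul_eq_mul, ← smul_eq_mul, ← smul_apply,
      ← fderiv_fun_const_smul]
    · congr 1
      refine Filter.EventuallyEq.fderiv_eq ?_
      filter_upwards [V.isOpen.mem_nhds x.2] with y hy
      rw [(c • f).ext'_apply ⟨y, hy⟩, f.ext'_apply ⟨y, hy⟩]
      exact map_smul l c _
    · exact f.smooth.grassDiffAt V.isOpen x.2 m l

theorem superRealD_val (i : Fin n) (f : SuperFun V p) (x : V) :
    (superRealD i f).1 x = realD i f.ext' x := rfl

theorem superRealD_restrict (i : Fin n) (f : SFun n p) (hf : IsSmooth (V : Set (Fin n → ℝ)) f)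
    (x : V) : (superRealD i (sRestrict V f hf)).1 x = realD i f x :=
  realD_congr V.isOpen (fun _ hx => extendFun_apply hx) i x.2

theorem superRealD_mapLocal (i : Fin n) {T : Ser p →ₗ[ℂ] Ser p} (hT : IsLocal T)
    (f : SuperFun V p) :
    superRealD i (mapLocal T hT f) = mapLocal T hT (superRealD i f) :=
  SuperFun.ext fun x => by
    rw [superRealD_val, mapLocal_val, superRealD_val, ← realD_mapLocal f.smooth V.isOpen hT i x.2]
    exact realD_congr V.isOpen (fun y hy => by
      rw [SuperFun.ext'_apply _ ⟨y, hy⟩, f.ext'_apply ⟨y, hy⟩, mapLocal_val]) i x.2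

theorem superRealD_mul (i : Fin n) (f g : SuperFun V p) :
    superRealD i (f * g) = superRealD i f * g + f * superRealD i g :=
  SuperFun.ext fun x => by
    change realD i (f * g).ext' x = realD i f.ext' x * g.1 x + f.1 x * realD i g.ext' x
    rw [← f.ext'_apply, ← g.ext'_apply, ← realD_mul f.smooth g.smooth V.isOpen i x.2]
    exact realD_congr V.isOpen (fun y hy => by
      rw [SuperFun.ext'_apply _ ⟨y, hy⟩, Pi.mul_apply, f.ext'_apply ⟨y, hy⟩,
        g.ext'_apply ⟨y, hy⟩]; rfl) i x.2

theorem superRealD_comm (i j : Fin n) (f : SuperFun V p) :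
    superRealD i (superRealD j f) = superRealD j (superRealD i f) :=
  SuperFun.ext fun x => by
    have h : ∀ i j, (superRealD i (superRealD j f)).1 x = realD i (realD j f.ext') x :=
      fun i j => superRealD_restrict i _ (f.smooth.realD V.isOpen j) x
    rw [h, h, realD_realD f.smooth V.isOpen i j x.2]

/-- The parities of all variables. -/
abbrev varPar (n : ℕ) (p : W → ZMod 2) : Fin n ⊕ W → ZMod 2 := Sum.elim (fun _ => 0) p

/-- The partial derivatives of superfunctions. -/
def funCalculus (V : Opens (Fin n → ℝ)) (p : W → ZMod 2) :
    SuperCalculus (SuperFun V p) (varPar n p) where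
  D v := match v with
    | .inl i => superRealD i
    | .inr w => mapLocal (serD w) (isLocal_serD w)
  D_mul v f g := by
    rcases v with i | w
    · simpa using superRealD_mul i f g
    · refine SuperFun.ext fun x => ?_
      change serD w (f.1 x * g.1 x) = serD w (f.1 x) * g.1 x + (twist (p w) f).1 x * serD w (g.1 x)
      rw [twist_val]
      exact (serCalculus p).D_mul w _ _
  D_invol v f := by
    rcases v with i | w
    · simp only [Sum.elim_inl, sg_zero, one_smul]
      exact superRealD_mapLocal i isLocal_invol f
    · exact SuperFun.ext fun x => (serCalculus p).D_invol w (f.1 x)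
  D_comm v w f := by
    rcases v with i | v <;> rcases w with j | w
    · simp only [Sum.elim_inl, mul_zero, sg_zero, one_smul]
      exact superRealD_comm i j f
    · simp only [Sum.elim_inl, zero_mul, sg_zero, one_smul]
      exact superRealD_mapLocal i (isLocal_serD w) f
    · simp only [Sum.elim_inl, mul_zero, sg_zero, one_smul]
      exact (superRealD_mapLocal j (isLocal_serD v) f).symm
    · exact SuperFun.ext fun x => (serCalculus p).D_comm v w (f.1 x)

theorem funCalculus_D_inl (i : Fin n) : (funCalculus V p).D (.inl i) = superRealD i := rfl

theorem funCalculus_D_inr (w : W) (f : SuperFun V p) (x : V) :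
    ((funCalculus V p).D (.inr w) f).1 x = serD w (f.1 x) := rfl

theorem funCalculus_DR_inr (w : W) (f : SuperFun V p) (x : V) :
    ((funCalculus V p).DR (.inr w) f).1 x = (serCalculus p).DR w (f.1 x) := by
  rw [SuperCalculus.DR_apply, twist_val]
  rfl

theorem lD_apply (v : Fin n ⊕ W) (f : SFun n p) (hf : IsSmooth (V : Set (Fin n → ℝ)) f) (x : V) :
    lD v f x = ((funCalculus V p).D v (sRestrict V f hf)).1 x := by
  rcases v with i | w
  · exact (superRealD_restrict i f hf x).symm
  · rw [lD_inr]; rfl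

theorem rD_apply (v : Fin n ⊕ W) (f : SFun n p) (hf : IsSmooth (V : Set (Fin n → ℝ)) f) (x : V) :
    rD v f x = ((funCalculus V p).DR v (sRestrict V f hf)).1 x := by
  rcases v with i | w
  · rw [SuperCalculus.DR_apply]
    simp only [Sum.elim_inl, twist_zero]
    exact (superRealD_restrict i f hf x).symm
  · rw [rD_inr, funCalculus_DR_inr]; rfl

theorem IsSmooth.lD {U : Set (Fin n → ℝ)} {f : SFun n p} (hf : IsSmooth U f) (hU : IsOpen U)
    (v : Fin n ⊕ W) : IsSmooth U (lD v f) := by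
  rcases v with i | w
  · exact hf.realD hU i
  · rw [lD_inr]
    exact hf.mapLocal (isLocal_serD w)

theorem IsSmooth.rD {U : Set (Fin n → ℝ)} {f : SFun n p} (hf : IsSmooth U f) (hU : IsOpen U)
    (v : Fin n ⊕ W) : IsSmooth U (rD v f) := by
  rcases v with i | w
  · exact hf.realD hU i
  · have : IsLocal ((serCalculus p).DR w) := by
      intro m l
      rcases zmod2_cases (p w) with h | h
      · obtain ⟨m', l', h'⟩ := isLocal_serD w m l
        refine ⟨m', l', fun s => ?_⟩
        rw [SuperCalculus.DR_apply, h, twist_zero]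
        exact h' s
      · obtain ⟨m₁, l₁, h₁⟩ := isLocal_invol (p := p) m l
        obtain ⟨m', l', h'⟩ := isLocal_serD w m₁ l₁
        refine ⟨m', l', fun s => ?_⟩
        rw [SuperCalculus.DR_apply, h, twist_one]
        exact (h₁ _).trans (h' s)
    rw [rD_inr]
    exact hf.mapLocal this

/-- Setting variables to zero, as a homomorphism of algebras of superfunctions. -/
def zeroing (T : Set W) : SuperFun V p →ₐ[ℂ] SuperFun V p :=
  AlgHom.ofLinearMap (mapLocal _ (isLocal_setZero T))
    (SuperFun.ext fun _ => map_one (setZeroHom (p := p) T))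
    fun f g => SuperFun.ext fun x => map_mul (setZeroHom (p := p) T) (f.1 x) (g.1 x)

@[simp]
theorem zeroing_val (T : Set W) (f : SuperFun V p) (x : V) :
    (zeroing T f).1 x = setZero T (f.1 x) := rfl

theorem zeroing_twist (T : Set W) (e : ZMod 2) (f : SuperFun V p) :
    zeroing T (twist e f) = twist e (zeroing T f) :=
  SuperFun.ext fun x => by
    rw [zeroing_val, twist_val, twist_val, zeroing_val, setZero_twist]

theorem IsHomog.zeroing {e : ZMod 2} {f : SuperFun V p} (h : IsHomog e f) (T : Set W) :
    IsHomog e (zeroing T f) := by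
  unfold IsHomog at *
  rw [← twist_one, ← zeroing_twist, twist_one, h, map_smul]

theorem D_zeroing {T : Set W} {v : Fin n ⊕ W} (hv : ∀ w ∈ T, v ≠ .inr w) (f : SuperFun V p) :
    (funCalculus V p).D v (zeroing T f) = zeroing T ((funCalculus V p).D v f) := by
  rcases v with i | w
  · exact superRealD_mapLocal i (isLocal_setZero T) f
  · exact SuperFun.ext fun x => serD_setZero_of_notMem (fun h => hv w h rfl) (f.1 x)

theorem DR_zeroing {T : Set W} {v : Fin n ⊕ W} (hv : ∀ w ∈ T, v ≠ .inr w)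
    (f : SuperFun V p) :
    (funCalculus V p).DR v (zeroing T f) = zeroing T ((funCalculus V p).DR v f) := by
  rw [SuperCalculus.DR_apply, D_zeroing hv, SuperCalculus.DR_apply, zeroing_twist]

theorem D_zeroing_of_mem {T : Set W} {w : W} (hw : w ∈ T) (f : SuperFun V p) :
    (funCalculus V p).D (.inr w) (zeroing T f) = 0 :=
  SuperFun.ext fun x => serD_setZero_of_mem hw (f.1 x)

/-- The constant superfunctions. -/
def superConst (s : Ser p) : SuperFun V p := sRestrict V (fun _ => s) (isSmooth_const s)

@[simp]
theorem superConst_val (s : Ser p) (x : V) : (superConst s : SuperFun V p).1 x = s := rfl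

theorem superRealD_superConst (i : Fin n) (s : Ser p) :
    superRealD i (superConst s : SuperFun V p) = 0 := by
  refine SuperFun.ext fun x => ?_
  rw [superConst, superRealD_restrict]
  refine ser_ext fun m l => ?_
  rw [(isSmooth_const s).apply_realD V.isOpen x.2]
  simp

end SuperFun

/-! ### The exponential -/

section Exponential

open scoped ContDiff
variable {V : Opens (Fin n → ℝ)}

/-- The series whose coefficients of degree less than `k` vanish. -/
def serLow (p : W → ZMod 2) (k : ℕ) : Submodule ℂ (Ser p) where
  carrier := {s | ∀ m, Finsupp.degree m < k → coeff m s = 0}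
  add_mem' ha hb m hm := by rw [map_add, ha m hm, hb m hm, add_zero]
  zero_mem' m _ := map_zero _
  smul_mem' c a ha m hm := by rw [coeff_csmul, ha m hm, smul_zero]

theorem mul_mem_serLow {k : ℕ} {b : Ser p} (a : Ser p) (hb : b ∈ serLow p k) :
    a * b ∈ serLow p k := by
  classical
  intro m hm
  rw [coeff_mul]
  refine sum_eq_zero fun x hx => ?_
  rw [Finset.HasAntidiagonal.mem_antidiagonal] at hx
  rw [hb, mul_zero]
  rw [← hx, map_add] at hm
  omega

theorem serD_mem_serLow {k : ℕ} {a : Ser p} (w : W) (ha : a ∈ serLow p (k + 1)) :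
    serD w a ∈ serLow p k := by
  intro m hm
  rcases zmod2_cases (p w) with h | h
  · rw [serD_even ⟨w, h⟩, coeff_evenDer, ha, smul_zero]
    rw [map_add, Finsupp.degree_single]
    omega
  · rw [serD_odd ⟨w, h⟩]
    change CliffordAlgebra.contractLeft _ _ = _
    rw [ha m (by omega), map_zero]

theorem eq_zero_of_forall_mem_serLow {a : Ser p} (ha : ∀ k, a ∈ serLow p k) : a = 0 :=
  MvPowerSeries.ext fun m => ha (Finsupp.degree m + 1) m (by omega)

/-- The functions with values in `serLow p k`. -/
def superLow (V : Opens (Fin n → ℝ)) (p : W → ZMod 2) (k : ℕ) : Submodule ℂ (SuperFun V p) where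
  carrier := {f | ∀ x, f.1 x ∈ serLow p k}
  add_mem' ha hb x := add_mem (ha x) (hb x)
  zero_mem' _ := zero_mem _
  smul_mem' c _ ha x := Submodule.smul_mem _ c (ha x)

theorem mul_mem_superLow {k : ℕ} {g : SuperFun V p} (f : SuperFun V p) (hg : g ∈ superLow V p k) :
    f * g ∈ superLow V p k := fun x => mul_mem_serLow _ (hg x)

theorem D_mem_superLow {k : ℕ} {f : SuperFun V p} (v : Fin n ⊕ W) (hf : f ∈ superLow V p (k + 1)) :
    (funCalculus V p).D v f ∈ superLow V p k := by
  rcases v with i | w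
  · intro x m hm
    refine grass_ext fun l => ?_
    change l (coeff m (realD i f.ext' x)) = _
    rw [f.smooth.apply_realD V.isOpen x.2, map_zero]
    have : (fun y => l (coeff m (f.ext' y))) =ᶠ[nhds x.1] fun _ => 0 := by
      filter_upwards [V.isOpen.mem_nhds x.2] with y hy
      rw [f.ext'_apply ⟨y, hy⟩, hf ⟨y, hy⟩ m (by omega), map_zero]
    rw [this.fderiv_eq]
    simp
  · exact fun x => serD_mem_serLow w (hf x)

theorem eq_zero_of_forall_mem_superLow {f : SuperFun V p} (hf : ∀ k, f ∈ superLow V p k) : f = 0 :=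
  SuperFun.ext fun x => eq_zero_of_forall_mem_serLow fun k => hf k x

theorem setZero_univ (s : Ser p) : setZero Set.univ s = algebraMap ℂ (Ser p) (body s) := by
  classical
  ext m
  rw [MvPowerSeries.algebraMap_apply, MvPowerSeries.coeff_C]
  by_cases h : m = 0
  · subst h
    rw [coeff_setZero_of_avoids (avoids_zero _), if_pos rfl, body]
    have h0 : oddProj p Set.univ = 0 :=
      LinearMap.ext fun v => funext fun w => oddProj_apply_of_mem (Set.mem_univ _) v
    rw [h0]
    generalize coeff 0 s = a
    induction a using ExteriorAlgebra.induction with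
    | algebraMap r => rw [AlgHom.commutes, ExteriorAlgebra.algebraMap_leftInverse]
    | ι v =>
      rw [ExteriorAlgebra.map_apply_ι, algebraMapInv_ι, LinearMap.zero_apply, map_zero, map_zero]
    | mul a b ha hb => rw [map_mul, ha, hb, map_mul, map_mul]
    | add a b ha hb => rw [map_add, ha, hb, map_add, map_add]
  · rw [coeff_setZero_of_not_avoids, if_neg h]
    intro h'
    refine h (Finsupp.support_eq_empty.1 (Finset.eq_empty_of_forall_notMem fun w hw => ?_))
    exact h' w hw (Set.mem_univ _)

theorem body_setZero (T : Set W) (s : Ser p) : body (setZero T s) = body s := by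
  have h : setZero Set.univ (setZero T s) = setZero Set.univ s := by
    rw [setZero_setZero, Set.univ_union]
  rw [setZero_univ, setZero_univ] at h
  have := congrArg body h
  rwa [← bodyHom_apply (algebraMap _ _ _), ← bodyHom_apply (algebraMap _ _ _), AlgHom.commutes,
    AlgHom.commutes] at this

@[simp]
theorem body_algebraMap (c : ℂ) : body (algebraMap ℂ (Ser p) c) = c :=
  (bodyHom p).commutes c

/-- The body of a superfunction, as a superfunction. -/
abbrev superBody : SuperFun V p →ₐ[ℂ] SuperFun V p := zeroing Set.univ

theorem superBody_val (f : SuperFun V p) (x : V) :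
    (superBody f).1 x = algebraMap ℂ (Ser p) (body (f.1 x)) := setZero_univ _

theorem isHomog_superBody (f : SuperFun V p) : IsHomog 0 (superBody f) :=
  isHomog_iff_val.2 fun x => by rw [superBody_val]; exact IsHomog.algebraMap _

theorem isSmooth_algebraMap {h : (Fin n → ℝ) → ℂ} {U : Set (Fin n → ℝ)} (hh : ContDiffOn ℝ ∞ h U) :
    IsSmooth U (fun x => algebraMap ℂ (Ser p) (h x)) := fun m l => by
  have : ∀ x, l (coeff m (algebraMap ℂ (Ser p) (h x))) =
      h x • l (coeff m (1 : Ser p)) := fun x => by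
    rw [Algebra.algebraMap_eq_smul_one, coeff_csmul, map_smul]
  simp only [this]
  exact hh.smul contDiffOn_const

/-- The superfunction given by a smooth complex function. -/
def scal (h : (Fin n → ℝ) → ℂ) (hh : ContDiffOn ℝ ∞ h (V : Set (Fin n → ℝ))) : SuperFun V p :=
  sRestrict V (fun x => algebraMap ℂ (Ser p) (h x)) (isSmooth_algebraMap hh)

@[simp]
theorem scal_val (h : (Fin n → ℝ) → ℂ) (hh : ContDiffOn ℝ ∞ h (V : Set (Fin n → ℝ))) (x : V) :
    (scal (p := p) h hh).1 x = algebraMap ℂ (Ser p) (h x) := rfl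

theorem isHomog_scal (h : (Fin n → ℝ) → ℂ) (hh : ContDiffOn ℝ ∞ h (V : Set (Fin n → ℝ))) :
    IsHomog 0 (scal (p := p) h hh) :=
  isHomog_iff_val.2 fun _ => IsHomog.algebraMap _

theorem zeroing_scal (T : Set W) (h : (Fin n → ℝ) → ℂ)
    (hh : ContDiffOn ℝ ∞ h (V : Set (Fin n → ℝ))) :
    zeroing T (scal (p := p) h hh) = scal h hh :=
  SuperFun.ext fun x => (setZeroHom T).commutes (h x)

theorem superRealD_scal (i : Fin n) (h : (Fin n → ℝ) → ℂ)
    (hh : ContDiffOn ℝ ∞ h (V : Set (Fin n → ℝ))) (x : V) :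
    (superRealD i (scal (p := p) h hh)).1 x =
      algebraMap ℂ (Ser p) (fderiv ℝ h x (Pi.single i 1)) := by
  rw [scal, superRealD_restrict]
  refine ser_ext fun m l => ?_
  rw [(isSmooth_algebraMap hh).apply_realD V.isOpen x.2]
  have : ∀ c : ℂ, l (coeff m (algebraMap ℂ (Ser p) c)) =
      c * l (coeff m (1 : Ser p)) := fun x => by
    rw [Algebra.algebraMap_eq_smul_one, coeff_csmul, map_smul, smul_eq_mul]
  simp only [this]
  rw [fderiv_mul_const ((hh.contDiffAt (V.isOpen.mem_nhds x.2)).differentiableAt (by simp))]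
  simp [mul_comm]

theorem contDiffOn_body (f : SuperFun V p) :
    ContDiffOn ℝ ∞ (fun x => body (f.ext' x)) (V : Set (Fin n → ℝ)) :=
  f.smooth 0 algebraMapInv.toLinearMap

theorem fderiv_body (f : SuperFun V p) (i : Fin n) (x : V) :
    fderiv ℝ (fun x => body (f.ext' x)) x (Pi.single i 1) = body ((superRealD i f).1 x) :=
  (f.smooth.apply_realD V.isOpen x.2 i 0 algebraMapInv.toLinearMap).symm

/-- The exponential of the body. -/
def expBody (f : SuperFun V p) : SuperFun V p :=
  scal (fun x => Complex.exp (body (f.ext' x))) (contDiffOn_body f).cexp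

theorem expBody_val (f : SuperFun V p) (x : V) :
    (expBody f).1 x = algebraMap ℂ (Ser p) (Complex.exp (body (f.1 x))) := by
  rw [← f.ext'_apply]; rfl

theorem D_expBody (f : SuperFun V p) (v : Fin n ⊕ W) :
    (funCalculus V p).D v (expBody f) = (funCalculus V p).D v (superBody f) * expBody f := by
  rcases v with i | w
  · refine SuperFun.ext fun x => ?_
    rw [funCalculus_D_inl]
    change _ = (superRealD i (superBody f)).1 x * _
    have h1 : superRealD i (superBody f) = superBody (superRealD i f) :=
      superRealD_mapLocal i (isLocal_setZero Set.univ) f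
    rw [h1, superBody_val, expBody, superRealD_scal, scal_val, ← map_mul, ← fderiv_body]
    congr 1
    have := ((contDiffOn_body f).contDiffAt (V.isOpen.mem_nhds x.2)).differentiableAt (by simp)
    rw [(this.hasFDerivAt.cexp).fderiv]
    simp [mul_comm]
  · have h1 : zeroing Set.univ (expBody f) = expBody f := zeroing_scal _ _ _
    rw [← h1, D_zeroing_of_mem (Set.mem_univ w), D_zeroing_of_mem (Set.mem_univ w),
      zero_mul]

/-- The superfunction without its body. -/
abbrev nilPart (f : SuperFun V p) : SuperFun V p := f - superBody f

theorem nilPart_val (f : SuperFun V p) (x : V) :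
    (nilPart f).1 x = f.1 x - algebraMap ℂ (Ser p) (body (f.1 x)) := by
  rw [← superBody_val]; rfl

theorem sub_body_mem_serGE (s : Ser p) : s - algebraMap ℂ (Ser p) (body s) ∈ serGE p 1 := by
  rw [mem_serGE_one_iff, ← bodyHom_apply, map_sub, AlgHom.commutes, bodyHom_apply]
  exact sub_self _

/-- Partial sums of the exponential series. -/
def expSum {R : Type*} [Ring R] [Algebra ℂ R] (K : ℕ) (a : R) : R :=
  ∑ k ∈ Finset.range K, ((k.factorial : ℂ)⁻¹) • a ^ k

theorem coeff_sexp (s : Ser p) {m} {K : ℕ} (hK : Finsupp.degree m + oddCard p < K) :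
    coeff m (sexp s) = coeff m
      (algebraMap ℂ (Ser p) (Complex.exp (body s)) *
        expSum K (s - algebraMap ℂ (Ser p) (body s))) := by
  rw [← Algebra.smul_def, coeff_csmul, sexp, coeff_ofCoeff, expSum, map_sum,
    finsum_eq_sum_of_support_subset (s := Finset.range K)]
  · rfl
  · intro k hk
    by_contra hk'
    refine hk ?_
    beta_reduce
    rw [coeff_eq_zero_of_mem_serGE (pow_mem_serGE (sub_body_mem_serGE s) k), smul_zero]
    simp only [Finset.coe_range, Set.mem_Iio, not_lt] at hk'
    omega

theorem isSmooth_sexp (f : SuperFun V p) :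
    IsSmooth (V : Set (Fin n → ℝ)) (fun x => sexp (f.ext' x)) := by
  intro m l
  have h := (expBody f * expSum (Finsupp.degree m + oddCard p + 1) (nilPart f)).smooth m l
  refine h.congr fun x hx => ?_
  rw [SuperFun.ext'_apply _ ⟨x, hx⟩]
  change l (coeff m (sexp (f.ext' x))) = _
  rw [f.ext'_apply ⟨x, hx⟩, coeff_sexp _ (Nat.lt_succ_self _)]
  change _ = l (coeff m ((expBody f).1 ⟨x, hx⟩ * SuperFun.eval ⟨x, hx⟩ (expSum _ _)))
  rw [expBody_val, expSum, expSum, map_sum]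
  simp only [map_smul, map_pow, SuperFun.eval_apply, nilPart_val]

/-- The exponential of a superfunction. -/
def superExp (f : SuperFun V p) : SuperFun V p := sRestrict V _ (isSmooth_sexp f)

theorem superExp_val (f : SuperFun V p) (x : V) : (superExp f).1 x = sexp (f.1 x) := by
  rw [← f.ext'_apply]; rfl

theorem superExp_sub_mem (f : SuperFun V p) (k : ℕ) {K : ℕ} (hK : k + oddCard p < K) :
    superExp f - expBody f * expSum K (nilPart f) ∈ superLow V p k := by
  intro x m hm
  change coeff m ((superExp f).1 x - (expBody f).1 x * SuperFun.eval x (expSum _ _))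
    = 0
  rw [superExp_val, map_sub, coeff_sexp (K := K) _ (by omega), expBody_val, expSum, expSum,
    map_sum]
  simp only [map_smul, map_pow, SuperFun.eval_apply, nilPart_val]
  exact sub_self _

theorem SuperCalculus.D_pow {R : Type*} [Ring R] [Algebra ℂ R] [SuperAlgebra R] {V : Type*}
    {q : V → ZMod 2} (𝒟 : SuperCalculus R q) (v : V) {a : R} (ha : IsHomog 0 a) (k : ℕ) :
    𝒟.D v (a ^ (k + 1)) = ((k + 1 : ℕ) : ℂ) • (𝒟.D v a * a ^ k) := by
  induction k with
  | zero => simp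
  | succ k ih =>
    rw [pow_succ', 𝒟.D_mul, ih, ha.twist_eq, mul_zero, sg_zero, one_smul, mul_smul_comm,
      ← mul_assoc, ha.mul_comm', twist_zero, mul_assoc, ← pow_succ', Nat.cast_succ (k + 1), add_smul,
      one_smul, add_comm]

theorem SuperCalculus.D_one {R : Type*} [Ring R] [Algebra ℂ R] [SuperAlgebra R] {V : Type*}
    {q : V → ZMod 2} (𝒟 : SuperCalculus R q) (v : V) : 𝒟.D v 1 = 0 := by
  have := 𝒟.D_mul v 1 1
  rw [map_one (twist (R := R) (q v)), mul_one, one_mul, mul_one] at this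
  exact left_eq_add.1 this

theorem D_expSum {R : Type*} [Ring R] [Algebra ℂ R] [SuperAlgebra R] {V : Type*}
    {q : V → ZMod 2} (𝒟 : SuperCalculus R q) (v : V) {a : R} (ha : IsHomog 0 a) (K : ℕ) :
    𝒟.D v (expSum (K + 1) a) = 𝒟.D v a * expSum K a := by
  rw [expSum, map_sum, Finset.sum_range_succ', expSum, mul_sum]
  rw [pow_zero, map_smul, 𝒟.D_one, smul_zero, add_zero]
  refine sum_congr rfl fun k _ => ?_
  rw [map_smul, 𝒟.D_pow v ha, smul_smul, mul_smul_comm, Nat.factorial_succ]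
  congr 1
  have : ((k + 1 : ℕ) : ℂ) ≠ 0 := Nat.cast_ne_zero.2 (Nat.succ_ne_zero k)
  push_cast at this ⊢
  field_simp

theorem D_superExp {f : SuperFun V p} (hf : IsHomog 0 f) (v : Fin n ⊕ W) :
    (funCalculus V p).D v (superExp f) = (funCalculus V p).D v f * superExp f := by
  set 𝒟 := funCalculus V p
  refine sub_eq_zero.1 (eq_zero_of_forall_mem_superLow fun k => ?_)
  set K := k + 1 + oddCard p + 1 with hK
  have hn : IsHomog 0 (nilPart f) := hf.sub (isHomog_superBody f)
  set ε := expBody f with hε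
  have hε0 : IsHomog 0 ε := isHomog_scal _ _
  have h1 : 𝒟.D v (ε * expSum (K + 1) (nilPart f)) =
      𝒟.D v (superBody f) * (ε * expSum (K + 1) (nilPart f)) +
        𝒟.D v (nilPart f) * (ε * expSum K (nilPart f)) := by
    rw [𝒟.D_mul, D_expSum 𝒟 v hn, D_expBody, hε0.twist_eq, mul_zero, sg_zero,
      one_smul, mul_assoc, ← mul_assoc ε (𝒟.D v _), hε0.mul_comm' (𝒟.D v _), twist_zero, mul_assoc]
  have h2 := D_mem_superLow v (superExp_sub_mem f (k + 1) (K := K + 1) (by omega))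
  have h3 := mul_mem_superLow (𝒟.D v (superBody f)) (superExp_sub_mem f k (K := K + 1) (by omega))
  have h4 := mul_mem_superLow (𝒟.D v (nilPart f)) (superExp_sub_mem f k (K := K) (by omega))
  have h5 := sub_mem h2 (add_mem h3 h4)
  rw [map_sub, ← hε] at h5
  convert h5 using 1
  change 𝒟.D v (superExp f) - 𝒟.D v f * superExp f = 𝒟.D v (superExp f) -
    𝒟.D v (ε * expSum (K + 1) (nilPart f)) - _
  have h6 : 𝒟.D v f = 𝒟.D v (superBody f) + 𝒟.D v (nilPart f) := by
    rw [← map_add, add_sub_cancel]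
  rw [h1, h6]
  simp only [mul_sub, add_mul]
  abel

theorem isUnit_sexp (s : Ser p) : IsUnit (sexp s) := by
  refine isUnit_of_body_ne_zero ?_
  have h1 : coeff 0 (sexp s) = _ :=
    coeff_sexp s (K := oddCard p + 1) (by simp)
  rw [body, h1]
  change body _ ≠ 0
  rw [← bodyHom_apply, map_mul, AlgHom.commutes, expSum, map_sum, Finset.sum_range_succ',
    sum_eq_zero]
  · simp [Complex.exp_ne_zero]
  · intro k _
    rw [map_smul, map_pow, map_sub, AlgHom.commutes, bodyHom_apply]
    simp

end Exponential

/-! ### Planck numbers -/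

section Planck

open scoped ContDiff
variable {V : Opens (Fin n → ℝ)}

/-- The formal variables, as constant series. -/
def serVar (p : W → ZMod 2) (w : W) : Ser p :=
  if h : p w = 0 then MvPowerSeries.X ⟨w, h⟩
  else if h : p w = 1 then
    MvPowerSeries.C (ι ℂ (Pi.single (⟨w, h⟩ : {w : W // p w = 1}) (1 : ℂ)))
  else 0

theorem coord_inr (w : W) (x : Fin n → ℝ) : coord p (.inr w) x = serVar p w := rfl

theorem serVar_even (w : {w : W // p w = 0}) : serVar p w.1 = MvPowerSeries.X w := dif_pos w.2

theorem serVar_odd (w : {w : W // p w = 1}) :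
    serVar p w.1 = MvPowerSeries.C (ι ℂ (Pi.single w (1 : ℂ))) := by
  rw [serVar, dif_neg (by rw [w.2]; exact one_ne_zero), dif_pos w.2]

theorem isHomog_serVar (w : W) : IsHomog (p w) (serVar p w) := by
  classical
  rcases zmod2_cases (p w) with h | h
  · rw [serVar_even ⟨w, h⟩, h, isHomog_zero_iff]
    ext m
    rw [coeff_invol, MvPowerSeries.coeff_X]
    split_ifs
    · exact map_one invol
    · exact map_zero invol
  · rw [serVar_odd ⟨w, h⟩, h, isHomog_one_iff]
    ext m
    rw [coeff_invol, map_neg, MvPowerSeries.coeff_C]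
    split_ifs
    · rw [exterior_invol, involute_ι]
    · rw [map_zero, neg_zero]

theorem serD_serVar (u w : W) : serD u (serVar p w) = if u = w then 1 else 0 := by
  classical
  rcases zmod2_cases (p u) with hu | hu <;> rcases zmod2_cases (p w) with hw | hw
  · rw [serD_even ⟨u, hu⟩, serVar_even ⟨w, hw⟩]
    ext m
    rw [coeff_evenDer, MvPowerSeries.coeff_X]
    by_cases h : u = w
    · subst h
      rw [if_pos rfl, MvPowerSeries.coeff_one]
      by_cases hm : m = 0
      · subst hm; simp
      · rw [if_neg (by simpa using hm), if_neg hm, smul_zero]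
    · rw [if_neg h, if_neg, smul_zero, map_zero]
      intro h'
      have := DFunLike.congr_fun h' ⟨u, hu⟩
      simp [Ne.symm h] at this
  · have h : u ≠ w := fun h => by rw [h, hw] at hu; exact one_ne_zero hu
    rw [serD_even ⟨u, hu⟩, serVar_odd ⟨w, hw⟩, if_neg h]
    ext m
    rw [coeff_evenDer, MvPowerSeries.coeff_C, if_neg (by simp), smul_zero, map_zero]
  · have h : u ≠ w := fun h => by rw [h, hw] at hu; exact zero_ne_one hu
    rw [serD_odd ⟨u, hu⟩, serVar_even ⟨w, hw⟩, if_neg h]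
    ext m
    change CliffordAlgebra.contractLeft _ _ = _
    rw [MvPowerSeries.coeff_X, map_zero]
    split_ifs
    · exact CliffordAlgebra.contractLeft_one _ _
    · exact map_zero _
  · rw [serD_odd ⟨u, hu⟩, serVar_odd ⟨w, hw⟩]
    ext m
    change CliffordAlgebra.contractLeft _ _ = _
    rw [MvPowerSeries.coeff_C]
    by_cases h : u = w
    · subst h
      rw [if_pos rfl, MvPowerSeries.coeff_one]
      split_ifs
      · rw [ι, CliffordAlgebra.contractLeft_ι]; simp
      · exact map_zero _
    · rw [if_neg h, map_zero]
      split_ifs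
      · rw [ι, CliffordAlgebra.contractLeft_ι]
        have h' : (⟨w, hw⟩ : {w : W // p w = 1}) ≠ ⟨u, hu⟩ := fun h' => h (congrArg Subtype.val h').symm
        simp [Ne.symm h']
      · exact map_zero _

theorem setZero_serVar {T : Set W} {w : W} (hw : w ∈ T) : setZero T (serVar p w) = 0 := by
  classical
  ext m
  rw [map_zero]
  by_cases ha : Avoids T m
  · rw [coeff_setZero_of_avoids ha]
    rcases zmod2_cases (p w) with h | h
    · rw [serVar_even ⟨w, h⟩, MvPowerSeries.coeff_X, if_neg, map_zero]
      rintro rfl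
      exact avoids_single.1 ha hw
    · rw [serVar_odd ⟨w, h⟩, MvPowerSeries.coeff_C]
      split_ifs
      · rw [ExteriorAlgebra.map_apply_ι]
        have : oddProj p T (Pi.single ⟨w, h⟩ 1) = 0 := by
          funext w'
          by_cases h' : w' = ⟨w, h⟩
          · subst h'; exact oddProj_apply_of_mem hw _
          · by_cases h'' : w'.1 ∈ T
            · exact oddProj_apply_of_mem h'' _
            · rw [oddProj_apply_of_notMem h'', Pi.single_eq_of_ne h', Pi.zero_apply]
        rw [this, map_zero]
      · exact map_zero _
  · exact coeff_setZero_of_not_avoids ha _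

/-- The formal variables, as superfunctions. -/
abbrev superVar (V : Opens (Fin n → ℝ)) (p : W → ZMod 2) (w : W) : SuperFun V p :=
  superConst (serVar p w)

theorem isHomog_superVar (w : W) : IsHomog (p w) (superVar V p w) :=
  isHomog_iff_val.2 fun _ => isHomog_serVar w

theorem D_superVar (v : Fin n ⊕ W) (w : W) :
    (funCalculus V p).D v (superVar V p w) = if v = .inr w then 1 else 0 := by
  rcases v with i | u
  · rw [if_neg (by simp)]
    exact superRealD_superConst i _
  · refine SuperFun.ext fun x => ?_
    refine (serD_serVar u w).trans ?_
    by_cases h : u = w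
    · rw [if_pos h, if_pos (by rw [h])]; rfl
    · rw [if_neg h, if_neg (by simpa using h)]; rfl

variable (pl : W → ℤ)

/-- The operator counting Planck numbers. -/
def superEuler : SuperFun V p →ₗ[ℂ] SuperFun V p :=
  ∑ w, (pl w : ℂ) • (LinearMap.mulLeft ℂ (superVar V p w) ∘ₗ (funCalculus V p).D (.inr w))

theorem superEuler_apply (f : SuperFun V p) :
    superEuler pl f = ∑ w, (pl w : ℂ) • (superVar V p w * (funCalculus V p).D (.inr w) f) := by
  simp [superEuler]

/-- Planck numbers of all variables. -/
abbrev varPlanck (n : ℕ) : Fin n ⊕ W → ℤ := Sum.elim (fun _ => 0) pl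

theorem D_superEuler (v : Fin n ⊕ W) (f : SuperFun V p) :
    (funCalculus V p).D v (superEuler pl f) = superEuler pl ((funCalculus V p).D v f) +
      (varPlanck pl n v : ℂ) • (funCalculus V p).D v f := by
  have h : ∀ w, (funCalculus V p).D v (superVar V p w * (funCalculus V p).D (.inr w) f) =
      superVar V p w * (funCalculus V p).D (.inr w) ((funCalculus V p).D v f) + if v = .inr w then (funCalculus V p).D v f else 0 := by
    intro w
    rw [SuperCalculus.D_mul, SuperCalculus.D_comm, (isHomog_superVar w).twist_eq, smul_mul_smul_comm, D_superVar]
    simp only [Sum.elim_inr]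
    rw [sg_mul_self, one_smul, add_comm]
    congr 1
    split_ifs with h
    · rw [one_mul, h]
    · rw [zero_mul]
  rw [superEuler_apply, superEuler_apply, map_sum]
  simp only [map_smul, h, smul_add, sum_add_distrib]
  congr 1
  rcases v with i | u
  · simp
  · rw [sum_eq_single u]
    · simp
    · intro w _ hw
      rw [if_neg (by simpa using hw.symm), smul_zero]
    · simp

theorem superEuler_twist (e : ZMod 2) (f : SuperFun V p) :
    superEuler pl (twist e f) = twist e (superEuler pl f) := by
  rw [superEuler_apply, superEuler_apply, map_sum]
  refine sum_congr rfl fun w _ => ?_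
  rw [map_smul, map_mul, (isHomog_superVar w).twist_eq, SuperCalculus.D_twist,
    mul_smul_comm, smul_mul_assoc, mul_comm e]
  rfl

/-- `f = ∑ iⁿ cₙ`, where the total Planck number is `j` if the factor `i` counts as one. -/
structure PlanckSeries (j : ℤ) (f : SuperFun V p) (c : ℕ → SuperFun V p) : Prop where
  euler : ∀ k, superEuler pl (c k) = ((j : ℂ) - k) • c k
  approx : ∀ k, ∃ K, ∀ K' ≥ K, f - ∑ i ∈ Finset.range K', Complex.I ^ i • c i ∈ superLow V p k

variable {pl}

theorem PlanckSeries.D {j : ℤ} {f : SuperFun V p} {c : ℕ → SuperFun V p}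
    (h : PlanckSeries pl j f c) (v : Fin n ⊕ W) :
    PlanckSeries pl (j - varPlanck pl n v) ((funCalculus V p).D v f)
      (fun k => (funCalculus V p).D v (c k)) where
  euler k := by
    have := D_superEuler pl v (c k)
    rw [h.euler, map_smul] at this
    rw [eq_sub_of_add_eq this.symm, ← sub_smul]
    congr 1
    push_cast
    ring
  approx k := by
    obtain ⟨K, hK⟩ := h.approx (k + 1)
    refine ⟨K, fun K' hK' => ?_⟩
    have := D_mem_superLow v (hK K' hK')
    rwa [map_sub, map_sum, sum_congr rfl fun i _ => map_smul _ _ _] at this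

theorem twist_mem_superLow {k : ℕ} {f : SuperFun V p} (e : ZMod 2) (hf : f ∈ superLow V p k) :
    twist e f ∈ superLow V p k := by
  intro x m hm
  rw [twist_val, coeff_twist, hf x m hm, map_zero]

theorem PlanckSeries.twist {j : ℤ} {f : SuperFun V p} {c : ℕ → SuperFun V p}
    (h : PlanckSeries pl j f c) (e : ZMod 2) :
    PlanckSeries pl j (twist e f) (fun k => BV.twist e (c k)) where
  euler k := by rw [superEuler_twist, h.euler, map_smul]
  approx k := by
    obtain ⟨K, hK⟩ := h.approx k
    refine ⟨K, fun K' hK' => ?_⟩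
    have := twist_mem_superLow e (hK K' hK')
    rwa [map_sub, map_sum, sum_congr rfl fun i _ => map_smul _ _ _] at this

theorem PlanckSeries.DR {j : ℤ} {f : SuperFun V p} {c : ℕ → SuperFun V p}
    (h : PlanckSeries pl j f c) (v : Fin n ⊕ W) :
    PlanckSeries pl (j - varPlanck pl n v) ((funCalculus V p).DR v f)
      (fun k => (funCalculus V p).DR v (c k)) := (h.D v).twist _

theorem zeroing_superVar {T : Set W} {w : W} (hw : w ∈ T) :
    zeroing T (superVar V p w) = 0 := SuperFun.ext fun _ => setZero_serVar hw

theorem zeroing_superEuler {T : Set W} (hT : ∀ w, pl w ≠ 0 → w ∈ T) (f : SuperFun V p) :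
    zeroing T (superEuler pl f) = 0 := by
  rw [superEuler_apply, map_sum]
  refine sum_eq_zero fun w _ => ?_
  by_cases h : pl w = 0
  · rw [h, Int.cast_zero, zero_smul, map_zero]
  · rw [map_smul, map_mul, zeroing_superVar (hT w h), zero_mul, smul_zero]

theorem zeroing_of_mem_superLow {T : Set W} (hT : ∀ w, p w = 0 → w ∈ T) {f : SuperFun V p}
    (hf : f ∈ superLow V p 1) : zeroing T f = 0 := by
  refine SuperFun.ext fun x => MvPowerSeries.ext fun m => ?_
  rw [zeroing_val]
  change _ = 0
  by_cases h : Avoids T m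
  · have hm : m = 0 :=
      Finsupp.support_eq_empty.1 (Finset.eq_empty_of_forall_notMem fun w hw => h w hw (hT w.1 w.2))
    rw [coeff_setZero_of_avoids h, hf x m (by simp [hm]), map_zero]
  · exact coeff_setZero_of_not_avoids h _

theorem PlanckSeries.zeroing_coeff {T : Set W} (hT : ∀ w, pl w ≠ 0 → w ∈ T)
    {j : ℤ} {f : SuperFun V p} {c : ℕ → SuperFun V p}
    (h : PlanckSeries pl j f c) {k : ℕ} (hk : (k : ℤ) ≠ j) : zeroing T (c k) = 0 := by
  have h1 := zeroing_superEuler hT (c k)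
  rw [h.euler, map_smul] at h1
  refine (smul_eq_zero.1 h1).resolve_left fun h2 => hk ?_
  rw [sub_eq_zero] at h2
  exact_mod_cast h2.symm

theorem PlanckSeries.zeroing_eq_zero {T : Set W} (hT : ∀ w, pl w ≠ 0 → w ∈ T)
    (hT' : ∀ w, p w = 0 → w ∈ T) {j : ℤ} {f : SuperFun V p} {c : ℕ → SuperFun V p}
    (h : PlanckSeries pl j f c) (hj : j < 0) : zeroing T f = 0 := by
  obtain ⟨K, hK⟩ := h.approx 1
  have h1 := zeroing_of_mem_superLow hT' (hK K le_rfl)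
  rw [map_sub, sub_eq_zero] at h1
  rw [h1, map_sum]
  exact sum_eq_zero fun k _ => by
    rw [map_smul, h.zeroing_coeff hT (by omega), smul_zero]

theorem PlanckSeries.zeroing_eq {T : Set W} (hT : ∀ w, pl w ≠ 0 → w ∈ T)
    (hT' : ∀ w, p w = 0 → w ∈ T) {j : ℕ} {f : SuperFun V p} {c : ℕ → SuperFun V p}
    (h : PlanckSeries pl j f c) : zeroing T f = Complex.I ^ j • zeroing T (c j) := by
  obtain ⟨K, hK⟩ := h.approx 1
  have h1 := zeroing_of_mem_superLow hT' (hK (K + (j + 1)) (by omega))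
  rw [map_sub, sub_eq_zero] at h1
  rw [h1, map_sum, sum_eq_single j, map_smul]
  · intro k _ hk
    rw [map_smul, h.zeroing_coeff hT (by exact_mod_cast hk), smul_zero]
  · intro h
    exact absurd (Finset.mem_range.2 (by omega)) h

/-! ### The action -/

/-- The operator counting Planck numbers, on the coefficient with index `m`. -/
def coeffEuler (pl : W → ℤ) (m : {w : W // p w = 0} →₀ ℕ) : Grass p →ₗ[ℂ] Grass p :=
  ∑ w : W, (pl w : ℂ) • if h : p w = 0 then (m ⟨w, h⟩ : ℂ) • LinearMap.id
    else if h : p w = 1 then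
      LinearMap.mulLeft ℂ (ι ℂ (Pi.single (⟨w, h⟩ : {w : W // p w = 1}) (1 : ℂ))) ∘ₗ
        CliffordAlgebra.contractLeft (LinearMap.proj ⟨w, h⟩)
    else 0

theorem coeff_euler (m) (s : Ser p) :
    coeff m (∑ w, (pl w : ℂ) • (serVar p w * serD w s)) =
      coeffEuler pl m (coeff m s) := by
  classical
  rw [map_sum, coeffEuler, LinearMap.sum_apply]
  refine sum_congr rfl fun w _ => ?_
  rw [coeff_csmul, LinearMap.smul_apply]
  congr 1
  rcases zmod2_cases (p w) with h | h
  · rw [dif_pos h, serVar_even ⟨w, h⟩, serD_even ⟨w, h⟩, LinearMap.smul_apply, LinearMap.id_apply,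
      MvPowerSeries.X, MvPowerSeries.coeff_monomial_mul, one_mul]
    split_ifs with hm
    · have h1 : m - Finsupp.single ⟨w, h⟩ 1 + Finsupp.single ⟨w, h⟩ 1 = m := tsub_add_cancel_of_le hm
      have h2 := DFunLike.congr_fun h1 ⟨w, h⟩
      rw [Finsupp.add_apply, Finsupp.single_eq_same] at h2
      rw [coeff_evenDer, h1, h2]
    · have : m ⟨w, h⟩ = 0 := by
        by_contra h0
        exact hm (Finsupp.single_le_iff.2 (Nat.one_le_iff_ne_zero.2 h0))
      rw [this, Nat.cast_zero, zero_smul]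
  · rw [dif_neg (by rw [h]; exact one_ne_zero), dif_pos h, serVar_odd ⟨w, h⟩, serD_odd ⟨w, h⟩,
      MvPowerSeries.coeff_C_mul]
    rfl

variable {U : Set (Fin n → ℝ)} {X : ℕ → SFun n p}

/-- Only finitely many terms of the expansion contribute in each degree. -/
theorem exists_forall_mem_serLow
    (hX : ∀ k, ∀ x ∈ U, ∑ w, (pl w : ℂ) • (coord _ (.inr w) x * lD (.inr w) (X k) x) =
      (1 - (k : ℂ)) • X k x) (d : ℕ) :
    ∃ K, ∀ k ≥ K, ∀ x ∈ U, X k x ∈ serLow p d := by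
  have h1 : ∀ m, {k : ℕ | ∃ x ∈ U, coeff m (X k x) ≠ 0}.Finite := by
    intro m
    have h := Module.End.finite_hasEigenvalue (coeffEuler pl m : Module.End ℂ (Grass p))
    refine (h.preimage (f := fun k : ℕ => 1 - (k : ℂ)) ?_).subset ?_
    · intro a _ b _ hab
      have : (a : ℂ) = b := sub_right_injective hab
      exact_mod_cast this
    · rintro k ⟨x, hx, hk⟩
      refine Module.End.hasEigenvalue_of_hasEigenvector
        ⟨Module.End.mem_eigenspace_iff.2 ?_, hk⟩
      have := congrArg (coeff m) (hX k x hx)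
      simp only [coord_inr, lD_inr] at this
      rw [coeff_euler, coeff_csmul] at this
      exact this
  have h2 : {m : {w : W // p w = 0} →₀ ℕ | Finsupp.degree m < d}.Finite :=
    (Finsupp.finite_of_degree_le d).subset fun m hm => by
      simp only [Set.mem_ofPred_eq] at hm ⊢
      exact hm.le
  obtain ⟨K, hK⟩ := (h2.biUnion fun m _ => h1 m).bddAbove
  refine ⟨K + 1, fun k hk x hx m hm => ?_⟩
  by_contra h
  have := hK (Set.mem_biUnion hm ⟨x, hx, h⟩)
  omega

theorem isSmooth_actionSum
    (hs : ∀ k, IsSmooth U (X k)) (hX : ∀ k, ∀ x ∈ U,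
      ∑ w, (pl w : ℂ) • (coord _ (.inr w) x * lD (.inr w) (X k) x) = (1 - (k : ℂ)) • X k x) :
    IsSmooth U (fun x => ofCoeff fun m =>
      ∑ᶠ k : ℕ, (Complex.I * (1 : ℝ)) ^ k • coeff m (X k x)) ∧
    ∀ d, ∃ K, ∀ K' ≥ K, ∀ x ∈ U, (ofCoeff (fun m =>
      ∑ᶠ k : ℕ, (Complex.I * (1 : ℝ)) ^ k • coeff m (X k x)) -
        ∑ i ∈ Finset.range K', Complex.I ^ i • X i x : Ser p) ∈ serLow p d := by
  have h0 : ∀ d, ∃ K, ∀ K' ≥ K, ∀ x ∈ U, ∀ m, Finsupp.degree m < d →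
      ∑ᶠ k : ℕ, (Complex.I * (1 : ℝ)) ^ k • coeff m (X k x) =
        ∑ i ∈ Finset.range K', Complex.I ^ i • coeff m (X i x) := by
    intro d
    obtain ⟨K, hK⟩ := exists_forall_mem_serLow hX d
    refine ⟨K, fun K' hK' x hx m hm => ?_⟩
    rw [finsum_eq_sum_of_support_subset (s := Finset.range K')]
    · simp
    · intro k hk
      by_contra hk'
      refine hk ?_
      simp only [Finset.coe_range, Set.mem_Iio, not_lt] at hk'
      beta_reduce
      rw [hK k (by omega) x hx m hm, smul_zero]
  constructor
  · intro m l
    obtain ⟨K, hK⟩ := h0 (Finsupp.degree m + 1)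
    have h2 : ContDiffOn ℝ ∞ (fun x => ∑ i ∈ Finset.range K,
        Complex.I ^ i • l (coeff m (X i x))) U :=
      ContDiffOn.sum fun i _ => (hs i m l).const_smul (Complex.I ^ i)
    refine h2.congr fun x hx => ?_
    rw [coeff_ofCoeff, hK K le_rfl x hx m (by omega), map_sum]
    exact sum_congr rfl fun i _ => map_smul _ _ _
  · intro d
    obtain ⟨K, hK⟩ := h0 d
    refine ⟨K, fun K' hK' x hx m hm => ?_⟩
    rw [map_sub, coeff_ofCoeff, hK K' hK' x hx m hm, map_sum, sub_eq_zero]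
    rfl

end Planck

/-! ### Inverses -/

section Inverse

open scoped ContDiff
variable {V : Opens (Fin n → ℝ)}

theorem map_eq_self_of_inverse {R : Type*} [Ring R] [Algebra ℂ R] (φ : R →ₐ[ℂ] R) {a b : R}
    (hab : a * b = 1) (hba : b * a = 1) (h : φ a = a) : φ b = b := by
  have h1 : a * φ b = 1 := by
    rw [← map_one φ, ← hab, map_mul, h]
  calc φ b = b * a * φ b := by rw [hba, one_mul]
    _ = b := by rw [mul_assoc, h1, mul_one]

/-- The superfunctions with values in `serGE p k`. -/
def superGE (V : Opens (Fin n → ℝ)) (p : W → ZMod 2) (k : ℕ) : Submodule ℂ (SuperFun V p) where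
  carrier := {f | ∀ x, f.1 x ∈ serGE p k}
  add_mem' ha hb x := add_mem (ha x) (hb x)
  zero_mem' _ := zero_mem _
  smul_mem' c _ ha x := Submodule.smul_mem _ c (ha x)

theorem mul_mem_superGE {k l : ℕ} {f g : SuperFun V p} (hf : f ∈ superGE V p k)
    (hg : g ∈ superGE V p l) : f * g ∈ superGE V p (k + l) := fun x => mul_mem_serGE (hf x) (hg x)

theorem mem_superGE_zero (f : SuperFun V p) : f ∈ superGE V p 0 := fun x m => by
  rw [Nat.zero_sub]; exact mem_degGE_zero _

theorem pow_mem_superGE {f : SuperFun V p} (hf : f ∈ superGE V p 1) (k : ℕ) :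
    f ^ k ∈ superGE V p k := fun x => pow_mem_serGE (hf x) k

theorem mem_superGE_one_iff {f : SuperFun V p} : f ∈ superGE V p 1 ↔ ∀ x, body (f.1 x) = 0 :=
  forall_congr' fun _ => mem_serGE_one_iff

theorem eq_zero_of_mem_superGE {T : Set W} (hT : ∀ w, p w = 0 → w ∈ T) {f : SuperFun V p}
    (hz : zeroing T f = f) {k : ℕ} (hk : oddCard p < k) (hf : f ∈ superGE V p k) : f = 0 := by
  rw [← hz]
  refine zeroing_of_mem_superLow hT fun x m hm => ?_
  exact coeff_eq_zero_of_mem_serGE (hf x) (by omega)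

theorem exists_inverse {T : Set W} (hT : ∀ w, p w = 0 → w ∈ T) {f : SuperFun V p}
    (hz : zeroing T f = f) (hb : ∀ x, body (f.1 x) ≠ 0) : ∃ g, f * g = 1 ∧ g * f = 1 := by
  have hsm : ContDiffOn ℝ ∞ (fun x => (body (f.ext' x))⁻¹) (V : Set (Fin n → ℝ)) :=
    (contDiffOn_body f).inv fun x hx => by rw [f.ext'_apply ⟨x, hx⟩]; exact hb _
  set b : SuperFun V p := scal _ hsm with hbdef
  have hb0 : IsHomog 0 b := isHomog_scal _ _
  have hbf : b * f = f * b := by rw [hb0.mul_comm', twist_zero]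
  set u := 1 - b * f with hu
  have hu1 : u ∈ superGE V p 1 := mem_superGE_one_iff.2 fun x => by
    change body (1 - algebraMap ℂ (Ser p) (body (f.ext' x))⁻¹ * f.1 x) = 0
    rw [← bodyHom_apply, map_sub, map_one, map_mul, AlgHom.commutes, bodyHom_apply, f.ext'_apply,
      Algebra.algebraMap_self, RingHom.id_apply, inv_mul_cancel₀ (hb x), sub_self]
  have huz : zeroing T u = u := by
    rw [hu, map_sub, map_mul, map_one, hz, zeroing_scal]
  have hun : u ^ (oddCard p + 1) = 0 :=
    eq_zero_of_mem_superGE hT (by rw [map_pow, huz]) (Nat.lt_succ_self _) (pow_mem_superGE hu1 _)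
  have hbf' : b * f = 1 - u := by rw [hu]; abel
  have h1 := mul_neg_geom_sum u (oddCard p + 1)
  have h2 := geom_sum_mul_neg u (oddCard p + 1)
  rw [hun, sub_zero, ← hbf'] at h1 h2
  refine ⟨b * ∑ i ∈ Finset.range (oddCard p + 1), u ^ i, ?_, ?_⟩
  · rw [← mul_assoc, ← hbf, h1]
  · rw [hb0.mul_comm', twist_zero, mul_assoc, h2]

end Inverse

section Restrict

open scoped ContDiff
variable {V : Opens (Fin n → ℝ)}

theorem sRestrict_mul {f g : SFun n p} (hf : IsSmooth (V : Set (Fin n → ℝ)) f)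
    (hg : IsSmooth (V : Set (Fin n → ℝ)) g) :
    sRestrict V (f * g) (hf.mul hg) = sRestrict V f hf * sRestrict V g hg := rfl

theorem sRestrict_lD {f : SFun n p} (hf : IsSmooth (V : Set (Fin n → ℝ)) f) (v : Fin n ⊕ W) :
    sRestrict V (lD v f) (hf.lD V.isOpen v) = (funCalculus V p).D v (sRestrict V f hf) :=
  SuperFun.ext fun x => lD_apply v f hf x

theorem sRestrict_rD {f : SFun n p} (hf : IsSmooth (V : Set (Fin n → ℝ)) f) (v : Fin n ⊕ W) :
    sRestrict V (rD v f) (hf.rD V.isOpen v) = (funCalculus V p).DR v (sRestrict V f hf) :=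
  SuperFun.ext fun x => rD_apply v f hf x

theorem isHomog_sRestrict {e : ZMod 2} {f : SFun n p}
    (hf : IsSmooth (V : Set (Fin n → ℝ)) f) (h : HasParity (V : Set (Fin n → ℝ)) e f) :
    IsHomog e (sRestrict V f hf) :=
  isHomog_iff_val.2 fun x => MvPowerSeries.ext fun m => h x x.2 m

theorem zeroing_sRestrict {T T' : Set W} {e : ZMod 2} {f : SFun n p}
    (hf : IsFn (V : Set (Fin n → ℝ)) T e f) (hT : ∀ w ∈ T', w ∉ T) :
    zeroing T' (sRestrict V f hf.smooth) = sRestrict V f hf.smooth :=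
  SuperFun.ext fun x => setZero_eq_self fun w hw => by
    have := hf.indep w (hT w hw) x x.2
    rwa [lD_inr] at this

theorem isFn_ext' {T : Set W} {e : ZMod 2} {f : SuperFun V p} (hf : IsHomog e f)
    (hz : zeroing Tᶜ f = f) : IsFn (V : Set (Fin n → ℝ)) T e f.ext' where
  smooth := f.smooth
  parity x hx m := by
    rw [f.ext'_apply ⟨x, hx⟩]
    exact congrArg (coeff m) (isHomog_iff_val.1 hf ⟨x, hx⟩)
  indep w hw x hx := by
    rw [lD_inr]
    change serD w (f.ext' x) = 0
    rw [f.ext'_apply ⟨x, hx⟩, ← hz]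
    exact serD_setZero_of_mem hw _

end Restrict

variable {N N₀ N₁ : ℕ} {ε₀ : Fin N₀ → ZMod 2} {ε₁ : Fin N₁ → ZMod 2}

/-! ### The antibracket and the odd Laplacian -/

section Antibracket

open scoped ContDiff
/-- The parities of all variables. -/
abbrev vPar (N : ℕ) {N₀ N₁ : ℕ} (ε₀ : Fin N₀ → ZMod 2) (ε₁ : Fin N₁ → ZMod 2) :
    Fin N ⊕ Fld N N₀ N₁ → ZMod 2 := varPar N (par ε₀ ε₁)

theorem vPar_gVar (A : Fin N ⊕ Fin N) : vPar N ε₀ ε₁ (gVar A) = gPar A := by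
  rcases A with i | i <;> rfl

variable {R : Type*} [Ring R] [Algebra ℂ R] [SuperAlgebra R]
  (𝒟 : SuperCalculus R (vPar N ε₀ ε₁))

/-- The antibracket. -/
def sbr (E : Fin N ⊕ Fin N → Fin N ⊕ Fin N → R) (f g : R) : R :=
  ∑ A, ∑ B, 𝒟.DR (gVar A) f * E A B * 𝒟.D (gVar B) g

/-- The odd Laplacian, for a density `r` with inverse `r'`. -/
def slap (E : Fin N ⊕ Fin N → Fin N ⊕ Fin N → R) (r r' : R) : R →ₗ[ℂ] R :=
  ∑ A, ∑ B, (sg (gPar A) / 2) • (LinearMap.mulLeft ℂ r' ∘ₗ 𝒟.D (gVar A) ∘ₗ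
    LinearMap.mulLeft ℂ (r * E A B) ∘ₗ 𝒟.D (gVar B))

theorem slap_apply (E : Fin N ⊕ Fin N → Fin N ⊕ Fin N → R) (r r' f : R) :
    slap 𝒟 E r r' f = ∑ A, ∑ B, (sg (gPar A) / 2) • (r' * 𝒟.D (gVar A)
      (r * E A B * 𝒟.D (gVar B) f)) := by
  simp only [slap, LinearMap.sum_apply, LinearMap.smul_apply, LinearMap.comp_apply,
    LinearMap.mulLeft_apply]

/-- The odd Laplacian on the minimal space. -/
def slapMin (E : Fin N ⊕ Fin N → Fin N ⊕ Fin N → R) (r r' : R) : R →ₗ[ℂ] R :=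
  slap 𝒟 E r r' + ∑ α, sg (ε₀ α) • (𝒟.D (.inr (.lam α)) ∘ₗ 𝒟.D (.inr (.lamS α))) +
    ∑ a, sg (ε₁ a + 1) • (𝒟.D (.inr (.c a)) ∘ₗ 𝒟.D (.inr (.cS a)))

theorem slapMin_apply (E : Fin N ⊕ Fin N → Fin N ⊕ Fin N → R) (r r' f : R) :
    slapMin 𝒟 E r r' f = slap 𝒟 E r r' f +
      ∑ α, sg (ε₀ α) • 𝒟.D (.inr (.lam α)) (𝒟.D (.inr (.lamS α)) f) +
      ∑ a, sg (ε₁ a + 1) • 𝒟.D (.inr (.c a)) (𝒟.D (.inr (.cS a)) f) := by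
  simp only [slapMin, LinearMap.add_apply, LinearMap.sum_apply, LinearMap.smul_apply,
    LinearMap.comp_apply]

/-- An antisymplectic bivector with a density, both not depending on the formal variables. -/
structure IsBivector (z : R →ₐ[ℂ] R) (E : Fin N ⊕ Fin N → Fin N ⊕ Fin N → R) (r r' : R) :
    Prop where
  homog : ∀ A B, IsHomog (gPar A + gPar B + 1) (E A B)
  setZero : ∀ A B, z (E A B) = E A B
  skew : ∀ A B, E B A = -(sg ((gPar A + 1) * (gPar B + 1)) • E A B)
  density_homog : IsHomog 0 r
  density_setZero : z r = r
  inverse_setZero : z r' = r'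
  inverse_mul : r' * r = 1

variable {z : R →ₐ[ℂ] R} {E : Fin N ⊕ Fin N → Fin N ⊕ Fin N → R} {r r' : R}

theorem zmod_mul_add_one (e : ZMod 2) : e * (e + 1) = 0 := by revert e; decide

theorem zmod_add_one_mul (e : ZMod 2) : (e + 1) * e = 0 := by revert e; decide

theorem zmod_mul_self (e : ZMod 2) : e * e = e := by revert e; decide

theorem slap_exp_aux (hE : IsBivector z E r r') {w x : R} (hw : IsHomog 0 w)
    (hx : ∀ v, 𝒟.D v x = 𝒟.D v w * x) (A B : Fin N ⊕ Fin N) :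
    (sg (gPar A) / 2) • (r' * 𝒟.D (gVar A) (r * E A B * 𝒟.D (gVar B) x)) =
      ((sg (gPar A) / 2) • (r' * 𝒟.D (gVar A) (r * E A B * 𝒟.D (gVar B) w)) + (1 / 2 : ℂ) •
        (𝒟.DR (gVar A) w * E A B * 𝒟.D (gVar B) w)) * x := by
  have h1 : IsHomog (gPar A + 1) (E A B * 𝒟.D (gVar B) w) := by
    refine (hE.homog A B).mul_of_eq (𝒟.isHomog_D hw _) ?_
    rw [vPar_gVar]
    generalize gPar A = a; generalize gPar B = b; revert a b; decide
  have h2 : IsHomog (gPar A) (𝒟.D (gVar A) w) := by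
    have := 𝒟.isHomog_D hw (gVar A)
    rwa [vPar_gVar, zero_add] at this
  have h3 : 𝒟.DR (gVar A) w = sg (gPar A) • 𝒟.D (gVar A) w := by
    rw [SuperCalculus.DR_eq _ hw, vPar_gVar, zero_add, zmod_mul_self]
  have h4 : 𝒟.D (gVar A) (r * E A B * 𝒟.D (gVar B) x) =
      𝒟.D (gVar A) (r * E A B * 𝒟.D (gVar B) w) * x +
        r * (𝒟.D (gVar A) w * (E A B * 𝒟.D (gVar B) w)) * x := by
    rw [hx, ← mul_assoc, SuperCalculus.D_mul, hx, mul_assoc r,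
      (hE.density_homog.mul h1).twist_eq, vPar_gVar, zero_add, zmod_mul_add_one, sg_zero, one_smul,
      h2.mul_comm h1, zmod_mul_add_one, sg_zero, one_smul]
    simp only [mul_assoc]
  rw [h4, h3, add_mul, smul_mul_assoc, smul_mul_assoc, smul_mul_assoc, smul_mul_assoc,
    smul_mul_assoc, smul_smul, mul_add, smul_add, show (1 / 2 : ℂ) * sg (gPar A) = sg (gPar A) / 2 by ring,
    ← mul_assoc r' _ x, ← mul_assoc r' (r * _) x, ← mul_assoc r' r, hE.inverse_mul, one_mul,
    mul_assoc (𝒟.D _ w) (E A B)]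

theorem slap_exp (hE : IsBivector z E r r') {w x : R} (hw : IsHomog 0 w)
    (hx : ∀ v, 𝒟.D v x = 𝒟.D v w * x) :
    slap 𝒟 E r r' x = (slap 𝒟 E r r' w + (1 / 2 : ℂ) • sbr 𝒟 E w w) * x := by
  simp only [slap_apply, sbr, smul_sum, ← sum_add_distrib, sum_mul]
  exact sum_congr rfl fun A _ => sum_congr rfl fun B _ =>
    slap_exp_aux 𝒟 hE hw hx A B

theorem D_D_exp {w x : R} (hw : IsHomog 0 w) (hx : ∀ v, 𝒟.D v x = 𝒟.D v w * x)
    (u v : Fin N ⊕ Fld N N₀ N₁) {e : ZMod 2} (hu : vPar N ε₀ ε₁ u = e)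
    (h : vPar N ε₀ ε₁ v = e + 1) :
    sg e • 𝒟.D u (𝒟.D v x) = (sg e • 𝒟.D u (𝒟.D v w) + 𝒟.DR u w * 𝒟.D v w) * x := by
  have h1 := 𝒟.isHomog_D hw u
  have h2 := 𝒟.isHomog_D hw v
  rw [h] at h2
  rw [hu] at h1
  rw [zero_add] at h1 h2
  rw [hx, SuperCalculus.D_mul, hx, h2.twist_eq, hu, zmod_mul_add_one, sg_zero,
    one_smul, ← mul_assoc, h2.mul_comm h1, zmod_add_one_mul, sg_zero, one_smul,
    ← add_mul, ← smul_mul_assoc, smul_add, SuperCalculus.DR_eq _ hw, zero_add, smul_mul_assoc,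
    zmod_mul_self, hu]

/-- The left side of the quantum master equation for `exp w`, divided by `exp w`. -/
def qme (E : Fin N ⊕ Fin N → Fin N ⊕ Fin N → R) (r r' w : R) : R :=
  slapMin 𝒟 E r r' w + (1 / 2 : ℂ) • sbr 𝒟 E w w +
    ∑ α, 𝒟.DR (.inr (.lam α)) w * 𝒟.D (.inr (.lamS α)) w +
    ∑ a, 𝒟.DR (.inr (.c a)) w * 𝒟.D (.inr (.cS a)) w

theorem slapMin_exp (hE : IsBivector z E r r') {w x : R} (hw : IsHomog 0 w)
    (hx : ∀ v, 𝒟.D v x = 𝒟.D v w * x) :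
    slapMin 𝒟 E r r' x = qme 𝒟 E r r' w * x := by
  have h1 := fun α => D_D_exp 𝒟 hw hx (.inr (.lam α)) (.inr (.lamS α)) (e := ε₀ α) rfl rfl
  have h2 := fun a => D_D_exp 𝒟 hw hx (.inr (.c a)) (.inr (.cS a)) (e := ε₁ a + 1) rfl (by
    change ε₁ a = ε₁ a + 1 + 1
    rw [add_assoc, CharTwo.add_self_eq_zero, add_zero])
  rw [slapMin_apply, slap_exp 𝒟 hE hw hx, sum_congr rfl fun α _ => h1 α,
    sum_congr rfl fun a _ => h2 a, qme, slapMin_apply, ← sum_mul, ← sum_mul,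
    ← add_mul, ← add_mul, sum_add_distrib, sum_add_distrib]
  congr 1
  abel

end Antibracket

/-! ### Right derivations -/

section RightDer

variable {R : Type*} [Ring R] [Algebra ℂ R] [SuperAlgebra R] {V : Type*} [Fintype V]
  {q : V → ZMod 2} (𝒟 : SuperCalculus R q)

/-- The right derivation with coefficients `Y`. -/
def rightDer (Y : V → R) (h : R) : R := ∑ v, 𝒟.DR v h * Y v

theorem DR_rightDer {Y : V → R} {s : ZMod 2} (hY : ∀ v, IsHomog (q v + s) (Y v)) (u : V) (h : R) :
    𝒟.DR u (rightDer 𝒟 Y h) = sg (q u * s) • rightDer 𝒟 Y (𝒟.DR u h) +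
      ∑ v, 𝒟.DR v h * 𝒟.DR u (Y v) := by
  rw [rightDer, rightDer, map_sum, smul_sum, ← sum_add_distrib]
  refine sum_congr rfl fun v _ => ?_
  rw [𝒟.DR_mul, 𝒟.DR_comm, (hY v).twist_eq, smul_mul_smul_comm, ← sg_add, add_comm]
  congr 3
  generalize q u = a; generalize q v = b; clear * -; decide +revert

theorem D_rightDer (Y : V → R) (u : V) (h : R) :
    𝒟.D u (rightDer 𝒟 Y h) = rightDer 𝒟 Y (𝒟.D u h) +
      ∑ v, twist (q u) (𝒟.DR v h) * 𝒟.D u (Y v) := by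
  rw [rightDer, rightDer, map_sum, ← sum_add_distrib]
  refine sum_congr rfl fun v _ => ?_
  rw [𝒟.D_mul, 𝒟.D_DR]

theorem SuperCalculus.DR_mul_of_D_eq_zero {v : V} {a : R} (h : 𝒟.D v a = 0) (b : R) :
    𝒟.DR v (a * b) = a * 𝒟.DR v b := by
  rw [𝒟.DR_mul, 𝒟.DR_apply v a, h, map_zero, zero_mul, add_zero]

theorem SuperCalculus.D_eq_twist_DR (v : V) (a : R) : 𝒟.D v a = twist (q v) (𝒟.DR v a) := by
  rw [𝒟.DR_apply, twist_twist_self]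

end RightDer

section Hamiltonian

/-- The variables, sorted by kind. -/
def fldEquiv (N N₀ N₁ : ℕ) : Fin N ⊕ Fld N N₀ N₁ ≃
    (Fin N ⊕ Fin N) ⊕ (Fin N₀ ⊕ Fin N₀) ⊕ (Fin N₁ ⊕ Fin N₁) ⊕ (Fin N₁ ⊕ Fin N₁) where
  toFun
    | .inl i => .inl (.inl i)
    | .inr (.th i) => .inl (.inr i)
    | .inr (.lam a) => .inr (.inl (.inl a))
    | .inr (.lamS a) => .inr (.inl (.inr a))
    | .inr (.c a) => .inr (.inr (.inl (.inl a)))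
    | .inr (.cS a) => .inr (.inr (.inl (.inr a)))
    | .inr (.pi a) => .inr (.inr (.inr (.inl a)))
    | .inr (.piS a) => .inr (.inr (.inr (.inr a)))
  invFun
    | .inl (.inl i) => .inl i
    | .inl (.inr i) => .inr (.th i)
    | .inr (.inl (.inl a)) => .inr (.lam a)
    | .inr (.inl (.inr a)) => .inr (.lamS a)
    | .inr (.inr (.inl (.inl a))) => .inr (.c a)
    | .inr (.inr (.inl (.inr a))) => .inr (.cS a)
    | .inr (.inr (.inr (.inl a))) => .inr (.pi a)
    | .inr (.inr (.inr (.inr a))) => .inr (.piS a)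
  left_inv v := by rcases v with i | w; · rfl
                   cases w <;> rfl
  right_inv v := by
    rcases v with (i | i) | (a | a) | (a | a) | (a | a) <;> rfl

theorem sum_fld {M : Type*} [AddCommMonoid M] (f : Fin N ⊕ Fld N N₀ N₁ → M) :
    ∑ v, f v = ∑ A, f (gVar A) + ((∑ a, f (.inr (.lam a)) + ∑ a, f (.inr (.lamS a))) +
      ((∑ a, f (.inr (.c a)) + ∑ a, f (.inr (.cS a))) +
        (∑ a, f (.inr (.pi a)) + ∑ a, f (.inr (.piS a))))) := by
  rw [← (fldEquiv N N₀ N₁).symm.sum_comp f]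
  simp only [Fintype.sum_sum_type]
  rfl

variable {R : Type*} [Ring R] [Algebra ℂ R] [SuperAlgebra R]
  (𝒟 : SuperCalculus R (vPar N ε₀ ε₁))

/-- The coefficients of the right derivation `(·, f)`, with all variables but `π, π*`. -/
def hamCoeff (E : Fin N ⊕ Fin N → Fin N ⊕ Fin N → R) (f : R) : Fin N ⊕ Fld N N₀ N₁ → R
  | .inl i => ∑ B, E (.inl i) B * 𝒟.D (gVar B) f
  | .inr (.th i) => ∑ B, E (.inr i) B * 𝒟.D (gVar B) f
  | .inr (.lam a) => 𝒟.D (.inr (.lamS a)) f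
  | .inr (.lamS a) => -𝒟.D (.inr (.lam a)) f
  | .inr (.c a) => 𝒟.D (.inr (.cS a)) f
  | .inr (.cS a) => -𝒟.D (.inr (.c a)) f
  | .inr (.pi _) => 0
  | .inr (.piS _) => 0

theorem hamCoeff_gVar (E : Fin N ⊕ Fin N → Fin N ⊕ Fin N → R) (f : R) (A : Fin N ⊕ Fin N) :
    hamCoeff 𝒟 E f (gVar A) = ∑ B, E A B * 𝒟.D (gVar B) f := by
  rcases A with i | i <;> rfl

variable {z : R →ₐ[ℂ] R} {E : Fin N ⊕ Fin N → Fin N ⊕ Fin N → R} {r r' : R}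

theorem isHomog_hamCoeff (hE : IsBivector z E r r') {s : ZMod 2} {f : R} (hf : IsHomog s f)
    (v : Fin N ⊕ Fld N N₀ N₁) : IsHomog (vPar N ε₀ ε₁ v + (s + 1)) (hamCoeff 𝒟 E f v) := by
  have h : ∀ u, IsHomog (s + vPar N ε₀ ε₁ u) (𝒟.D u f) := fun u => 𝒟.isHomog_D hf u
  have hg : ∀ A, IsHomog (gPar A + (s + 1)) (∑ B, E A B * 𝒟.D (gVar B) f) := fun A =>
    IsHomog.sum fun B _ => (hE.homog A B).mul_of_eq (h _) (by
      rw [vPar_gVar]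
      generalize gPar A = a; generalize gPar B = b; clear * -; decide +revert)
  have e1 : ∀ a : ZMod 2, s + (a + 1) = a + (s + 1) := by clear * -; decide +revert
  have e2 : ∀ a : ZMod 2, s + a = a + 1 + (s + 1) := by clear * -; decide +revert
  rcases v with i | (i | a | a | a | a | a | a)
  · exact hg (.inl i)
  · exact hg (.inr i)
  · exact e1 (ε₀ a) ▸ h (.inr (.lamS a))
  · exact (e2 (ε₀ a) ▸ h (.inr (.lam a))).neg
  · have := h (.inr (.cS a))
    rw [show s + vPar N ε₀ ε₁ (.inr (.cS a)) = vPar N ε₀ ε₁ (.inr (.c a)) + (s + 1) from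
      e2 (ε₁ a)] at this
    exact this
  · exact (e1 (ε₁ a) ▸ h (.inr (.c a))).neg
  · exact IsHomog.zero _
  · exact IsHomog.zero _

theorem sbr_term_comm (hE : IsBivector z E r r') {s t : ZMod 2} {f g : R} (hf : IsHomog s f)
    (hg : IsHomog t g) (A B : Fin N ⊕ Fin N) :
    𝒟.DR (gVar A) f * E A B * 𝒟.D (gVar B) g =
      -(sg ((s + 1) * (t + 1)) • (𝒟.DR (gVar B) g * E B A * 𝒟.D (gVar A) f)) := by
  have h1 := 𝒟.isHomog_D hf (gVar A)
  have h2 := 𝒟.isHomog_D hg (gVar B)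
  rw [vPar_gVar] at h1 h2
  rw [hE.skew A B, 𝒟.DR_eq hf, 𝒟.DR_eq hg, vPar_gVar, vPar_gVar, mul_neg, neg_mul, smul_neg,
    neg_neg]
  simp only [smul_mul_assoc, mul_smul_comm, smul_smul]
  rw [((hE.homog A B).mul h2).mul_comm' (𝒟.D (gVar A) f) |> fun h => mul_assoc (𝒟.D (gVar A) f) _ _,
    h1.mul_comm ((hE.homog A B).mul h2), (hE.homog A B).mul_comm h2, smul_mul_assoc, smul_smul,
    smul_smul, ← sg_add, ← sg_add, ← sg_add, ← sg_add]
  congr 2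
  generalize gPar A = a; generalize gPar B = b; clear * -; decide +revert

theorem sbr_comm (hE : IsBivector z E r r') {s t : ZMod 2} {f g : R} (hf : IsHomog s f)
    (hg : IsHomog t g) : sbr 𝒟 E f g = -(sg ((s + 1) * (t + 1)) • sbr 𝒟 E g f) := by
  rw [sbr, sbr, sum_comm, smul_sum, ← sum_neg_distrib]
  refine sum_congr rfl fun B _ => ?_
  rw [smul_sum, ← sum_neg_distrib]
  exact sum_congr rfl fun A _ => sbr_term_comm 𝒟 hE hf hg A B

theorem DR_sbr_self (hE : IsBivector z E r r') {b : Fin N ⊕ Fld N N₀ N₁}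
    (hb : ∀ A B, 𝒟.D b (E A B) = 0) {f : R} (hf : IsHomog 0 f) :
    𝒟.DR b ((1 / 2 : ℂ) • sbr 𝒟 E f f) = sbr 𝒟 E f (𝒟.DR b f) := by
  have h1 : ∀ A B, 𝒟.DR b (𝒟.DR (gVar A) f * E A B * 𝒟.D (gVar B) f) =
      𝒟.DR (gVar A) f * E A B * 𝒟.D (gVar B) (𝒟.DR b f) +
      sg (vPar N ε₀ ε₁ b) • (𝒟.DR (gVar A) (𝒟.DR b f) * E A B * 𝒟.D (gVar B) f) := by
    intro A B
    have h2 : IsHomog (gPar A + 1) (E A B * 𝒟.D (gVar B) f) :=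
      (hE.homog A B).mul_of_eq (𝒟.isHomog_D hf _) (by
        rw [vPar_gVar]
        generalize gPar A = a; generalize gPar B = b; clear * -; decide +revert)
    rw [mul_assoc, 𝒟.DR_mul, 𝒟.DR_mul_of_D_eq_zero (hb A B), 𝒟.D_DR, h2.twist_eq, 𝒟.DR_comm,
      vPar_gVar, smul_mul_smul_comm, ← sg_add, ← mul_assoc, ← mul_assoc]
    congr 3
    generalize gPar A = a; generalize vPar N ε₀ ε₁ b = b; clear * -; decide +revert
  have h3 : 𝒟.DR b (sbr 𝒟 E f f) = sbr 𝒟 E f (𝒟.DR b f) +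
      sg (vPar N ε₀ ε₁ b) • sbr 𝒟 E (𝒟.DR b f) f := by
    simp only [sbr, map_sum, h1, sum_add_distrib, smul_sum]
  rw [map_smul, h3, sbr_comm 𝒟 hE (𝒟.isHomog_DR hf b) hf, zero_add, zero_add, mul_one, sg_add,
    sg_one, mul_neg_one, neg_smul, neg_neg, sg_smul_sg_smul, ← two_smul ℂ, smul_smul]
  norm_num

theorem DR_pair (b u v : Fin N ⊕ Fld N N₀ N₁) {e : ZMod 2} (hu : vPar N ε₀ ε₁ u = e)
    (hv : vPar N ε₀ ε₁ v = e + 1) {f : R} (hf : IsHomog 0 f) :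
    𝒟.DR b (𝒟.DR u f * 𝒟.D v f) =
      𝒟.DR u f * 𝒟.D v (𝒟.DR b f) + 𝒟.DR v f * -𝒟.D u (𝒟.DR b f) := by
  have h1 := 𝒟.isHomog_DR hf b
  have h2 := 𝒟.isHomog_D h1 u
  have h3 := 𝒟.isHomog_D hf v
  rw [𝒟.DR_mul, 𝒟.D_DR, h3.twist_eq, 𝒟.DR_comm, 𝒟.DR_eq h1 u, 𝒟.DR_eq hf v]
  congr 1
  simp only [smul_mul_assoc, mul_smul_comm, smul_smul, mul_neg]
  rw [h2.mul_comm h3, smul_smul, ← neg_one_smul ℂ (_ • _), smul_smul, ← sg_one, ← sg_add, ← sg_add,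
    ← sg_add, ← sg_add, hu, hv]
  congr 2
  generalize vPar N ε₀ ε₁ b = b; clear * -; decide +revert

theorem DR_slap (b : Fin N ⊕ Fld N N₀ N₁) (hb : ∀ A B, 𝒟.D b (E A B) = 0) (hr : 𝒟.D b r = 0)
    (hr' : 𝒟.D b r' = 0) (f : R) :
    𝒟.DR b (slap 𝒟 E r r' f) = slap 𝒟 E r r' (𝒟.DR b f) := by
  simp only [slap_apply, map_sum, map_smul]
  refine sum_congr rfl fun A _ => sum_congr rfl fun B _ => ?_
  rw [𝒟.DR_mul_of_D_eq_zero hr', ← 𝒟.D_DR, mul_assoc, 𝒟.DR_mul_of_D_eq_zero hr,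
    𝒟.DR_mul_of_D_eq_zero (hb A B), ← 𝒟.D_DR, mul_assoc]

theorem DR_slapMin (b : Fin N ⊕ Fld N N₀ N₁) (hb : ∀ A B, 𝒟.D b (E A B) = 0) (hr : 𝒟.D b r = 0)
    (hr' : 𝒟.D b r' = 0) (f : R) :
    𝒟.DR b (slapMin 𝒟 E r r' f) = slapMin 𝒟 E r r' (𝒟.DR b f) := by
  simp only [slapMin_apply, map_add, map_sum, map_smul, DR_slap 𝒟 b hb hr hr', 𝒟.D_DR]

/-- The derivative of the quantum master equation. -/
theorem rightDer_hamCoeff_self (hE : IsBivector z E r r') {b : Fin N ⊕ Fld N N₀ N₁}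
    (hb : ∀ A B, 𝒟.D b (E A B) = 0) (hr : 𝒟.D b r = 0) (hr' : 𝒟.D b r' = 0) {f : R}
    (hf : IsHomog 0 f) (hq : qme 𝒟 E r r' (Complex.I • f) = 0) :
    rightDer 𝒟 (hamCoeff 𝒟 E (𝒟.DR b f)) f = Complex.I • slapMin 𝒟 E r r' (𝒟.DR b f) := by
  have h1 : (1 / 2 : ℂ) • sbr 𝒟 E f f +
      ∑ α, 𝒟.DR (.inr (.lam α)) f * 𝒟.D (.inr (.lamS α)) f +
      ∑ a, 𝒟.DR (.inr (.c a)) f * 𝒟.D (.inr (.cS a)) f =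
      Complex.I • slapMin 𝒟 E r r' f := by
    have hs : sbr 𝒟 E (Complex.I • f) (Complex.I • f) = -sbr 𝒟 E f f := by
      simp only [sbr, map_smul, smul_mul_assoc, mul_smul_comm, smul_smul, Complex.I_mul_I,
        neg_one_smul, sum_neg_distrib]
    have hp : ∀ u v, 𝒟.DR u (Complex.I • f) * 𝒟.D v (Complex.I • f) = -(𝒟.DR u f * 𝒟.D v f) :=
      fun u v => by
        simp only [map_smul, smul_mul_assoc, mul_smul_comm, smul_smul, Complex.I_mul_I,
          neg_one_smul]
    rw [qme, hs, map_smul] at hq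
    simp only [hp, sum_neg_distrib, smul_neg] at hq
    rw [← sub_eq_zero, ← neg_eq_zero, ← hq]
    abel
  have h2 := congrArg (𝒟.DR b) h1
  rw [map_add, map_add, DR_sbr_self 𝒟 hE hb hf, map_sum, map_sum, map_smul,
    DR_slapMin 𝒟 b hb hr hr', sum_congr rfl fun α _ => DR_pair 𝒟 b (.inr (.lam α))
      (.inr (.lamS α)) rfl rfl hf, sum_congr rfl fun a _ => DR_pair 𝒟 b (.inr (.c a))
      (.inr (.cS a)) (e := ε₁ a + 1) rfl (by
        change ε₁ a = ε₁ a + 1 + 1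
        rw [add_assoc, CharTwo.add_self_eq_zero, add_zero]) hf, sum_add_distrib,
      sum_add_distrib] at h2
  rw [← h2, rightDer, sum_fld]
  simp only [hamCoeff_gVar]
  simp only [hamCoeff, mul_zero, sum_const_zero, add_zero, sbr,
    mul_sum, mul_assoc, add_assoc]

end Hamiltonian

/-! ### Consequences of the quantum master equation -/

section MasterEquation

variable {R : Type*} [Ring R] [Algebra ℂ R] [SuperAlgebra R]

/-- `z` sets all formal even variables, and those with nonzero Planck number, to zero. -/
structure IsReduction (𝒟 : SuperCalculus R (vPar N ε₀ ε₁)) (z : R →ₐ[ℂ] R) : Prop where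
  idem : ∀ f, z (z f) = z f
  twist : ∀ e f, z (twist e f) = BV.twist e (z f)
  D : ∀ A f, z (𝒟.D (gVar A) f) = 𝒟.D (gVar A) (z f)
  D_eq_zero : ∀ w ∉ gammaVars, ∀ f, 𝒟.D (.inr w) (z f) = 0

theorem IsReduction.DR {𝒟 : SuperCalculus R (vPar N ε₀ ε₁)} {z : R →ₐ[ℂ] R}
    (hz : IsReduction 𝒟 z) (A : Fin N ⊕ Fin N) (f : R) :
    z (𝒟.DR (gVar A) f) = 𝒟.DR (gVar A) (z f) := by
  rw [𝒟.DR_apply, hz.twist, hz.D, 𝒟.DR_apply]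

/-- A relation `P j f f₀ f₁` saying that `f` has the expansion `f₀ + i f₁ + ⋯` of total Planck
number `j`. -/
structure IsPlanckRel (𝒟 : SuperCalculus R (vPar N ε₀ ε₁)) (z : R →ₐ[ℂ] R)
    (P : ℤ → R → R → R → Prop) : Prop where
  D : ∀ {j f f₀ f₁}, P j f f₀ f₁ → ∀ v, P (j - varPlanck planck N v) (𝒟.D v f) (𝒟.D v f₀) (𝒟.D v f₁)
  DR : ∀ {j f f₀ f₁}, P j f f₀ f₁ → ∀ v,
    P (j - varPlanck planck N v) (𝒟.DR v f) (𝒟.DR v f₀) (𝒟.DR v f₁)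
  neg : ∀ {j f f₀ f₁}, P j f f₀ f₁ → ∀ (_ : j < 0 := by simp [planck]), z f = 0
  zero : ∀ {j f f₀ f₁}, P j f f₀ f₁ → ∀ (_ : j = 0 := by simp [planck]), z f = z f₀
  one : ∀ {j f f₀ f₁}, P j f f₀ f₁ → j = 1 → z f = Complex.I • z f₁

variable {𝒟 : SuperCalculus R (vPar N ε₀ ε₁)} {z : R →ₐ[ℂ] R} {P : ℤ → R → R → R → Prop}
  {E : Fin N ⊕ Fin N → Fin N ⊕ Fin N → R} {r r' f X₀ X₁ : R}

theorem IsReduction.slap (hz : IsReduction 𝒟 z) (hE : IsBivector z E r r') (g : R) :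
    z (slap 𝒟 E r r' g) = BV.slap 𝒟 E r r' (z g) := by
  simp only [slap_apply, map_sum, map_smul, map_mul, hz.D, hE.setZero, hE.density_setZero,
    hE.inverse_setZero]

theorem IsReduction.sbr_left (hz : IsReduction 𝒟 z) (hE : IsBivector z E r r') (g h : R) :
    ∑ A, z (𝒟.DR (gVar A) g) * z (∑ B, E A B * 𝒟.D (gVar B) h) =
      sbr 𝒟 E (z g) (z h) := by
  simp only [sbr, map_sum, map_mul, hz.D, hz.DR, hE.setZero, mul_sum, mul_assoc]

theorem lam_notMem (a : Fin N₀) : (.lam a : Fld N N₀ N₁) ∉ gammaVars := by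
  rintro ⟨i, hi⟩; cases hi

theorem lamS_notMem (a : Fin N₀) : (.lamS a : Fld N N₀ N₁) ∉ gammaVars := by
  rintro ⟨i, hi⟩; cases hi

theorem c_notMem (a : Fin N₁) : (.c a : Fld N N₀ N₁) ∉ gammaVars := by
  rintro ⟨i, hi⟩; cases hi

/-- The quantum master equation holds for the action `f = X₀ + i X₁ + ⋯`. -/
structure IsQuantumAction (𝒟 : SuperCalculus R (vPar N ε₀ ε₁)) (z : R →ₐ[ℂ] R)
    (P : ℤ → R → R → R → Prop) (E : Fin N ⊕ Fin N → Fin N ⊕ Fin N → R) (r r' f X₀ X₁ : R) :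
    Prop where
  reduction : IsReduction 𝒟 z
  rel : IsPlanckRel 𝒟 z P
  bivector : IsBivector z E r r'
  homog : IsHomog 0 f
  homog_zero : IsHomog 0 X₀
  expansion : P 1 f X₀ X₁
  master : qme 𝒟 E r r' (Complex.I • f) = 0

theorem IsQuantumAction.rightDer_eq
    (S : IsQuantumAction 𝒟 z P E r r' f X₀ X₁) {w : Fld N N₀ N₁} (hw : w ∉ gammaVars) :
    rightDer 𝒟 (hamCoeff 𝒟 E (𝒟.DR (.inr w) f)) f =
      Complex.I • slapMin 𝒟 E r r' (𝒟.DR (.inr w) f) := by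
  have hz := S.reduction
  have hE := S.bivector
  refine rightDer_hamCoeff_self 𝒟 hE (fun A B => ?_) ?_ ?_ S.homog S.master
  · rw [← hE.setZero]; exact hz.D_eq_zero w hw _
  · rw [← hE.density_setZero]; exact hz.D_eq_zero w hw _
  · rw [← hE.inverse_setZero]; exact hz.D_eq_zero w hw _

theorem IsQuantumAction.constraint_mul_reducibility
    (S : IsQuantumAction 𝒟 z P E r r' f X₀ X₁) (k : Fin N₁) :
    ∑ a, z (𝒟.DR (.inr (.lam a)) X₀) * z (𝒟.D (.inr (.lamS a)) (𝒟.DR (.inr (.c k)) X₀)) = 0 := by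
  have hz := S.reduction
  have hE := S.bivector
  have h := congrArg z (S.rightDer_eq (c_notMem k))
  have P1 := S.rel.DR S.expansion (.inr (.c k))
  have k0 := S.rel.neg P1
  have k1 := fun a => S.rel.zero (S.rel.DR S.expansion (.inr (.lam a)))
  have k2 := fun a => S.rel.zero (S.rel.D P1 (.inr (.lamS a)))
  have k3 := fun a => S.rel.neg (S.rel.D P1 (.inr (.lam a)))
  have k4 := fun a => S.rel.neg (S.rel.DR S.expansion (.inr (.c a)))
  have k5 := fun a => S.rel.neg (S.rel.D P1 (.inr (.c a)))
  have k6 := fun a =>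
    S.rel.neg (S.rel.D (S.rel.D P1 (.inr (.lamS a))) (.inr (.lam a)))
  have k7 := fun a =>
    S.rel.neg (S.rel.D (S.rel.D P1 (.inr (.cS a))) (.inr (.c a)))
  rw [map_smul, slapMin_apply, map_add, map_add, hz.slap hE, k0, map_zero, map_sum, map_sum] at h
  simp only [map_smul, k6, k7, smul_zero, sum_const_zero, add_zero] at h
  rw [rightDer, map_sum, sum_fld] at h
  simp only [hamCoeff_gVar] at h
  simp only [map_mul, hamCoeff, map_neg, k3, k4, k5, neg_zero, mul_zero, zero_mul, map_zero,
    sum_const_zero, add_zero, k1, k2] at h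
  rw [hz.sbr_left hE, k0] at h
  simpa [sbr] using h

theorem IsQuantumAction.sbr_quantumCorrection
    (S : IsQuantumAction 𝒟 z P E r r' f X₀ X₁) (b : Fin N₀) :
    ∃ y : Fin N₀ → R, sbr 𝒟 E (z X₁) (z (𝒟.DR (.inr (.lam b)) X₀)) +
        ∑ a, z (𝒟.DR (.inr (.lam a)) X₀) * y a =
      slap 𝒟 E r r' (z (𝒟.DR (.inr (.lam b)) X₀)) +
      ∑ a, sg (ε₀ a) • z (𝒟.D (.inr (.lam a)) (𝒟.D (.inr (.lamS a)) (𝒟.DR (.inr (.lam b)) X₀))) +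
      ∑ a, sg (ε₁ a + 1) •
        z (𝒟.D (.inr (.c a)) (𝒟.D (.inr (.cS a)) (𝒟.DR (.inr (.lam b)) X₀))) := by
  have hz := S.reduction
  have hE := S.bivector
  have h := congrArg z (S.rightDer_eq (lam_notMem b))
  have P1 := S.rel.DR S.expansion (.inr (.lam b))
  have k1 := fun a => S.rel.zero (S.rel.DR S.expansion (.inr (.lam a)))
  have k3 := fun a => S.rel.neg (S.rel.D P1 (.inr (.lam a)))
  have k4 := fun a => S.rel.neg (S.rel.DR S.expansion (.inr (.c a)))
  have k5 := fun a => S.rel.neg (S.rel.D P1 (.inr (.c a)))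
  have k6 := fun a =>
    S.rel.zero (S.rel.D (S.rel.D P1 (.inr (.lamS a))) (.inr (.lam a)))
  have k7 := fun a =>
    S.rel.zero (S.rel.D (S.rel.D P1 (.inr (.cS a))) (.inr (.c a)))
  have k8 : z f = Complex.I • z X₁ := S.rel.one S.expansion rfl
  rw [map_smul, slapMin_apply, map_add, map_add, hz.slap hE, k1, map_sum, map_sum] at h
  simp only [map_smul, k6, k7] at h
  rw [rightDer, map_sum, sum_fld] at h
  simp only [hamCoeff_gVar] at h
  simp only [map_mul, hamCoeff, map_neg, k3, k4, k5, neg_zero, mul_zero, zero_mul, map_zero,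
    sum_const_zero, add_zero, k1] at h
  rw [hz.sbr_left hE, k1, k8] at h
  refine ⟨fun a => (-Complex.I) • z (𝒟.D (.inr (.lamS a)) (𝒟.DR (.inr (.lam b)) f)), ?_⟩
  have h2 := congrArg (fun t => (-Complex.I) • t) h
  simp only [smul_smul, neg_mul, Complex.I_mul_I, neg_neg, one_smul] at h2
  rw [← h2, smul_add, smul_sum]
  simp only [mul_smul_comm]
  congr 1
  simp only [sbr, map_smul, smul_mul_assoc, ← smul_sum, smul_smul, neg_mul,
    Complex.I_mul_I, neg_neg, one_smul]

theorem IsQuantumAction.sbr_constraint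
    (S : IsQuantumAction 𝒟 z P E r r' f X₀ X₁) (a b : Fin N₀) :
    sg (ε₀ a * (ε₀ b + 1)) •
        sbr 𝒟 E (z (𝒟.DR (.inr (.lam a)) X₀)) (z (𝒟.DR (.inr (.lam b)) X₀)) +
      ∑ g, z (𝒟.DR (.inr (.lam g)) X₀) *
        z (𝒟.DR (.inr (.lam a)) (𝒟.D (.inr (.lamS g)) (𝒟.DR (.inr (.lam b)) X₀))) = 0 := by
  have hz := S.reduction
  have hE := S.bivector
  have P1 := S.rel.DR S.expansion (.inr (.lam b))
  have P2 := S.rel.DR S.expansion (.inr (.lam a))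
  have hD0 : ∀ g, 𝒟.D (.inr (.lam a)) (z g) = 0 := hz.D_eq_zero _ (lam_notMem a)
  have hDE : ∀ A B, 𝒟.D (.inr (.lam a)) (E A B) = 0 := fun A B => hE.setZero A B ▸ hD0 _
  have hDr : 𝒟.D (.inr (.lam a)) r = 0 := hE.density_setZero ▸ hD0 _
  have hDr' : 𝒟.D (.inr (.lam a)) r' = 0 := hE.inverse_setZero ▸ hD0 _
  have hW : IsHomog (ε₀ b) (𝒟.DR (.inr (.lam b)) f) := by
    have := 𝒟.isHomog_DR S.homog (.inr (.lam b))
    rwa [zero_add] at this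
  have h := congrArg (fun t => z (𝒟.DR (.inr (.lam a)) t)) (S.rightDer_eq (lam_notMem b))
  have k0 := S.rel.neg (S.rel.DR P1 (.inr (.lam a)))
  have k1 := fun a => S.rel.zero (S.rel.DR S.expansion (.inr (.lam a)))
  have k2 := fun g =>
    S.rel.zero (S.rel.DR (S.rel.D P1 (.inr (.lamS g))) (.inr (.lam a)))
  have k3 := fun g => S.rel.neg (S.rel.D P1 (.inr (.lam g)))
  have k3' := fun g =>
    S.rel.neg (S.rel.DR (S.rel.D P1 (.inr (.lam g))) (.inr (.lam a)))
  have k4 := fun a => S.rel.neg (S.rel.DR S.expansion (.inr (.c a)))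
  have k5 := fun g => S.rel.neg (S.rel.D P1 (.inr (.c g)))
  have k5' := fun g =>
    S.rel.neg (S.rel.DR (S.rel.D P1 (.inr (.c g))) (.inr (.lam a)))
  have k6 := fun g =>
    S.rel.neg (S.rel.D (S.rel.D (S.rel.DR P1 (.inr (.lam a))) (.inr (.lamS g))) (.inr (.lam g)))
  have k7 := fun g =>
    S.rel.neg (S.rel.D (S.rel.D (S.rel.DR P1 (.inr (.lam a))) (.inr (.cS g))) (.inr (.c g)))
  have k8 := fun g => S.rel.neg (S.rel.DR P2 (.inr (.lam g)))
  have k9 := fun g => S.rel.neg (S.rel.DR P2 (.inr (.c g)))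
  have k10 : ∀ B, z (𝒟.DR (.inr (.lam a)) (𝒟.D (gVar B) (𝒟.DR (.inr (.lam b)) f))) = 0 :=
    fun B => by rw [← 𝒟.D_DR, hz.D, k0, map_zero]
  have hG : ∀ A, z (𝒟.DR (.inr (.lam a)) (∑ B, E A B * 𝒟.D (gVar B) (𝒟.DR (.inr (.lam b)) f))) = 0 := by
    intro A
    rw [map_sum, map_sum]
    exact sum_eq_zero fun B _ => by
      rw [𝒟.DR_mul_of_D_eq_zero (hDE A B), map_mul, k10, mul_zero]
  simp only [map_smul] at h
  rw [DR_slapMin 𝒟 _ hDE hDr hDr', slapMin_apply, map_add, map_add, hz.slap hE, k0, map_zero,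
    map_sum, map_sum] at h
  simp only [map_smul, k6, k7, smul_zero, sum_const_zero, add_zero] at h
  rw [DR_rightDer 𝒟 (isHomog_hamCoeff 𝒟 hE hW), map_add, map_smul, rightDer, map_sum, map_sum,
    sum_fld, sum_fld] at h
  simp only [hamCoeff_gVar] at h
  simp only [map_mul, hamCoeff, map_neg, hG, k3, k3', k4, k5, k5', neg_zero, mul_zero, zero_mul,
    map_zero, sum_const_zero, add_zero, zero_add, k2, k8, k9] at h
  rw [hz.sbr_left hE, k1, k1] at h
  simp only [k1] at h
  exact h

theorem IsQuantumAction.sbr_reducibility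
    (S : IsQuantumAction 𝒟 z P E r r' f X₀ X₁) (a b : Fin N₀) (k : Fin N₁) :
    ∃ y : Fin N₀ → R, sg ((ε₁ k + 1) * (ε₀ b + 1)) •
      (sbr 𝒟 E (z (𝒟.D (.inr (.lamS a)) (𝒟.DR (.inr (.c k)) X₀)))
          (z (𝒟.DR (.inr (.lam b)) X₀)) -
        ∑ g, twist (ε₀ a + 1) (z (𝒟.DR (.inr (.lamS g)) (𝒟.DR (.inr (.c k)) X₀))) *
          z (𝒟.D (.inr (.lamS a)) (𝒟.D (.inr (.lam g)) (𝒟.DR (.inr (.lam b)) X₀)))) +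
      ∑ l, z (𝒟.D (.inr (.lamS a)) (𝒟.DR (.inr (.c l)) X₀)) *
        z (𝒟.DR (.inr (.c k)) (𝒟.D (.inr (.cS l)) (𝒟.DR (.inr (.lam b)) X₀))) +
      ∑ g, twist (ε₀ a + 1) (z (𝒟.DR (.inr (.lam g)) X₀)) * y g = 0 := by
  have hz := S.reduction
  have hE := S.bivector
  have P1 := S.rel.DR S.expansion (.inr (.lam b))
  have P2 := S.rel.DR S.expansion (.inr (.c k))
  have hDE : ∀ w ∉ gammaVars, ∀ A B, 𝒟.D (.inr w) (E A B) = 0 := fun w hw A B =>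
    hE.setZero A B ▸ hz.D_eq_zero w hw _
  have hDr : ∀ w ∉ gammaVars, 𝒟.D (.inr w) r = 0 := fun w hw =>
    hE.density_setZero ▸ hz.D_eq_zero w hw _
  have hDr' : ∀ w ∉ gammaVars, 𝒟.D (.inr w) r' = 0 := fun w hw =>
    hE.inverse_setZero ▸ hz.D_eq_zero w hw _
  have hW : IsHomog (ε₀ b) (𝒟.DR (.inr (.lam b)) f) := by
    have := 𝒟.isHomog_DR S.homog (.inr (.lam b))
    rwa [zero_add] at this
  have h := congrArg (fun t => z (𝒟.D (.inr (.lamS a)) (𝒟.DR (.inr (.c k)) t)))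
    (S.rightDer_eq (lam_notMem b))
  -- the right side
  have hrhs : z (𝒟.D (.inr (.lamS a)) (𝒟.DR (.inr (.c k))
      (Complex.I • slapMin 𝒟 E r r' (𝒟.DR (.inr (.lam b)) f)))) = 0 := by
    have P3 := S.rel.DR (S.rel.DR P1 (.inr (.c k))) (.inr (.lamS a))
    have k0 := S.rel.neg P3
    have k6 := fun g =>
    S.rel.neg (S.rel.D (S.rel.D P3 (.inr (.lamS g))) (.inr (.lam g)))
    have k7 := fun g =>
    S.rel.neg (S.rel.D (S.rel.D P3 (.inr (.cS g))) (.inr (.c g)))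
    rw [𝒟.D_eq_twist_DR, hz.twist, map_smul, map_smul, map_smul,
      DR_slapMin 𝒟 _ (hDE _ (c_notMem k)) (hDr _ (c_notMem k)) (hDr' _ (c_notMem k)),
      DR_slapMin 𝒟 _ (hDE _ (lamS_notMem a)) (hDr _ (lamS_notMem a)) (hDr' _ (lamS_notMem a)),
      slapMin_apply, map_add, map_add, hz.slap hE, k0, map_zero, map_sum, map_sum]
    simp only [map_smul, k6, k7, smul_zero, sum_const_zero, add_zero, map_zero]
  rw [hrhs, DR_rightDer 𝒟 (isHomog_hamCoeff 𝒟 hE hW), map_add, map_add, map_smul, map_smul,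
    D_rightDer, map_add, rightDer, map_sum, map_sum] at h
  simp only [map_sum, 𝒟.D_mul, map_add, sum_add_distrib, map_mul, hz.twist] at h
  simp only [sum_fld] at h
  simp only [hamCoeff_gVar] at h
  simp only [hamCoeff, map_neg, map_zero, mul_zero, sum_const_zero, add_zero] at h
  -- coefficients of the Hamiltonian derivation
  have a1 := fun g => S.rel.neg (S.rel.D P1 (.inr (.lam g)))
  have a2 := fun g => S.rel.neg (S.rel.D P1 (.inr (.c g)))
  have P4 := S.rel.D P2 (.inr (.lamS a))
  have a3 := fun g => S.rel.neg (S.rel.DR P4 (.inr (.lam g)))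
  have a4 := fun g => S.rel.neg (S.rel.DR P4 (.inr (.c g)))
  have a5 := S.rel.zero P4
  have a6 : ∀ A, z (𝒟.DR (gVar A) (𝒟.DR (.inr (.c k)) f)) = 0 := fun A => by
    rw [hz.DR, S.rel.neg P2, map_zero]
  have a7 := fun g => S.rel.neg (S.rel.DR P2 (.inr (.lam g)))
  have a8 := fun g => S.rel.neg (S.rel.DR P2 (.inr (.c g)))
  have a9 := fun g => S.rel.zero (S.rel.DR P2 (.inr (.lamS g)))
  have a10 := fun g =>
    S.rel.zero (S.rel.D (S.rel.D P1 (.inr (.lam g))) (.inr (.lamS a)))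
  have a11 := fun g =>
    S.rel.neg (S.rel.D (S.rel.D P1 (.inr (.c g))) (.inr (.lamS a)))
  have a12 := fun g =>
    S.rel.neg (S.rel.DR (S.rel.D P1 (.inr (.lamS g))) (.inr (.c k)))
  have a13 := fun g =>
    S.rel.neg (S.rel.DR (S.rel.D P1 (.inr (.lam g))) (.inr (.c k)))
  have a14 := fun g =>
    S.rel.neg (S.rel.DR (S.rel.D P1 (.inr (.c g))) (.inr (.c k)))
  have a15 := fun l =>
    S.rel.zero (S.rel.DR (S.rel.D P1 (.inr (.cS l))) (.inr (.c k)))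
  have a16 := fun l =>
    S.rel.zero (S.rel.D (S.rel.DR S.expansion (.inr (.c l))) (.inr (.lamS a)))
  have a17 := fun g =>
    S.rel.neg (S.rel.D (S.rel.DR (S.rel.D P1 (.inr (.lam g))) (.inr (.c k))) (.inr (.lamS a)))
  have a18 := fun g =>
    S.rel.neg (S.rel.D (S.rel.DR (S.rel.D P1 (.inr (.c g))) (.inr (.c k))) (.inr (.lamS a)))
  have a19 := fun a => S.rel.neg (S.rel.DR S.expansion (.inr (.c a)))
  have a20 := fun a => S.rel.zero (S.rel.DR S.expansion (.inr (.lam a)))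
  have a21 : ∀ B, z (𝒟.DR (.inr (.c k)) (𝒟.D (gVar B) (𝒟.DR (.inr (.lam b)) f))) = 0 := fun B =>
    S.rel.neg (S.rel.DR (S.rel.D P1 _) _) (by rcases B with B | B <;> simp [planck, gVar])
  have a22 : ∀ B, z (𝒟.D (.inr (.lamS a)) (𝒟.DR (.inr (.c k)) (𝒟.D (gVar B)
      (𝒟.DR (.inr (.lam b)) f)))) = 0 := fun B =>
    S.rel.neg (S.rel.D (S.rel.DR (S.rel.D P1 _) _) _)
      (by rcases B with B | B <;> simp [planck, gVar])
  have hG1 : ∀ A, z (𝒟.DR (.inr (.c k)) (∑ B, E A B * 𝒟.D (gVar B)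
      (𝒟.DR (.inr (.lam b)) f))) = 0 := fun A => by
    rw [map_sum, map_sum]
    exact sum_eq_zero fun B _ => by
      rw [𝒟.DR_mul_of_D_eq_zero (hDE _ (c_notMem k) A B), map_mul, a21, mul_zero]
  have hG2 : ∀ A, z (𝒟.D (.inr (.lamS a)) (𝒟.DR (.inr (.c k)) (∑ B, E A B * 𝒟.D (gVar B)
      (𝒟.DR (.inr (.lam b)) f)))) = 0 := fun A => by
    rw [map_sum, map_sum, map_sum]
    exact sum_eq_zero fun B _ => by
      rw [𝒟.DR_mul_of_D_eq_zero (hDE _ (c_notMem k) A B), 𝒟.D_mul,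
        hDE _ (lamS_notMem a) A B, zero_mul, zero_add, map_mul, a22, mul_zero]
  simp only [hG1, hG2, a1, a2, a3, a4, a6, a7, a8, a9, a10, a11, a12, a13, a14, a15, a16, a17, a18,
    a19, a20, neg_zero, mul_zero, zero_mul, map_zero, sum_const_zero, add_zero, zero_add,
    mul_neg, sum_neg_distrib] at h
  rw [hz.sbr_left hE, a5, a20] at h
  refine ⟨fun g => z (𝒟.D (.inr (.lamS a)) (𝒟.DR (.inr (.c k)) (𝒟.D (.inr (.lamS g))
      (𝒟.DR (.inr (.lam b)) f)))), ?_⟩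
  rw [← h]
  simp only [smul_add, smul_neg, Sum.elim_inr, par, sub_eq_add_neg, add_assoc]

end MasterEquation

/-! ### Supermatrices -/

section SuperMatrix

variable {R : Type*} [Ring R] [Algebra ℂ R] [SuperAlgebra R]
  {l m n : Type*} [Fintype l] [Fintype m] [Fintype n]
  {p : l → ZMod 2} {q : m → ZMod 2} {t : n → ZMod 2}

/-- Supermatrices of parity `s`. -/
def IsMat (s : ZMod 2) (p : l → ZMod 2) (q : m → ZMod 2) (K : Matrix l m R) : Prop :=
  ∀ i j, IsHomog (p i + q j + s) (K i j)

theorem IsMat.mul {s s' : ZMod 2} {K : Matrix l m R} {L : Matrix m n R} (hK : IsMat s p q K)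
    (hL : IsMat s' q t L) : IsMat (s + s') p t (K * L) := fun i j =>
  IsHomog.sum fun k _ => (hK i k).mul_of_eq (hL k j) (by
    generalize p i = a; generalize q k = b; generalize t j = c; clear * -; decide +revert)

theorem IsMat.mul_of_eq {s s' s'' : ZMod 2} {K : Matrix l m R} {L : Matrix m n R}
    (hK : IsMat s p q K) (hL : IsMat s' q t L) (h : s + s' = s'') : IsMat s'' p t (K * L) :=
  h ▸ hK.mul hL

/-- The supertrace. -/
def str (p : l → ZMod 2) (K : Matrix l l R) : R := ∑ i, sg (p i) • K i i

theorem str_add (K L : Matrix l l R) : str p (K + L) = str p K + str p L := by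
  simp only [str, Matrix.add_apply, smul_add, sum_add_distrib]

theorem str_neg (K : Matrix l l R) : str p (-K) = -str p K := by
  simp only [str, Matrix.neg_apply, smul_neg, sum_neg_distrib]

theorem str_sub (K L : Matrix l l R) : str p (K - L) = str p K - str p L := by
  rw [sub_eq_add_neg, str_add, str_neg, ← sub_eq_add_neg]

theorem str_mul_comm {s : ZMod 2} {K : Matrix l m R} {L : Matrix m l R} (hK : IsMat s p q K)
    (hL : IsMat s q p L) : str p (K * L) = sg s • str q (L * K) := by
  simp only [str, Matrix.mul_apply, smul_sum]
  rw [sum_comm]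
  refine sum_congr rfl fun j _ => sum_congr rfl fun i _ => ?_
  rw [(hK i j).mul_comm (hL j i), smul_smul, smul_smul, ← sg_add, ← sg_add]
  congr 2
  generalize p i = a; generalize q j = b; clear * -; decide +revert

theorem str_mul_comm_zero {K : Matrix l m R} {L : Matrix m l R} (hK : IsMat 0 p q K)
    (hL : IsMat 0 q p L) : str p (K * L) = str q (L * K) := by
  rw [str_mul_comm hK hL, sg_zero, one_smul]

/-- The supertranspose of an even supermatrix. -/
def supT (p : l → ZMod 2) (q : m → ZMod 2) (K : Matrix l m R) : Matrix m l R :=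
  Matrix.of fun j i => sg (p i * (p i + q j)) • K i j

theorem isMat_supT {K : Matrix l m R} (hK : IsMat 0 p q K) : IsMat 0 q p (supT p q K) :=
  fun j i => by
    rw [add_comm (q j)]
    exact (hK i j).smul _

theorem supT_mul {K : Matrix l m R} {L : Matrix m n R} (hK : IsMat 0 p q K) (hL : IsMat 0 q t L) :
    supT p t (K * L) = supT q t L * supT p q K := by
  ext k i
  simp only [supT, of_apply, Matrix.mul_apply, smul_sum]
  refine sum_congr rfl fun j _ => ?_
  rw [smul_mul_smul_comm, (hK i j).mul_comm (hL j k), smul_smul, ← sg_add, ← sg_add]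
  congr 2
  generalize p i = a; generalize q j = b; generalize t k = c; clear * -; decide +revert

theorem str_supT (K : Matrix l l R) : str p (supT p p K) = str p K := by
  refine sum_congr rfl fun i _ => ?_
  rw [supT, of_apply, CharTwo.add_self_eq_zero, mul_zero, sg_zero, one_smul]

theorem supT_one [DecidableEq l] : supT p p (1 : Matrix l l R) = 1 := by
  ext i j
  rw [supT, of_apply]
  by_cases h : i = j
  · subst h
    rw [CharTwo.add_self_eq_zero, mul_zero, sg_zero, one_smul]
  · rw [Matrix.one_apply_ne h, Matrix.one_apply_ne (Ne.symm h), smul_zero]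

theorem IsMat.of_inverse [DecidableEq l] {s : ZMod 2} {K : Matrix l m R} {L : Matrix m l R}
    [DecidableEq m]
    (hK : IsMat s p q K) (h1 : K * L = 1) (h2 : L * K = 1) : IsMat s q p L := by
  set L' : Matrix m l R := Matrix.of fun j i => sg (q j + p i + s) • invol (L j i) with hL'
  have h3 : K * L' = 1 := by
    ext i k
    have := congrArg invol (congrFun (congrFun h1 i) k)
    rw [Matrix.mul_apply, map_sum] at this
    rw [Matrix.mul_apply]
    have e : ∀ j, K i j * L' j k = sg (p i + p k) • invol (K i j * L j k) := by
      intro j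
      rw [map_mul, show invol (K i j) = _ from hK i j, hL', of_apply, mul_smul_comm,
        smul_mul_assoc, smul_smul, ← sg_add]
      congr 2
      generalize p i = a; generalize p k = b; generalize q j = c; clear * -; decide +revert
    rw [sum_congr rfl fun j _ => e j, ← smul_sum, this]
    by_cases h : i = k
    · subst h
      rw [CharTwo.add_self_eq_zero, sg_zero, one_smul, Matrix.one_apply_eq, map_one]
    · rw [Matrix.one_apply_ne h, map_zero, smul_zero]
  have h4 : L' = L := by
    calc L' = L * K * L' := by rw [h2, Matrix.one_mul]
      _ = L := by rw [Matrix.mul_assoc, h3, Matrix.mul_one]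
  intro j i
  have := congrFun (congrFun h4 j) i
  rw [hL', of_apply] at this
  have h5 := congrArg (fun x => sg (q j + p i + s) • x) this
  simp only [sg_smul_sg_smul] at h5
  exact h5

/-- The main cancellation of supertraces: for a Jacobian `(F₀, *, Fs; G, ωᵀ, 0)` with inverse
`(Az, Bz; Ap, Bp; As, Bs)`, and a derivation that maps each matrix `M` to `dM`. -/
theorem str_identity [DecidableEq l] [DecidableEq m] [DecidableEq n]
    {F₀ K : Matrix m l R} {dFp Fs dFs : Matrix m n R} {G : Matrix m l R}
    {ω dω : Matrix n m R} {e : Matrix l m R} {Z : Matrix m n R} {N Ni : Matrix m m R}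
    {Az : Matrix l m R} {Ap As : Matrix n m R} {Bz : Matrix l m R} {Bp : Matrix n m R}
    {D Di W : Matrix n n R} {X' : Matrix l l R} {U : Matrix m m R}
    (hK : IsMat 1 q p K) (hdFs : IsMat 0 q t dFs)
    (hG : IsMat 0 q p G) (hω : IsMat 0 t q ω) (hdω : IsMat 0 t q dω) (he : IsMat 1 p q e)
    (hZ : IsMat 0 q t Z) (hNi : IsMat 0 q q Ni) (hDi : IsMat 0 t t Di)
    (hBz : IsMat 0 p q Bz) (hU : IsMat 0 q q U)
    (hzz : Az * F₀ + Bz * G = 1)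
    (hze : Az * N = e) (hpe : Ap * N = 0) (hse : As * N = -ω)
    (hGB : G * Bz + supT t q ω * Bp = 1)
    (hN : N = F₀ * e - Fs * ω) (hNi1 : N * Ni = 1) (hNi2 : Ni * N = 1)
    (hD : D = ω * Z) (hDi1 : D * Di = 1) (hDi2 : Di * D = 1)
    (heZ : e * Z = 0) (hZG : supT q t Z * G = 0) :
    str p (Az * (K - F₀ * X') + Bz * (supT q q U * G - G * X')) +
      str t (Ap * dFp + Bp * supT t q dω) - str t (As * dFs) +
      str q (Ni * (K * e + F₀ * e * U - dFs * ω - Fs * dω)) -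
      (2 : ℂ) • str t (Di * (dω * Z + ω * (-(U * Z) - Z * W))) =
    -str p X' + (2 : ℂ) • str q U + (2 : ℂ) • str t W := by
  have hDm : IsMat 0 t t D := hD ▸ hω.mul_of_eq hZ (add_zero 0)
  have hAz : Az = e * Ni := by rw [← hze, Matrix.mul_assoc, hNi1, Matrix.mul_one]
  have hAp : Ap = 0 := by
    rw [← Matrix.mul_one Ap, ← hNi1, ← Matrix.mul_assoc, hpe, Matrix.zero_mul]
  have hAs : As = -(ω * Ni) := by
    rw [← Matrix.neg_mul, ← hse, Matrix.mul_assoc, hNi1, Matrix.mul_one]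
  have hNFs : Ni * Fs = -(Z * Di) := by
    have h1 : N * (Z * Di) = -Fs := by
      rw [hN, Matrix.sub_mul, ← Matrix.mul_assoc (F₀ * e), Matrix.mul_assoc F₀, heZ,
        Matrix.mul_zero, Matrix.zero_mul, zero_sub, Matrix.mul_assoc, ← Matrix.mul_assoc ω, ← hD,
        hDi1, Matrix.mul_one]
    rw [← neg_eq_iff_eq_neg, ← Matrix.mul_neg, ← h1, ← Matrix.mul_assoc, hNi2, Matrix.one_mul]
  have hBp : Bp = supT t t Di * supT q t Z := by
    have h1 : supT t t D * Bp = supT q t Z := by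
      have := congrArg (fun B => supT q t Z * B) hGB
      simp only [Matrix.mul_add, Matrix.mul_one] at this
      rw [← Matrix.mul_assoc, hZG, Matrix.zero_mul, zero_add, ← Matrix.mul_assoc,
        ← supT_mul hω hZ, ← hD] at this
      exact this
    rw [← h1, ← Matrix.mul_assoc, ← supT_mul hDm hDi, hDi1, supT_one, Matrix.one_mul]
  have hZD : IsMat 0 q t (Z * Di) := hZ.mul_of_eq hDi (add_zero 0)
  -- the traces containing unknown derivatives
  have t1 : str q (Ni * (K * e)) = -str p (Az * K) := by
    rw [← Matrix.mul_assoc, str_mul_comm (s := 1) (hNi.mul_of_eq hK (zero_add 1)) he, sg_one,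
      neg_one_smul, ← Matrix.mul_assoc, hAz]
  have t2 : str q (Ni * (F₀ * e * U)) = str q U - str q (Z * Di * ω * U) := by
    have : Ni * (F₀ * e * U) = U - Z * Di * ω * U := by
      have h1 : F₀ * e = N + Fs * ω := by rw [hN]; abel
      rw [h1, Matrix.add_mul, Matrix.mul_add, ← Matrix.mul_assoc, hNi2, Matrix.one_mul,
        Matrix.mul_assoc Fs, ← Matrix.mul_assoc Ni, hNFs, Matrix.neg_mul, ← sub_eq_add_neg,
        Matrix.mul_assoc (Z * Di)]
    rw [this, str_sub]
  have t3 : str q (Ni * (dFs * ω)) = -str t (As * dFs) := by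
    rw [← Matrix.mul_assoc, str_mul_comm_zero (hNi.mul_of_eq hdFs (add_zero 0)) hω, hAs,
      Matrix.neg_mul, str_neg, neg_neg, Matrix.mul_assoc]
  have t4 : str q (Ni * (Fs * dω)) = -str q (Z * Di * dω) := by
    rw [← Matrix.mul_assoc, hNFs, Matrix.neg_mul, str_neg]
  have hZDω : IsMat 0 q q (Z * Di * ω) := hZD.mul_of_eq hω (add_zero 0)
  have t5 : str p (Bz * (supT q q U * G)) = str q U - str q (Z * Di * ω * U) := by
    have h1 : supT q q U * G * Bz = supT q q U - supT q q (Z * Di * ω * U) := by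
      have h2 : G * Bz = 1 - supT t q ω * Bp := by rw [← hGB]; abel
      rw [Matrix.mul_assoc, h2, Matrix.mul_sub, Matrix.mul_one, hBp, ← supT_mul hZ hDi,
        ← supT_mul hZD hω, ← supT_mul hZDω hU]
    rw [str_mul_comm_zero hBz ((isMat_supT hU).mul_of_eq hG (add_zero 0)), h1, str_sub, str_supT,
      str_supT]
  have t6 : str t (Bp * supT t q dω) = str q (Z * Di * dω) := by
    rw [hBp, ← supT_mul hZ hDi, ← supT_mul hdω hZD, str_supT, str_mul_comm_zero hdω hZD]
  have t7 : str p (Az * (F₀ * X')) + str p (Bz * (G * X')) = str p X' := by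
    rw [← str_add, ← Matrix.mul_assoc, ← Matrix.mul_assoc, ← Matrix.add_mul, hzz, Matrix.one_mul]
  have t8 : str t (Di * (dω * Z)) = str q (Z * Di * dω) := by
    rw [← Matrix.mul_assoc, str_mul_comm_zero (hDi.mul_of_eq hdω (add_zero 0)) hZ,
      Matrix.mul_assoc]
  have t9 : str t (Di * (ω * (U * Z))) = str q (Z * Di * ω * U) := by
    rw [← Matrix.mul_assoc, ← Matrix.mul_assoc, str_mul_comm_zero
      ((hDi.mul_of_eq hω (add_zero 0)).mul_of_eq hU (add_zero 0)) hZ]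
    simp only [Matrix.mul_assoc]
  have t10 : str t (Di * (ω * (Z * W))) = str t W := by
    rw [← Matrix.mul_assoc ω, ← hD, ← Matrix.mul_assoc, hDi2, Matrix.one_mul]
  have e1 : (2 : ℂ) • str q (Z * Di * dω) = str q (Z * Di * dω) + str q (Z * Di * dω) := two_smul _ _
  rw [hAp, Matrix.zero_mul, zero_add]
  simp only [Matrix.mul_add, Matrix.mul_sub, Matrix.mul_neg, str_add, str_sub, str_neg, t1, t2, t3,
    t4, t5, t6, t8, t9, t10, smul_add, smul_sub, smul_neg, two_smul]
  rw [← t7]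
  abel

end SuperMatrix

/-! ### Superdeterminants -/

section SDet

variable {R : Type} [Ring R] {ι : Type} [Fintype ι] [DecidableEq ι] {e : ι → ZMod 2}

/-- The block with row parity `f` and column parity `g`. -/
def blk (e : ι → ZMod 2) (f g : ZMod 2) (M : Matrix ι ι R) :
    Matrix {i // e i = f} {i // e i = g} R := M.submatrix Subtype.val Subtype.val

theorem toCenter_of_mem {a : R} (h : a ∈ Subring.center R) : toCenter a = ⟨a, h⟩ := dif_pos h

/-- The superdeterminant, computed in any commutative ring mapping to the center. -/
theorem sdet_eq_map {K : Type*} [CommRing K] (i : K →+* R) (hi : ∀ k, i k ∈ Subring.center R)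
    (M : Matrix ι ι R) (D D' : Matrix {i // e i = 1} {i // e i = 1} K)
    (S : Matrix {i // e i = 0} {i // e i = 0} K) (d : K)
    (hD : ∀ a b, M a.1 b.1 = i (D a b)) (hDD : D * D' = 1) (hd : D.det * d = 1)
    (hS : blk e 0 0 M - blk e 0 1 M * D'.map i * blk e 1 0 M = S.map i) :
    sdet e M = i (S.det * d) := by
  set i' : K →+* Subring.center R := i.codRestrict _ hi with hi'
  have hi'v : ∀ k, ((i' k : Subring.center R) : R) = i k := fun k => rfl
  have h0 : ∀ k, toCenter (i k) = i' k := fun k => toCenter_of_mem (hi k)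
  have h1 : (blk e 1 1 M).map toCenter = D.map i' := by
    ext a b
    rw [map_apply, blk, submatrix_apply, hD, h0, map_apply]
  have h2 : (D.map i')⁻¹ = D'.map i' := by
    refine Matrix.inv_eq_right_inv ?_
    rw [← Matrix.map_mul, hDD, Matrix.map_one _ (map_zero _) (map_one _)]
  have h3 : Ring.inverse (i' D.det) = i' d := by
    have h4 : i' D.det * i' d = 1 := by rw [← map_mul, hd, map_one]
    exact left_inv_eq_right_inv (Ring.inverse_mul_cancel _ (.of_mul_eq_one _ h4)) h4
  change ((((blk e 0 0 M - blk e 0 1 M * (((blk e 1 1 M).map toCenter)⁻¹.map Subtype.val) *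
    blk e 1 0 M).map toCenter).det * Ring.inverse ((blk e 1 1 M).map toCenter).det :
      Subring.center R) : R) = _
  rw [h1, h2]
  have h5 : (D'.map i').map (Subtype.val : Subring.center R → R) = D'.map i := by
    ext a b; rfl
  rw [h5, hS]
  have h6 : (S.map i).map toCenter = S.map i' := by
    ext a b
    rw [map_apply, map_apply, h0, map_apply]
  rw [h6]
  have h7 : (D.map i').det = i' D.det := (RingHom.map_det i' D).symm
  have h8 : (S.map i').det = i' S.det := (RingHom.map_det i' S).symm
  rw [h7, h8, h3, ← map_mul, hi'v]

end SDet

section EvenPart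

variable {R : Type} [Ring R] [Algebra ℂ R] [SuperAlgebra R]

/-- The even elements. -/
def evenPart (R : Type) [Ring R] [Algebra ℂ R] [SuperAlgebra R] : Subring R where
  carrier := {a | invol a = a}
  mul_mem' {a b} (ha : _ = _) (hb : _ = _) := by
    change invol (a * b) = a * b
    rw [map_mul, ha, hb]
  one_mem' := map_one _
  add_mem' {a b} (ha : _ = _) (hb : _ = _) := by
    change invol (a + b) = a + b
    rw [map_add, ha, hb]
  zero_mem' := map_zero _
  neg_mem' {a} (ha : _ = _) := by
    change invol (-a) = -a
    rw [map_neg, ha]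

theorem mem_evenPart {a : R} : a ∈ evenPart R ↔ IsHomog 0 a := isHomog_zero_iff.symm

instance : CommRing (evenPart R) :=
  { (evenPart R).toRing with
    mul_comm := fun a b => Subtype.ext (SuperAlgebra.comm_even a.1 b.1 a.2) }

theorem even_mem_center {a : R} (h : IsHomog 0 a) : a ∈ Subring.center R :=
  Subring.mem_center_iff.2 fun b => by rw [h.mul_comm', twist_zero]

variable {ι : Type} [Fintype ι] [DecidableEq ι] {e : ι → ZMod 2} {M : Matrix ι ι R}

theorem IsMat.even_block (hM : IsMat 0 e e M) (f : ZMod 2) (a b : {i // e i = f}) :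
    M a.1 b.1 ∈ evenPart R := by
  have := hM a.1 b.1
  rw [a.2, b.2, CharTwo.add_self_eq_zero, add_zero] at this
  exact mem_evenPart.2 this

theorem IsMat.odd_block (hM : IsMat 0 e e M) {f g : ZMod 2} (h : f + g = 1) (a : {i // e i = f})
    (b : {i // e i = g}) : IsHomog 1 (M a.1 b.1) := by
  have := hM a.1 b.1
  rwa [a.2, b.2, h, add_zero] at this

/-- The diagonal blocks of an even supermatrix. -/
def evenBlock (hM : IsMat 0 e e M) (f : ZMod 2) :
    Matrix {i // e i = f} {i // e i = f} (evenPart R) :=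
  Matrix.of fun a b => ⟨M a.1 b.1, hM.even_block f a b⟩

theorem schur_even (hM : IsMat 0 e e M) (D' : Matrix {i // e i = 1} {i // e i = 1} (evenPart R))
    (a b : {i // e i = 0}) :
    (blk e 0 0 M - blk e 0 1 M * D'.map (evenPart R).subtype * blk e 1 0 M) a b ∈ evenPart R := by
  refine sub_mem (hM.even_block 0 a b) (mem_evenPart.2 ?_)
  refine IsHomog.sum fun c _ => IsHomog.mul_of_eq (e := 1) (f := 1) ?_
    (hM.odd_block (add_zero 1) c b) (by decide)
  exact IsHomog.sum fun c' _ => (hM.odd_block (zero_add 1) a c').mul_of_eq (mem_evenPart.1 (D' c' c).2) (add_zero 1)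

/-- The Schur complement. -/
def schur (hM : IsMat 0 e e M) (D' : Matrix {i // e i = 1} {i // e i = 1} (evenPart R)) :
    Matrix {i // e i = 0} {i // e i = 0} (evenPart R) :=
  Matrix.of fun a b => ⟨_, schur_even hM D' a b⟩

theorem exists_sdet_eq (hM : IsMat 0 e e M) (hD : IsUnit (evenBlock hM 1).det) :
    ∃ d, (evenBlock hM 1).det * d = 1 ∧ evenBlock hM 1 * (evenBlock hM 1)⁻¹ = 1 ∧
      sdet e M = (evenPart R).subtype ((schur hM (evenBlock hM 1)⁻¹).det * d) := by
  obtain ⟨d, hd⟩ := hD.exists_right_inv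
  have hinv := Matrix.mul_nonsing_inv _ hD
  exact ⟨d, hd, hinv, sdet_eq_map (evenPart R).subtype
    (fun k => even_mem_center (mem_evenPart.1 k.2)) M _ _ _ _ (fun a b => rfl) hinv hd rfl⟩

theorem sdet_map {R' : Type} [Ring R'] [Algebra ℂ R'] [SuperAlgebra R'] (φ : R →ₐ[ℂ] R')
    (hφ : ∀ a, invol (φ a) = φ (invol a)) (hM : IsMat 0 e e M)
    (hD : IsUnit (evenBlock hM 1).det) : sdet e (M.map φ) = φ (sdet e M) := by
  obtain ⟨d, hdet, hinv, hsd⟩ := exists_sdet_eq hM hD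
  rw [hsd]
  refine sdet_eq_map (φ.toRingHom.comp (evenPart R).subtype) (fun k => even_mem_center ?_) _
    (evenBlock hM 1) (evenBlock hM 1)⁻¹ (schur hM (evenBlock hM 1)⁻¹) _ (fun a b => rfl) hinv hdet ?_
  · rw [isHomog_zero_iff]
    exact (hφ _).trans (congrArg φ (isHomog_zero_iff.1 (mem_evenPart.1 k.2)))
  · ext a b
    change _ = φ ((blk e 0 0 M - blk e 0 1 M * (evenBlock hM 1)⁻¹.map (evenPart R).subtype *
      blk e 1 0 M) a b)
    simp only [Matrix.sub_apply, Matrix.mul_apply, map_apply, blk, submatrix_apply,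
      map_sub, map_sum, map_mul]
    rfl

theorem isHomog_sdet (hM : IsMat 0 e e M) (hD : IsUnit (evenBlock hM 1).det) :
    IsHomog 0 (sdet e M) := by
  obtain ⟨d, -, -, hsd⟩ := exists_sdet_eq hM hD
  rw [hsd]
  exact mem_evenPart.1 ((schur hM (evenBlock hM 1)⁻¹).det * d).2

theorem blk_mul (f g : ZMod 2) (M M' : Matrix ι ι R) :
    blk e f g (M * M') = blk e f 0 M * blk e 0 g M' + blk e f 1 M * blk e 1 g M' := by
  ext a b
  simp only [blk, Matrix.add_apply, Matrix.mul_apply, submatrix_apply]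
  have h0 : ∀ h : ZMod 2, ∑ j : {i // e i = h}, M a.1 j.1 * M' j.1 b.1 =
      ∑ j with e j = h, M a.1 j * M' j b.1 := fun h =>
    (Finset.sum_subtype (p := fun i => e i = h) _ (by simp) (fun j => M a.1 j * M' j b.1)).symm
  change ∑ j, M a.1 j * M' j b.1 = (∑ j : {i // e i = 0}, M a.1 j.1 * M' j.1 b.1) +
    ∑ j : {i // e i = 1}, M a.1 j.1 * M' j.1 b.1
  rw [h0, h0, ← Finset.sum_filter_add_sum_filter_not Finset.univ (fun j => e j = 0)]
  congr 2
  ext j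
  rcases zmod2_cases (e j) with h | h <;> simp [h]

/-- Homomorphisms to `ℂ` vanishing on odd elements do not vanish on the determinant of the odd block
of an invertible supermatrix. -/
theorem map_det_oddBlock_ne_zero (β : R →ₐ[ℂ] ℂ) (hβ : ∀ a, IsHomog 1 a → β a = 0)
    (hM : IsMat 0 e e M) {M' : Matrix ι ι R} (h : M * M' = 1) (f : ZMod 2) :
    β (evenBlock hM f).det ≠ 0 := by
  have h1 : (evenBlock hM f).map (β.toRingHom.comp (evenPart R).subtype) *
      (blk e f f M').map β = 1 := by
    have h2 : (blk e f f (M * M')).map β = 1 := by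
      rw [h]
      ext a b
      simp only [blk, map_apply, submatrix_apply, Matrix.one_apply, Subtype.ext_iff]
      split_ifs <;> simp
    rw [blk_mul] at h2
    have h3 : ∀ g, g ≠ f → (blk e f g M * blk e g f M').map β = 0 := by
      intro g hg
      ext a b
      simp only [map_apply, Matrix.mul_apply, map_sum, map_mul, Matrix.zero_apply]
      refine sum_eq_zero fun c _ => ?_
      change β (M a.1 c.1) * _ = 0
      rw [hβ _ (hM.odd_block (by clear * - hg; decide +revert) a c), zero_mul]
    rw [Matrix.map_add _ (map_add β)] at h2
    rcases zmod2_cases f with rfl | rfl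
    · rw [h3 1 (by decide), add_zero] at h2
      rw [← h2, Matrix.map_mul]
      rfl
    · rw [h3 0 (by decide), zero_add] at h2
      rw [← h2, Matrix.map_mul]
      rfl
  have h5 := congrArg Matrix.det h1
  rw [Matrix.det_mul, Matrix.det_one] at h5
  have h6 : β (evenBlock hM f).det =
      ((evenBlock hM f).map (β.toRingHom.comp (evenPart R).subtype)).det :=
    RingHom.map_det (β.toRingHom.comp (evenPart R).subtype) _
  rw [h6]
  exact left_ne_zero_of_mul_eq_one h5

end EvenPart

section LogDerivative

theorem map_one_of_leibniz {K : Type*} [Ring K] (δ : K →+ K)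
    (hδ : ∀ a b, δ (a * b) = δ a * b + a * δ b) : δ 1 = 0 := by
  have := hδ 1 1
  rw [one_mul, mul_one, one_mul] at this
  exact left_eq_add.1 this

theorem trivSqZeroExt_det {K : Type*} [CommRing K] (δ : K →+ K)
    (hδ : ∀ a b, δ (a * b) = δ a * b + a * δ b) {ι : Type*} [Fintype ι] [DecidableEq ι]
    (S P : Matrix ι ι K) (h : P * S = 1) : δ S.det = S.det * (P * S.map δ).trace := by
  have h1 := map_one_of_leibniz δ hδ
  let j : K →+* DualNumber K :=
    { toFun := fun a => TrivSqZeroExt.inl a + TrivSqZeroExt.inr (δ a)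
      map_one' := by rw [h1]; simp
      map_zero' := by simp
      map_add' := fun a b => by
        rw [map_add]; ext <;> simp
      map_mul' := fun a b => by
        rw [hδ]
        ext
        · simp
        · simp only [TrivSqZeroExt.snd_add, TrivSqZeroExt.snd_inl, TrivSqZeroExt.snd_inr,
            DualNumber.snd_mul, TrivSqZeroExt.fst_add, TrivSqZeroExt.fst_inl,
            TrivSqZeroExt.fst_inr, zero_add, add_zero]
          exact add_comm _ _ }
  have hj : ∀ a, j a = algebraMap K (DualNumber K) a +
      DualNumber.eps * algebraMap K (DualNumber K) (δ a) := fun a => by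
    change TrivSqZeroExt.inl a + TrivSqZeroExt.inr (δ a) = TrivSqZeroExt.inl a +
      TrivSqZeroExt.inr 1 * TrivSqZeroExt.inl (δ a)
    ext <;> simp
  have h2 : S.map j = S.map (algebraMap K (DualNumber K)) *
      (1 + (DualNumber.eps : DualNumber K) • (P * S.map δ).map (algebraMap K (DualNumber K))) := by
    have h3 : S * (P * S.map δ) = S.map δ := by
      rw [← Matrix.mul_assoc, mul_eq_one_comm.1 h, Matrix.one_mul]
    rw [mul_add, mul_one, Matrix.mul_smul, ← Matrix.map_mul, h3]
    ext1 a b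
    rw [map_apply, hj, Matrix.add_apply, Matrix.smul_apply, smul_eq_mul]
    rfl
  have h4 := congrArg Matrix.det h2
  have h8 : ((P * S.map δ).map (algebraMap K (DualNumber K))).trace =
      algebraMap K (DualNumber K) (P * S.map δ).trace :=
    (map_sum (algebraMap K (DualNumber K)) _ _).symm
  rw [Matrix.det_mul, Matrix.det_one_add_smul, sq, DualNumber.eps_mul_eps, mul_zero, add_zero,
    h8, mul_add, mul_one] at h4
  have h5 : (S.map j).det = j S.det := (RingHom.map_det j S).symm
  have h6 : (S.map (algebraMap K (DualNumber K))).det = algebraMap K (DualNumber K) S.det :=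
    (RingHom.map_det _ S).symm
  rw [h5, h6, hj] at h4
  have h7 := congrArg TrivSqZeroExt.snd (add_left_cancel h4)
  have h9 : ∀ a b : K, TrivSqZeroExt.snd (algebraMap K (DualNumber K) a *
      (algebraMap K (DualNumber K) b * DualNumber.eps)) = a * b := fun a b => by
    change TrivSqZeroExt.snd (TrivSqZeroExt.inl a * (TrivSqZeroExt.inl b *
      TrivSqZeroExt.inr 1)) = a * b
    simp
  rw [h9] at h7
  rw [← h7, mul_comm]
  change _ = TrivSqZeroExt.snd (TrivSqZeroExt.inl _ * TrivSqZeroExt.inr 1)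
  simp

variable {R : Type} [Ring R] [Algebra ℂ R] [SuperAlgebra R]
variable {ι : Type} [Fintype ι] [DecidableEq ι] {e : ι → ZMod 2} {M M' : Matrix ι ι R}

theorem trace_mul_comm_odd {l m : Type} [Fintype l] [Fintype m] {K : Matrix l m R}
    {L : Matrix m l R} (hK : ∀ i j, IsHomog 1 (K i j)) (hL : ∀ i j, IsHomog 1 (L i j)) :
    (K * L).trace = -(L * K).trace := by
  simp only [Matrix.trace, Matrix.diag_apply, Matrix.mul_apply]
  rw [sum_comm, ← sum_neg_distrib]
  refine sum_congr rfl fun i _ => ?_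
  rw [← sum_neg_distrib]
  refine sum_congr rfl fun j _ => ?_
  rw [(hK j i).mul_comm (hL i j)]
  simp [sg]

theorem map_derivation_mul {l m n : Type} [Fintype m] (X : R →+ R)
    (hX : ∀ a b, X (a * b) = X a * b + a * X b) (K : Matrix l m R) (L : Matrix m n R) :
    (K * L).map X = K.map X * L + K * L.map X := by
  ext i j
  simp only [map_apply, Matrix.mul_apply, Matrix.add_apply, map_sum, hX,
    sum_add_distrib]

theorem map_derivation_inverse {l : Type} [Fintype l] [DecidableEq l] (X : R →+ R)
    (hX : ∀ a b, X (a * b) = X a * b + a * X b) {K L : Matrix l l R} (h : K * L = 1)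
    (h' : L * K = 1) : L.map X = -(L * K.map X * L) := by
  have h1 := map_derivation_mul X hX K L
  have hX1 := map_one_of_leibniz X hX
  have h2 : (1 : Matrix l l R).map X = 0 := by
    ext i j
    rw [map_apply, Matrix.one_apply]
    split_ifs <;> simp [hX1]
  rw [h, h2] at h1
  have h3 := congrArg (L * ·) h1
  simp only [mul_add, mul_zero, ← mul_assoc, h', one_mul] at h3
  exact eq_neg_of_add_eq_zero_right h3.symm

/-- The supertrace splits into the traces of the blocks. -/
theorem str_mul_blocks (K L : Matrix ι ι R) : str e (K * L) =
    (blk e 0 0 K * blk e 0 0 L).trace + (blk e 0 1 K * blk e 1 0 L).trace -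
      (blk e 1 0 K * blk e 0 1 L).trace - (blk e 1 1 K * blk e 1 1 L).trace := by
  have h0 : ∀ h : ZMod 2, (blk e h h (K * L)).trace = ∑ j with e j = h, (K * L) j j := fun h =>
    (Finset.sum_subtype (p := fun i => e i = h) _ (by simp) (fun j => (K * L) j j)).symm
  have h1 : str e (K * L) = (blk e 0 0 (K * L)).trace - (blk e 1 1 (K * L)).trace := by
    rw [h0, h0, str, ← Finset.sum_filter_add_sum_filter_not Finset.univ (fun j => e j = 0),
      sub_eq_add_neg, ← sum_neg_distrib]
    refine congrArg₂ _ (sum_congr rfl fun j hj => ?_) (sum_congr ?_ fun j hj => ?_)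
    · rw [(Finset.mem_filter.1 hj).2, sg_zero, one_smul]
    · ext j
      rcases zmod2_cases (e j) with h | h <;> simp [h]
    · rw [(Finset.mem_filter.1 hj).2, sg_one, neg_one_smul]
  rw [h1, blk_mul, blk_mul, Matrix.trace_add, Matrix.trace_add]
  abel

/-- The logarithmic derivative of the superdeterminant. -/
theorem derivation_sdet (X : R →+ R) (hX : ∀ a b, X (a * b) = X a * b + a * X b)
    (hXi : ∀ a, X (invol a) = invol (X a)) (hM : IsMat 0 e e M) (h : M * M' = 1) (h' : M' * M = 1)
    (hD : IsUnit (evenBlock hM 1).det) :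
    X (sdet e M) = sdet e M * str e (M' * M.map X) := by
  obtain ⟨d, hdet, hinv, hsd⟩ := exists_sdet_eq hM hD
  rw [hsd]
  have hM' : IsMat 0 e e M' := hM.of_inverse h h'
  have hXh : ∀ {f : ZMod 2} {a : R}, IsHomog f a → IsHomog f (X a) := by
    intro f a ha
    have h1 : invol a = sg f • a := ha
    change invol (X a) = sg f • X a
    rw [← hXi, h1, sg]
    split_ifs <;> simp
  let δ : evenPart R →+ evenPart R :=
    { toFun := fun a => ⟨X a, mem_evenPart.2 (hXh (mem_evenPart.1 a.2))⟩
      map_zero' := Subtype.ext (map_zero X)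
      map_add' := fun a b => Subtype.ext (map_add X _ _) }
  have hδ : ∀ a b, δ (a * b) = δ a * b + a * δ b := fun a b => Subtype.ext (hX _ _)
  set i := (evenPart R).subtype with hi
  have hii : ∀ {l m : Type} {K L : Matrix l m (evenPart R)}, K.map i = L.map i → K = L := by
    intro l m K L hKL
    ext a b
    exact congrFun (congrFun hKL a) b
  have hio : ∀ {l : Type} [DecidableEq l], (1 : Matrix l l (evenPart R)).map i = 1 :=
    Matrix.map_one _ (map_zero _) (map_one _)
  set Dk := evenBlock hM 1 with hDk
  set Tk := Dk⁻¹ with hTk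
  set S := schur hM Tk with hS
  set A := blk e 0 0 M with hA
  set B := blk e 0 1 M with hB
  set C := blk e 1 0 M with hC
  set D := blk e 1 1 M with hD
  set P := blk e 0 0 M' with hP
  set Q := blk e 0 1 M' with hQ
  set R' := blk e 1 0 M' with hR'
  set T := blk e 1 1 M' with hT
  set J := Tk.map i with hJ
  have hDD : Dk.map i = D := rfl
  have hSS : S.map i = A - B * J * C := rfl
  have hDJ : D * J = 1 := by rw [← hDD, hJ, ← Matrix.map_mul, hinv, hio]
  have hJD : J * D = 1 := by rw [← hDD, hJ, ← Matrix.map_mul, mul_eq_one_comm.1 hinv, hio]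
  have hb1 : ∀ f, blk e f f (1 : Matrix ι ι R) = 1 := fun f => by
    ext a b; simp [blk, Matrix.one_apply, Subtype.ext_iff]
  have hb0 : ∀ f g, f ≠ g → blk e f g (1 : Matrix ι ι R) = 0 := fun f g hfg => by
    ext a b
    have : a.1 ≠ b.1 := fun h => hfg (by rw [← a.2, ← b.2, h])
    simp [blk, this]
  have e1 : A * P + B * R' = 1 := by rw [← blk_mul, h, hb1]
  have e2 : C * P + D * R' = 0 := by rw [← blk_mul, h, hb0 _ _ (by decide)]
  have e3 : P * B + Q * D = 0 := by rw [← blk_mul, h', hb0 _ _ (by decide)]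
  have e4 : R' * B + T * D = 1 := by rw [← blk_mul, h', hb1]
  have r1 : R' = -(J * C * P) := by
    have := congrArg (J * ·) e2
    simp only [Matrix.mul_add, ← Matrix.mul_assoc, hJD, Matrix.one_mul,
      Matrix.mul_zero] at this
    exact eq_neg_of_add_eq_zero_right this
  have r2 : Q = -(P * B * J) := by
    have := congrArg (· * J) e3
    simp only [Matrix.add_mul, Matrix.mul_assoc, hDJ, Matrix.mul_one, Matrix.zero_mul] at this
    rw [Matrix.mul_assoc]
    exact eq_neg_of_add_eq_zero_right this
  have r3 : T = J + J * C * P * B * J := by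
    have := congrArg (· * J) e4
    simp only [Matrix.add_mul, Matrix.mul_assoc, hDJ, Matrix.mul_one, Matrix.one_mul] at this
    rw [r1, Matrix.neg_mul, neg_add_eq_iff_eq_add] at this
    rw [this]
    simp only [Matrix.mul_assoc]
    abel
  have hSP : S.map i * P = 1 := by
    rw [hSS, Matrix.sub_mul, ← e1, r1]
    simp only [Matrix.mul_neg, Matrix.mul_assoc]
    abel
  have hPS : evenBlock hM' 0 * S = 1 := by
    rw [mul_eq_one_comm]
    refine hii ?_
    rw [Matrix.map_mul, hio]
    exact hSP
  have l1 := congrArg i (trivSqZeroExt_det δ hδ S _ hPS)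
  have l2 := congrArg i (trivSqZeroExt_det δ hδ Dk Tk (mul_eq_one_comm.1 hinv))
  have htr : ∀ {l : Type} [Fintype l] (K L : Matrix l l (evenPart R)),
      i (K * L.map δ).trace = (K.map i * (L.map i).map X).trace := by
    intro l _ K L
    simp only [Matrix.trace, Matrix.diag_apply, Matrix.mul_apply, map_sum, map_mul]
    rfl
  rw [map_mul, htr] at l1 l2
  have l1' : X (i S.det) = i S.det * (P * (S.map i).map X).trace := l1
  have l2' : X (i Dk.det) = i Dk.det * (J * D.map X).trace := l2
  have l3 : X (i d) = -(i d * (J * D.map X).trace) := by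
    have h1 : i Dk.det * i d = 1 := by rw [← map_mul, hdet, map_one]
    have h1' : i d * i Dk.det = 1 := by rw [← map_mul, mul_comm, hdet, map_one]
    have h2 := hX (i Dk.det) (i d)
    have hX1 := map_one_of_leibniz X hX
    rw [h1, hX1, l2', mul_assoc, SuperAlgebra.comm_even (i d) _ d.2 |>.symm, ← mul_assoc, h1,
      one_mul] at h2
    have h3 := congrArg (i d * ·) h2
    simp only [mul_zero, mul_add, ← mul_assoc, h1', one_mul] at h3
    exact eq_neg_of_add_eq_zero_right h3.symm
  have key : str e (M' * M.map X) = (P * (S.map i).map X).trace - (J * D.map X).trace := by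
    rw [str_mul_blocks]
    change (P * A.map X).trace + (Q * C.map X).trace - (R' * B.map X).trace -
      (T * D.map X).trace = _
    have hBo : ∀ a b, IsHomog 1 (B a b) := hM.odd_block (zero_add 1)
    have hCo : ∀ a b, IsHomog 1 (C a b) := hM.odd_block (add_zero 1)
    have hBX : ∀ a b, IsHomog 1 (B.map X a b) := fun a b => hXh (hBo a b)
    have hJe : ∀ a b, IsHomog 0 (J a b) := fun a b => mem_evenPart.1 (Tk a b).2
    have hPe : ∀ a b, IsHomog 0 (P a b) := fun a b =>
      mem_evenPart.1 (evenBlock hM' 0 a b).2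
    have hDe : ∀ a b, IsHomog 0 (D.map X a b) := fun a b => hXh (mem_evenPart.1 (Dk a b).2)
    have mulh : ∀ {l m n : Type} [Fintype m] {f g k : ZMod 2} {K : Matrix l m R}
        {L : Matrix m n R}, (∀ a b, IsHomog f (K a b)) → (∀ a b, IsHomog g (L a b)) →
        f + g = k → ∀ a b, IsHomog k ((K * L) a b) := fun hK hL hfg a b =>
      IsHomog.sum fun c _ => (hK a c).mul_of_eq (hL c b) hfg
    have t1 : (R' * B.map X).trace = (P * B.map X * (J * C)).trace := by
      rw [r1, Matrix.neg_mul, Matrix.trace_neg, Matrix.mul_assoc,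
        trace_mul_comm_odd (mulh hJe hCo (zero_add 1))
          (mulh hPe hBX (zero_add 1)), neg_neg]
    have t2 : (J * C * P * B * J * D.map X).trace =
        -(P * B * J * D.map X * (J * C)).trace := by
      have : J * C * P * B * J * D.map X = J * C * (P * B * J * D.map X) := by
        simp only [Matrix.mul_assoc]
      rw [this, trace_mul_comm_odd (mulh hJe hCo (zero_add 1))
        (mulh (mulh (mulh hPe hBo (zero_add 1)) hJe (add_zero 1)) hDe (add_zero 1))]
    rw [hSS, r2, r3, t1, Matrix.map_sub _ (map_sub X), map_derivation_mul X hX,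
      map_derivation_mul X hX, map_derivation_inverse X hX hDJ hJD, Matrix.add_mul,
      Matrix.trace_add, t2]
    simp only [Matrix.mul_sub, Matrix.mul_add, Matrix.add_mul, Matrix.mul_neg, Matrix.neg_mul,
      Matrix.trace_sub, Matrix.trace_add, Matrix.trace_neg, ← Matrix.mul_assoc]
    abel
  have hc1 : i S.det * X (i d) = -(i S.det * i d * (J * D.map X).trace) := by
    rw [l3, mul_neg, mul_assoc]
  rw [map_mul, hX, hc1, l1', key, mul_assoc (i S.det),
    SuperAlgebra.comm_even (i d) _ d.2 |>.symm, mul_sub, ← mul_assoc, sub_eq_add_neg]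

end LogDerivative

/-! ### Supercommutative quotients -/

section Quotient

/-- The quotient by the ideal generated by homogeneous elements. -/
theorem exists_superQuotient {R : Type} [Ring R] [Algebra ℂ R] [SuperAlgebra R] {m : Type}
    [Fintype m] {q : m → ZMod 2} {G : m → R} (hG : ∀ a, IsHomog (q a) (G a)) :
    ∃ (Q : Type) (_ : Ring Q) (_ : Algebra ℂ Q) (_ : SuperAlgebra Q) (φ : R →ₐ[ℂ] Q),
      (∀ a, invol (φ a) = φ (invol a)) ∧ ∀ x, φ x = 0 ↔ ∃ k : m → R, x = ∑ a, G a * k a := by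
  set I : Ideal R := Ideal.span (Set.range G) with hI
  have hmem : ∀ x, x ∈ I ↔ ∃ k : m → R, x = ∑ a, G a * k a := by
    intro x
    rw [hI, Ideal.mem_span_range_iff_exists_fun]
    constructor
    · rintro ⟨k, rfl⟩
      refine ⟨fun a => twist (q a) (k a), sum_congr rfl fun a _ => ?_⟩
      rw [(hG a).mul_comm', twist_twist_self]
    · rintro ⟨k, rfl⟩
      exact ⟨fun a => twist (q a) (k a), sum_congr rfl fun a _ => ((hG a).mul_comm' _).symm⟩
  have hT : I.IsTwoSided := ⟨fun {x} y hx => by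
    obtain ⟨k, rfl⟩ := (hmem x).1 hx
    exact (hmem _).2 ⟨fun a => k a * y, by simp only [sum_mul, mul_assoc]⟩⟩
  have hs : ∀ x ∈ I, Ideal.Quotient.mkₐ ℂ I (invol x) = 0 := by
    intro x hx
    obtain ⟨k, rfl⟩ := (hmem x).1 hx
    refine Ideal.Quotient.eq_zero_iff_mem.2 ((hmem _).2 ⟨fun a => sg (q a) • invol (k a), ?_⟩)
    rw [map_sum]
    refine sum_congr rfl fun a _ => ?_
    rw [map_mul, show invol (G a) = _ from hG a, smul_mul_assoc, mul_smul_comm]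
  let j : R ⧸ I →ₐ[ℂ] R ⧸ I := Ideal.Quotient.liftₐ I ((Ideal.Quotient.mkₐ ℂ I).comp invol) hs
  have hj : ∀ a, j (Ideal.Quotient.mkₐ ℂ I a) = Ideal.Quotient.mkₐ ℂ I (invol a) := fun a => rfl
  have hlift : ∀ (e : ZMod 2) (x : R ⧸ I), j x = sg e • x →
      ∃ a, IsHomog e a ∧ Ideal.Quotient.mkₐ ℂ I a = x := by
    intro e x hx
    obtain ⟨a, rfl⟩ := Ideal.Quotient.mkₐ_surjective ℂ I x
    refine ⟨homogPart e a, isHomog_homogPart e a, ?_⟩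
    rw [homogPart, map_smul, map_add, map_smul, ← hj, hx, smul_smul, sg_mul_self, one_smul,
      ← two_smul ℂ, smul_smul]
    norm_num
  let S : SuperAlgebra (R ⧸ I) :=
    { invol := j
      invol_invol := fun x => by
        obtain ⟨a, rfl⟩ := Ideal.Quotient.mkₐ_surjective ℂ I x
        rw [hj, hj, SuperAlgebra.invol_invol]
      comm_even := fun x y hx => by
        obtain ⟨a, ha, rfl⟩ := hlift 0 x (by rw [hx, sg_zero, one_smul])
        obtain ⟨b, rfl⟩ := Ideal.Quotient.mkₐ_surjective ℂ I y
        rw [← map_mul, ← map_mul, ha.mul_comm', twist_zero]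
      comm_odd := fun x y hx => by
        obtain ⟨a, ha, rfl⟩ := hlift 1 x (by rw [hx, sg_one, neg_one_smul])
        obtain ⟨b, rfl⟩ := Ideal.Quotient.mkₐ_surjective ℂ I y
        rw [hj, ← map_mul, ← map_mul, ha.mul_comm', twist_one] }
  exact ⟨R ⧸ I, inferInstance, inferInstance, S, Ideal.Quotient.mkₐ ℂ I, fun a => rfl,
    fun x => Ideal.Quotient.eq_zero_iff_mem.trans (hmem x)⟩

end Quotient

/-! ### Even derivations -/

section Derivation

variable {R : Type} [Ring R] [Algebra ℂ R] [SuperAlgebra R] {V : Type} [Fintype V]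
  {q : V → ZMod 2} (𝒟 : SuperCalculus R q)

/-- The even derivation with coefficients `Y`. -/
def coeffDer (Y : V → R) : R →ₗ[ℂ] R := ∑ v, (LinearMap.mulRight ℂ (Y v)) ∘ₗ 𝒟.DR v

theorem coeffDer_apply (Y : V → R) (h : R) : coeffDer 𝒟 Y h = ∑ v, 𝒟.DR v h * Y v := by
  simp [coeffDer]

theorem coeffDer_mul {Y : V → R} (hY : ∀ v, IsHomog (q v) (Y v)) (f g : R) :
    coeffDer 𝒟 Y (f * g) = coeffDer 𝒟 Y f * g + f * coeffDer 𝒟 Y g := by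
  simp only [coeffDer_apply, sum_mul, mul_sum, ← sum_add_distrib]
  refine sum_congr rfl fun v _ => ?_
  rw [𝒟.DR_mul, add_mul, mul_assoc, mul_assoc, mul_assoc, (hY v).mul_comm' g, add_comm]

theorem coeffDer_invol {Y : V → R} (hY : ∀ v, IsHomog (q v) (Y v)) (f : R) :
    coeffDer 𝒟 Y (invol f) = invol (coeffDer 𝒟 Y f) := by
  simp only [coeffDer_apply, map_sum, map_mul]
  refine sum_congr rfl fun v _ => ?_
  rw [show invol (Y v) = _ from hY v, ← twist_one f, 𝒟.DR_twist, mul_one, smul_mul_assoc,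
    mul_smul_comm, twist_one]

theorem isHomog_coeffDer {Y : V → R} (hY : ∀ v, IsHomog (q v) (Y v)) {e : ZMod 2} {f : R}
    (hf : IsHomog e f) : IsHomog e (coeffDer 𝒟 Y f) := by
  have h : invol f = sg e • f := hf
  rw [IsHomog, ← coeffDer_invol 𝒟 hY, h, map_smul]

theorem coeffDer_DR {Y : V → R} (hY : ∀ v, IsHomog (q v) (Y v)) (u : V) (h : R) :
    coeffDer 𝒟 Y (𝒟.DR u h) = 𝒟.DR u (coeffDer 𝒟 Y h) - ∑ v, 𝒟.DR v h * 𝒟.DR u (Y v) := by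
  have := DR_rightDer 𝒟 (Y := Y) (s := 0) (fun v => by rw [add_zero]; exact hY v) u h
  rw [mul_zero, sg_zero, one_smul] at this
  rw [coeffDer_apply, coeffDer_apply]
  exact eq_sub_of_add_eq this.symm

theorem coeffDer_log {Y : V → R} {L a : R} (h : ∀ v, 𝒟.D v a = 𝒟.D v L * a)
    (ha : IsHomog 0 a) : coeffDer 𝒟 Y a = coeffDer 𝒟 Y L * a := by
  simp only [coeffDer_apply, sum_mul]
  refine sum_congr rfl fun v _ => ?_
  rw [𝒟.DR_apply, 𝒟.DR_apply, h, map_mul, ha.twist_eq, mul_zero, sg_zero, one_smul, mul_assoc,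
    mul_assoc, ha.mul_comm', twist_zero]

end Derivation

/-! ### Hamiltonian derivations -/

section Gamma

variable {R : Type} [Ring R] [Algebra ℂ R] [SuperAlgebra R]
  (𝒟 : SuperCalculus R (vPar N ε₀ ε₁))

/-- The derivatives along the zeroth-level coordinates. -/
def gammaCalculus : SuperCalculus R (gPar (N := N)) where
  D A := 𝒟.D (gVar A)
  D_mul A a b := by rw [𝒟.D_mul, vPar_gVar]
  D_invol A a := by rw [𝒟.D_invol, vPar_gVar]
  D_comm A B a := by rw [𝒟.D_comm, vPar_gVar, vPar_gVar]

theorem gammaCalculus_DR (A : Fin N ⊕ Fin N) (a : R) :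
    (gammaCalculus 𝒟).DR A a = 𝒟.DR (gVar A) a := by
  rw [SuperCalculus.DR_apply, SuperCalculus.DR_apply, vPar_gVar]; rfl

variable {z : R →ₐ[ℂ] R} {E : Fin N ⊕ Fin N → Fin N ⊕ Fin N → R} {r r' : R}

/-- The coefficients of the Hamiltonian derivation of `g τ`. -/
def hamVec (E : Fin N ⊕ Fin N → Fin N ⊕ Fin N → R) (g τ : R) (A : Fin N ⊕ Fin N) : R :=
  (∑ B, E A B * 𝒟.D (gVar B) g) * τ

/-- The derivation `(·, g τ)`. -/
def hamDer (E : Fin N ⊕ Fin N → Fin N ⊕ Fin N → R) (g τ : R) : R →ₗ[ℂ] R :=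
  coeffDer (gammaCalculus 𝒟) (hamVec 𝒟 E g τ)

theorem hamDer_apply (g τ f : R) : hamDer 𝒟 E g τ f = sbr 𝒟 E f g * τ := by
  simp only [hamDer, coeffDer_apply, gammaCalculus_DR, hamVec, sbr, sum_mul, mul_sum,
    mul_assoc]

theorem isHomog_hamVec (hE : IsBivector z E r r') {s : ZMod 2} {g τ : R} (hg : IsHomog s g)
    (hτ : IsHomog (s + 1) τ) (A : Fin N ⊕ Fin N) : IsHomog (gPar A) (hamVec 𝒟 E g τ A) := by
  have h : IsHomog (gPar A + 1 + s) (∑ B, E A B * 𝒟.D (gVar B) g) := IsHomog.sum fun B _ =>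
    (hE.homog A B).mul_of_eq (𝒟.isHomog_D hg _) (by
      rw [vPar_gVar]
      generalize gPar A = a; generalize gPar B = b; clear * -; decide +revert)
  refine h.mul_of_eq hτ ?_
  generalize gPar A = a; clear * -; decide +revert

theorem isHomog_sbr (hE : IsBivector z E r r') {s t : ZMod 2} {f g : R} (hf : IsHomog s f)
    (hg : IsHomog t g) : IsHomog (s + t + 1) (sbr 𝒟 E f g) :=
  IsHomog.sum fun A _ => IsHomog.sum fun B _ =>
    ((𝒟.isHomog_DR hf _).mul (hE.homog A B)).mul_of_eq (𝒟.isHomog_D hg _) (by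
      rw [vPar_gVar, vPar_gVar]
      generalize gPar A = a; generalize gPar B = b; clear * -; decide +revert)

theorem sbr_neg_right (f g : R) : sbr 𝒟 E f (-g) = -sbr 𝒟 E f g := by
  simp only [sbr, map_neg, mul_neg, sum_neg_distrib]

theorem sbr_smul_right (c : ℂ) (f g : R) : sbr 𝒟 E f (c • g) = c • sbr 𝒟 E f g := by
  simp only [sbr, map_smul, mul_smul_comm, smul_sum]

theorem sbr_mul_right {τ : R} (hτ : ∀ A, 𝒟.D (gVar A) τ = 0) (f g : R) :
    sbr 𝒟 E f (g * τ) = sbr 𝒟 E f g * τ := by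
  simp only [sbr, sum_mul]
  refine sum_congr rfl fun A _ => sum_congr rfl fun B _ => ?_
  rw [𝒟.D_mul, hτ, mul_zero, add_zero, ← mul_assoc]

theorem sbr_mul_left (hE : IsBivector z E r r') {τ : R} (hτ : ∀ A, 𝒟.D (gVar A) τ = 0) {s t : ZMod 2}
    (hs : IsHomog s τ) (f : R) {g : R} (hg : IsHomog t g) :
    sbr 𝒟 E (f * τ) g = sg (s * (t + 1)) • (sbr 𝒟 E f g * τ) := by
  simp only [sbr, sum_mul, smul_sum]
  refine sum_congr rfl fun A _ => sum_congr rfl fun B _ => ?_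
  have h1 := 𝒟.isHomog_D hg (gVar B)
  rw [vPar_gVar] at h1
  rw [𝒟.DR_mul, 𝒟.DR_apply _ τ, hτ, map_zero, mul_zero, zero_add, hs.twist_eq, vPar_gVar]
  simp only [mul_smul_comm, smul_mul_assoc, mul_assoc]
  rw [hs.mul_comm ((hE.homog A B).mul h1), mul_smul_comm, smul_smul, ← sg_add, mul_assoc]
  congr 2
  generalize gPar A = a; generalize gPar B = b; clear * -; decide +revert

/-- A Hamiltonian derivation is a derivation of the antibracket. -/
theorem hamDer_sbr (hE : IsBivector z E r r') {e₁ e₂ e₃ : ZMod 2} {f g h τ : R}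
    (hf : IsHomog e₁ f) (hg : IsHomog e₂ g) (hh : IsHomog e₃ h) (hτ : ∀ A, 𝒟.D (gVar A) τ = 0)
    (hs : IsHomog (e₃ + 1) τ)
    (hJ : sg ((e₁ + 1) * (e₃ + 1)) • sbr 𝒟 E f (sbr 𝒟 E g h) +
      sg ((e₂ + 1) * (e₁ + 1)) • sbr 𝒟 E g (sbr 𝒟 E h f) +
      sg ((e₃ + 1) * (e₂ + 1)) • sbr 𝒟 E h (sbr 𝒟 E f g) = 0) :
    hamDer 𝒟 E h τ (sbr 𝒟 E f g) =
      sbr 𝒟 E (hamDer 𝒟 E h τ f) g + sbr 𝒟 E f (hamDer 𝒟 E h τ g) := by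
  rw [hamDer_apply, hamDer_apply, hamDer_apply, sbr_mul_right 𝒟 hτ,
    sbr_mul_left 𝒟 hE hτ hs _ hg, ← smul_mul_assoc, ← add_mul]
  congr 1
  have hfh := isHomog_sbr 𝒟 hE hf hh
  have hfg := isHomog_sbr 𝒟 hE hf hg
  have hgf := isHomog_sbr 𝒟 hE hfh hg
  rw [sbr_comm 𝒟 hE hh hf, sbr_comm 𝒟 hE hh hfg, sbr_neg_right, sbr_smul_right,
    sbr_comm 𝒟 hE hg hfh] at hJ
  have h1 := congrArg (fun x => sg ((e₁ + 1) * (e₃ + 1)) • x) hJ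
  simp only [smul_add, smul_neg, neg_neg, smul_smul, ← sg_add, smul_zero] at h1
  generalize sbr 𝒟 E f (sbr 𝒟 E g h) = x at h1 ⊢
  generalize sbr 𝒟 E (sbr 𝒟 E f h) g = y at h1 ⊢
  generalize sbr 𝒟 E (sbr 𝒟 E f g) h = w at h1 ⊢
  clear * - h1
  have h2 : sg ((e₃ + 1) * (e₂ + 1)) • y + x - w = 0 := by
    rw [← h1, show (e₁ + 1) * (e₃ + 1) + (e₁ + 1) * (e₃ + 1) = 0 from CharTwo.add_self_eq_zero _,
      sg_zero, one_smul, ← sub_eq_add_neg, add_comm x]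
    rcases zmod2_cases e₁ with rfl | rfl <;> rcases zmod2_cases e₂ with rfl | rfl <;>
    rcases zmod2_cases e₃ with rfl | rfl <;> simp [sg, CharTwo.add_self_eq_zero]
  rw [← sub_eq_zero, ← neg_eq_zero, neg_sub]
  exact h2

/-- The Laplacian as a divergence. -/
theorem two_smul_slap (hE : IsBivector z E r r') {s : ZMod 2} {g τ : R} (hg : IsHomog s g)
    (hτ : ∀ A, 𝒟.D (gVar A) τ = 0) (hs : IsHomog (s + 1) τ) :
    (2 : ℂ) • (slap 𝒟 E r r' g * τ) = r' * hamDer 𝒟 E g τ r +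
      str gPar (Matrix.of fun B A => 𝒟.DR (gVar A) (hamVec 𝒟 E g τ B)) := by
  have h1 : ∀ A, ∑ B, (sg (gPar A) / 2) • (r' * 𝒟.D (gVar A) (r * E A B * 𝒟.D (gVar B) g)) * τ =
      (1 / 2 : ℂ) • (sg (gPar A) • (r' * 𝒟.D (gVar A) (r * hamVec 𝒟 E g τ A))) := by
    intro A
    rw [← sum_mul, ← smul_sum, ← mul_sum, ← map_sum, hamVec, ← mul_assoc r,
      𝒟.D_mul (gVar A) (r * _) τ, hτ, mul_zero, add_zero, mul_sum, smul_smul, smul_mul_assoc,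
      mul_assoc r']
    simp only [mul_assoc]
    congr 1
    ring
  rw [slap_apply, sum_mul, smul_sum]
  simp only [sum_mul] at h1 ⊢
  rw [sum_congr rfl fun A _ => congrArg (fun x => (2 : ℂ) • x) (h1 A), str, hamDer,
    coeffDer_apply, mul_sum, ← sum_add_distrib]
  refine sum_congr rfl fun A _ => ?_
  have hy := isHomog_hamVec 𝒟 hE hg hs A
  have h2 := 𝒟.DR_eq hy (gVar A)
  rw [vPar_gVar, CharTwo.add_self_eq_zero, mul_zero, sg_zero, one_smul] at h2
  have h3 := 𝒟.DR_eq hE.density_homog (gVar A)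
  rw [vPar_gVar, zero_add, zmod_mul_self] at h3
  rw [of_apply, h2, gammaCalculus_DR, h3, smul_smul, 𝒟.D_mul, vPar_gVar,
    hE.density_homog.twist_eq, mul_zero, sg_zero, one_smul, mul_add, ← mul_assoc r' r,
    hE.inverse_mul, one_mul, smul_add, smul_add, smul_mul_assoc, mul_smul_comm, smul_smul,
    smul_smul]
  norm_num

end Gamma

/-! ### The logarithmic derivative of the radicand -/

section Hom

variable {R Q : Type} [Ring R] [Algebra ℂ R] [SuperAlgebra R] [Ring Q] [Algebra ℂ Q]
  [SuperAlgebra Q] (φ : R →ₐ[ℂ] Q) {l m n : Type} [Fintype l] [Fintype m] [Fintype n]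
  {p : l → ZMod 2} {q : m → ZMod 2}

theorem IsHomog.map_hom (hφ : ∀ a, invol (φ a) = φ (invol a)) {e : ZMod 2} {a : R}
    (h : IsHomog e a) : IsHomog e (φ a) := by
  have h1 : invol a = sg e • a := h
  rw [IsHomog, hφ, h1, map_smul]

theorem map_str (K : Matrix l l R) : φ (str p K) = str p (K.map φ) := by
  simp only [str, map_sum, map_smul, map_apply]

theorem map_supT (K : Matrix l m R) : (supT p q K).map φ = supT p q (K.map φ) := by
  ext i j
  simp only [supT, map_apply, of_apply, map_smul]

theorem map_matrix_mul (K : Matrix l m R) (L : Matrix m n R) :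
    (K * L).map φ = K.map φ * L.map φ := Matrix.map_mul

theorem IsMat.map_hom (hφ : ∀ a, invol (φ a) = φ (invol a)) {s : ZMod 2} {K : Matrix l m R}
    (hK : IsMat s p q K) : IsMat s p q (K.map φ) := fun i j => (hK i j).map_hom φ hφ

end Hom

section Core

variable {R : Type} [Ring R] [Algebra ℂ R] [SuperAlgebra R]
  (𝒟 : SuperCalculus R (vPar N ε₀ ε₁))

/-- The matrix of derivatives along the zeroth-level coordinates. -/
def jac₀ {m : Type} (F : m → R) : Matrix m (Fin N ⊕ Fin N) R :=
  Matrix.of fun a A => 𝒟.DR (gVar A) (F a)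

/-- The Jacobian matrix at `π = π* = 0`. -/
def jacExt (F G : Fin N₀ → R) (Fp Fs : Matrix (Fin N₀) (Fin N₁) R)
    (ω : Matrix (Fin N₁) (Fin N₀) R) :
    Matrix (Fin N₀ ⊕ Fin N₀) ((Fin N ⊕ Fin N) ⊕ (Fin N₁ ⊕ Fin N₁)) R :=
  Matrix.fromBlocks (jac₀ 𝒟 F) (Matrix.fromCols Fp Fs) (jac₀ 𝒟 G)
    (Matrix.fromCols (supT ε₁ ε₀ ω) 0)

/-- The matrix of antibrackets at `π = π* = 0`. -/
def brMat (E : Fin N ⊕ Fin N → Fin N ⊕ Fin N → R) (F G : Fin N₀ → R)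
    (Fs : Matrix (Fin N₀) (Fin N₁) R) (ω : Matrix (Fin N₁) (Fin N₀) R) :
    Matrix (Fin N₀) (Fin N₀) R :=
  Matrix.of (fun a g => sbr 𝒟 E (F a) (G g)) - Fs * ω

/-- The Hamiltonian vector fields of the constraints. -/
def eMat (E : Fin N ⊕ Fin N → Fin N ⊕ Fin N → R) (G : Fin N₀ → R) :
    Matrix (Fin N ⊕ Fin N) (Fin N₀) R :=
  Matrix.of fun A g => ∑ B, E A B * 𝒟.D (gVar B) (G g)

theorem jac₀_mul_eMat (E : Fin N ⊕ Fin N → Fin N ⊕ Fin N → R) {m : Type} (F : m → R)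
    (G : Fin N₀ → R) : jac₀ 𝒟 F * eMat 𝒟 E G = Matrix.of fun a g => sbr 𝒟 E (F a) (G g) := by
  ext a g
  simp only [jac₀, eMat, Matrix.mul_apply, of_apply, sbr, mul_sum, mul_assoc]

variable {z : R →ₐ[ℂ] R} {E : Fin N ⊕ Fin N → Fin N ⊕ Fin N → R} {r r' : R}
variable {Q : Type} [Ring Q] [Algebra ℂ Q] [SuperAlgebra Q] {φ : R →ₐ[ℂ] Q}
variable {F G : Fin N₀ → R} {Fp Fs : Matrix (Fin N₀) (Fin N₁) R} {ω : Matrix (Fin N₁) (Fin N₀) R}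
  {Z : Matrix (Fin N₀) (Fin N₁) R}

theorem isMat_jac₀ {m : Type} {q : m → ZMod 2} {s : ZMod 2} {F : m → R}
    (hF : ∀ a, IsHomog (q a + s) (F a)) : IsMat s q gPar (jac₀ 𝒟 F) := fun a A => by
  have := 𝒟.isHomog_DR (hF a) (gVar A)
  rw [vPar_gVar] at this
  rwa [add_right_comm]

theorem isMat_eMat (hE : IsBivector z E r r') (hG : ∀ a, IsHomog (ε₀ a) (G a)) :
    IsMat 1 gPar ε₀ (eMat 𝒟 E G) := fun A a => by
  change IsHomog (gPar A + ε₀ a + 1) (∑ B, E A B * 𝒟.D (gVar B) (G a))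
  refine IsHomog.sum fun B _ => (hE.homog A B).mul_of_eq (𝒟.isHomog_D (hG a) (gVar B)) ?_
  rw [vPar_gVar]
  generalize gPar A = a; generalize gPar B = b; generalize ε₀ _ = c; clear * -
  decide +revert

/-- Supertransposed form of the derivative of a sum of products with constraints. -/
theorem map_DR_sum_constraint (hφG : ∀ a, φ (G a) = 0) (hG : ∀ a, IsHomog (ε₀ a) (G a))
    {n : Type} {t : n → ZMod 2} {K : Matrix (Fin N₀) n R} (hK : IsMat 0 ε₀ t K) (A : Fin N ⊕ Fin N)
    (k : n) : φ (𝒟.DR (gVar A) (∑ a, G a * K a k)) = φ ((supT ε₀ t K * jac₀ 𝒟 G) k A) := by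
  simp only [map_sum, Matrix.mul_apply]
  refine sum_congr rfl fun a _ => ?_
  have h1 := 𝒟.isHomog_DR (hG a) (gVar A)
  have h2 := hK a k
  rw [vPar_gVar] at h1
  rw [𝒟.DR_mul, map_add, map_mul, hφG, zero_mul, zero_add, vPar_gVar, h2.twist_eq, supT,
    of_apply, jac₀, of_apply, mul_smul_comm, smul_mul_assoc, h1.mul_comm h2,
    smul_smul, ← sg_add]
  congr 3
  generalize gPar A = a; generalize ε₀ _ = b; generalize t _ = c; clear * -; decide +revert

theorem map_D_sum_constraint (hφG : ∀ a, φ (G a) = 0)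
    (hφ : ∀ a, invol (φ a) = φ (invol a)) {f : R} {k : Fin N₀ → R} (h : f = ∑ a, G a * k a)
    (v : Fin N ⊕ Fld N N₀ N₁) :
    φ (𝒟.D v f) = ∑ a, φ (𝒟.D v (G a)) * φ (k a) := by
  rw [h]
  simp only [map_sum]
  refine sum_congr rfl fun a _ => ?_
  have : φ (twist (vPar N ε₀ ε₁ v) (G a)) = 0 := by
    rcases zmod2_cases (vPar N ε₀ ε₁ v) with h | h <;> rw [h]
    · rw [twist_zero, hφG]
    · rw [twist_one, ← hφ, hφG, map_zero]
  rw [𝒟.D_mul, map_add, map_mul, map_mul, this, zero_mul, add_zero]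

/-- The supertraces in the logarithmic derivative of the radicand. -/
theorem str_radicand (hE : IsBivector z E r r') (hG : ∀ a, IsHomog (ε₀ a) (G a))
    (hF : ∀ a, IsHomog (ε₀ a + 1) (F a)) (hFs : IsMat 0 ε₀ ε₁ Fs) (hω : IsMat 0 ε₁ ε₀ ω)
    (hZ : IsMat 0 ε₀ ε₁ Z) (hGZ : ∀ k, ∑ a, G a * Z a k = 0)
    (hφ : ∀ a, invol (φ a) = φ (invol a)) (hφG : ∀ a, φ (G a) = 0)
    (hGG : ∀ a g, φ (sbr 𝒟 E (G a) (G g)) = 0)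
    {b : Fin N₀} {τ : R} (hτ : ∀ A, 𝒟.D (gVar A) τ = 0) (hs : IsHomog (ε₀ b + 1) τ)
    (hJ : ∀ a g, sg ((ε₀ a + 1 + 1) * (ε₀ b + 1)) • sbr 𝒟 E (F a) (sbr 𝒟 E (G g) (G b)) +
      sg ((ε₀ g + 1) * (ε₀ a + 1 + 1)) • sbr 𝒟 E (G g) (sbr 𝒟 E (G b) (F a)) +
      sg ((ε₀ b + 1) * (ε₀ g + 1)) • sbr 𝒟 E (G b) (sbr 𝒟 E (F a) (G g)) = 0)
    {U : Matrix (Fin N₀) (Fin N₀) R} {W : Matrix (Fin N₁) (Fin N₁) R} (hU : IsMat 0 ε₀ ε₀ U)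
    (hXG : ∀ a, hamDer 𝒟 E (G b) τ (G a) = ∑ g, G g * U g a)
    (hXZ : (Z.map (hamDer 𝒟 E (G b) τ)).map φ = (-(U * Z) - Z * W).map φ)
    {J' : Matrix ((Fin N ⊕ Fin N) ⊕ (Fin N₁ ⊕ Fin N₁)) (Fin N₀ ⊕ Fin N₀) R}
    (hJ1 : jacExt 𝒟 F G Fp Fs ω * J' = 1) (hJ2 : J' * jacExt 𝒟 F G Fp Fs ω = 1)
    (hJ' : ∀ v s, IsHomog (extPar ε₁ v + newPar ε₀ s) (J' v s))
    {Ni : Matrix (Fin N₀) (Fin N₀) R} (hN1 : brMat 𝒟 E F G Fs ω * Ni = 1)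
    (hN2 : Ni * brMat 𝒟 E F G Fs ω = 1)
    {Di : Matrix (Fin N₁) (Fin N₁) R} (hD1 : ω * Z * Di = 1) (hD2 : Di * (ω * Z) = 1) :
    φ (str (extPar ε₁) (J' * (jacExt 𝒟 F G Fp Fs ω).map (hamDer 𝒟 E (G b) τ)) +
      str ε₀ (Ni * (brMat 𝒟 E F G Fs ω).map (hamDer 𝒟 E (G b) τ)) -
      (2 : ℂ) • str ε₁ (Di * (ω * Z).map (hamDer 𝒟 E (G b) τ))) =
    φ (-str gPar (Matrix.of fun B A => 𝒟.DR (gVar A) (hamVec 𝒟 E (G b) τ B)) +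
      (2 : ℂ) • str ε₀ U + (2 : ℂ) • str ε₁ W) := by
  set X := hamDer 𝒟 E (G b) τ with hX
  set N' := brMat 𝒟 E F G Fs ω with hN'
  set X' : Matrix (Fin N ⊕ Fin N) (Fin N ⊕ Fin N) R :=
    Matrix.of fun B A => 𝒟.DR (gVar A) (hamVec 𝒟 E (G b) τ B) with hX'
  have hy := isHomog_hamVec 𝒟 hE (hG b) hs
  have hXm : ∀ f g, X (f * g) = X f * g + f * X g := coeffDer_mul _ hy
  have hXmm : ∀ {i j k : Type} [Fintype j] (K : Matrix i j R) (L : Matrix j k R),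
      (K * L).map X = K.map X * L + K * L.map X := fun K L =>
    map_derivation_mul X.toAddMonoidHom hXm K L
  have hXh : ∀ {e : ZMod 2} {f : R}, IsHomog e f → IsHomog e (X f) := fun h =>
    isHomog_coeffDer _ hy h
  have hXJ : ∀ h : Fin N₀ → R, (jac₀ 𝒟 h).map X = jac₀ 𝒟 (fun a => X (h a)) - jac₀ 𝒟 h * X' := by
    intro h
    ext a A
    have := coeffDer_DR (gammaCalculus 𝒟) hy A (h a)
    simp only [gammaCalculus_DR] at this
    rw [map_apply, jac₀, of_apply, hX, hamDer, this]
    rfl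
  set F₀ := jac₀ 𝒟 F with hF₀
  set K := jac₀ 𝒟 (fun a => X (F a)) with hK
  set Gm := jac₀ 𝒟 G with hGm
  set em := eMat 𝒟 E G with hem
  set Az : Matrix (Fin N ⊕ Fin N) (Fin N₀) R := J'.submatrix .inl .inl
  set Bz : Matrix (Fin N ⊕ Fin N) (Fin N₀) R := J'.submatrix .inl .inr
  set Ap : Matrix (Fin N₁) (Fin N₀) R := J'.submatrix (.inr ∘ .inl) .inl
  set Bp : Matrix (Fin N₁) (Fin N₀) R := J'.submatrix (.inr ∘ .inl) .inr
  set As : Matrix (Fin N₁) (Fin N₀) R := J'.submatrix (.inr ∘ .inr) .inl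
  set Bs : Matrix (Fin N₁) (Fin N₀) R := J'.submatrix (.inr ∘ .inr) .inr
  -- block form of the inverse
  have b1 : Az * F₀ + Bz * Gm = 1 := by
    ext A B
    have := congrFun (congrFun hJ2 (.inl A)) (.inl B)
    simp [Matrix.mul_apply, jacExt, Matrix.one_apply] at this ⊢
    exact this
  have b2 : Az * Fs = 0 := by
    ext A k
    have := congrFun (congrFun hJ2 (.inl A)) (.inr (.inr k))
    simp [Matrix.mul_apply, jacExt] at this ⊢
    exact this
  have b3 : Ap * F₀ + Bp * Gm = 0 := by
    ext A B
    have := congrFun (congrFun hJ2 (.inr (.inl A))) (.inl B)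
    simp [Matrix.mul_apply, jacExt] at this ⊢
    exact this
  have b4 : Ap * Fs = 0 := by
    ext A k
    have := congrFun (congrFun hJ2 (.inr (.inl A))) (.inr (.inr k))
    simp [Matrix.mul_apply, jacExt] at this ⊢
    exact this
  have b5 : As * F₀ + Bs * Gm = 0 := by
    ext A B
    have := congrFun (congrFun hJ2 (.inr (.inr A))) (.inl B)
    simp [Matrix.mul_apply, jacExt] at this ⊢
    exact this
  have b6 : As * Fs = 1 := by
    ext A k
    have := congrFun (congrFun hJ2 (.inr (.inr A))) (.inr (.inr k))
    simp [Matrix.mul_apply, jacExt, Matrix.one_apply] at this ⊢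
    exact this
  have b7 : Gm * Bz + supT ε₁ ε₀ ω * Bp = 1 := by
    ext A B
    have := congrFun (congrFun hJ1 (.inr A)) (.inr B)
    simp [Matrix.mul_apply, jacExt, Matrix.one_apply] at this ⊢
    exact this
  have hstr : str (extPar ε₁) (J' * (jacExt 𝒟 F G Fp Fs ω).map X) =
      str gPar (Az * F₀.map X + Bz * Gm.map X) +
      str ε₁ (Ap * Fp.map X + Bp * (supT ε₁ ε₀ ω).map X) - str ε₁ (As * Fs.map X) := by
    have hsg : ∀ x : ZMod 2, sg (x + 1) = -sg x := fun x => by rw [sg_add, sg_one, mul_neg_one]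
    simp [str, Matrix.mul_apply, Fintype.sum_sum_type, jacExt, extPar, hsg, sub_eq_add_neg,
      add_assoc]
    rfl
  -- the congruences
  have hGe : (Gm * em).map φ = 0 := by
    rw [hGm, hem, jac₀_mul_eMat]
    ext a g
    exact hGG a g
  have hNe : N' = F₀ * em - Fs * ω := by rw [hN', brMat, hF₀, hem, jac₀_mul_eMat]
  have cz : (Az * N').map φ = em.map φ := by
    have : Az * N' = em - Bz * (Gm * em) := by
      rw [hNe, Matrix.mul_sub, ← Matrix.mul_assoc, ← Matrix.mul_assoc, b2, Matrix.zero_mul,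
        sub_zero, eq_sub_of_add_eq b1, Matrix.sub_mul, Matrix.one_mul, Matrix.mul_assoc]
    rw [this, Matrix.map_sub _ (map_sub φ), map_matrix_mul, hGe, Matrix.mul_zero, sub_zero]
  have cp : (Ap * N').map φ = 0 := by
    have : Ap * N' = -(Bp * (Gm * em)) := by
      rw [hNe, Matrix.mul_sub, ← Matrix.mul_assoc, ← Matrix.mul_assoc, b4, Matrix.zero_mul,
        sub_zero, eq_neg_of_add_eq_zero_left b3, Matrix.neg_mul, Matrix.mul_assoc]
    rw [this, Matrix.map_neg _ (map_neg φ), map_matrix_mul, hGe, Matrix.mul_zero, neg_zero]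
  have cs : (As * N').map φ = -ω.map φ := by
    have : As * N' = -(Bs * (Gm * em)) - ω := by
      rw [hNe, Matrix.mul_sub, ← Matrix.mul_assoc, ← Matrix.mul_assoc, b6, Matrix.one_mul,
        eq_neg_of_add_eq_zero_left b5, Matrix.neg_mul, Matrix.mul_assoc]
    rw [this, Matrix.map_sub _ (map_sub φ), Matrix.map_neg _ (map_neg φ), map_matrix_mul, hGe,
      Matrix.mul_zero, neg_zero, zero_sub]
  have ceZ : (em * Z).map φ = 0 := by
    ext A k
    have h1 : ∀ B, ∑ a, φ (𝒟.D (gVar B) (G a)) * φ (Z a k) = 0 := fun B => by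
      rw [← map_D_sum_constraint 𝒟 hφG hφ (hGZ k).symm, map_zero, map_zero]
    simp only [map_apply, Matrix.mul_apply, hem, eMat, of_apply, sum_mul,
      map_sum, map_mul, Matrix.zero_apply]
    rw [sum_comm]
    refine sum_eq_zero fun B _ => ?_
    simp only [mul_assoc]
    rw [← mul_sum, h1, mul_zero]
  have cZG : (supT ε₀ ε₁ Z * Gm).map φ = 0 := by
    ext k A
    rw [map_apply, hGm, ← map_DR_sum_constraint 𝒟 hφG hG hZ, hGZ, map_zero, map_zero]
    rfl
  have cXG : (Gm.map X).map φ = (supT ε₀ ε₀ U * Gm - Gm * X').map φ := by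
    rw [hGm, hXJ, Matrix.map_sub _ (map_sub φ), Matrix.map_sub _ (map_sub φ)]
    congr 1
    ext a A
    rw [map_apply, jac₀, of_apply, hXG, map_DR_sum_constraint 𝒟 hφG hG hU]
    rfl
  have cXN : (N'.map X).map φ = (K * em + F₀ * em * U - Fs.map X * ω - Fs * ω.map X).map φ := by
    rw [hN', brMat, Matrix.map_sub _ (map_sub X), hXmm,
      ← sub_sub, Matrix.map_sub _ (map_sub φ), Matrix.map_sub _ (map_sub φ),
      Matrix.map_sub _ (map_sub φ), Matrix.map_sub _ (map_sub φ)]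
    congr 2
    ext a g
    rw [map_apply, map_apply, of_apply,
      hamDer_sbr 𝒟 hE (hF a) (hG g) (hG b) hτ hs (hJ a g), map_add, hK, hem, jac₀_mul_eMat,
      hF₀, map_apply, Matrix.add_apply, map_add, of_apply]
    congr 1
    simp only [Matrix.mul_apply, jac₀, eMat, of_apply, sbr, map_sum, map_mul]
    change (∑ A, ∑ B, φ (𝒟.DR (gVar A) (F a)) * φ (E A B) * φ (𝒟.D (gVar B) (X (G g)))) = _
    simp only [map_D_sum_constraint 𝒟 hφG hφ (hXG g), mul_sum, sum_mul, mul_assoc]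
    rw [sum_congr rfl fun A _ => sum_comm, sum_comm]
  have cXD : ((ω * Z).map X).map φ = (ω.map X * Z).map φ + (ω * (-(U * Z) - Z * W)).map φ := by
    rw [hXmm, Matrix.map_add _ (map_add φ), map_matrix_mul φ ω, hXZ, ← map_matrix_mul]
  have hAll : IsMat 0 ε₀ ε₀ N' := fun a g => by
    rw [hN', brMat, Matrix.sub_apply]
    have h1 := isHomog_sbr 𝒟 hE (hF a) (hG g)
    rw [show ε₀ a + 1 + ε₀ g + 1 = ε₀ a + ε₀ g + 0 by
      generalize ε₀ a = a; generalize ε₀ g = g; clear * -; decide +revert] at h1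
    exact h1.sub (hFs.mul_of_eq hω (add_zero 0) a g)
  have hNi : IsMat 0 ε₀ ε₀ Ni := hAll.of_inverse hN1 hN2
  have hDi : IsMat 0 ε₁ ε₁ Di := IsMat.of_inverse (hω.mul_of_eq hZ (add_zero 0)) hD1 hD2
  have hBzm : IsMat 0 gPar ε₀ Bz := fun A a => by
    rw [add_zero]; exact hJ' (.inl A) (.inr a)
  have hGmm : IsMat 0 ε₀ gPar Gm := isMat_jac₀ 𝒟 fun a => by rw [add_zero]; exact hG a
  have hKm : IsMat 1 ε₀ gPar K := isMat_jac₀ 𝒟 fun a => hXh (hF a)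
  have hdFs : IsMat 0 ε₀ ε₁ (Fs.map X) := fun i j => hXh (hFs i j)
  have hdω : IsMat 0 ε₁ ε₀ (ω.map X) := fun i j => hXh (hω i j)
  have hone : ∀ {l : Type} [DecidableEq l], (1 : Matrix l l R).map φ = 1 :=
    Matrix.map_one _ (map_zero _) (map_one _)
  have key := str_identity (R := Q) (F₀ := F₀.map φ) (K := K.map φ)
    (dFp := (Fp.map X).map φ) (Fs := Fs.map φ) (dFs := (Fs.map X).map φ) (G := Gm.map φ)
    (ω := ω.map φ) (dω := (ω.map X).map φ) (e := em.map φ) (Z := Z.map φ) (N := N'.map φ)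
    (Ni := Ni.map φ) (Az := Az.map φ) (Ap := Ap.map φ) (As := As.map φ) (Bz := Bz.map φ)
    (Bp := Bp.map φ) (D := (ω * Z).map φ) (Di := Di.map φ) (W := W.map φ) (X' := X'.map φ)
    (U := U.map φ) (hKm.map_hom φ hφ) (hdFs.map_hom φ hφ) (hGmm.map_hom φ hφ)
    (hω.map_hom φ hφ) (hdω.map_hom φ hφ) ((isMat_eMat 𝒟 hE hG).map_hom φ hφ)
    (hZ.map_hom φ hφ) (hNi.map_hom φ hφ) (hDi.map_hom φ hφ) (hBzm.map_hom φ hφ)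
    (hU.map_hom φ hφ)
    (by rw [← map_matrix_mul, ← map_matrix_mul, ← Matrix.map_add _ (map_add φ), b1, hone])
    (by rw [← map_matrix_mul, cz]) (by rw [← map_matrix_mul, cp]) (by rw [← map_matrix_mul, cs])
    (by rw [← map_supT, ← map_matrix_mul, ← map_matrix_mul, ← Matrix.map_add _ (map_add φ), b7,
          hone])
    (by rw [hNe, Matrix.map_sub _ (map_sub φ), map_matrix_mul, map_matrix_mul])
    (by rw [← map_matrix_mul, hN1, hone]) (by rw [← map_matrix_mul, hN2, hone])
    (by rw [map_matrix_mul])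
    (by rw [← map_matrix_mul, hD1, hone]) (by rw [← map_matrix_mul, hD2, hone])
    (by rw [← map_matrix_mul, ceZ]) (by rw [← map_supT, ← map_matrix_mul, cZG])
  rw [hstr, hXJ F]
  have hsX : (supT ε₁ ε₀ ω).map X = supT ε₁ ε₀ (ω.map X) := by
    ext i j
    simp only [supT, map_apply, of_apply, map_smul]
  simp only [map_add, map_sub, map_neg, map_smul, map_str, map_matrix_mul, Matrix.map_add _ (map_add φ),
    Matrix.map_sub _ (map_sub φ), cXG, cXN, cXD, hsX, map_supT, Matrix.map_neg _ (map_neg φ)] at key ⊢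
  exact key

/-- `a` is even with logarithmic derivative `α`. -/
structure IsLogDer (X : R →ₗ[ℂ] R) (a α : R) : Prop where
  even : IsHomog 0 a
  eq : X a = a * α

theorem IsHomog.central {a : R} (h : IsHomog 0 a) (b : R) : a * b = b * a := by
  rw [h.mul_comm', twist_zero]

theorem IsLogDer.mul {X : R →ₗ[ℂ] R} (hX : ∀ f g, X (f * g) = X f * g + f * X g) {a b α β : R}
    (ha : IsLogDer X a α) (hb : IsLogDer X b β) : IsLogDer X (a * b) (α + β) where
  even := ha.even.mul_of_eq hb.even (add_zero 0)
  eq := by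
    rw [hX, ha.eq, hb.eq, mul_add, mul_assoc, ← hb.even.central α]
    simp only [mul_assoc]

theorem IsHomog.of_mul_eq_one {a a' : R} (ha : IsHomog 0 a) (h : a * a' = 1) : IsHomog 0 a' := by
  have h1 : a * invol a' = 1 := by
    rw [← isHomog_zero_iff.1 ha, ← map_mul, h, map_one]
  have h2 : a' * a = 1 := by rw [← ha.central, h]
  rw [isHomog_zero_iff, ← one_mul (invol a'), ← h2, mul_assoc, h1, mul_one]

theorem IsLogDer.inverse {X : R →ₗ[ℂ] R} (hX : ∀ f g, X (f * g) = X f * g + f * X g) {a a' α : R}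
    (ha : IsLogDer X a α) (h : a * a' = 1) : IsLogDer X a' (-α) where
  even := ha.even.of_mul_eq_one h
  eq := by
    have ha' := ha.even.of_mul_eq_one h
    have h2 : a' * a = 1 := by rw [← ha.even.central, h]
    have hX1 : X 1 = 0 := map_one_of_leibniz X.toAddMonoidHom hX
    have h3 := congrArg (a' * ·) (hX a a')
    simp only [h, hX1, ha.eq, mul_zero, mul_add, ← mul_assoc, h2, one_mul] at h3
    rw [eq_neg_of_add_eq_zero_right h3.symm, mul_neg, ha'.central]

theorem IsLogDer.sdet {X : R →ₗ[ℂ] R} (hX : ∀ f g, X (f * g) = X f * g + f * X g)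
    (hXi : ∀ a, X (invol a) = invol (X a)) {ι : Type} [Fintype ι] [DecidableEq ι]
    {e : ι → ZMod 2} {M M' : Matrix ι ι R} (hM : IsMat 0 e e M) (h : M * M' = 1) (h' : M' * M = 1)
    (hD : IsUnit (evenBlock hM 1).det) : IsLogDer X (sdet e M) (str e (M' * M.map X)) where
  even := isHomog_sdet hM hD
  eq := derivation_sdet X.toAddMonoidHom hX hXi hM h h' hD

/-- On shell, the correction `H` is minus the logarithm `L` of the square root of the radicand. -/
theorem map_hamDer_radicand {X : R →ₗ[ℂ] R} (hX : ∀ f g, X (f * g) = X f * g + f * X g)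
    (hXi : ∀ a, X (invol a) = invol (X a)) {e : Fin N₀ ⊕ Fin N₀ ≃ (Fin N ⊕ Fin N) ⊕ (Fin N₁ ⊕ Fin N₁)}
    (he : ∀ r, extPar ε₁ (e r) = newPar ε₀ r)
    {J : Matrix (Fin N₀ ⊕ Fin N₀) ((Fin N ⊕ Fin N) ⊕ (Fin N₁ ⊕ Fin N₁)) R}
    {J' : Matrix ((Fin N ⊕ Fin N) ⊕ (Fin N₁ ⊕ Fin N₁)) (Fin N₀ ⊕ Fin N₀) R}
    {K Ni : Matrix (Fin N₀) (Fin N₀) R} {D Di : Matrix (Fin N₁) (Fin N₁) R}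
    (hJ : IsMat 0 (newPar ε₀) (newPar ε₀) (J.submatrix id e)) (hK : IsMat 0 ε₀ ε₀ K)
    (hD : IsMat 0 ε₁ ε₁ D) (hJu : IsUnit (evenBlock hJ 1).det) (hKu : IsUnit (evenBlock hK 1).det)
    (hDu : IsUnit (evenBlock hD 1).det)
    (hJ1 : J * J' = 1) (hJ2 : J' * J = 1) (hN1 : K * Ni = 1) (hN2 : Ni * K = 1)
    (hD1 : D * Di = 1) (hD2 : Di * D = 1) (hr : IsHomog 0 r) (hrr : r' * r = 1) {s L : R}
    (hs : r * BV.sdet ε₁ D ^ 2 * s = 1)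
    (hu : IsUnit (BV.sdet (newPar ε₀) (J.submatrix id e) * BV.sdet ε₀ K * s))
    (hL : X (BV.sdet (newPar ε₀) (J.submatrix id e) * BV.sdet ε₀ K * s) =
      X ((2 : ℂ) • L) * (BV.sdet (newPar ε₀) (J.submatrix id e) * BV.sdet ε₀ K * s)) :
    (2 : ℂ) • X L = str (extPar ε₁) (J' * J.map X) + str ε₀ (Ni * K.map X) -
      (2 : ℂ) • str ε₁ (Di * D.map X) - r' * X r := by
  have hM1 : J.submatrix id e * J'.submatrix e id = 1 := by
    rw [Matrix.submatrix_mul_equiv, hJ1, Matrix.submatrix_id_id]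
  have hM2 : J'.submatrix e id * J.submatrix id e = 1 := by
    rw [← Matrix.submatrix_mul J' J e id e Function.bijective_id, hJ2, Matrix.submatrix_one_equiv]
  have hrr' : r * r' = 1 := by rw [← hrr, hr.central]
  have l1 := IsLogDer.sdet hX hXi hJ hM1 hM2 hJu
  have l2 := IsLogDer.sdet hX hXi hK hN1 hN2 hKu
  have l3 := IsLogDer.sdet hX hXi hD hD1 hD2 hDu
  have l4 : IsLogDer X r (r' * X r) := ⟨hr, by rw [← mul_assoc, hrr', one_mul]⟩
  have l5 := (l1.mul hX l2).mul hX ((l4.mul hX (by rw [sq]; exact l3.mul hX l3)).inverse hX hs)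
  have h1 : str (newPar ε₀) (J'.submatrix e id * (J.submatrix id e).map X) =
      str (extPar ε₁) (J' * J.map X) := by
    simp only [str]
    rw [← e.sum_comp]
    refine sum_congr rfl fun i _ => ?_
    rw [he]
    rfl
  have h2 := l5.eq
  rw [hL, ← l5.even.central, h1] at h2
  have h3 := hu.mul_left_cancel h2
  rw [← map_smul, h3, two_smul]
  abel

end Core

/-! ### The derivative of the quantum correction on shell -/

section Correction

variable {R : Type} [Ring R] [Algebra ℂ R] [SuperAlgebra R]
  {𝒟 : SuperCalculus R (vPar N ε₀ ε₁)} {z : R →ₐ[ℂ] R} {P : ℤ → R → R → R → Prop}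
  {E : Fin N ⊕ Fin N → Fin N ⊕ Fin N → R} {r r' f X₀ X₁ : R}

theorem vPar_lam (a : Fin N₀) : vPar N ε₀ ε₁ (.inr (.lam a)) = ε₀ a := rfl

theorem vPar_lamS (a : Fin N₀) : vPar N ε₀ ε₁ (.inr (.lamS a)) = ε₀ a + 1 := rfl

theorem vPar_c (a : Fin N₁) : vPar N ε₀ ε₁ (.inr (.c a)) = ε₁ a + 1 := rfl

theorem vPar_cS (a : Fin N₁) : vPar N ε₀ ε₁ (.inr (.cS a)) = ε₁ a := rfl

theorem IsReduction.isHomog (hz : IsReduction 𝒟 z) {e : ZMod 2} {a : R} (h : IsHomog e a) :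
    IsHomog e (z a) := by
  have h1 := hz.twist 1 a
  rw [twist_one, twist_one, show invol a = sg e • a from h, map_smul] at h1
  exact h1.symm

/-- The constraints. -/
def cons (𝒟 : SuperCalculus R (vPar N ε₀ ε₁)) (z : R →ₐ[ℂ] R) (X₀ : R) (a : Fin N₀) : R :=
  z (𝒟.DR (.inr (.lam a)) X₀)

/-- The reducibility matrix. -/
def redMat (𝒟 : SuperCalculus R (vPar N ε₀ ε₁)) (z : R →ₐ[ℂ] R) (X₀ : R) :
    Matrix (Fin N₀) (Fin N₁) R :=
  Matrix.of fun a k => z (𝒟.D (.inr (.lamS a)) (𝒟.DR (.inr (.c k)) X₀))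

theorem IsQuantumAction.isHomog_cons (S : IsQuantumAction 𝒟 z P E r r' f X₀ X₁) (a : Fin N₀) :
    IsHomog (ε₀ a) (cons 𝒟 z X₀ a) := by
  have := 𝒟.isHomog_DR S.homog_zero (.inr (.lam a))
  rw [zero_add] at this
  exact S.reduction.isHomog this

theorem IsQuantumAction.isMat_redMat (S : IsQuantumAction 𝒟 z P E r r' f X₀ X₁) :
    IsMat 0 ε₀ ε₁ (redMat 𝒟 z X₀) := fun a k => by
  have := 𝒟.isHomog_D (𝒟.isHomog_DR S.homog_zero (.inr (.c k))) (.inr (.lamS a))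
  rw [show 0 + vPar N ε₀ ε₁ (.inr (.c k)) + vPar N ε₀ ε₁ (.inr (.lamS a)) = ε₀ a + ε₁ k + 0 by
    change 0 + (ε₁ k + 1) + (ε₀ a + 1) = _
    generalize ε₀ a = a; generalize ε₁ k = k; clear * -; decide +revert] at this
  exact S.reduction.isHomog this

/-- The structure functions of the constraints. -/
def uMat (𝒟 : SuperCalculus R (vPar N ε₀ ε₁)) (z : R →ₐ[ℂ] R) (X₀ : R) (b : Fin N₀) (τ : R) :
    Matrix (Fin N₀) (Fin N₀) R :=
  Matrix.of fun g a => -(sg (ε₀ a * (ε₀ b + 1)) •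
    (z (𝒟.DR (.inr (.lam a)) (𝒟.D (.inr (.lamS g)) (𝒟.DR (.inr (.lam b)) X₀))) * τ))

/-- The structure functions of the reducibility matrix. -/
def wMat (𝒟 : SuperCalculus R (vPar N ε₀ ε₁)) (z : R →ₐ[ℂ] R) (X₀ : R) (b : Fin N₀) (τ : R) :
    Matrix (Fin N₁) (Fin N₁) R :=
  Matrix.of fun l k => sg ((ε₁ k + 1) * (ε₀ b + 1)) •
    (z (𝒟.DR (.inr (.c k)) (𝒟.D (.inr (.cS l)) (𝒟.DR (.inr (.lam b)) X₀))) * τ)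

variable {b : Fin N₀} {τ : R}

theorem IsQuantumAction.isHomog_coeff (S : IsQuantumAction 𝒟 z P E r r' f X₀ X₁) (a g b : Fin N₀) :
    IsHomog (ε₀ b + (ε₀ g + 1) + ε₀ a)
      (z (𝒟.DR (.inr (.lam a)) (𝒟.D (.inr (.lamS g)) (𝒟.DR (.inr (.lam b)) X₀)))) := by
  have := 𝒟.isHomog_DR (𝒟.isHomog_D (𝒟.isHomog_DR S.homog_zero (.inr (.lam b))) (.inr (.lamS g)))
    (.inr (.lam a))
  rw [zero_add] at this
  exact S.reduction.isHomog this

theorem IsQuantumAction.isMat_uMat (S : IsQuantumAction 𝒟 z P E r r' f X₀ X₁)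
    (hs : IsHomog (ε₀ b + 1) τ) : IsMat 0 ε₀ ε₀ (uMat 𝒟 z X₀ b τ) := fun g a => by
  refine (((S.isHomog_coeff a g b).mul_of_eq hs ?_).smul _).neg
  generalize ε₀ a = a; generalize ε₀ b = b; generalize ε₀ g = g; clear * -; decide +revert

theorem IsQuantumAction.hamDer_cons (S : IsQuantumAction 𝒟 z P E r r' f X₀ X₁) (a : Fin N₀) :
    hamDer 𝒟 E (cons 𝒟 z X₀ b) τ (cons 𝒟 z X₀ a) =
      ∑ g, cons 𝒟 z X₀ g * uMat 𝒟 z X₀ b τ g a := by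
  have h := congrArg (fun x => sg (ε₀ a * (ε₀ b + 1)) • x)
    (eq_neg_of_add_eq_zero_left (S.sbr_constraint a b))
  simp only [sg_smul_sg_smul] at h
  rw [hamDer_apply, cons, cons, h, smul_neg, neg_mul, smul_sum, sum_mul,
    ← sum_neg_distrib]
  refine sum_congr rfl fun g _ => ?_
  rw [uMat, of_apply, mul_neg, mul_smul_comm, smul_mul_assoc, mul_assoc, cons]

theorem IsQuantumAction.str_uMat (S : IsQuantumAction 𝒟 z P E r r' f X₀ X₁) :
    str ε₀ (uMat 𝒟 z X₀ b τ) = -((∑ a, sg (ε₀ a) •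
      z (𝒟.D (.inr (.lam a)) (𝒟.D (.inr (.lamS a)) (𝒟.DR (.inr (.lam b)) X₀)))) * τ) := by
  rw [str, sum_mul, ← sum_neg_distrib]
  refine sum_congr rfl fun a _ => ?_
  have h := 𝒟.DR_eq (𝒟.isHomog_D (𝒟.isHomog_DR S.homog_zero (.inr (.lam b))) (.inr (.lamS a)))
    (.inr (.lam a))
  rw [uMat, of_apply, h, map_smul, smul_mul_assoc, smul_smul, smul_neg, smul_mul_assoc,
    ← sg_add]
  have e2 : ε₀ a * (ε₀ b + 1) + vPar N ε₀ ε₁ (.inr (.lam a)) * (0 + vPar N ε₀ ε₁ (.inr (.lam b)) +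
      vPar N ε₀ ε₁ (.inr (.lamS a)) + vPar N ε₀ ε₁ (.inr (.lam a))) = 0 := by
    rw [vPar_lam, vPar_lam, vPar_lamS]
    generalize ε₀ a = a; generalize ε₀ b = b; clear * -; decide +revert
  rw [e2, sg_zero, one_smul]

theorem IsQuantumAction.str_wMat (S : IsQuantumAction 𝒟 z P E r r' f X₀ X₁) :
    str ε₁ (wMat 𝒟 z X₀ b τ) = -((∑ a, sg (ε₁ a + 1) •
      z (𝒟.D (.inr (.c a)) (𝒟.D (.inr (.cS a)) (𝒟.DR (.inr (.lam b)) X₀)))) * τ) := by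
  rw [str, sum_mul, ← sum_neg_distrib]
  refine sum_congr rfl fun a _ => ?_
  have h := 𝒟.DR_eq (𝒟.isHomog_D (𝒟.isHomog_DR S.homog_zero (.inr (.lam b))) (.inr (.cS a)))
    (.inr (.c a))
  rw [wMat, of_apply, h, map_smul, smul_mul_assoc, smul_smul, smul_mul_assoc, ← sg_add]
  have e2 : (ε₁ a + 1) * (ε₀ b + 1) + vPar N ε₀ ε₁ (.inr (.c a)) *
      (0 + vPar N ε₀ ε₁ (.inr (.lam b)) + vPar N ε₀ ε₁ (.inr (.cS a)) +
        vPar N ε₀ ε₁ (.inr (.c a))) = 0 := by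
    rw [vPar_lam, vPar_c, vPar_cS]
    generalize ε₁ a = a; generalize ε₀ b = b; clear * -; decide +revert
  rw [smul_smul, ← sg_add, add_assoc, e2, add_zero, sg_add, sg_one, mul_neg_one, neg_smul, neg_neg]

variable {Q : Type} [Ring Q] [Algebra ℂ Q] [SuperAlgebra Q] {φ : R →ₐ[ℂ] Q}

theorem IsQuantumAction.map_hamDer_correction (S : IsQuantumAction 𝒟 z P E r r' f X₀ X₁)
    (hφ : ∀ a, φ (cons 𝒟 z X₀ a) = 0) :
    φ (hamDer 𝒟 E (cons 𝒟 z X₀ b) τ (z X₁)) = φ (slap 𝒟 E r r' (cons 𝒟 z X₀ b) * τ -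
      str ε₀ (uMat 𝒟 z X₀ b τ) - str ε₁ (wMat 𝒟 z X₀ b τ)) := by
  obtain ⟨y, hy⟩ := S.sbr_quantumCorrection b
  rw [S.str_uMat, S.str_wMat, sub_neg_eq_add, sub_neg_eq_add, ← add_mul, ← add_mul, cons, ← hy,
    hamDer_apply, add_mul, map_add, sum_mul, map_sum]
  rw [sum_eq_zero fun a _ => ?_, add_zero]
  rw [mul_assoc, map_mul]
  exact mul_eq_zero_of_left (hφ a) _

theorem IsQuantumAction.map_hamDer_redMat (S : IsQuantumAction 𝒟 z P E r r' f X₀ X₁)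
    (hφ : ∀ a, φ (cons 𝒟 z X₀ a) = 0)
    (hs : IsHomog (ε₀ b + 1) τ) :
    ((redMat 𝒟 z X₀).map (hamDer 𝒟 E (cons 𝒟 z X₀ b) τ)).map φ =
      (-(uMat 𝒟 z X₀ b τ * redMat 𝒟 z X₀) - redMat 𝒟 z X₀ * wMat 𝒟 z X₀ b τ).map φ := by
  ext a k
  obtain ⟨y, hy⟩ := S.sbr_reducibility a b k
  have h1 : φ (∑ g, twist (ε₀ a + 1) (z (𝒟.DR (.inr (.lam g)) X₀)) * y g) = 0 := by
    rw [map_sum]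
    refine sum_eq_zero fun g _ => ?_
    have : φ (twist (ε₀ a + 1) (cons 𝒟 z X₀ g)) = 0 := by
      rw [(S.isHomog_cons g).twist_eq, map_smul, hφ, smul_zero]
    rw [map_mul]
    exact mul_eq_zero_of_left this _
  have h2 := congrArg φ hy
  rw [map_add, h1, add_zero, map_zero, map_add] at h2
  have h3 := congrArg (fun x => sg ((ε₁ k + 1) * (ε₀ b + 1)) • x) (eq_neg_of_add_eq_zero_left h2)
  simp only [map_smul, sg_smul_sg_smul, map_sub] at h3
  have h4 := congrArg (fun x => x * φ τ) (sub_eq_iff_eq_add.1 h3)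
  simp only [← map_mul φ] at h4
  rw [map_apply, map_apply, map_apply, Matrix.sub_apply, Matrix.neg_apply,
    hamDer_apply, redMat, of_apply, cons, h4, add_comm, sub_eq_add_neg, map_add, add_mul]
  congr 1
  · rw [← map_mul, sum_mul, Matrix.mul_apply, ← sum_neg_distrib]
    congr 1
    refine sum_congr rfl fun g _ => ?_
    have hY := 𝒟.isHomog_DR S.homog_zero (.inr (.lam b))
    have hw := 𝒟.isHomog_DR S.homog_zero (.inr (.c k))
    have hZ := S.reduction.isHomog (𝒟.isHomog_D hw (.inr (.lamS g)))
    have hV := 𝒟.isHomog_D (𝒟.isHomog_D hY (.inr (.lamS a))) (.inr (.lam g))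
    have hVτ := (S.reduction.isHomog hV).mul hs
    have e1 := 𝒟.DR_eq hw (.inr (.lamS g))
    have e2 := 𝒟.D_comm (.inr (.lamS a)) (.inr (.lam g)) (𝒟.DR (.inr (.lam b)) X₀)
    have e3 := 𝒟.DR_eq (𝒟.isHomog_D hY (.inr (.lamS a))) (.inr (.lam g))
    rw [uMat, of_apply, of_apply, neg_mul, neg_neg, e1, e2, e3, map_smul, map_smul,
      map_smul, map_smul, hZ.twist_eq]
    simp only [smul_mul_assoc, mul_smul_comm, smul_smul, ← sg_add]
    rw [mul_assoc, hZ.mul_comm hVτ, smul_smul, ← sg_add]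
    congr 2
    rw [vPar_lam, vPar_lam, vPar_lamS, vPar_lamS, vPar_c]
    generalize ε₀ a = a; generalize ε₀ b = b; generalize ε₀ g = g; generalize ε₁ k = k
    clear * -; decide +revert
  · rw [map_neg, smul_neg, neg_mul, ← map_smul φ, ← map_mul φ]
    congr 2
    rw [smul_sum, sum_mul, Matrix.mul_apply]
    refine sum_congr rfl fun l _ => ?_
    rw [wMat, of_apply, of_apply, mul_smul_comm, smul_mul_assoc, mul_assoc]

/-- On shell, `H + L` has vanishing antibrackets with the constraints. -/
theorem IsQuantumAction.exists_sbr_eq (S : IsQuantumAction 𝒟 z P E r r' f X₀ X₁)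
    (hτg : ∀ A, 𝒟.D (gVar A) τ = 0) (hτ1 : 𝒟.D (.inr (.lamS b)) τ = 1)
    (hs : IsHomog (ε₀ b + 1) τ)
    {F : Fin N₀ → R} {Fp Fs : Matrix (Fin N₀) (Fin N₁) R} {ω : Matrix (Fin N₁) (Fin N₀) R}
    (hJac : ∀ a g,
      sg ((ε₀ a + 1 + 1) * (ε₀ b + 1)) •
        sbr 𝒟 E (F a) (sbr 𝒟 E (cons 𝒟 z X₀ g) (cons 𝒟 z X₀ b)) +
      sg ((ε₀ g + 1) * (ε₀ a + 1 + 1)) •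
        sbr 𝒟 E (cons 𝒟 z X₀ g) (sbr 𝒟 E (cons 𝒟 z X₀ b) (F a)) +
      sg ((ε₀ b + 1) * (ε₀ g + 1)) •
        sbr 𝒟 E (cons 𝒟 z X₀ b) (sbr 𝒟 E (F a) (cons 𝒟 z X₀ g)) = 0)
    (hF : ∀ a, IsHomog (ε₀ a + 1) (F a)) (hFs : IsMat 0 ε₀ ε₁ Fs)
    (hω : IsMat 0 ε₁ ε₀ ω)
    {e : Fin N₀ ⊕ Fin N₀ ≃ (Fin N ⊕ Fin N) ⊕ (Fin N₁ ⊕ Fin N₁)}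
    (he : ∀ r, extPar ε₁ (e r) = newPar ε₀ r)
    {J : Matrix (Fin N₀ ⊕ Fin N₀) ((Fin N ⊕ Fin N) ⊕ (Fin N₁ ⊕ Fin N₁)) R}
    (hJJ : J = jacExt 𝒟 F (cons 𝒟 z X₀) Fp Fs ω)
    {J' : Matrix ((Fin N ⊕ Fin N) ⊕ (Fin N₁ ⊕ Fin N₁)) (Fin N₀ ⊕ Fin N₀) R}
    {K Ni : Matrix (Fin N₀) (Fin N₀) R} (hKK : K = brMat 𝒟 E F (cons 𝒟 z X₀) Fs ω)
    {D Di : Matrix (Fin N₁) (Fin N₁) R} (hDD : D = ω * redMat 𝒟 z X₀)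
    (hJ : IsMat 0 (newPar ε₀) (newPar ε₀) (J.submatrix id e)) (hK : IsMat 0 ε₀ ε₀ K)
    (hD : IsMat 0 ε₁ ε₁ D) (hJu : IsUnit (evenBlock hJ 1).det) (hKu : IsUnit (evenBlock hK 1).det)
    (hDu : IsUnit (evenBlock hD 1).det)
    (hJ1 : J * J' = 1) (hJ2 : J' * J = 1) (hN1 : K * Ni = 1) (hN2 : Ni * K = 1)
    (hD1 : D * Di = 1) (hD2 : Di * D = 1) {s L : R} (hs' : r * BV.sdet ε₁ D ^ 2 * s = 1)
    (hLz : z L = L)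
    (hu : IsUnit (BV.sdet (newPar ε₀) (J.submatrix id e) * BV.sdet ε₀ K * s))
    (hL : ∀ A, 𝒟.D (gVar A) (BV.sdet (newPar ε₀) (J.submatrix id e) * BV.sdet ε₀ K * s) =
      𝒟.D (gVar A) ((2 : ℂ) • L) * (BV.sdet (newPar ε₀) (J.submatrix id e) * BV.sdet ε₀ K * s)) :
    ∃ k : Fin N₀ → R, (∀ a, z (k a) = k a) ∧
      sbr 𝒟 E (z X₁ + L) (cons 𝒟 z X₀ b) = ∑ a, cons 𝒟 z X₀ a * k a := by
  have hz := S.reduction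
  have hE := S.bivector
  have hG := S.isHomog_cons
  obtain ⟨Q, iQ, aQ, sQ, φ, hφ, hφ0⟩ := exists_superQuotient hG
  have hφG : ∀ a, φ (cons 𝒟 z X₀ a) = 0 := fun a => (hφ0 _).2 ⟨Pi.single a 1, by
    rw [sum_eq_single a (fun b _ hb => by rw [Pi.single_eq_of_ne hb, mul_zero]) (by simp),
      Pi.single_eq_same, mul_one]⟩
  have hGz : ∀ a, z (cons 𝒟 z X₀ a) = cons 𝒟 z X₀ a := fun a => hz.idem _
  have hGG : ∀ a g, φ (sbr 𝒟 E (cons 𝒟 z X₀ a) (cons 𝒟 z X₀ g)) = 0 := fun a g => by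
    have := congrArg (fun x => sg (ε₀ a * (ε₀ g + 1)) • φ x)
      (eq_neg_of_add_eq_zero_left (S.sbr_constraint a g))
    simp only [map_smul, sg_smul_sg_smul, map_neg, map_sum] at this
    rw [cons, cons, this, sum_eq_zero, neg_zero, smul_zero]
    intro x _
    rw [map_mul]
    exact mul_eq_zero_of_left (hφG x) _
  have hZ := S.isMat_redMat
  have hy := isHomog_hamVec 𝒟 hE (hG b) hs
  set X := hamDer 𝒟 E (cons 𝒟 z X₀ b) τ with hX
  have hXm : ∀ f g, X (f * g) = X f * g + f * X g := coeffDer_mul _ hy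
  have hXi : ∀ a, X (invol a) = invol (X a) := coeffDer_invol _ hy
  subst hJJ hKK hDD
  have k1 := str_radicand (𝒟 := 𝒟) hE hG hF hFs hω hZ (S.constraint_mul_reducibility)
    hφ hφG hGG hτg hs hJac
    (S.isMat_uMat hs) S.hamDer_cons (S.map_hamDer_redMat hφG hs) hJ1 hJ2 (by
      intro v s
      have hM1 : (jacExt 𝒟 F (cons 𝒟 z X₀) Fp Fs ω).submatrix id e * J'.submatrix e id = 1 := by
        rw [Matrix.submatrix_mul_equiv, hJ1, Matrix.submatrix_id_id]
      have hM2 : J'.submatrix e id * (jacExt 𝒟 F (cons 𝒟 z X₀) Fp Fs ω).submatrix id e = 1 := by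
        rw [← Matrix.submatrix_mul J' _ e id e Function.bijective_id, hJ2,
          Matrix.submatrix_one_equiv]
      have := hJ.of_inverse hM1 hM2 (e.symm v) s
      rw [← he, Equiv.apply_symm_apply, add_zero, submatrix_apply,
        Equiv.apply_symm_apply] at this
      exact this) hN1 hN2 hD1 hD2
  have hrh : IsHomog 0 (BV.sdet (newPar ε₀) ((jacExt 𝒟 F (cons 𝒟 z X₀) Fp Fs ω).submatrix id e) *
      BV.sdet ε₀ (brMat 𝒟 E F (cons 𝒟 z X₀) Fs ω) * s) := by
    have h1 := isHomog_sdet hD hDu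
    refine ((isHomog_sdet hJ hJu).mul_of_eq (isHomog_sdet hK hKu) (add_zero 0)).mul_of_eq
      (IsHomog.of_mul_eq_one ?_ hs') (add_zero 0)
    rw [sq]
    exact hE.density_homog.mul_of_eq (h1.mul_of_eq h1 (add_zero 0)) (add_zero 0)
  have k2 := map_hamDer_radicand hXm hXi he hJ hK hD hJu hKu hDu hJ1 hJ2 hN1 hN2 hD1 hD2
    hE.density_homog hE.inverse_mul hs' hu (coeffDer_log (gammaCalculus 𝒟) hL hrh)
  have k3 := S.map_hamDer_correction (b := b) (τ := τ) hφG
  have k4 := two_smul_slap 𝒟 hE (hG b) hτg hs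
  have k5 : φ (X (z X₁ + L)) = 0 := by
    have h1 : (2 : ℂ) • φ (X (z X₁ + L)) = 0 := by
      rw [map_add, map_add, smul_add, k3, ← map_smul, ← map_smul φ, k2, map_sub φ _ (r' * _), k1,
        smul_sub, smul_sub, k4]
      simp only [map_sub, map_add, map_neg]
      abel
    exact (smul_eq_zero.1 h1).resolve_left two_ne_zero
  obtain ⟨k, hk⟩ := (hφ0 _).1 k5
  have hzs : z (sbr 𝒟 E (z X₁ + L) (cons 𝒟 z X₀ b)) = sbr 𝒟 E (z X₁ + L) (cons 𝒟 z X₀ b) := by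
    have := hz.sbr_left hE (X₁ + L) (cons 𝒟 z X₀ b)
    rw [map_add, hLz, hGz] at this
    rw [← this, map_sum]
    simp only [map_mul, hz.idem]
  have h1 := congrArg (fun x => z (𝒟.D (.inr (.lamS b)) x)) hk
  have hD0 : ∀ x, z x = x → 𝒟.D (.inr (.lamS b)) x = 0 := fun x hx => by
    rw [← hx]; exact hz.D_eq_zero _ (lamS_notMem b) _
  simp only [hX, hamDer_apply, 𝒟.D_mul, hD0 _ hzs, hτ1, zero_mul, zero_add, mul_one, map_sum,
    hD0 _ (hGz _)] at h1
  have h2 := congrArg (twist (vPar N ε₀ ε₁ (.inr (.lamS b)))) h1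
  simp only [map_sum, map_mul, hz.twist, hzs, twist_twist_self, hGz] at h2
  refine ⟨fun a => twist (vPar N ε₀ ε₁ (.inr (.lamS b))) (z (𝒟.D (.inr (.lamS b)) (k a))),
    fun a => ?_, h2⟩
  rw [hz.twist, hz.idem]

end Correction

/-! ### Inverses of matrices of superfunctions -/

section Abstract

open scoped ContDiff
variable {R : Type} [Ring R] [Algebra ℂ R] [SuperAlgebra R] {X ι : Type} [Fintype ι]
  [DecidableEq ι]

theorem isUnit_evenPart {d : evenPart R} (h : ∃ g, d.1 * g = 1 ∧ g * d.1 = 1) : IsUnit d := by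
  obtain ⟨g, hg1, hg2⟩ := h
  exact ⟨⟨d, ⟨g, mem_evenPart.2 ((mem_evenPart.1 d.2).of_mul_eq_one hg1)⟩, Subtype.ext hg1,
    Subtype.ext hg2⟩, rfl⟩

theorem map_det_congr {S R : Type*} [CommRing S] [Ring R] (f g : S →+* R) (B : Matrix ι ι S)
    (h : ∀ i j, f (B i j) = g (B i j)) : f B.det = g B.det := by
  have h1 := RingHom.map_det (f.eqLocus g).subtype (Matrix.of fun i j => ⟨B i j, h i j⟩)
  have h2 : (f.eqLocus g).subtype.mapMatrix (Matrix.of fun i j => ⟨B i j, h i j⟩) = B := rfl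
  rw [h2] at h1
  rw [← h1]
  exact (Matrix.det _ : f.eqLocus g).2

/-- A matrix whose body is invertible is invertible. -/
theorem exists_matrix_inverse_of_body (z bd : R →ₐ[ℂ] R) (β : X → R →ₐ[ℂ] ℂ)
    (hbd : ∀ a, IsHomog 0 (bd a)) (hzbd : ∀ a, z (bd a) = bd a) (hβ : ∀ x a, β x (bd a) = β x a)
    (hinv : ∀ d, IsHomog 0 d → z d = d → (∀ x, β x d ≠ 0) → ∃ g, d * g = 1 ∧ g * d = 1) {K : ℕ}
    (hnil : ∀ u : Matrix ι ι R, (∀ i j, z (u i j) = u i j) → (∀ x i j, β x (u i j) = 0) →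
      u ^ K = 0)
    {M : Matrix ι ι R} (hz : ∀ i j, z (M i j) = M i j) (hb : ∀ x, (M.map (β x)).det ≠ 0) :
    ∃ M', M * M' = 1 ∧ M' * M = 1 := by
  set i : evenPart R →+* R := (evenPart R).subtype with hi
  obtain ⟨B, hB⟩ : ∃ B : Matrix ι ι (evenPart R), B.map i = M.map bd :=
    ⟨Matrix.of fun a b => ⟨bd (M a b), mem_evenPart.2 (hbd _)⟩, rfl⟩
  have hz1 : (1 : Matrix ι ι R).map z = 1 := Matrix.map_one _ (map_zero _) (map_one _)
  have hBz : (B.map i).map z = B.map i := by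
    rw [hB]
    ext a b : 1
    exact hzbd _
  have hMz : M.map z = M := by
    ext a b : 1
    exact hz a b
  have hBx : ∀ x, (B.map i).map (β x) = M.map (β x) := by
    intro x
    rw [hB]
    ext a b
    exact hβ x _
  have hdet : IsUnit B.det := by
    refine isUnit_evenPart (hinv _ (mem_evenPart.1 B.det.2) ?_ fun x => ?_)
    · exact map_det_congr ((z : R →+* R).comp i) i B fun a b => congrFun (congrFun hBz a) b
    · have h1 := RingHom.map_det ((β x : R →+* ℂ).comp i) B
      have h2 : (((β x : R →+* ℂ).comp i).mapMatrix B) = M.map (β x) := hBx x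
      rw [h2] at h1
      exact fun h => hb x (h1.symm.trans h)
  set B' : Matrix ι ι R := (B⁻¹).map i with hB'
  have hone : (1 : Matrix ι ι (evenPart R)).map i = 1 :=
    Matrix.map_one _ (map_zero _) (map_one _)
  have h1 : B' * B.map i = 1 := by
    rw [hB', ← Matrix.map_mul, Matrix.nonsing_inv_mul _ hdet, hone]
  have h1' : B.map i * B' = 1 := by
    rw [hB', ← Matrix.map_mul, Matrix.mul_nonsing_inv _ hdet, hone]
  have hB'z : B'.map z = B' := by
    have h2 : B.map i * B'.map z = 1 := by
      calc _ = (B.map i).map z * B'.map z := by rw [hBz]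
        _ = 1 := by rw [← Matrix.map_mul, h1', hz1]
    calc _ = B' * B.map i * B'.map z := by rw [h1, Matrix.one_mul]
      _ = B' := by rw [Matrix.mul_assoc, h2, Matrix.mul_one]
  have huz : (1 - B' * M).map z = 1 - B' * M := by
    rw [Matrix.map_sub _ (map_sub _), hz1, Matrix.map_mul, hB'z, hMz]
  have hnu : IsNilpotent (1 - B' * M) := by
    refine ⟨K, hnil _ (fun a b => congrFun (congrFun huz a) b) fun x => ?_⟩
    have h4 : (1 : Matrix ι ι R).map (β x) = 1 := Matrix.map_one _ (map_zero _) (map_one _)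
    have h2 : (1 - B' * M).map (β x) = 0 := by
      rw [Matrix.map_sub _ (map_sub _), Matrix.map_mul, ← hBx, ← Matrix.map_mul, h1, sub_self]
    exact fun a b => congrFun (congrFun h2 a) b
  obtain ⟨w, hw⟩ := hnu.isUnit_one_sub
  rw [sub_sub_cancel] at hw
  have h3 : M = B.map i * w.1 := by
    rw [hw, ← Matrix.mul_assoc, h1', Matrix.one_mul]
  refine ⟨(w⁻¹).1 * B', ?_, ?_⟩
  · rw [h3, Matrix.mul_assoc, ← Matrix.mul_assoc w.1, w.mul_inv, Matrix.one_mul, h1']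
  · rw [h3, Matrix.mul_assoc, ← Matrix.mul_assoc B', h1, Matrix.one_mul, w.inv_mul]

/-- An inverse of a matrix fixed by a homomorphism is fixed by it. -/
theorem map_inverse_matrix {κ : Type} [Fintype κ] [DecidableEq κ] (z : R →ₐ[ℂ] R)
    {M : Matrix ι κ R} {M' : Matrix κ ι R} (hz : ∀ i j, z (M i j) = M i j) (h1 : M * M' = 1)
    (h2 : M' * M = 1) (i : κ) (j : ι) : z (M' i j) = M' i j := by
  have hMz : M.map z = M := by
    ext a b : 1
    exact hz a b
  have h3 : M * M'.map z = 1 := by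
    calc _ = M.map z * M'.map z := by rw [hMz]
      _ = 1 := by rw [← Matrix.map_mul, h1, Matrix.map_one _ (map_zero _) (map_one _)]
  have h4 : M'.map z = M' := by
    calc _ = M' * M * M'.map z := by rw [h2, Matrix.one_mul]
      _ = M' := by rw [Matrix.mul_assoc, h3, Matrix.mul_one]
  exact congrFun (congrFun h4 i) j

theorem isUnit_det_evenBlock_of_body (z : R →ₐ[ℂ] R) (β : X → R →ₐ[ℂ] ℂ)
    (hβ : ∀ x a, IsHomog 1 a → β x a = 0)
    (hinv : ∀ d, IsHomog 0 d → z d = d → (∀ x, β x d ≠ 0) → ∃ g, d * g = 1 ∧ g * d = 1)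
    {e : ι → ZMod 2} {M M' : Matrix ι ι R} (hM : IsMat 0 e e M) (hz : ∀ i j, z (M i j) = M i j)
    (h : M * M' = 1) (f : ZMod 2) : IsUnit (evenBlock hM f).det := by
  refine isUnit_evenPart (hinv _ (mem_evenPart.1 (evenBlock hM f).det.2) ?_ fun x => ?_)
  · exact map_det_congr ((z : R →+* R).comp (evenPart R).subtype) (evenPart R).subtype
      (evenBlock hM f) fun a b => hz _ _
  · exact map_det_oddBlock_ne_zero (β x) (hβ x) hM h f

theorem SuperCalculus.D_mul_inverse {V : Type*} {q : V → ZMod 2} (𝒟 : SuperCalculus R q) {v : V}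
    {a a' l E : R} (ha' : IsHomog 0 a') (h1 : a' * a = 1) (h2 : a * a' = 1)
    (hl : 𝒟.D v a = l * a) (hE : 𝒟.D v E = l * E) : 𝒟.D v (a' * E) = 0 := by
  have h3 : 𝒟.D v a' = -(l * a') := by
    have h := 𝒟.D_mul v a' a
    rw [h1, 𝒟.D_one, ha'.twist_eq, mul_zero, sg_zero, one_smul, hl] at h
    have h4 : 𝒟.D v a' * a = -l := by
      rw [eq_neg_iff_add_eq_zero, h, ← mul_assoc, ha'.central, mul_assoc, h1, mul_one]
    calc 𝒟.D v a' = 𝒟.D v a' * a * a' := by rw [mul_assoc, h2, mul_one]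
      _ = _ := by rw [h4, neg_mul]
  rw [𝒟.D_mul, h3, ha'.twist_eq, mul_zero, sg_zero, one_smul, hE, ← mul_assoc a', ha'.central,
    neg_mul, neg_add_cancel]

/-- Partial sums of the logarithm series. -/
def logSum {R : Type*} [Ring R] [Algebra ℂ R] (K : ℕ) (a : R) : R :=
  ∑ k ∈ Finset.range K, ((-1) ^ k / (k + 1 : ℕ) : ℂ) • a ^ (k + 1)

theorem isHomog_logSum {a : R} (ha : IsHomog 0 a) (K : ℕ) : IsHomog 0 (logSum K a) := by
  refine IsHomog.sum fun k _ => IsHomog.smul ?_ _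
  induction k + 1 with
  | zero => rw [pow_zero]; exact IsHomog.one
  | succ k ih => rw [pow_succ]; exact ih.mul_of_eq ha (add_zero 0)

theorem map_logSum {R R' : Type*} [Ring R] [Algebra ℂ R] [Ring R'] [Algebra ℂ R']
    (φ : R →ₐ[ℂ] R') (K : ℕ) (a : R) : φ (logSum K a) = logSum K (φ a) := by
  simp only [logSum, map_sum, map_smul, map_pow]

theorem logSum_zero {R : Type*} [Ring R] [Algebra ℂ R] (K : ℕ) : logSum K (0 : R) = 0 :=
  sum_eq_zero fun k _ => by rw [zero_pow (Nat.succ_ne_zero k), smul_zero]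

theorem SuperCalculus.D_logSum {V : Type*}
    {q : V → ZMod 2} (𝒟 : SuperCalculus R q) (v : V) {a : R} (ha : IsHomog 0 a) {K : ℕ}
    (hK : a ^ K = 0) : 𝒟.D v (logSum K a) * (1 + a) = 𝒟.D v a := by
  have h1 : 𝒟.D v (logSum K a) = 𝒟.D v a * ∑ k ∈ Finset.range K, (-a) ^ k := by
    rw [logSum, map_sum, mul_sum]
    refine sum_congr rfl fun k _ => ?_
    have h2 : (-a) ^ k = ((-1) ^ k : ℂ) • a ^ k := by
      rw [neg_pow, Algebra.smul_def, map_pow, map_neg, map_one]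
    have h3 : ((k + 1 : ℕ) : ℂ) ≠ 0 := Nat.cast_ne_zero.2 (Nat.succ_ne_zero k)
    rw [map_smul, 𝒟.D_pow v ha, smul_smul, div_mul_cancel₀ _ h3, h2, mul_smul_comm]
  rw [h1, mul_assoc]
  have h2 := geom_sum_mul (-a) K
  rw [neg_pow a K, hK, mul_zero, zero_sub, ← neg_add', mul_neg, neg_inj, add_comm] at h2
  rw [h2, mul_one]

theorem SuperCalculus.D_mul_one_add {V : Type*} {q : V → ZMod 2} (𝒟 : SuperCalculus R q) (v : V)
    {b l u : R} {K : ℕ} (hb : IsHomog 0 b) (hu : IsHomog 0 u) (h1 : 𝒟.D v b = 0)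
    (h2 : 𝒟.D v l = 0) (hK : u ^ K = 0) :
    𝒟.D v (b * (1 + u)) = 𝒟.D v (l + logSum K u) * (b * (1 + u)) := by
  rw [𝒟.D_mul, h1, zero_mul, zero_add, hb.twist_eq, mul_zero, sg_zero, one_smul, map_add, 𝒟.D_one,
    zero_add, map_add, h2, zero_add, ← 𝒟.D_logSum v hu hK, ← mul_assoc, ← mul_assoc, hb.central]

end Abstract

section MatrixInverse

open scoped ContDiff
variable {V : Opens (Fin n → ℝ)} {ι : Type} [Fintype ι] [DecidableEq ι]

/-- The body at a point. -/
def bodyAt (x : V) : SuperFun V p →ₐ[ℂ] ℂ := (bodyHom p).comp (SuperFun.eval x)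

theorem bodyAt_apply (x : V) (f : SuperFun V p) : bodyAt x f = body (f.1 x) := rfl

theorem bodyAt_zeroing (x : V) (T : Set W) (f : SuperFun V p) :
    bodyAt x (zeroing T f) = bodyAt x f := body_setZero T _

theorem bodyAt_of_odd (x : V) {f : SuperFun V p} (hf : IsHomog 1 f) : bodyAt x f = 0 :=
  IsHomog.body_eq_zero (isHomog_iff_val.1 hf x)

theorem zeroing_superBody (T : Set W) (f : SuperFun V p) :
    zeroing T (superBody f) = superBody f :=
  SuperFun.ext fun x => by
    rw [zeroing_val, superBody_val]
    exact (setZeroHom T).commutes _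

theorem pow_mem_superGE' {M : Matrix ι ι (SuperFun V p)} (h : ∀ i j, M i j ∈ superGE V p 1) (k : ℕ) :
    ∀ i j, (M ^ k) i j ∈ superGE V p k := by
  induction k with
  | zero => exact fun a b => mem_superGE_zero _
  | succ k ih =>
    intro a b
    rw [pow_succ, Matrix.mul_apply]
    exact sum_mem fun c _ => mul_mem_superGE (ih a c) (h c b)

theorem matrix_pow_eq_zero {T : Set W} (hT : ∀ w, p w = 0 → w ∈ T)
    {u : Matrix ι ι (SuperFun V p)} (hz : ∀ i j, zeroing T (u i j) = u i j)
    (hb : ∀ x i j, bodyAt x (u i j) = 0) : u ^ (oddCard p + 1) = 0 := by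
  have h1 : ∀ k i j, zeroing T ((u ^ k) i j) = (u ^ k) i j := by
    intro k
    induction k with
    | zero =>
      intro i j
      rw [pow_zero, Matrix.one_apply]
      split_ifs
      · rw [map_one]
      · rw [map_zero]
    | succ k ih =>
      intro i j
      simp only [pow_succ, Matrix.mul_apply, map_sum, map_mul, ih, hz]
  ext i j : 1
  exact eq_zero_of_mem_superGE hT (h1 _ i j) (Nat.lt_succ_self _)
    (pow_mem_superGE' (fun i j => mem_superGE_one_iff.2 fun x => hb x i j) _ i j)

theorem exists_matrix_inverse {T : Set W} (hT : ∀ w, p w = 0 → w ∈ T)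
    {M : Matrix ι ι (SuperFun V p)} (hz : ∀ i j, zeroing T (M i j) = M i j)
    (hb : ∀ x, (M.map (bodyAt x)).det ≠ 0) : ∃ M', M * M' = 1 ∧ M' * M = 1 := by
  have h1 : ∀ d : SuperFun V p, IsHomog 0 d → zeroing T d = d → (∀ x : V, bodyAt x d ≠ 0) →
      ∃ g, d * g = 1 ∧ g * d = 1 := fun d _ hdz hdb => exists_inverse hT hdz hdb
  have h2 : ∀ u : Matrix ι ι (SuperFun V p), (∀ i j, zeroing T (u i j) = u i j) →
      (∀ (x : V) i j, bodyAt x (u i j) = 0) → u ^ (oddCard p + 1) = 0 :=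
    fun u hu hub => matrix_pow_eq_zero hT hu hub
  have h3 : ∀ (x : V) (a : SuperFun V p), bodyAt x (superBody a) = bodyAt x a :=
    fun x a => bodyAt_zeroing x _ a
  exact exists_matrix_inverse_of_body (zeroing T) superBody bodyAt isHomog_superBody
    (zeroing_superBody T) h3 h1 h2 hz hb

variable {e : ι → ZMod 2}

theorem isUnit_det_evenBlock {T : Set W} (hT : ∀ w, p w = 0 → w ∈ T)
    {M M' : Matrix ι ι (SuperFun V p)} (hM : IsMat 0 e e M)
    (hz : ∀ i j, zeroing T (M i j) = M i j) (h : M * M' = 1) (f : ZMod 2) :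
    IsUnit (evenBlock hM f).det :=
  isUnit_det_evenBlock_of_body (zeroing T) bodyAt (fun x _ ha => bodyAt_of_odd x ha)
    (fun _ _ hdz hdb => exists_inverse hT hdz hdb) hM hz h f

theorem isUnit_det_evenBlock_ser {M : Matrix ι ι (Ser p)} (hM : IsMat 0 e e M) (h : IsUnit M)
    (f : ZMod 2) : IsUnit (evenBlock hM f).det := by
  obtain ⟨u, rfl⟩ := h
  refine isUnit_det_evenBlock_of_body (X := Unit) (AlgHom.id ℂ _) (fun _ => bodyHom p)
    (fun _ _ ha => ha.body_eq_zero) (fun _ _ _ hb => ?_) hM (fun _ _ => rfl) u.mul_inv f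
  obtain ⟨w, rfl⟩ := isUnit_of_body_ne_zero (hb ())
  exact ⟨_, w.mul_inv, w.inv_mul⟩

end MatrixInverse

/-! ### Logarithms -/

section Log

open scoped ContDiff
variable {V : Opens (Fin n → ℝ)}

theorem superBody_eq_self {f : SuperFun V p} (h : ∀ w, (funCalculus V p).D (.inr w) f = 0) :
    superBody f = f :=
  SuperFun.ext fun x => setZero_eq_self fun w _ => congrArg (fun g : SuperFun V p => g.1 x) (h w)

theorem body_sexp (s : Ser p) : body (sexp s) = Complex.exp (body s) := by
  have h := coeff_sexp s (m := 0) (K := oddCard p + 1) (by simp)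
  have h1 : body (sexp s) = body (algebraMap ℂ (Ser p) (Complex.exp (body s)) *
      expSum (oddCard p + 1) (s - algebraMap ℂ (Ser p) (body s))) :=
    congrArg algebraMapInv h
  rw [h1, ← bodyHom_apply, map_mul, AlgHom.commutes, expSum, map_sum,
    Finset.sum_range_succ', sum_eq_zero]
  · simp
  · intro k _
    rw [map_smul, map_pow, map_sub, AlgHom.commutes, bodyHom_apply, Algebra.algebraMap_self_apply,
      sub_self, zero_pow (Nat.succ_ne_zero k), smul_zero]

/-- Existence of logarithms. -/
theorem exists_log {T : Set W} (hT : ∀ w, p w = 0 → w ∈ T) {a : SuperFun V p} (ha : IsHomog 0 a)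
    (hz : zeroing T a = a) {c : ℂ} (hc : c ≠ 0)
    (hb : ∀ x, bodyAt x a / c ∈ Complex.slitPlane) :
    ∃ L : SuperFun V p, IsHomog 0 L ∧ zeroing T L = L ∧ superExp L = a := by
  have hb0 : ∀ x, bodyAt x a ≠ 0 := fun x h => by
    have := hb x
    rw [h, zero_div] at this
    exact Complex.zero_notMem_slitPlane this
  have hsm : ContDiffOn ℝ ∞ (fun x => Complex.log (body (a.ext' x) / c) + Complex.log c)
      (V : Set (Fin n → ℝ)) := by
    refine ContDiffOn.add ?_ contDiffOn_const
    intro x hx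
    have h1 : ContDiffWithinAt ℝ ∞ (fun x => body (a.ext' x) / c) (V : Set (Fin n → ℝ)) x :=
      (contDiffOn_body a x hx).div_const c
    have h2 : body (a.ext' x) / c ∈ Complex.slitPlane := by
      rw [a.ext'_apply ⟨x, hx⟩]
      exact hb ⟨x, hx⟩
    exact ((Complex.contDiffAt_log h2).restrict_scalars ℝ).comp_contDiffWithinAt x h1
  set l : SuperFun V p := scal _ hsm with hl
  have hlb : ∀ x, Complex.exp (bodyAt x l) = bodyAt x a := by
    intro x
    rw [bodyAt_apply, hl, scal_val, body_algebraMap, Complex.exp_add, a.ext'_apply x,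
      Complex.exp_log hc, Complex.exp_log, div_mul_cancel₀ _ hc]
    · rfl
    · exact div_ne_zero (hb0 x) hc
  obtain ⟨a', haa, haa'⟩ := exists_inverse hT hz hb0
  obtain ⟨b', hbb, hbb'⟩ := exists_inverse hT (f := superBody a) (zeroing_superBody T a)
    fun x => by
      have := bodyAt_zeroing x Set.univ a
      rw [bodyAt_apply] at this
      rw [this]
      exact hb0 x
  have hbh := isHomog_superBody a
  have hb'h := hbh.of_mul_eq_one hbb
  have hb'z := map_eq_self_of_inverse (zeroing T) hbb hbb' (zeroing_superBody T a)
  set u := b' * a - 1 with hu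
  have hu0 : IsHomog 0 u := (hb'h.mul_of_eq ha (add_zero 0)).sub IsHomog.one
  have huz : zeroing T u = u := by rw [hu, map_sub, map_mul, hb'z, hz, map_one]
  have hu1 : u ∈ superGE V p 1 := by
    rw [mem_superGE_one_iff]
    intro x
    have h1 : bodyAt x b' * bodyAt x a = 1 := by
      rw [← bodyAt_zeroing x Set.univ a, ← map_mul, hbb', map_one]
    rw [← bodyAt_apply, hu, map_sub, map_mul, h1, map_one, sub_self]
  have hun : u ^ (oddCard p + 1) = 0 :=
    eq_zero_of_mem_superGE hT (by rw [map_pow, huz]) (Nat.lt_succ_self _) (pow_mem_superGE hu1 _)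
  set L := l + logSum (oddCard p + 1) u with hL
  have hL0 : IsHomog 0 L := (isHomog_scal _ _).add (isHomog_logSum hu0 _)
  have hLz : zeroing T L = L := by
    rw [hL, map_add, hl, zeroing_scal, map_logSum, huz]
  refine ⟨L, hL0, hLz, ?_⟩
  have hau : superBody a * (1 + u) = a := by
    rw [hu, add_sub_cancel, ← mul_assoc, hbb, one_mul]
  have hD : ∀ w, (funCalculus V p).D (.inr w) a = (funCalculus V p).D (.inr w) L * a := by
    intro w
    have h1 : (funCalculus V p).D (.inr w) (superBody a) = 0 :=
      D_zeroing_of_mem (Set.mem_univ w) a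
    have h2 : (funCalculus V p).D (.inr w) l = 0 := by
      have h : zeroing Set.univ l = l := zeroing_scal _ _ _
      rw [← h]
      exact D_zeroing_of_mem (Set.mem_univ w) l
    have h3 := (funCalculus V p).D_mul_one_add (.inr w) hbh hu0 h1 h2 hun
    rw [hau] at h3
    exact h3
  have ha'h := ha.of_mul_eq_one haa
  have hq : ∀ w, (funCalculus V p).D (.inr w) (a' * superExp L) = 0 := fun w =>
    (funCalculus V p).D_mul_inverse ha'h haa' haa (hD w) (D_superExp hL0 _)
  have h1 : a' * superExp L = 1 := by
    rw [← superBody_eq_self hq]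
    refine SuperFun.ext fun x => ?_
    have h2 : bodyAt x (a' * superExp L) = 1 := by
      have h3 : bodyAt x (superExp L) = bodyAt x a := by
        have h4 : bodyAt x u = 0 := by
          rw [bodyAt_apply]
          exact mem_superGE_one_iff.1 hu1 x
        rw [← hlb, bodyAt_apply, superExp_val, body_sexp, ← bodyAt_apply, hL, map_add, map_logSum,
          h4, logSum_zero, add_zero]
      rw [map_mul, h3, ← map_mul, haa', map_one]
    rw [superBody_val, ← bodyAt_apply, h2, map_one]
    rfl
  calc superExp L = a * a' * superExp L := by rw [haa, one_mul]
    _ = a := by rw [mul_assoc, h1, mul_one]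

end Log

/-! ### Superfunctions of all variables -/

section Concrete

open scoped ContDiff
variable {V : Opens (Fin N → ℝ)}
  {U : Set (Fin N → ℝ)}

/-- Superfunctions of the variables of the theory. -/
abbrev SF (ε₀ : Fin N₀ → ZMod 2) (ε₁ : Fin N₁ → ZMod 2) (V : Opens (Fin N → ℝ)) : Type :=
  SuperFun V (par (N := N) ε₀ ε₁)

abbrev SC (ε₀ : Fin N₀ → ZMod 2) (ε₁ : Fin N₁ → ZMod 2) (V : Opens (Fin N → ℝ)) :
    SuperCalculus (SF ε₀ ε₁ V) (vPar N ε₀ ε₁) :=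
  funCalculus V (par (N := N) ε₀ ε₁)

theorem IsSmooth.of_subset {f : Fun N ε₀ ε₁} (h : IsSmooth U f) {U' : Set (Fin N → ℝ)}
    (hU : U' ⊆ U) : IsSmooth U' f := fun m l => (h m l).mono hU

theorem IsFn.of_subset {T : Set (Fld N N₀ N₁)} {e : ZMod 2} {f : Fun N ε₀ ε₁} (h : IsFn U T e f)
    {U' : Set (Fin N → ℝ)} (hU : U' ⊆ U) : IsFn U' T e f where
  smooth := h.smooth.of_subset hU
  parity x hx := h.parity x (hU hx)
  indep w hw x hx := h.indep w hw x (hU hx)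

/-- The superfunction on `V` defined by `f`. -/
def IsFn.toSuperFun {T : Set (Fld N N₀ N₁)} {e : ZMod 2} {f : Fun N ε₀ ε₁}
    (h : IsFn (V : Set (Fin N → ℝ)) T e f) : SF ε₀ ε₁ V :=
  sRestrict V f h.smooth

theorem IsFn.toSuperFun_val {T : Set (Fld N N₀ N₁)} {e : ZMod 2} {f : Fun N ε₀ ε₁}
    (h : IsFn (V : Set (Fin N → ℝ)) T e f) (x : V) : h.toSuperFun.1 x = f x := rfl

theorem IsFn.isHomog {T : Set (Fld N N₀ N₁)} {e : ZMod 2} {f : Fun N ε₀ ε₁}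
    (h : IsFn (V : Set (Fin N → ℝ)) T e f) : IsHomog e h.toSuperFun :=
  isHomog_sRestrict _ h.parity

theorem IsFn.zeroing {T : Set (Fld N N₀ N₁)} {e : ZMod 2} {f : Fun N ε₀ ε₁}
    (h : IsFn (V : Set (Fin N → ℝ)) T e f) {T' : Set (Fld N N₀ N₁)} (hT : ∀ w ∈ T', w ∉ T) :
    BV.zeroing T' h.toSuperFun = h.toSuperFun :=
  zeroing_sRestrict h hT

variable (V ε₀ ε₁) in
/-- Setting all formal variables except the `θ` to zero. -/
abbrev gammaPart : SF ε₀ ε₁ V →ₐ[ℂ] SF ε₀ ε₁ V :=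
  zeroing gammaVarsᶜ

theorem IsFn.gammaPart {e : ZMod 2} {f : Fun N ε₀ ε₁}
    (h : IsFn (V : Set (Fin N → ℝ)) gammaVars e f) : gammaPart ε₀ ε₁ V h.toSuperFun = h.toSuperFun :=
  h.zeroing fun _ h => h

theorem even_mem_compl_gammaVars (w : Fld N N₀ N₁) (h : par ε₀ ε₁ w = 0) : w ∈ gammaVarsᶜ := by
  rintro ⟨i, rfl⟩
  exact one_ne_zero h

theorem planck_mem_compl_gammaVars (w : Fld N N₀ N₁) (h : planck w ≠ 0) : w ∈ gammaVarsᶜ := by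
  rintro ⟨i, rfl⟩
  exact h rfl

theorem gVar_ne (A : Fin N ⊕ Fin N) (w : Fld N N₀ N₁) (hw : w ∈ gammaVarsᶜ) : gVar A ≠ .inr w := by
  rintro h
  rcases A with i | i
  · cases h
  · exact hw ⟨i, (Sum.inr_injective h).symm⟩

theorem zeroing_zeroing (T T' : Set (Fld N N₀ N₁)) (f : SF ε₀ ε₁ V) :
    zeroing T (zeroing T' f) = zeroing (T ∪ T') f :=
  SuperFun.ext fun _ => setZero_setZero T T' _

variable (V ε₀ ε₁) in
theorem isReduction_gammaPart :
    IsReduction (SC ε₀ ε₁ V) (gammaPart ε₀ ε₁ V) where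
  idem f := by rw [zeroing_zeroing, Set.union_self]
  twist e f := zeroing_twist _ e f
  D A f := (D_zeroing (fun w hw => gVar_ne A w hw) f).symm
  D_eq_zero w hw f := D_zeroing_of_mem hw f

variable (V ε₀ ε₁) in
/-- The relation between an action and the first two coefficients of its expansion. -/
def PlanckRel (j : ℤ) (f f₀ f₁ : SF ε₀ ε₁ V) : Prop :=
  ∃ c, PlanckSeries planck j f c ∧ c 0 = f₀ ∧ c 1 = f₁

variable (V ε₀ ε₁) in
theorem isPlanckRel_planckRel :
    IsPlanckRel (SC ε₀ ε₁ V) (gammaPart ε₀ ε₁ V) (PlanckRel ε₀ ε₁ V) where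
  D := by
    rintro j f _ _ ⟨c, hc, rfl, rfl⟩ v
    exact ⟨_, hc.D v, rfl, rfl⟩
  DR := by
    rintro j f _ _ ⟨c, hc, rfl, rfl⟩ v
    exact ⟨_, hc.DR v, rfl, rfl⟩
  neg := by
    rintro j f _ _ ⟨c, hc, rfl, rfl⟩ hj
    exact hc.zeroing_eq_zero planck_mem_compl_gammaVars even_mem_compl_gammaVars hj
  zero := by
    rintro j f _ _ ⟨c, hc, rfl, rfl⟩ rfl
    have := PlanckSeries.zeroing_eq (j := 0) planck_mem_compl_gammaVars
      even_mem_compl_gammaVars hc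
    rwa [pow_zero, one_smul] at this
  one := by
    rintro j f _ _ ⟨c, hc, rfl, rfl⟩ rfl
    have := PlanckSeries.zeroing_eq (j := 1) planck_mem_compl_gammaVars
      even_mem_compl_gammaVars hc
    rwa [pow_one] at this

variable {E : Fin N ⊕ Fin N → Fin N ⊕ Fin N → Fun N ε₀ ε₁} {ρ : Fun N ε₀ ε₁}

theorem bracket_apply (hE : ∀ A B, IsSmooth (V : Set (Fin N → ℝ)) (E A B)) {f g : Fun N ε₀ ε₁}
    (hf : IsSmooth (V : Set (Fin N → ℝ)) f) (hg : IsSmooth (V : Set (Fin N → ℝ)) g) (x : V) :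
    bracket E f g x = (sbr (SC ε₀ ε₁ V)
      (fun A B => sRestrict V (E A B) (hE A B)) (sRestrict V f hf)
      (sRestrict V g hg)).1 x := by
  have h : (sbr (SC ε₀ ε₁ V)
      (fun A B => sRestrict V (E A B) (hE A B)) (sRestrict V f hf)
      (sRestrict V g hg)).1 x = ∑ A, ∑ B,
        ((SC ε₀ ε₁ V).DR (gVar A) (sRestrict V f hf)).1 x * E A B x *
          ((SC ε₀ ε₁ V).D (gVar B) (sRestrict V g hg)).1 x := by
    simp only [← SuperFun.eval_apply, sbr, map_sum, map_mul]
    rfl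
  rw [h, bracket]
  simp only [Finset.sum_apply, Pi.mul_apply]
  exact sum_congr rfl fun A _ => sum_congr rfl fun B _ => by
    rw [rD_apply _ f hf, lD_apply _ g hg]

theorem isSmooth_bracket (hE : ∀ A B, IsSmooth (V : Set (Fin N → ℝ)) (E A B)) {f g : Fun N ε₀ ε₁}
    (hf : IsSmooth (V : Set (Fin N → ℝ)) f) (hg : IsSmooth (V : Set (Fin N → ℝ)) g) :
    IsSmooth (V : Set (Fin N → ℝ)) (bracket E f g) :=
  (SuperFun.smooth (sbr (SC ε₀ ε₁ V)
      (fun A B => sRestrict V (E A B) (hE A B)) (sRestrict V f hf)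
      (sRestrict V g hg))).congr fun x hx => by
    rw [SuperFun.ext'_apply _ ⟨x, hx⟩]
    exact bracket_apply hE hf hg ⟨x, hx⟩

theorem lapMin_apply (hE : ∀ A B, IsSmooth (V : Set (Fin N → ℝ)) (E A B))
    (hρ : IsSmooth (V : Set (Fin N → ℝ)) ρ) {f : Fun N ε₀ ε₁}
    (hf : IsSmooth (V : Set (Fin N → ℝ)) f) {r' : SF ε₀ ε₁ V}
    (hr : ∀ x, r'.1 x = Ring.inverse (ρ x)) (x : V) :
    lapMin E ρ f x = (slapMin (SC ε₀ ε₁ V)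
      (fun A B => sRestrict V (E A B) (hE A B)) (sRestrict V ρ hρ) r'
      (sRestrict V f hf)).1 x := by
  have h0 : ∀ u v, lD u (lD v f) x = ((SC ε₀ ε₁ V).D u
      ((SC ε₀ ε₁ V).D v (sRestrict V f hf))).1 x := by
    intro u v
    rw [lD_apply u _ (hf.lD V.isOpen v), sRestrict_lD]
  have h1 : ∀ A B, Ring.inverse (ρ x) * lD (gVar A) (ρ * E A B * lD (gVar B) f) x =
      (r' * (SC ε₀ ε₁ V).D (gVar A) (sRestrict V ρ hρ *
        sRestrict V (E A B) (hE A B) * (SC ε₀ ε₁ V).D (gVar B)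
          (sRestrict V f hf))).1 x := by
    intro A B
    rw [lD_apply _ _ ((hρ.mul (hE A B)).mul (hf.lD V.isOpen (gVar B))),
      sRestrict_mul (hρ.mul (hE A B)) (hf.lD V.isOpen (gVar B)), sRestrict_mul hρ (hE A B),
      sRestrict_lD, ← hr]
    rfl
  have h2 := congrArg (SuperFun.eval x) (slapMin_apply (SC ε₀ ε₁ V)
      (fun A B => sRestrict V (E A B) (hE A B)) (sRestrict V ρ hρ) r'
      (sRestrict V f hf))
  rw [slap_apply] at h2
  simp only [map_add, map_sum, map_smul, SuperFun.eval_apply, ← h0, ← h1] at h2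
  rw [h2]
  simp only [lapMin, lap, Pi.add_apply, Finset.sum_apply, Pi.smul_apply]

theorem inverse_val {f g : SF ε₀ ε₁ V} (h1 : f * g = 1) (h2 : g * f = 1)
    (x : V) : g.1 x = Ring.inverse (f.1 x) := by
  have h3 : f.1 x * g.1 x = 1 := congrArg (fun a : SF ε₀ ε₁ V => a.1 x) h1
  have h4 : g.1 x * f.1 x = 1 := congrArg (fun a : SF ε₀ ε₁ V => a.1 x) h2
  exact (Ring.inverse_unit ⟨f.1 x, g.1 x, h3, h4⟩).symm

theorem IsCompatible.exists_isBivector (hE : IsCompatible U E ρ) (hV : (V : Set (Fin N → ℝ)) ⊆ U) :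
    ∃ r', (∀ x : V, r'.1 x = Ring.inverse (ρ x)) ∧ IsBivector (gammaPart ε₀ ε₁ V)
      (fun A B => ((hE.isFn A B).of_subset hV).toSuperFun) (hE.density.of_subset hV).toSuperFun r' := by
  have h0 : ∀ x : V, body ((hE.density.of_subset hV).toSuperFun.1 x) ≠ 0 := fun x =>
    ((hE.density_isUnit x (hV x.2)).map (bodyHom _)).ne_zero
  obtain ⟨r', h1, h2⟩ := exists_inverse even_mem_compl_gammaVars
    (hE.density.of_subset hV).gammaPart h0
  refine ⟨r', inverse_val h1 h2, ?_⟩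
  exact
  { homog := fun A B => ((hE.isFn A B).of_subset hV).isHomog
    setZero := fun A B => ((hE.isFn A B).of_subset hV).gammaPart
    skew := fun A B => SuperFun.ext fun x => hE.skew A B x (hV x.2)
    density_homog := (hE.density.of_subset hV).isHomog
    density_setZero := (hE.density.of_subset hV).gammaPart
    inverse_setZero := map_eq_self_of_inverse _ h1 h2 (hE.density.of_subset hV).gammaPart
    inverse_mul := h2 }

theorem IsCompatible.jacobi_superFun (hE : IsCompatible U E ρ)
    (hV : (V : Set (Fin N → ℝ)) ⊆ U) {e₁ e₂ e₃ : ZMod 2} {f g h : Fun N ε₀ ε₁}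
    (hf : IsFn U gammaVars e₁ f) (hg : IsFn U gammaVars e₂ g) (hh : IsFn U gammaVars e₃ h) :
    sg ((e₁ + 1) * (e₃ + 1)) • sbr (SC ε₀ ε₁ V)
        (fun A B => ((hE.isFn A B).of_subset hV).toSuperFun) (hf.of_subset hV).toSuperFun
        (sbr (SC ε₀ ε₁ V)
          (fun A B => ((hE.isFn A B).of_subset hV).toSuperFun) (hg.of_subset hV).toSuperFun
          (hh.of_subset hV).toSuperFun) +
      sg ((e₂ + 1) * (e₁ + 1)) • sbr (SC ε₀ ε₁ V)
        (fun A B => ((hE.isFn A B).of_subset hV).toSuperFun) (hg.of_subset hV).toSuperFun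
        (sbr (SC ε₀ ε₁ V)
          (fun A B => ((hE.isFn A B).of_subset hV).toSuperFun) (hh.of_subset hV).toSuperFun
          (hf.of_subset hV).toSuperFun) +
      sg ((e₃ + 1) * (e₂ + 1)) • sbr (SC ε₀ ε₁ V)
        (fun A B => ((hE.isFn A B).of_subset hV).toSuperFun) (hh.of_subset hV).toSuperFun
        (sbr (SC ε₀ ε₁ V)
          (fun A B => ((hE.isFn A B).of_subset hV).toSuperFun) (hf.of_subset hV).toSuperFun
          (hg.of_subset hV).toSuperFun) = 0 := by
  have hEs : ∀ A B, IsSmooth (V : Set (Fin N → ℝ)) (E A B) := fun A B =>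
    ((hE.isFn A B).of_subset hV).smooth
  have hb : ∀ {e e' : ZMod 2} {f g : Fun N ε₀ ε₁} (hf : IsFn U gammaVars e f)
      (hg : IsFn U gammaVars e' g), sbr (SC ε₀ ε₁ V)
        (fun A B => sRestrict V (E A B) (hEs A B)) (hf.of_subset hV).toSuperFun
        (hg.of_subset hV).toSuperFun = sRestrict V (bracket E f g)
          (isSmooth_bracket hEs (hf.of_subset hV).smooth (hg.of_subset hV).smooth) :=
    fun hf hg => SuperFun.ext fun x => (bracket_apply hEs _ _ x).symm
  have hbb : ∀ {e e' e'' : ZMod 2} {f g h : Fun N ε₀ ε₁} (hf : IsFn U gammaVars e f)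
      (hg : IsFn U gammaVars e' g) (hh : IsFn U gammaVars e'' h) (x : V),
      (sbr (SC ε₀ ε₁ V)
        (fun A B => sRestrict V (E A B) (hEs A B)) (hf.of_subset hV).toSuperFun
        (sbr (SC ε₀ ε₁ V)
        (fun A B => sRestrict V (E A B) (hEs A B)) (hg.of_subset hV).toSuperFun
        (hh.of_subset hV).toSuperFun)).1 x = bracket E f (bracket E g h) x := by
    intro e e' e'' f g h hf hg hh x
    rw [hb hg hh]
    exact (bracket_apply hEs _ _ x).symm
  refine SuperFun.ext fun x => ?_
  refine Eq.trans ?_ (hE.jacobi e₁ e₂ e₃ f g h hf hg hh x (hV x.2))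
  rw [← hbb hf hg hh, ← hbb hg hh hf, ← hbb hh hf hg]
  rfl

variable {X : ℕ → Fun N ε₀ ε₁}

theorem IsMinAction.exists_isQuantumAction (hX : IsMinAction U X) (hE : IsCompatible U E ρ)
    (hV : (V : Set (Fin N → ℝ)) ⊆ U) (hQ : QuantumMasterEquation U E ρ X) :
    ∃ r' f, (∀ x : V, r'.1 x = Ring.inverse (ρ x)) ∧
      IsQuantumAction (SC ε₀ ε₁ V) (gammaPart ε₀ ε₁ V) (PlanckRel ε₀ ε₁ V)
        (fun A B => ((hE.isFn A B).of_subset hV).toSuperFun) (hE.density.of_subset hV).toSuperFun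
        r' f ((hX.isFn 0).of_subset hV).toSuperFun ((hX.isFn 1).of_subset hV).toSuperFun := by
  obtain ⟨r', hr', hb⟩ := hE.exists_isBivector hV
  obtain ⟨hs, ha⟩ := isSmooth_actionSum (pl := planck) (U := (V : Set (Fin N → ℝ)))
    (fun k => ((hX.isFn k).of_subset hV).smooth) fun k x hx => hX.planck_eq k x (hV hx)
  set f : SF ε₀ ε₁ V := sRestrict V (actionAt X 1) hs with hf
  have happ : ∀ k, ∃ K, ∀ K' ≥ K, f - ∑ i ∈ Finset.range K', Complex.I ^ i •
      ((hX.isFn i).of_subset hV).toSuperFun ∈ superLow V (par (N := N) ε₀ ε₁) k := by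
    intro k
    obtain ⟨K, hK⟩ := ha k
    refine ⟨K, fun K' hK' x => ?_⟩
    have h1 := hK K' hK' x x.2
    rw [← SuperFun.eval_apply, map_sub, map_sum]
    simp only [map_smul]
    exact h1
  have hf0 : IsHomog 0 f := by
    rw [isHomog_zero_iff]
    refine sub_eq_zero.1 (eq_zero_of_forall_mem_superLow fun k => ?_)
    obtain ⟨K, hK⟩ := happ k
    have h1 := hK K le_rfl
    have h2 := twist_mem_superLow 1 h1
    have h3 : IsHomog 0 (∑ i ∈ Finset.range K, Complex.I ^ i •
      ((hX.isFn i).of_subset hV).toSuperFun) := IsHomog.sum fun i _ =>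
        (((hX.isFn i).of_subset hV).isHomog).smul _
    rw [map_sub, twist_one, twist_one, isHomog_zero_iff.1 h3] at h2
    have := sub_mem h2 h1
    rwa [sub_sub_sub_cancel_right] at this
  refine ⟨r', f, hr', ?_⟩
  have hw : IsHomog 0 (Complex.I • f) := hf0.smul _
  exact
  { reduction := isReduction_gammaPart ε₀ ε₁ V
    rel := isPlanckRel_planckRel ε₀ ε₁ V
    bivector := hb
    homog := hf0
    homog_zero := ((hX.isFn 0).of_subset hV).isHomog
    expansion := ⟨fun k => ((hX.isFn k).of_subset hV).toSuperFun,
      { euler := fun k => SuperFun.ext fun x => by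
          rw [superEuler_apply, ← SuperFun.eval_apply, map_sum]
          simp only [map_smul, map_mul, SuperFun.eval_apply]
          refine Eq.trans (sum_congr rfl fun w _ => ?_) ((hX.planck_eq k x (hV x.2)).trans ?_)
          · rw [lD_apply _ _ ((hX.isFn k).of_subset hV).smooth]
            rfl
          · rw [Int.cast_one]
            rfl
        approx := happ }, rfl, rfl⟩
    master := by
      have h1 := slapMin_exp (SC ε₀ ε₁ V) hb hw (fun v => D_superExp hw v)
      have h2 : slapMin (SC ε₀ ε₁ V)
          (fun A B => ((hE.isFn A B).of_subset hV).toSuperFun)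
          (hE.density.of_subset hV).toSuperFun r' (superExp (Complex.I • f)) = 0 := by
        have h3 : ∀ x ∈ (V : Set (Fin N → ℝ)), (superExp (Complex.I • f)).ext' x =
            sexp ((Complex.I / ((1 : ℝ) : ℂ)) • actionAt X 1 x) := by
          intro x hx
          rw [SuperFun.ext'_apply _ ⟨x, hx⟩, superExp_val, Complex.ofReal_one, div_one]
          rfl
        have h4 : IsSmooth (V : Set (Fin N → ℝ))
            (fun x => sexp ((Complex.I / ((1 : ℝ) : ℂ)) • actionAt X 1 x)) :=
          (superExp (Complex.I • f)).smooth.congr fun x hx => (h3 x hx).symm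
        have h5 : superExp (Complex.I • f) = sRestrict V _ h4 := SuperFun.ext fun x => by
          rw [← SuperFun.ext'_apply, h3 x x.2]
          rfl
        refine SuperFun.ext fun x => ?_
        rw [h5]
        exact (lapMin_apply (fun A B => ((hE.isFn A B).of_subset hV).smooth)
          (hE.density.of_subset hV).smooth h4 hr' x).symm.trans (hQ 1 one_ne_zero x (hV x.2))
      rw [h2] at h1
      refine SuperFun.ext fun x => ?_
      have h6 : (qme (SC ε₀ ε₁ V)
          (fun A B => ((hE.isFn A B).of_subset hV).toSuperFun)
          (hE.density.of_subset hV).toSuperFun r' (Complex.I • f)).1 x *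
            (superExp (Complex.I • f)).1 x = 0 :=
        (congrArg (fun a : SF ε₀ ε₁ V => a.1 x) h1).symm
      rw [superExp_val] at h6
      exact (isUnit_sexp _).mul_left_eq_zero.1 h6 }

end Concrete

/-! ### The data of the theorem as superfunctions on an open set -/

section VarMul

variable {V : Opens (Fin n → ℝ)} {T : Set W} {w : W}

theorem zeroing_D_superVar_mul (hw : w ∈ T) (v : Fin n ⊕ W) (g : SuperFun V p) :
    zeroing T ((funCalculus V p).D v (superVar V p w * g)) =
      if v = .inr w then zeroing T g else 0 := by
  rw [SuperCalculus.D_mul, D_superVar, (isHomog_superVar w).twist_eq, map_add, map_mul, map_mul,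
    map_smul, zeroing_superVar hw, smul_zero, zero_mul, add_zero]
  split_ifs
  · rw [map_one, one_mul]
  · rw [map_zero, zero_mul]

end VarMul

section Setting

/-- The hypotheses on the data of the theorem. -/
structure IsSetting (U : Set (Fin N → ℝ)) (E : Fin N ⊕ Fin N → Fin N ⊕ Fin N → Fun N ε₀ ε₁)
    (ρ : Fun N ε₀ ε₁) (X : ℕ → Fun N ε₀ ε₁) (ω : Fin N₁ → Fin N₀ → Fun N ε₀ ε₁)
    (F : Fin N₀ → Fun N ε₀ ε₁) (e : Fin N₀ ⊕ Fin N₀ ≃ (Fin N ⊕ Fin N) ⊕ (Fin N₁ ⊕ Fin N₁)) :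
    Prop where
  isOpen : IsOpen U
  compatible : IsCompatible U E ρ
  action : IsMinAction U X
  master : QuantumMasterEquation U E ρ X
  real : ∀ α, ∀ x ∈ U, (body (constraint X α x)).im = 0
  isFn_ω : ∀ a α, IsFn U gammaVars (ε₀ α + ε₁ a) (ω a α)
  isUnit_faddeevPopov : ∀ x ∈ U, IsUnit (faddeevPopov X ω x)
  isFn_F : ∀ α, IsFn U extVars (ε₀ α + 1) (F α)
  parity : ∀ r, extPar ε₁ (e r) = newPar ε₀ r
  isUnit_jacobian : ∀ x ∈ U, IsUnit (jacobian X ω F e x)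

variable {U : Set (Fin N → ℝ)} {E : Fin N ⊕ Fin N → Fin N ⊕ Fin N → Fun N ε₀ ε₁}
  {ρ : Fun N ε₀ ε₁} {X : ℕ → Fun N ε₀ ε₁} {ω : Fin N₁ → Fin N₀ → Fun N ε₀ ε₁}
  {F : Fin N₀ → Fun N ε₀ ε₁} {e : Fin N₀ ⊕ Fin N₀ ≃ (Fin N ⊕ Fin N) ⊕ (Fin N₁ ⊕ Fin N₁)}
  (S : IsSetting U E ρ X ω F e) {V : Opens (Fin N → ℝ)} (hV : (V : Set (Fin N → ℝ)) ⊆ U)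

namespace IsSetting

/-- The coefficients of the action. -/
def act (n : ℕ) : SF ε₀ ε₁ V := ((S.action.isFn n).of_subset hV).toSuperFun

/-- The bivector. -/
def biv (A B : Fin N ⊕ Fin N) : SF ε₀ ε₁ V :=
  ((S.compatible.isFn A B).of_subset hV).toSuperFun

/-- The constraints. -/
def con (α : Fin N₀) : SF ε₀ ε₁ V :=
  cons (SC ε₀ ε₁ V) (gammaPart ε₀ ε₁ V) (S.act hV 0) α

/-- The reducibility matrix. -/
def red : Matrix (Fin N₀) (Fin N₁) (SF ε₀ ε₁ V) :=
  redMat (SC ε₀ ε₁ V) (gammaPart ε₀ ε₁ V) (S.act hV 0)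

/-- The matrix deforming the constraints. -/
def om : Matrix (Fin N₁) (Fin N₀) (SF ε₀ ε₁ V) :=
  Matrix.of fun a α => ((S.isFn_ω a α).of_subset hV).toSuperFun

/-- The functions `F`. -/
def fld (α : Fin N₀) : SF ε₀ ε₁ V := ((S.isFn_F α).of_subset hV).toSuperFun

/-- The functions `F` at `π = π* = 0`. -/
def fld₀ (α : Fin N₀) : SF ε₀ ε₁ V := zeroing piVars (S.fld hV α)

/-- The derivatives of `F` along `π` at `π = π* = 0`. -/
def fldP : Matrix (Fin N₀) (Fin N₁) (SF ε₀ ε₁ V) :=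
  Matrix.of fun α a => zeroing piVars
    ((SC ε₀ ε₁ V).DR (.inr (.pi a)) (S.fld hV α))

/-- The derivatives of `F` along `π*` at `π = π* = 0`. -/
def fldS : Matrix (Fin N₀) (Fin N₁) (SF ε₀ ε₁ V) :=
  Matrix.of fun α a => zeroing piVars
    ((SC ε₀ ε₁ V).DR (.inr (.piS a)) (S.fld hV α))

/-- The deformed constraints. -/
def dfm (α : Fin N₀) : SF ε₀ ε₁ V :=
  S.con hV α + ∑ a, superVar V (par (N := N) ε₀ ε₁) (.pi a) * S.om hV a α

/-- The Jacobian matrix at `π = π* = 0`. -/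
def jac : Matrix (Fin N₀ ⊕ Fin N₀) ((Fin N ⊕ Fin N) ⊕ (Fin N₁ ⊕ Fin N₁))
    (SF ε₀ ε₁ V) :=
  jacExt (SC ε₀ ε₁ V) (S.fld₀ hV) (S.con hV) (S.fldP hV) (S.fldS hV)
    (S.om hV)

/-- The matrix of brackets at `π = π* = 0`. -/
def brk : Matrix (Fin N₀) (Fin N₀) (SF ε₀ ε₁ V) :=
  brMat (SC ε₀ ε₁ V) (S.biv hV) (S.fld₀ hV) (S.con hV) (S.fldS hV)
    (S.om hV)

/-- The Faddeev–Popov matrix. -/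
def fp : Matrix (Fin N₁) (Fin N₁) (SF ε₀ ε₁ V) := S.om hV * S.red hV

end IsSetting

theorem zeroing_piVars_of_gammaPart {f : SF ε₀ ε₁ V}
    (h : gammaPart ε₀ ε₁ V f = f) : zeroing piVars f = f := by
  have h1 : (piVars : Set (Fld N N₀ N₁)) ⊆ gammaVarsᶜ := by
    rintro w ⟨a, rfl | rfl⟩ ⟨i, hi⟩ <;> cases hi
  rw [← h, zeroing_zeroing, Set.union_eq_self_of_subset_left h1]

theorem zeroing_levelOneVars {f : SF ε₀ ε₁ V}
    (h : zeroing piVars f = f) : zeroing levelOneVars f = gammaPart ε₀ ε₁ V f := by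
  have h1 : (levelOneVars ∪ piVars : Set (Fld N N₀ N₁)) = gammaVarsᶜ := by
    ext w
    cases w <;> simp [levelOneVars, piVars, gammaVars]
  conv_lhs => rw [← h]
  rw [zeroing_zeroing, h1]

theorem zeroing_piVars_eq_gammaPart {f : SF ε₀ ε₁ V}
    (h : zeroing levelOneVars f = f) : zeroing piVars f = gammaPart ε₀ ε₁ V f := by
  have h1 : (piVars ∪ levelOneVars : Set (Fld N N₀ N₁)) = gammaVarsᶜ := by
    ext w
    cases w <;> simp [levelOneVars, piVars, gammaVars]
  conv_lhs => rw [← h]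
  rw [zeroing_zeroing, h1]

theorem gammaPart_zeroing_piVars {f : SF ε₀ ε₁ V}
    (h : zeroing levelOneVars f = f) :
    gammaPart ε₀ ε₁ V (zeroing piVars f) = zeroing piVars f := by
  rw [zeroing_piVars_eq_gammaPart h, zeroing_zeroing, Set.union_self]

namespace IsSetting

theorem act_piVars (n : ℕ) : zeroing piVars (S.act hV n) = S.act hV n := by
  refine IsFn.zeroing _ ?_
  rintro w ⟨a, rfl | rfl⟩ (⟨i, hi⟩ | ⟨i, hi | hi⟩ | ⟨i, hi | hi⟩) <;> cases hi

theorem DR_act_piVars (n : ℕ) {v : Fin N ⊕ Fld N N₀ N₁} (hv : ∀ w ∈ piVars, v ≠ .inr w) :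
    zeroing piVars ((SC ε₀ ε₁ V).DR v (S.act hV n)) =
      (SC ε₀ ε₁ V).DR v (S.act hV n) := by
  rw [← DR_zeroing hv, act_piVars]

theorem con_val (α : Fin N₀) (x : V) : (S.con hV α).1 x = constraint X α x := by
  have h1 : ∀ w ∈ piVars, (.inr (.lam α) : Fin N ⊕ Fld N N₀ N₁) ≠ .inr w := by
    rintro w ⟨a, rfl | rfl⟩ h <;> cases h
  rw [con, cons, ← zeroing_levelOneVars (S.DR_act_piVars hV 0 h1), zeroing_val,
    constraint, rD_apply _ _ ((S.action.isFn 0).of_subset hV).smooth]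
  rfl

theorem gammaPart_act_one_val (x : V) :
    (gammaPart ε₀ ε₁ V (S.act hV 1)).1 x = quantumCorrection X x := by
  rw [← zeroing_levelOneVars (S.act_piVars hV 1)]
  rfl

theorem red_val (α : Fin N₀) (a : Fin N₁) (x : V) :
    (S.red hV α a).1 x = reducibility X α a x := by
  have h1 : ∀ w ∈ piVars, (.inr (.c a) : Fin N ⊕ Fld N N₀ N₁) ≠ .inr w := by
    rintro w ⟨a, rfl | rfl⟩ h <;> cases h
  have h2 : ∀ w ∈ piVars, (.inr (.lamS α) : Fin N ⊕ Fld N N₀ N₁) ≠ .inr w := by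
    rintro w ⟨a, rfl | rfl⟩ h <;> cases h
  have h3 : zeroing piVars ((SC ε₀ ε₁ V).D (.inr (.lamS α))
      ((SC ε₀ ε₁ V).DR (.inr (.c a)) (S.act hV 0))) =
      (SC ε₀ ε₁ V).D (.inr (.lamS α))
      ((SC ε₀ ε₁ V).DR (.inr (.c a)) (S.act hV 0)) := by
    rw [← D_zeroing h2, DR_act_piVars S hV 0 h1]
  have h4 : IsSmooth (V : Set (Fin N → ℝ)) (X 0) := ((S.action.isFn 0).of_subset hV).smooth
  rw [red, redMat, of_apply, ← zeroing_levelOneVars h3, zeroing_val,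
    reducibility, lD_apply _ _ (h4.rD V.isOpen _), sRestrict_rD h4]
  rfl

theorem gammaPart_con (α : Fin N₀) : gammaPart ε₀ ε₁ V (S.con hV α) = S.con hV α :=
  (isReduction_gammaPart ε₀ ε₁ V).idem _

theorem gammaPart_red (α : Fin N₀) (a : Fin N₁) :
    gammaPart ε₀ ε₁ V (S.red hV α a) = S.red hV α a :=
  (isReduction_gammaPart ε₀ ε₁ V).idem _

theorem gammaPart_om (a : Fin N₁) (α : Fin N₀) :
    gammaPart ε₀ ε₁ V (S.om hV a α) = S.om hV a α :=
  ((S.isFn_ω a α).of_subset hV).gammaPart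

theorem gammaPart_biv (A B : Fin N ⊕ Fin N) :
    gammaPart ε₀ ε₁ V (S.biv hV A B) = S.biv hV A B :=
  ((S.compatible.isFn A B).of_subset hV).gammaPart

theorem fld_levelOneVars (α : Fin N₀) :
    zeroing levelOneVars (S.fld hV α) = S.fld hV α := by
  refine IsFn.zeroing _ ?_
  rintro w (⟨a, rfl | rfl⟩ | ⟨a, rfl | rfl⟩) (⟨i, hi⟩ | ⟨i, hi | hi⟩) <;> cases hi

theorem gammaPart_fld₀ (α : Fin N₀) : gammaPart ε₀ ε₁ V (S.fld₀ hV α) = S.fld₀ hV α :=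
  gammaPart_zeroing_piVars (S.fld_levelOneVars hV α)

theorem gammaPart_fldP (α : Fin N₀) (a : Fin N₁) :
    gammaPart ε₀ ε₁ V (S.fldP hV α a) = S.fldP hV α a := by
  refine gammaPart_zeroing_piVars ?_
  have h : ∀ w ∈ levelOneVars, (.inr (.pi a) : Fin N ⊕ Fld N N₀ N₁) ≠ .inr w := by
    rintro w (⟨a, rfl | rfl⟩ | ⟨a, rfl | rfl⟩) h <;> cases h
  rw [← DR_zeroing h, fld_levelOneVars]

theorem gammaPart_fldS (α : Fin N₀) (a : Fin N₁) :
    gammaPart ε₀ ε₁ V (S.fldS hV α a) = S.fldS hV α a := by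
  refine gammaPart_zeroing_piVars ?_
  have h : ∀ w ∈ levelOneVars, (.inr (.piS a) : Fin N ⊕ Fld N N₀ N₁) ≠ .inr w := by
    rintro w (⟨a, rfl | rfl⟩ | ⟨a, rfl | rfl⟩) h <;> cases h
  rw [← DR_zeroing h, fld_levelOneVars]

theorem isHomog_act (n : ℕ) : IsHomog 0 (S.act hV n) :=
  ((S.action.isFn n).of_subset hV).isHomog

theorem isHomog_con (α : Fin N₀) : IsHomog (ε₀ α) (S.con hV α) := by
  have h := (SC ε₀ ε₁ V).isHomog_DR (S.isHomog_act hV 0) (.inr (.lam α))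
  rw [zero_add] at h
  exact IsHomog.zeroing h _

theorem isHomog_fld₀ (α : Fin N₀) : IsHomog (ε₀ α + 1) (S.fld₀ hV α) :=
  IsHomog.zeroing ((S.isFn_F α).of_subset hV).isHomog _

theorem isMat_om : IsMat 0 ε₁ ε₀ (S.om hV) := fun a α => by
  rw [add_zero, add_comm]
  exact ((S.isFn_ω a α).of_subset hV).isHomog

theorem isMat_fldS : IsMat 0 ε₀ ε₁ (S.fldS hV) := fun α a => by
  have h := (SC ε₀ ε₁ V).isHomog_DR
    (((S.isFn_F α).of_subset hV).isHomog) (.inr (.piS a))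
  change IsHomog (ε₀ α + 1 + (ε₁ a + 1)) _ at h
  have h' : ε₀ α + 1 + (ε₁ a + 1) = ε₀ α + ε₁ a + 0 := by
    generalize ε₀ α = x; generalize ε₁ a = y; clear * -; decide +revert
  rw [h'] at h
  exact IsHomog.zeroing h _

theorem isMat_red : IsMat 0 ε₀ ε₁ (S.red hV) := fun α a => by
  have h := (SC ε₀ ε₁ V).isHomog_D
    ((SC ε₀ ε₁ V).isHomog_DR (S.isHomog_act hV 0) (.inr (.c a)))
    (.inr (.lamS α))
  change IsHomog (0 + (ε₁ a + 1) + (ε₀ α + 1)) _ at h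
  have h' : 0 + (ε₁ a + 1) + (ε₀ α + 1) = ε₀ α + ε₁ a + 0 := by
    generalize ε₀ α = x; generalize ε₁ a = y; clear * -; decide +revert
  rw [h'] at h
  exact IsHomog.zeroing h _

theorem isMat_fp : IsMat 0 ε₁ ε₁ (S.fp hV) := (S.isMat_om hV).mul (S.isMat_red hV)

theorem gammaPart_fp (a b : Fin N₁) : gammaPart ε₀ ε₁ V (S.fp hV a b) = S.fp hV a b := by
  simp only [fp, Matrix.mul_apply, map_sum, map_mul, gammaPart_om, gammaPart_red]

theorem fp_val (x : V) : (S.fp hV).map (SuperFun.eval x) = faddeevPopov X ω x := by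
  ext1 a b
  simp only [fp, map_apply, Matrix.mul_apply, map_sum, map_mul, SuperFun.eval_apply,
    red_val, faddeevPopov, of_apply]
  rfl

theorem dfm_val (α : Fin N₀) (x : V) : (S.dfm hV α).1 x = deformed X ω α x := by
  rw [dfm, ← SuperFun.eval_apply, map_add, map_sum]
  simp only [map_mul, SuperFun.eval_apply, con_val, deformed, Pi.add_apply, Finset.sum_apply,
    Pi.mul_apply]
  rfl

/-- The functions `{F; G_ω}`. -/
def new : Fin N₀ ⊕ Fin N₀ → SF ε₀ ε₁ V := Sum.elim (S.fld hV) (S.dfm hV)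

theorem new_val (r : Fin N₀ ⊕ Fin N₀) (x : V) : (S.new hV r).1 x = newCoord X ω F r x := by
  rcases r with α | α
  · rfl
  · exact S.dfm_val hV α x

theorem isHomog_dfm (α : Fin N₀) : IsHomog (ε₀ α) (S.dfm hV α) := by
  have h : ∀ a, IsHomog (ε₀ α) (superVar V (par (N := N) ε₀ ε₁) (.pi a) * S.om hV a α) := by
    intro a
    have h1 : IsHomog (ε₁ a) (superVar V (par (N := N) ε₀ ε₁) (.pi a)) :=
      isHomog_superVar (Fld.pi a)
    have h2 : IsHomog (ε₁ a + ε₀ α + 0) (S.om hV a α) := S.isMat_om hV a α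
    have h3 : ε₁ a + (ε₁ a + ε₀ α + 0) = ε₀ α := by
      generalize ε₀ α = x; generalize ε₁ a = y; clear * -; decide +revert
    exact h1.mul_of_eq h2 h3
  have h4 : IsHomog (ε₀ α) (∑ a, superVar V (par (N := N) ε₀ ε₁) (.pi a) * S.om hV a α) :=
    IsHomog.sum fun a _ => h a
  exact (S.isHomog_con hV α).add h4

theorem piVars_con (α : Fin N₀) : zeroing piVars (S.con hV α) = S.con hV α :=
  zeroing_piVars_of_gammaPart (S.gammaPart_con hV α)

theorem piVars_om (a : Fin N₁) (α : Fin N₀) : zeroing piVars (S.om hV a α) = S.om hV a α :=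
  zeroing_piVars_of_gammaPart (S.gammaPart_om hV a α)

theorem pi_mem (a : Fin N₁) : (.pi a : Fld N N₀ N₁) ∈ piVars := ⟨a, .inl rfl⟩

theorem piS_mem (a : Fin N₁) : (.piS a : Fld N N₀ N₁) ∈ piVars := ⟨a, .inr rfl⟩

theorem gVar_ne_piVars (A : Fin N ⊕ Fin N) (w : Fld N N₀ N₁) (hw : w ∈ piVars) :
    gVar A ≠ .inr w := by
  refine gVar_ne A w ?_
  obtain ⟨a, rfl | rfl⟩ := hw <;> rintro ⟨i, hi⟩ <;> cases hi

theorem D_con_of_mem {w : Fld N N₀ N₁} (hw : w ∈ piVars) (α : Fin N₀) :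
    (SC ε₀ ε₁ V).D (.inr w) (S.con hV α) = 0 := by
  rw [← piVars_con, D_zeroing_of_mem hw]

theorem piVars_dfm (α : Fin N₀) : zeroing piVars (S.dfm hV α) = S.con hV α := by
  rw [dfm, map_add, map_sum, sum_eq_zero, add_zero, piVars_con]
  intro a _
  rw [map_mul, zeroing_superVar (pi_mem a), zero_mul]

theorem piVars_D_pi_dfm (a : Fin N₁) (α : Fin N₀) :
    zeroing piVars ((SC ε₀ ε₁ V).D (.inr (.pi a)) (S.dfm hV α)) =
      S.om hV a α := by
  rw [dfm, map_add, D_con_of_mem S hV (pi_mem a), zero_add, map_sum, map_sum,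
    sum_eq_single a]
  · rw [zeroing_D_superVar_mul (pi_mem a), if_pos rfl, piVars_om]
  · intro b _ hb
    rw [zeroing_D_superVar_mul (pi_mem b), if_neg]
    intro h
    cases h
    exact hb rfl
  · simp

theorem piVars_D_piS_dfm (a : Fin N₁) (α : Fin N₀) :
    zeroing piVars ((SC ε₀ ε₁ V).D (.inr (.piS a)) (S.dfm hV α)) =
      0 := by
  rw [dfm, map_add, D_con_of_mem S hV (piS_mem a), zero_add, map_sum, map_sum,
    sum_eq_zero]
  intro b _
  rw [zeroing_D_superVar_mul (pi_mem b), if_neg]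
  intro h
  cases h

theorem piVars_DR_new (r : Fin N₀ ⊕ Fin N₀) (s : (Fin N ⊕ Fin N) ⊕ (Fin N₁ ⊕ Fin N₁)) :
    zeroing piVars ((SC ε₀ ε₁ V).DR (extVar s) (S.new hV r)) =
      S.jac hV r s := by
  rcases r with α | α <;> rcases s with A | a | a
  · exact (DR_zeroing (gVar_ne_piVars A) _).symm
  · rfl
  · rfl
  · refine (DR_zeroing (gVar_ne_piVars A) _).symm.trans ?_
    change (SC ε₀ ε₁ V).DR (gVar A) (zeroing piVars (S.dfm hV α)) = _
    rw [piVars_dfm]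
    rfl
  · change zeroing piVars ((SC ε₀ ε₁ V).DR (.inr (.pi a))
      (S.dfm hV α)) = supT ε₁ ε₀ (S.om hV) α a
    rw [SuperCalculus.DR_apply, zeroing_twist, piVars_D_pi_dfm, (S.isMat_om hV a α).twist_eq,
      add_zero]
    rfl
  · change zeroing piVars ((SC ε₀ ε₁ V).DR (.inr (.piS a))
      (S.dfm hV α)) = 0
    rw [SuperCalculus.DR_apply, zeroing_twist, piVars_D_piS_dfm, map_zero]

theorem jac_val (x : V) : ((S.jac hV).submatrix id e).map (SuperFun.eval x) =
    (jacobian X ω F e x).map (setZeroHom piVars) := by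
  ext1 r s
  rw [map_apply, submatrix_apply, id_eq, ← piVars_DR_new]
  refine congrArg (setZero piVars) ?_
  have h : IsSmooth (V : Set (Fin N → ℝ)) (newCoord X ω F r) :=
    (S.new hV r).smooth.congr fun y hy => by
      rw [SuperFun.ext'_apply _ ⟨y, hy⟩]
      exact (S.new_val hV r ⟨y, hy⟩).symm
  rw [jacobian, of_apply, rD_apply _ _ h]
  have h1 : sRestrict V _ h = S.new hV r := SuperFun.ext fun y => (S.new_val hV r y).symm
  rw [h1]

end IsSetting

end Setting

/-! ### The radicand -/

section Abstract

variable {R : Type} [Ring R] [Algebra ℂ R] [SuperAlgebra R] {ι : Type} [Fintype ι] [DecidableEq ι]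
  {e : ι → ZMod 2} {M M' : Matrix ι ι R}

theorem map_sdet_ne_zero (β : R →ₐ[ℂ] ℂ) (hβ : ∀ a, IsHomog 1 a → β a = 0)
    (hM : IsMat 0 e e M) (h : M * M' = 1) (hD : IsUnit (evenBlock hM 1).det) :
    β (sdet e M) ≠ 0 := by
  have h0 := map_det_oddBlock_ne_zero β hβ hM h 0
  obtain ⟨u, hu⟩ := hD
  have hdet : (evenBlock hM 1).det * ((u⁻¹ : (evenPart R)ˣ) : evenPart R) = 1 := by
    rw [← hu, Units.mul_inv]
  rw [sdet_eq_map (evenPart R).subtype (fun k => even_mem_center (mem_evenPart.1 k.2)) M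
    (evenBlock hM 1) (evenBlock hM 1)⁻¹ (schur hM (evenBlock hM 1)⁻¹) _ (fun a b => rfl)
    (Matrix.mul_nonsing_inv _ (hu ▸ u.isUnit)) hdet rfl]
  set γ : evenPart R →+* ℂ := β.toRingHom.comp (evenPart R).subtype with hγ
  change γ ((schur hM (evenBlock hM 1)⁻¹).det * ((u⁻¹ : (evenPart R)ˣ) : evenPart R)) ≠ 0
  rw [map_mul]
  refine mul_ne_zero ?_ ((u⁻¹).isUnit.map γ).ne_zero
  have h1 : γ.mapMatrix (schur hM (evenBlock hM 1)⁻¹) = γ.mapMatrix (evenBlock hM 0) := by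
    ext a b
    change β (M a.1 b.1 - ∑ c : {i // e i = 1}, _ * M c.1 b.1) = β (M a.1 b.1)
    rw [map_sub, map_sum, sum_eq_zero, sub_zero]
    intro c _
    have h2 : IsHomog 1 (M c.1 b.1) := by
      have := hM c.1 b.1
      rwa [c.2, b.2, add_zero, add_zero] at this
    rw [map_mul, hβ _ h2, mul_zero]
  rw [RingHom.map_det, h1, ← RingHom.map_det]
  exact h0

theorem map_sdet_eq_self (φ : R →ₐ[ℂ] R) (hφ : ∀ a, invol (φ a) = φ (invol a))
    (hM : IsMat 0 e e M) (hD : IsUnit (evenBlock hM 1).det) (h : ∀ i j, φ (M i j) = M i j) :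
    φ (sdet e M) = sdet e M := by
  have h1 : M.map φ = M := by
    ext i j : 1
    exact h i j
  rw [← sdet_map φ hφ hM hD, h1]

theorem map_det_evenBlock_congr {R' : Type} [Ring R'] [Algebra ℂ R'] [SuperAlgebra R']
    (β : R →ₐ[ℂ] ℂ) (β' : R' →ₐ[ℂ] ℂ) {M' : Matrix ι ι R'} (hM : IsMat 0 e e M)
    (hM' : IsMat 0 e e M') (h : M.map β = M'.map β') (f : ZMod 2) :
    β (evenBlock hM f).det = β' (evenBlock hM' f).det := by
  have h1 := RingHom.map_det ((β : R →+* ℂ).comp (evenPart R).subtype) (evenBlock hM f)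
  have h2 := RingHom.map_det ((β' : R' →+* ℂ).comp (evenPart R').subtype) (evenBlock hM' f)
  have h3 : ((β : R →+* ℂ).comp (evenPart R).subtype).mapMatrix (evenBlock hM f) =
      ((β' : R' →+* ℂ).comp (evenPart R').subtype).mapMatrix (evenBlock hM' f) := by
    ext a b
    exact congrFun (congrFun h a.1) b.1
  rw [h3, ← h2] at h1
  exact h1

theorem isUnit_det_evenBlock_of_ne_zero {W : Type} [Fintype W] [DecidableEq W] {p : W → ZMod 2}
    {M : Matrix ι ι (Ser p)} (hM : IsMat 0 e e M) (f : ZMod 2)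
    (h : bodyHom p (evenBlock hM f).det ≠ 0) : IsUnit (evenBlock hM f).det := by
  obtain ⟨w, hw⟩ := isUnit_of_body_ne_zero h
  refine isUnit_evenPart ⟨(w⁻¹).1, ?_, ?_⟩
  · rw [← hw, w.mul_inv]
  · rw [← hw, w.inv_mul]

theorem exists_quotient {Y : Type} (z : R →ₐ[ℂ] R) (β : Y → R →ₐ[ℂ] ℂ)
    (hinv : ∀ f, z f = f → (∀ x, β x f ≠ 0) → ∃ g, f * g = 1 ∧ g * f = 1) {r d j k : R}
    (hr : IsHomog 0 r) (hd : IsHomog 0 d) (hj : IsHomog 0 j) (hk : IsHomog 0 k)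
    (zr : z r = r) (zd : z d = d) (zj : z j = j) (zk : z k = k) (br : ∀ x, β x r ≠ 0)
    (bd : ∀ x, β x d ≠ 0) (bj : ∀ x, β x j ≠ 0) (bk : ∀ x, β x k ≠ 0) :
    ∃ s, r * d ^ 2 * s = 1 ∧ s * (r * d ^ 2) = 1 ∧ z s = s ∧ IsHomog 0 (j * k * s) ∧
      z (j * k * s) = j * k * s ∧ ∀ x, β x (j * k * s) ≠ 0 := by
  have hd2 : IsHomog 0 (r * d ^ 2) := by
    rw [pow_two]
    exact hr.mul_of_eq (hd.mul_of_eq hd (add_zero 0)) (add_zero 0)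
  have hz : z (r * d ^ 2) = r * d ^ 2 := by rw [map_mul, map_pow, zr, zd]
  obtain ⟨s, hs, hs'⟩ := hinv _ hz fun x => by
    rw [map_mul, map_pow]
    exact mul_ne_zero (br x) (pow_ne_zero 2 (bd x))
  have hsz := map_eq_self_of_inverse z hs hs' hz
  refine ⟨s, hs, hs', hsz, (hj.mul_of_eq hk (add_zero 0)).mul_of_eq (hd2.of_mul_eq_one hs)
    (add_zero 0), by rw [map_mul, map_mul, zj, zk, hsz], fun x => ?_⟩
  have h1 : β x s * β x (r * d ^ 2) = 1 := by rw [← map_mul, hs', map_one]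
  rw [map_mul, map_mul]
  exact mul_ne_zero (mul_ne_zero (bj x) (bk x)) (left_ne_zero_of_mul_eq_one h1)

end Abstract

/-! ### Invertibility of the matrix of brackets on the constraint surface -/

section Abstract

open Matrix
variable {R : Type} [Ring R] [Algebra ℂ R] [SuperAlgebra R] (𝒟 : SuperCalculus R (vPar N ε₀ ε₁))
  {E : Fin N ⊕ Fin N → Fin N ⊕ Fin N → R} {F G : Fin N₀ → R}
  {Fp Fs : Matrix (Fin N₀) (Fin N₁) R} {ω : Matrix (Fin N₁) (Fin N₀) R} (β : R →ₐ[ℂ] ℂ)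

theorem map_sg_smul_of_odd (hβ : ∀ a, IsHomog 1 a → β a = 0) {s t : ZMod 2} {a : R}
    (ha : IsHomog (s + t) a) : β (sg (s * (s + t)) • a) = β a := by
  rcases zmod2_cases (s + t) with h | h
  · rw [h, mul_zero, sg_zero, one_smul]
  · rw [map_smul, hβ a (h ▸ ha), smul_zero]

theorem eq_zero_of_brMat_mulVec (hβ : ∀ a, IsHomog 1 a → β a = 0)
    (hG : ∀ a, IsHomog (ε₀ a) (G a)) (hω : IsMat 0 ε₁ ε₀ ω)
    (hJ : ∀ y, (jacExt 𝒟 F G Fp Fs ω).map β *ᵥ y = 0 → y = 0)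
    (hJ' : ∀ y, y ᵥ* (jacExt 𝒟 F G Fp Fs ω).map β = 0 → y = 0)
    (hE : ∀ y, (Matrix.of E).map β *ᵥ y = 0 → y = 0) (hGG : ∀ a g, β (sbr 𝒟 E (G a) (G g)) = 0)
    {v : Fin N₀ → ℂ} (hv : (brMat 𝒟 E F G Fs ω).map β *ᵥ v = 0) : v = 0 := by
  set u := (eMat 𝒟 E G).map β *ᵥ v with hu
  set w := ω.map β *ᵥ v with hw
  have h1 : (jac₀ 𝒟 F).map β *ᵥ u - Fs.map β *ᵥ w = 0 := by
    rw [← hv, hu, hw, mulVec_mulVec, mulVec_mulVec, ← Matrix.map_mul,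
      ← Matrix.map_mul, jac₀_mul_eMat, brMat, Matrix.map_sub _ (map_sub β), Matrix.sub_mulVec]
  have h2 : (jac₀ 𝒟 G).map β *ᵥ u = 0 := by
    rw [hu, mulVec_mulVec, ← Matrix.map_mul, jac₀_mul_eMat]
    have h3 : (Matrix.of fun a g => sbr 𝒟 E (G a) (G g)).map β = 0 := by
      ext a g
      exact hGG a g
    rw [h3, Matrix.zero_mulVec]
  have h4 := hJ (Sum.elim u (Sum.elim 0 (-w))) (by
    funext r
    rcases r with a | a
    · have := congrFun h1 a
      simp only [Pi.sub_apply, mulVec, dotProduct, map_apply, Pi.zero_apply] at this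
      simpa [mulVec, dotProduct, jacExt, sub_eq_add_neg] using this
    · have := congrFun h2 a
      simp only [mulVec, dotProduct, map_apply, Pi.zero_apply] at this
      simpa [mulVec, dotProduct, jacExt] using this)
  have h5 : u = 0 := funext fun A => congrFun h4 (.inl A)
  have h6 : w = 0 := funext fun a => neg_eq_zero.1 (congrFun h4 (.inr (.inr a)))
  have h7 : ∀ B, ∑ g, β (𝒟.D (gVar B) (G g)) * v g = 0 := by
    refine fun B => congrFun (hE (fun B => ∑ g, β (𝒟.D (gVar B) (G g)) * v g) ?_) B
    rw [← h5, hu]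
    funext A
    simp only [mulVec, dotProduct, map_apply, of_apply, eMat, map_sum,
      map_mul, mul_sum, sum_mul]
    rw [sum_comm]
    exact sum_congr rfl fun g _ => sum_congr rfl fun B _ => (mul_assoc _ _ _).symm
  have h8 : ∀ B g, β (𝒟.DR (gVar B) (G g)) = β (𝒟.D (gVar B) (G g)) := by
    intro B g
    have h := 𝒟.isHomog_D (hG g) (gVar B)
    rw [add_comm] at h
    rw [𝒟.DR_apply, h.twist_eq, map_sg_smul_of_odd β hβ h]
  have h9 := hJ' (Sum.elim 0 v) (by
    funext r
    rcases r with A | a | a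
    · rw [Pi.zero_apply, ← h7 A]
      simp [vecMul, dotProduct, jacExt, jac₀, h8, mul_comm]
    · have h := congrFun h6 a
      refine Eq.trans ?_ h
      rw [hw]
      simp only [vecMul, mulVec, dotProduct, jacExt, Fintype.sum_sum_type,
        Sum.elim_inl, Sum.elim_inr, Pi.zero_apply, zero_mul, sum_const_zero, zero_add,
        map_apply, Matrix.fromBlocks_apply₂₂, Matrix.fromCols_apply_inl, supT,
        of_apply]
      refine sum_congr rfl fun g _ => ?_
      have h10 := hω a g
      rw [add_zero] at h10
      rw [map_sg_smul_of_odd β hβ h10, mul_comm]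
    · simp [vecMul, dotProduct, jacExt])
  exact funext fun a => congrFun h9 (.inr a)

end Abstract

section Analysis

open scoped ContDiff
open Set Filter Topology MeasureTheory Metric

/-! ### A smooth division lemma -/

theorem contDiffAt_integral {Y H : Type} [NormedAddCommGroup Y] [NormedSpace ℝ Y]
    [NormedAddCommGroup H] [NormedSpace ℝ H] [CompleteSpace H] {Φ : Y × ℝ → H} {O : Set (Y × ℝ)}
    (hO : IsOpen O) (hΦ : ContDiffOn ℝ ∞ Φ O) {y₀ : Y} (hy₀ : {y₀} ×ˢ Icc (0 : ℝ) 1 ⊆ O) :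
    ContDiffAt ℝ ∞ (fun y => ∫ t in (0 : ℝ)..1, Φ (y, t)) y₀ := by
  obtain ⟨s, w, hs, hw, hs₀, hw₀, hsw⟩ := generalized_tube_lemma isCompact_singleton
    isCompact_Icc hO hy₀
  obtain ⟨δ, hδ, hδw⟩ := isCompact_Icc.exists_cthickening_subset_open hw hw₀
  let χ : ContDiffBump (1 / 2 : ℝ) := ⟨1 / 2, 1 / 2 + δ, by norm_num, by linarith⟩
  have hsub : closedBall (1 / 2 : ℝ) (1 / 2 + δ) ⊆ w := by
    refine Subset.trans (fun t ht => ?_) hδw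
    have h1 : Icc (0 : ℝ) 1 = closedBall (1 / 2) (1 / 2) := by
      rw [Real.closedBall_eq_Icc]; norm_num
    rw [h1, cthickening_closedBall hδ.le (by norm_num), add_comm]
    exact ht
  let g : Y → ℝ → H := fun y t => χ (-t) • Φ (y, -t)
  have hg : ContDiffOn ℝ ∞ ↿g (s ×ˢ univ) := by
    rintro ⟨y, t⟩ ⟨hy, -⟩
    refine ContDiffAt.contDiffWithinAt ?_
    have hn : ContDiffAt ℝ ∞ (fun q : Y × ℝ => (q.1, -q.2)) (y, t) := by fun_prop
    by_cases ht : -t ∈ w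
    · refine ContDiffAt.smul (χ.contDiffAt.comp (y, t) (by fun_prop)) ?_
      exact ContDiffAt.comp (y, t) (hΦ.contDiffAt (hO.mem_nhds (hsw ⟨hy, ht⟩))) hn
    · have : ↿g =ᶠ[𝓝 (y, t)] fun _ => 0 := by
        have hc : -t ∈ (closedBall (1 / 2 : ℝ) (1 / 2 + δ))ᶜ := fun h => ht (hsub h)
        have := (continuous_snd.neg.tendsto (y, t)).eventually
          (isClosed_closedBall.isOpen_compl.mem_nhds hc)
        filter_upwards [this] with q hq
        have : χ (-q.2) = 0 := χ.zero_of_le_dist (by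
          exact (not_le.1 fun h => hq (mem_closedBall.2 h)).le)
        simp [Function.HasUncurry.uncurry, g, this]
      exact contDiffAt_const.congr_of_eventuallyEq this
  have hf : LocallyIntegrable ((Icc (0 : ℝ) 1).indicator fun _ => (1 : ℝ)) volume :=
    (locallyIntegrable_const 1).indicator measurableSet_Icc
  have h := contDiffOn_convolution_right_with_param (n := ⊤) (ContinuousLinearMap.lsmul ℝ ℝ)
    (μ := volume) hs (isCompact_closedBall (-(1 / 2) : ℝ) (1 / 2 + δ)) (g := g)
    (fun y t _ ht => by
      have : χ (-t) = 0 := χ.zero_of_le_dist (by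
        rw [mem_closedBall, not_le, Real.dist_eq] at ht
        rw [Real.dist_eq, show -t - 1 / 2 = -(t - -(1 / 2)) by ring, abs_neg]
        exact ht.le)
      simp [g, this]) hf hg
  have h2 : ContDiffOn ℝ ∞ (fun y => ∫ t in (0 : ℝ)..1, Φ (y, t)) s := by
    have h3 : ContDiffOn ℝ ∞ (fun y : Y => (y, (0 : ℝ))) s := by fun_prop
    refine (h.comp h3 fun y hy => ⟨hy, mem_univ _⟩).congr fun y _ => ?_
    simp only [Function.comp_def, convolution, zero_sub, ContinuousLinearMap.lsmul_apply, g, neg_neg]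
    rw [intervalIntegral.integral_of_le zero_le_one, ← integral_Icc_eq_integral_Ioc,
      ← integral_indicator measurableSet_Icc]
    refine integral_congr_ae (Eventually.of_forall fun t => ?_)
    by_cases ht : t ∈ Icc (0 : ℝ) 1
    · have : χ t = 1 := χ.one_of_mem_closedBall (by
        rw [Real.closedBall_eq_Icc]
        norm_num [χ]
        exact ht)
      simp [ht, this]
    · simp [ht]
  exact h2.contDiffAt (hs.mem_nhds (hs₀ rfl))

theorem exists_smooth_division {E F Y : Type} [NormedAddCommGroup E] [NormedSpace ℝ E]
    [FiniteDimensional ℝ E] [NormedAddCommGroup F] [NormedSpace ℝ F] [FiniteDimensional ℝ F]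
    [NormedAddCommGroup Y] [NormedSpace ℝ Y] {W : Set E} (hW : IsOpen W) {x₀ : E} (hx₀ : x₀ ∈ W)
    {g : E → F} (hg : ContDiffOn ℝ ∞ g W) (hg₀ : g x₀ = 0) {A : E → F →L[ℝ] Y}
    (hA : ContinuousOn A W) (hAg : ∀ x ∈ W, A x (g x) = 0)
    (hker : ∀ v, A x₀ v = 0 → v ∈ (fderiv ℝ g x₀).range) :
    ∃ V : Set E, IsOpen V ∧ x₀ ∈ V ∧ V ⊆ W ∧ ∀ h : E → ℂ, ContDiffOn ℝ ∞ h V →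
      (∀ x ∈ V, g x = 0 → fderiv ℝ h x = 0) →
      ∃ (c : ℂ) (k : E → F →L[ℝ] ℂ), ContDiffOn ℝ ∞ k V ∧ ∀ x ∈ V, h x = c + k x (g x) := by
  set D := fderiv ℝ g x₀ with hD
  obtain ⟨p, hp⟩ := Submodule.ClosedComplemented.of_finiteDimensional D.range
  obtain ⟨q, hq⟩ := Submodule.ClosedComplemented.of_finiteDimensional D.ker
  let Ψ : E → D.range × D.ker := fun x => (p (g x), q (x - x₀))
  have hΨ : ContDiffOn ℝ ∞ Ψ W := (p.contDiff.comp_contDiffOn hg).prodMk (by fun_prop)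
  have hΨ₀ : Ψ x₀ = 0 := by simp [Ψ, hg₀]
  have hD' : HasFDerivAt Ψ ((p.comp D).prod q) x₀ :=
    (p.hasFDerivAt.comp x₀ ((hg.contDiffAt (hW.mem_nhds hx₀)).differentiableAt
      (by simp)).hasFDerivAt).prodMk (q.hasFDerivAt.comp x₀ ((hasFDerivAt_id x₀).sub_const x₀))
  have hinj : Function.Injective ((p.comp D).prod q : E →L[ℝ] D.range × D.ker).toLinearMap := by
    refine (injective_iff_map_eq_zero _).2 fun v hv => ?_
    have h1 : p (D v) = 0 := congrArg Prod.fst hv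
    have h2 : q v = 0 := congrArg Prod.snd hv
    have h3 := hp ⟨D v, v, rfl⟩
    rw [h1] at h3
    have h4 : D v = 0 := (congrArg Subtype.val h3).symm
    have h5 := hq ⟨v, h4⟩
    rw [h2] at h5
    exact (congrArg Subtype.val h5).symm
  let e : E ≃L[ℝ] D.range × D.ker := (LinearMap.linearEquivOfInjective _ hinj (by
    rw [Module.finrank_prod]
    exact (D.toLinearMap.finrank_range_add_finrank_ker).symm)).toContinuousLinearEquiv
  have he : HasFDerivAt Ψ (e : E →L[ℝ] D.range × D.ker) x₀ := hD'
  have hΨc := hΨ.contDiffAt (hW.mem_nhds hx₀)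
  let Φ := hΨc.toOpenPartialHomeomorph Ψ he (by simp)
  have hΦ : ∀ x, Φ x = Ψ x := fun _ => rfl
  have hΦ₀ : x₀ ∈ Φ.source := hΨc.mem_toOpenPartialHomeomorph_source he (by simp)
  let O : Set E := (W ∩ fderiv ℝ Ψ ⁻¹' range ((↑) : (E ≃L[ℝ] D.range × D.ker) → _)) ∩
    (W ∩ (fun x => p.prod (A x)) ⁻¹' {L | Function.Injective L})
  have hO : IsOpen O := by
    refine ((hΨ.continuousOn_fderiv_of_isOpen hW (by simp)).isOpen_inter_preimage hW
      ContinuousLinearEquiv.isOpen).inter (ContinuousOn.isOpen_inter_preimage ?_ hW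
      ContinuousLinearMap.isOpen_injective)
    exact (ContinuousLinearMap.prodₗᵢ ℝ).continuous.comp_continuousOn (continuousOn_const.prodMk hA)
  have hO₀ : x₀ ∈ O := by
    refine ⟨⟨hx₀, e, he.fderiv.symm⟩, hx₀, (injective_iff_map_eq_zero _).2 fun v hv => ?_⟩
    obtain ⟨w, hw⟩ := hker v (congrArg Prod.snd hv)
    have h1 := hp ⟨v, w, hw⟩
    rw [show p v = 0 from congrArg Prod.fst hv] at h1
    exact (congrArg Subtype.val h1).symm
  have hΦO : IsOpen (Φ.target ∩ Φ.symm ⁻¹' O) := Φ.isOpen_inter_preimage_symm hO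
  obtain ⟨r, hr, hB⟩ := Metric.isOpen_iff.1 hΦO 0 (by
    rw [← hΨ₀, ← hΦ]
    exact ⟨Φ.map_source hΦ₀, by rwa [mem_preimage, Φ.left_inv hΦ₀]⟩)
  have hVo : IsOpen (Φ.source ∩ Φ ⁻¹' ball 0 r) := Φ.isOpen_inter_preimage isOpen_ball
  have hVO : Φ.source ∩ Φ ⁻¹' ball 0 r ⊆ O := fun x hx => by
    have := (hB hx.2).2
    rwa [mem_preimage, Φ.left_inv hx.1] at this
  refine ⟨Φ.source ∩ Φ ⁻¹' ball 0 r, hVo, ⟨hΦ₀, by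
    rw [mem_preimage, hΦ, hΨ₀]; exact mem_ball_self hr⟩, fun x hx => (hVO hx).1.1, fun h hh h0 => ?_⟩
  set V := Φ.source ∩ Φ ⁻¹' ball 0 r with hV
  have hs : ∀ y ∈ ball (0 : D.range × D.ker) r, Φ.symm y ∈ V := fun y hy =>
    ⟨Φ.map_target (hB hy).1, by rwa [mem_preimage, Φ.right_inv (hB hy).1]⟩
  let h' := h ∘ Φ.symm
  have hsym : ∀ y ∈ ball (0 : D.range × D.ker) r, ContDiffAt ℝ ∞ Φ.symm y := by
    intro y hy
    obtain ⟨⟨hW', f, hf⟩, -⟩ := hVO (hs y hy)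
    have h1 := hΨ.contDiffAt (hW.mem_nhds hW')
    refine Φ.contDiffAt_symm (f₀' := f) (hB hy).1 ?_ h1
    rw [hf]
    exact (h1.differentiableAt (by simp)).hasFDerivAt
  have hh' : ContDiffOn ℝ ∞ h' (ball 0 r) := fun y hy =>
    ((hh.contDiffAt (hVo.mem_nhds (hs y hy))).comp y (hsym y hy)).contDiffWithinAt
  have hd : ∀ y ∈ ball (0 : D.range × D.ker) r, DifferentiableAt ℝ h' y := fun y hy =>
    (hh'.contDiffAt (isOpen_ball.mem_nhds hy)).differentiableAt (by simp)
  have hz : ∀ κ : D.ker, ((0 : D.range), κ) ∈ ball (0 : D.range × D.ker) r →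
      fderiv ℝ h' (0, κ) = 0 := by
    intro κ hκ
    set x := Φ.symm (0, κ) with hx
    have hxV := hs _ hκ
    have h1 : Ψ x = (0, κ) := by rw [← hΦ, hx, Φ.right_inv (hB hκ).1]
    have h2 : p (g x) = 0 := congrArg Prod.fst h1
    have hxO := hVO hxV
    have h3 : g x = 0 := (injective_iff_map_eq_zero _).1 hxO.2.2 _
      (Prod.ext h2 (hAg x hxO.1.1))
    have h4 := h0 x hxV h3
    have h5 : HasFDerivAt h' ((fderiv ℝ h x).comp (fderiv ℝ Φ.symm (0, κ))) (0, κ) :=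
      ((hh.contDiffAt (hVo.mem_nhds hxV)).differentiableAt (by simp)).hasFDerivAt.comp _
        ((hsym _ hκ).differentiableAt (by simp)).hasFDerivAt
    rw [h5.fderiv, h4, ContinuousLinearMap.zero_comp]
  have hmem : ∀ (u : D.range) (κ : D.ker), (u, κ) ∈ ball (0 : D.range × D.ker) r →
      ∀ t ∈ Icc (0 : ℝ) 1, (t • u, κ) ∈ ball (0 : D.range × D.ker) r := by
    intro u κ hu t ht
    rw [mem_ball_zero_iff, Prod.norm_def, max_lt_iff] at hu ⊢
    refine ⟨lt_of_le_of_lt ?_ hu.1, hu.2⟩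
    rw [norm_smul, Real.norm_of_nonneg ht.1]
    exact mul_le_of_le_one_left (norm_nonneg _) ht.2
  have hfd : ContDiffOn ℝ ∞ (fderiv ℝ h') (ball 0 r) :=
    hh'.fderiv_of_isOpen isOpen_ball (by simp)
  let κ' : D.range × D.ker → (D.range × D.ker →L[ℝ] ℂ) := fun y =>
    ∫ t in (0 : ℝ)..1, fderiv ℝ h' (t • y.1, y.2)
  have hκ' : ∀ y ∈ ball (0 : D.range × D.ker) r, ContDiffAt ℝ ∞ κ' y := by
    intro y hy
    have hc : Continuous fun s : (D.range × D.ker) × ℝ => (s.2 • s.1.1, s.1.2) := by fun_prop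
    refine contDiffAt_integral (Φ := fun s => fderiv ℝ h' (s.2 • s.1.1, s.1.2))
      (isOpen_ball.preimage hc) (hfd.comp (f := fun s : (D.range × D.ker) × ℝ =>
        (s.2 • s.1.1, s.1.2)) (ContDiff.contDiffOn (by fun_prop)) fun _ hs => hs) ?_
    rintro ⟨y', t⟩ ⟨rfl, ht⟩
    exact hmem _ _ hy t ht
  refine ⟨h' 0, fun x => (κ' (Ψ x)).comp ((ContinuousLinearMap.inl ℝ _ _).comp p), ?_, ?_⟩
  · intro x hx
    refine ContDiffAt.contDiffWithinAt (ContDiffAt.clm_comp ?_ contDiffAt_const)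
    exact (hκ' _ hx.2).comp x (hΨ.contDiffAt (hW.mem_nhds (hVO hx).1.1))
  · intro x hx
    obtain ⟨u, κ, hy⟩ : ∃ u κ, Ψ x = (u, κ) := ⟨_, _, rfl⟩
    have hyB : (u, κ) ∈ ball (0 : D.range × D.ker) r := hy ▸ hx.2
    have hx' : h x = h' (u, κ) := by
      rw [← hy, ← hΦ, show h' (Φ x) = h (Φ.symm (Φ x)) from rfl, Φ.left_inv hx.1]
    have hu : p (g x) = u := congrArg Prod.fst hy
    have hc : h' (0, κ) = h' 0 := by
      have hb : ∀ w ∈ ball (0 : D.ker) r, ((0 : D.range), w) ∈ ball (0 : D.range × D.ker) r := by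
        intro w hw
        rw [mem_ball_zero_iff] at hw ⊢
        simpa [Prod.norm_def] using hw
      have hder : ∀ w ∈ ball (0 : D.ker) r,
          HasFDerivAt (fun w => h' ((0 : D.range), w)) (0 : D.ker →L[ℝ] ℂ) w := by
        intro w hw
        have := (hd _ (hb w hw)).hasFDerivAt.comp w (hasFDerivAt_prodMk_right (𝕜 := ℝ) (0 : D.range) w)
        rwa [hz _ (hb w hw), ContinuousLinearMap.zero_comp] at this
      refine isOpen_ball.is_const_of_fderiv_eq_zero (𝕜 := ℝ) (s := ball (0 : D.ker) r)
        (f := fun w => h' ((0 : D.range), w))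
        (convex_ball _ _).isPreconnected (fun w hw => (hder w hw).differentiableAt.differentiableWithinAt)
        (fun w hw => (hder w hw).fderiv) (x := κ) ?_ (mem_ball_self hr)
      rw [mem_ball_zero_iff, Prod.norm_def, max_lt_iff] at hyB
      exact mem_ball_zero_iff.2 hyB.2
    have hI : ContinuousOn (fun t : ℝ => fderiv ℝ h' (t • u, κ)) (uIcc 0 1) := by
      rw [uIcc_of_le zero_le_one]
      exact hfd.continuousOn.comp (by fun_prop) fun t ht => hmem u κ hyB t ht
    have hint : ∫ t in (0 : ℝ)..1, fderiv ℝ h' (t • u, κ) (u, 0) = h' (u, κ) - h' (0, κ) := by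
      rw [intervalIntegral.integral_eq_sub_of_hasDerivAt (f := fun t : ℝ => h' (t • u, κ))
        (fun t ht => ?_) (hI.clm_apply continuousOn_const).intervalIntegrable, one_smul, zero_smul]
      rw [uIcc_of_le zero_le_one] at ht
      have h1 : HasDerivAt (fun t : ℝ => (t • u, κ)) (u, (0 : D.ker)) t := by
        have := ((hasDerivAt_id t).smul_const u).prodMk (hasDerivAt_const t κ)
        simpa using this
      exact (hd _ (hmem u κ hyB t ht)).hasFDerivAt.comp_hasDerivAt t h1
    rw [hx', ← hc, ← sub_eq_iff_eq_add', ← hint]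
    simp only [ContinuousLinearMap.comp_apply, hu, hy, κ', ContinuousLinearMap.inl_apply]
    exact (ContinuousLinearMap.intervalIntegral_apply hI.intervalIntegrable _).symm

end Analysis

/-! ### Functions whose antibrackets with the constraints vanish on shell -/

section Abstract

variable {R : Type} [Ring R] [Algebra ℂ R] [SuperAlgebra R] (𝒟 : SuperCalculus R (vPar N ε₀ ε₁))
  {Q : Type} [Ring Q] [Algebra ℂ Q] [SuperAlgebra Q] {φ : R →ₐ[ℂ] Q}
  {E : Fin N ⊕ Fin N → Fin N ⊕ Fin N → R} {F G : Fin N₀ → R}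
  {Fp Fs : Matrix (Fin N₀) (Fin N₁) R} {ω : Matrix (Fin N₁) (Fin N₀) R}

theorem map_DR_of_sbr (hGG : ∀ a g, φ (sbr 𝒟 E (G a) (G g)) = 0)
    {J' : Matrix ((Fin N ⊕ Fin N) ⊕ (Fin N₁ ⊕ Fin N₁)) (Fin N₀ ⊕ Fin N₀) R}
    (hJ' : J' * jacExt 𝒟 F G Fp Fs ω = 1)
    {Ni : Matrix (Fin N₀) (Fin N₀) R} (hN : brMat 𝒟 E F G Fs ω * Ni = 1) {f : R}
    (hf : ∀ g, φ (sbr 𝒟 E f (G g)) = 0) (A : Fin N ⊕ Fin N) :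
    φ (𝒟.DR (gVar A) f) =
      ∑ g, φ (∑ C, 𝒟.DR (gVar C) f * J' (.inl C) (.inr g)) * φ (𝒟.DR (gVar A) (G g)) := by
  set Az : Matrix (Fin N ⊕ Fin N) (Fin N₀) R := J'.submatrix .inl .inl with hAz
  set Bz : Matrix (Fin N ⊕ Fin N) (Fin N₀) R := J'.submatrix .inl .inr with hBz
  set f' : Matrix Unit (Fin N ⊕ Fin N) R := jac₀ 𝒟 (fun _ : Unit => f) with hf'
  set em := eMat 𝒟 E G with hem
  have b1 : Az * jac₀ 𝒟 F + Bz * jac₀ 𝒟 G = 1 := by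
    ext A B
    have := congrFun (congrFun hJ' (.inl A)) (.inl B)
    simpa [Matrix.mul_apply, Fintype.sum_sum_type, jacExt, Matrix.one_apply, Az, Bz] using this
  have b2 : Az * Fs = 0 := by
    ext A B
    have := congrFun (congrFun hJ' (.inl A)) (.inr (.inr B))
    simpa [Matrix.mul_apply, Fintype.sum_sum_type, jacExt, Matrix.one_apply, Az] using this
  have h1 : (f' * em).map φ = 0 := by
    rw [hf', hem, jac₀_mul_eMat]; ext i g; exact hf g
  have h2 : (jac₀ 𝒟 G * em).map φ = 0 := by
    rw [hem, jac₀_mul_eMat]; ext i g; exact hGG i g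
  have h3 : em = Az * brMat 𝒟 E F G Fs ω + Bz * (jac₀ 𝒟 G * em) := by
    rw [brMat, ← jac₀_mul_eMat, ← hem, Matrix.mul_sub, ← Matrix.mul_assoc Az Fs, b2,
      Matrix.zero_mul, sub_zero, ← Matrix.mul_assoc, ← Matrix.mul_assoc, ← Matrix.add_mul, b1,
      Matrix.one_mul]
  have h4 : f' * Az = (f' * em) * Ni - f' * Bz * (jac₀ 𝒟 G * em) * Ni := by
    have := congrArg (f' * · * Ni) h3
    simp only [Matrix.mul_add, Matrix.add_mul] at this
    rw [this, ← Matrix.mul_assoc f' Az, Matrix.mul_assoc (f' * Az), hN, Matrix.mul_one,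
      ← Matrix.mul_assoc f' Bz, add_sub_cancel_right]
  have h5 : (f' * Az).map φ = 0 := by
    rw [h4, Matrix.map_sub _ (map_sub φ), Matrix.map_mul, h1, Matrix.map_mul, Matrix.map_mul, h2,
      Matrix.mul_zero, Matrix.zero_mul, sub_zero]
  have h6 : f'.map φ = (f' * Bz).map φ * (jac₀ 𝒟 G).map φ := by
    have : f' = f' * Az * jac₀ 𝒟 F + f' * Bz * jac₀ 𝒟 G := by
      rw [Matrix.mul_assoc, Matrix.mul_assoc, ← Matrix.mul_add, b1, Matrix.mul_one]
    rw [← Matrix.map_mul, ← sub_eq_zero, ← Matrix.map_sub _ (map_sub φ)]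
    nth_rewrite 1 [this]
    rw [add_sub_cancel_right, Matrix.map_mul, h5, Matrix.zero_mul]
  exact congrFun (congrFun h6 ()) A

theorem map_DR_sub_sum (hφG : ∀ a, φ (G a) = 0) (hφ : ∀ a, invol (φ a) = φ (invol a)) {f : R} {u : Fin N₀ → R}
    (A : Fin N ⊕ Fin N) (h : φ (𝒟.DR (gVar A) f) = ∑ g, φ (u g) * φ (𝒟.DR (gVar A) (G g))) :
    φ (𝒟.D (gVar A) (f - ∑ g, u g * G g)) = 0 := by
  have h0 : ∀ e g, φ (twist e (G g)) = 0 := by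
    intro e g
    rcases zmod2_cases e with h | h <;> rw [h]
    · rw [twist_zero, hφG]
    · rw [twist_one, ← hφ, hφG, map_zero]
  have h1 : φ (𝒟.DR (gVar A) (f - ∑ g, u g * G g)) = 0 := by
    rw [map_sub, map_sub, h, map_sum, map_sum, sub_eq_zero]
    refine sum_congr rfl fun g _ => ?_
    rw [𝒟.DR_mul, map_add, map_mul, map_mul, h0, mul_zero, add_zero]
  rw [𝒟.D_eq_twist_DR]
  rcases zmod2_cases (vPar N ε₀ ε₁ (gVar A)) with h | h <;> rw [h]
  · rw [twist_zero, h1]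
  · rw [twist_one, ← hφ, h1, map_zero]

theorem sbr_smul_add_left (c : ℂ) (f h g : R) :
    sbr 𝒟 E (c • f + h) g = c • sbr 𝒟 E f g + sbr 𝒟 E h g := by
  simp only [sbr, map_add, map_smul, add_mul, smul_mul_assoc, sum_add_distrib,
    smul_sum]

theorem map_sbr_of_map_eq_zero (hG : ∀ a, IsHomog (ε₀ a) (G a)) (hφG : ∀ a, φ (G a) = 0)
    (hφ : ∀ a, invol (φ a) = φ (invol a)) (hφ0 : ∀ x, φ x = 0 ↔ ∃ k : Fin N₀ → R, x = ∑ a, G a * k a)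
    (hGG : ∀ a g, φ (sbr 𝒟 E (G a) (G g)) = 0) {f : R} (hf : φ f = 0) (g : Fin N₀) :
    φ (sbr 𝒟 E f (G g)) = 0 := by
  obtain ⟨k, rfl⟩ := (hφ0 _).1 hf
  have h0 : ∀ e g, φ (twist e (G g)) = 0 := by
    intro e g
    rcases zmod2_cases e with h | h <;> rw [h]
    · rw [twist_zero, hφG]
    · rw [twist_one, ← hφ, hφG, map_zero]
  have h1 : ∑ a, G a * k a = ∑ a, twist (ε₀ a) (k a) * G a :=
    sum_congr rfl fun a _ => (hG a).mul_comm' _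
  have h2 : φ (sbr 𝒟 E (∑ a, G a * k a) (G g)) =
      ∑ a, φ (twist (ε₀ a) (k a)) * φ (sbr 𝒟 E (G a) (G g)) := by
    simp only [h1, sbr, map_sum, map_mul, 𝒟.DR_mul, map_add, h0, mul_zero, add_zero,
      sum_mul, mul_sum, mul_assoc]
    exact (sum_congr rfl fun A _ => sum_comm).trans sum_comm
  rw [h2]
  exact sum_eq_zero fun a _ => by rw [hGG, mul_zero]

end Abstract

/-! ### The degree in the odd coordinates -/

section Degree

variable {V : Opens (Fin n → ℝ)}

theorem superRealD_mem_superGE {k : ℕ} {f : SuperFun V p} (hf : f ∈ superGE V p k) (i : Fin n) :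
    superRealD i f ∈ superGE V p k := by
  intro x m
  by_contra h
  obtain ⟨l, hl, hle⟩ := Submodule.exists_le_ker_of_notMem h
  refine hl ?_
  rw [superRealD_val, f.smooth.apply_realD V.isOpen x.2]
  have : (fun y => l (coeff m (f.ext' y))) =ᶠ[nhds x.1] fun _ => 0 := by
    filter_upwards [V.isOpen.mem_nhds x.2] with y hy
    rw [f.ext'_apply ⟨y, hy⟩]
    exact hle (hf ⟨y, hy⟩ m)
  rw [this.fderiv_eq, fderiv_fun_const]
  rfl

theorem serD_mem_serGE {k : ℕ} {a : Ser p} (ha : a ∈ serGE p (k + 1)) {w : W} (hw : p w = 1) :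
    serD w a ∈ serGE p k := by
  intro m
  have h := contractLeft_mem_degGE (LinearMap.proj (⟨w, hw⟩ : {w : W // p w = 1})) (ha m)
  rw [show k + 1 - Finsupp.degree m - 1 = k - Finsupp.degree m by omega] at h
  rw [serD_odd ⟨w, hw⟩]
  exact h

theorem coeff_eq_zero_of_zeroing {T : Set W} (hT : ∀ w, p w = 0 → w ∈ T) {f : SuperFun V p}
    (hz : zeroing T f = f) (x : V) {m : {w : W // p w = 0} →₀ ℕ} (hm : m ≠ 0) :
    coeff m (f.1 x) = 0 := by
  rw [← hz, zeroing_val]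
  refine if_neg fun h => hm ?_
  ext w
  by_contra hw
  exact h w (Finsupp.mem_support_iff.2 hw) (hT w w.2)

theorem sum_superVar_mul_D_sub_mem {T : Set W} (hT : ∀ w, p w = 0 → w ∈ T) {f : SuperFun V p}
    (hz : zeroing T f = f) {k : ℕ} (hf : f ∈ superGE V p k) :
    ∑ w : {w // p w = 1}, superVar V p w * (funCalculus V p).D (.inr w) f - (k : ℂ) • f ∈
      superGE V p (k + 1) := by
  intro x m
  have h1 : coeff m ((∑ w : {w // p w = 1}, superVar V p w *
      (funCalculus V p).D (.inr w) f - (k : ℂ) • f).1 x) =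
      oddEuler _ (coeff m (f.1 x)) - (k : ℂ) • coeff m (f.1 x) := by
    rw [oddEuler_apply, ← SuperFun.eval_apply, map_sub, map_sum, map_smul, map_sub, map_sum,
      coeff_csmul]
    refine congrArg₂ _ (sum_congr rfl fun w _ => ?_) rfl
    rw [map_mul, SuperFun.eval_apply, SuperFun.eval_apply, superConst_val, serVar_odd w,
      MvPowerSeries.coeff_C_mul, funCalculus_D_inr, serD_odd w]
    rfl
  rw [h1]
  by_cases hm : m = 0
  · subst hm
    have := hf x 0
    rw [map_zero, Nat.sub_zero] at this ⊢
    exact oddEuler_sub_mem this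
  · rw [coeff_eq_zero_of_zeroing hT hz x hm, map_zero, smul_zero, sub_zero]
    exact zero_mem _

theorem zeroing_superVar_of_notMem {T : Set W} {w : W} (hw : w ∉ T) (hw1 : p w = 1) :
    zeroing T (superVar V p w) = superVar V p w := by
  refine SuperFun.ext fun x => ?_
  rw [zeroing_val]
  change setZero T (serVar p w) = serVar p w
  rw [serVar_odd ⟨w, hw1⟩]
  classical
  ext m
  by_cases ha : Avoids T m
  · rw [coeff_setZero_of_avoids ha, MvPowerSeries.coeff_C]
    split_ifs
    · rw [ExteriorAlgebra.map_apply_ι]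
      congr 1
      funext w'
      by_cases h : w'.1 ∈ T
      · rw [oddProj_apply_of_mem h, Pi.single_eq_of_ne]
        rintro rfl
        exact hw h
      · exact oddProj_apply_of_notMem h _
    · exact map_zero _
  · rw [coeff_setZero_of_not_avoids ha, MvPowerSeries.coeff_C, if_neg]
    rintro rfl
    exact ha (by simp [Avoids])

end Degree

section OddStep

variable {V : Opens (Fin N → ℝ)}

theorem mem_superGE_one_of_odd {f : SF ε₀ ε₁ V} (hf : IsHomog 1 f) :
    f ∈ superGE V (par (N := N) ε₀ ε₁) 1 :=
  mem_superGE_one_iff.2 fun x => bodyAt_of_odd x hf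

/-- Subtracting constraints from a function with vanishing brackets does not lower its degree. -/
theorem sum_mul_constraint_mem {G : Fin N₀ → SF ε₀ ε₁ V} (hG : ∀ a, IsHomog (ε₀ a) (G a))
    {B : (Fin N ⊕ Fin N) → Fin N₀ → SF ε₀ ε₁ V} (hB : ∀ A g, IsHomog (gPar A + ε₀ g) (B A g))
    {k : ℕ} {f : SF ε₀ ε₁ V} (hf : f ∈ superGE V (par (N := N) ε₀ ε₁) (k + 1)) (hf0 : IsHomog 0 f) :
    ∑ g, (∑ C, (SC ε₀ ε₁ V).DR (gVar C) f * B C g) * G g ∈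
      superGE V (par (N := N) ε₀ ε₁) (k + 1) := by
  have hD : ∀ C, (SC ε₀ ε₁ V).DR (gVar C) f =
      sg (gPar C * gPar C) • (SC ε₀ ε₁ V).D (gVar C) f := by
    intro C
    have h := (SC ε₀ ε₁ V).isHomog_D hf0 (gVar C)
    rw [vPar_gVar, zero_add] at h
    rw [(SC ε₀ ε₁ V).DR_apply, vPar_gVar, h.twist_eq]
  refine sum_mem fun g _ => ?_
  rw [sum_mul]
  refine sum_mem fun C _ => ?_
  rw [hD, smul_mul_assoc, smul_mul_assoc]
  refine Submodule.smul_mem _ _ ?_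
  rcases C with i | i
  · have h1 : (SC ε₀ ε₁ V).D (gVar (.inl i)) f ∈ superGE V (par (N := N) ε₀ ε₁) (k + 1) :=
      superRealD_mem_superGE hf i
    exact mul_mem_superGE (k := k + 1) (l := 0) (mul_mem_superGE (k := k + 1) (l := 0) h1
      (mem_superGE_zero _)) (mem_superGE_zero _)
  · have h1 : (SC ε₀ ε₁ V).D (gVar (.inr i)) f ∈ superGE V (par (N := N) ε₀ ε₁) k := fun x => by
      rw [show gVar (.inr i) = .inr (Fld.th i) from rfl, funCalculus_D_inr]
      exact serD_mem_serGE (hf x) rfl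
    rcases zmod2_cases (ε₀ g) with h | h
    · have h2 := hB (.inr i) g
      rw [h] at h2
      exact mul_mem_superGE (k := k + 1) (l := 0) (mul_mem_superGE (k := k) (l := 1) h1
        (mem_superGE_one_of_odd h2)) (mem_superGE_zero _)
    · have h2 := hG g
      rw [h] at h2
      exact mul_mem_superGE (k := k) (l := 1) (mul_mem_superGE (k := k) (l := 0) h1
        (mem_superGE_zero _)) (mem_superGE_one_of_odd h2)

variable {Q : Type} [Ring Q] [Algebra ℂ Q] [SuperAlgebra Q] {φ : SF ε₀ ε₁ V →ₐ[ℂ] Q}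
  {E : Fin N ⊕ Fin N → Fin N ⊕ Fin N → SF ε₀ ε₁ V}

set_option maxHeartbeats 1000000 in
theorem map_eq_zero_of_mem_superGE {G : Fin N₀ → SF ε₀ ε₁ V} (hG : ∀ a, IsHomog (ε₀ a) (G a))
    (hGz : ∀ a, gammaPart ε₀ ε₁ V (G a) = G a)
    {B : (Fin N ⊕ Fin N) → Fin N₀ → SF ε₀ ε₁ V} (hB : ∀ A g, IsHomog (gPar A + ε₀ g) (B A g))
    (hBz : ∀ A g, gammaPart ε₀ ε₁ V (B A g) = B A g)
    (hφG : ∀ a, φ (G a) = 0) (hφ : ∀ a, invol (φ a) = φ (invol a))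
    (hφ0 : ∀ f, φ f = 0 → ∀ g, φ (sbr (SC ε₀ ε₁ V) E f (G g)) = 0)
    (hP : ∀ f, (∀ g, φ (sbr (SC ε₀ ε₁ V) E f (G g)) = 0) → ∀ A, φ ((SC ε₀ ε₁ V).DR (gVar A) f) =
      ∑ g, φ (∑ C, (SC ε₀ ε₁ V).DR (gVar C) f * B C g) * φ ((SC ε₀ ε₁ V).DR (gVar A) (G g)))
    (m : ℕ) {k : ℕ} (hk : oddCard (par (N := N) ε₀ ε₁) < k + 1 + m) {f : SF ε₀ ε₁ V}
    (hf : f ∈ superGE V (par (N := N) ε₀ ε₁) (k + 1)) (hf0 : IsHomog 0 f)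
    (hfz : gammaPart ε₀ ε₁ V f = f) (hfG : ∀ g, φ (sbr (SC ε₀ ε₁ V) E f (G g)) = 0) : φ f = 0 := by
  have hz := isReduction_gammaPart (N := N) ε₀ ε₁ V
  induction m generalizing k f with
  | zero => rw [eq_zero_of_mem_superGE even_mem_compl_gammaVars hfz hk hf, map_zero]
  | succ m ih =>
    set u : Fin N₀ → SF ε₀ ε₁ V := fun g => ∑ C, (SC ε₀ ε₁ V).DR (gVar C) f * B C g with hu
    set f1 : SF ε₀ ε₁ V := f - ∑ g, u g * G g with hf1
    have h1 : f1 ∈ superGE V (par (N := N) ε₀ ε₁) (k + 1) :=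
      sub_mem hf (sum_mul_constraint_mem hG hB hf hf0)
    have h1D : ∀ A, φ ((SC ε₀ ε₁ V).D (gVar A) f1) = 0 := fun A =>
      map_DR_sub_sum (SC ε₀ ε₁ V) hφG hφ A (hP f hfG A)
    have h1z : gammaPart ε₀ ε₁ V f1 = f1 := by
      simp only [hf1, hu, map_sub, map_sum, map_mul, hz.DR, hfz, hBz, hGz]
    have h1φ : φ f1 = φ f := by
      rw [hf1, map_sub, map_sum, sum_eq_zero, sub_zero]
      intro g _
      rw [map_mul, hφG, mul_zero]
    have h10 : IsHomog 0 f1 := by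
      refine hf0.sub (IsHomog.sum fun g _ => ?_)
      have hug : IsHomog (ε₀ g) (u g) := IsHomog.sum fun C _ => by
        refine ((SC ε₀ ε₁ V).isHomog_DR hf0 (gVar C)).mul_of_eq (hB C g) ?_
        rw [vPar_gVar, zero_add, ← add_assoc, CharTwo.add_self_eq_zero, zero_add]
      exact hug.mul_of_eq (hG g) (CharTwo.add_self_eq_zero _)
    set v : SF ε₀ ε₁ V := ∑ w : {w // par (N := N) ε₀ ε₁ w = 1},
      superVar V (par (N := N) ε₀ ε₁) w * (SC ε₀ ε₁ V).D (.inr w) f1 with hv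
    have hvk : v - ((k + 1 : ℕ) : ℂ) • f1 ∈ superGE V (par (N := N) ε₀ ε₁) (k + 1 + 1) :=
      sum_superVar_mul_D_sub_mem even_mem_compl_gammaVars h1z h1
    have hD0 : ∀ w ∉ gammaVars, (SC ε₀ ε₁ V).D (.inr w) f1 = 0 := fun w hw => by
      rw [← h1z]; exact hz.D_eq_zero w hw f1
    have hvφ : φ v = 0 := by
      rw [hv, map_sum]
      refine sum_eq_zero fun w _ => ?_
      by_cases hw : w.1 ∈ gammaVars
      · obtain ⟨i, hi⟩ := hw
        rw [map_mul, hi]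
        exact mul_eq_zero_of_right _ (h1D (.inr i))
      · rw [hD0 _ hw, mul_zero, map_zero]
    have hvz : gammaPart ε₀ ε₁ V v = v := by
      rw [hv, map_sum]
      refine sum_congr rfl fun w _ => ?_
      by_cases hw : w.1 ∈ gammaVars
      · have h2 : gammaPart ε₀ ε₁ V ((SC ε₀ ε₁ V).D (.inr w) f1) = (SC ε₀ ε₁ V).D (.inr w) f1 := by
          obtain ⟨i, hi⟩ := hw
          rw [hi]
          exact (hz.D (.inr i) f1).trans (by rw [h1z]; rfl)
        rw [map_mul, h2]
        congr 1
        exact zeroing_superVar_of_notMem (fun h => h hw) w.2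
      · rw [hD0 _ hw, mul_zero, map_zero]
    have hv0 : IsHomog 0 v := IsHomog.sum fun w _ =>
      (isHomog_superVar w.1).mul_of_eq ((SC ε₀ ε₁ V).isHomog_D h10 (.inr w)) (by
        rw [zero_add]; exact CharTwo.add_self_eq_zero _)
    have hk0 : ((k + 1 : ℕ) : ℂ) ≠ 0 := Nat.cast_ne_zero.2 k.succ_ne_zero
    set r : SF ε₀ ε₁ V := v - ((k + 1 : ℕ) : ℂ) • f1 with hr
    have hrφ : φ (((k + 1 : ℕ) : ℂ) • f + r) = 0 := by
      rw [hr, map_add, map_sub, map_smul, map_smul, hvφ, h1φ, zero_sub, add_neg_cancel]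
    have h3 : φ r = 0 := by
      refine ih (by omega) hvk (hv0.sub (h10.smul _)) (by rw [hr, map_sub, map_smul, hvz, h1z])
        fun g => ?_
      have := hφ0 _ hrφ g
      rwa [sbr_smul_add_left, map_add, map_smul, hfG, smul_zero, zero_add] at this
    rw [map_add, map_smul, h3, add_zero] at hrφ
    exact (smul_eq_zero.1 hrφ).resolve_left hk0

end OddStep

/-! ### Division by the constraints -/

section Abstract

open Matrix
variable {R : Type} [Ring R] [Algebra ℂ R] [SuperAlgebra R] (𝒟 : SuperCalculus R (vPar N ε₀ ε₁))
  {F G : Fin N₀ → R} {Fp Fs : Matrix (Fin N₀) (Fin N₁) R} {ω : Matrix (Fin N₁) (Fin N₀) R}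
  {Z : Matrix (Fin N₀) (Fin N₁) R} (β : R →ₐ[ℂ] ℂ)

theorem map_twist_of_odd (hβ : ∀ a, IsHomog 1 a → β a = 0) (e : ZMod 2) (a : R) :
    β (twist e a) = β a := by
  rw [← homogPart_zero_add_one a]
  simp only [map_add]
  rw [(isHomog_homogPart 0 a).twist_eq, (isHomog_homogPart 1 a).twist_eq, mul_zero, sg_zero, one_smul,
    map_smul, hβ _ (isHomog_homogPart 1 a), smul_zero]

/-- A vector annihilated by the reducibility matrix is tangent to the image of the constraints. -/
theorem exists_sum_map_DR_eq (hβ : ∀ a, IsHomog 1 a → β a = 0) (hω : IsMat 0 ε₁ ε₀ ω)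
    {J' : Matrix ((Fin N ⊕ Fin N) ⊕ (Fin N₁ ⊕ Fin N₁)) (Fin N₀ ⊕ Fin N₀) R}
    (hJ : jacExt 𝒟 F G Fp Fs ω * J' = 1) (hG : ∀ a, β (G a) = 0)
    (hGZ : ∀ k, ∑ a, G a * Z a k = 0) (hZ : ((ω * Z).map β).det ≠ 0) {v : Fin N₀ → ℂ}
    (hv : ∀ k, ∑ a, v a * β (Z a k) = 0) :
    ∃ w : Fin N ⊕ Fin N → ℂ, ∀ a, ∑ A, β (𝒟.DR (gVar A) (G a)) * w A = v a := by
  set Gm := (jac₀ 𝒟 G).map β with hGm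
  set Bz := (J'.submatrix .inl .inr).map β with hBz
  set Bp := (J'.submatrix (.inr ∘ .inl) .inr).map β with hBp
  have h1 : Gm * Bz + (ω.map β)ᵀ * Bp = 1 := by
    ext a b
    have := congrArg β (congrFun (congrFun hJ (.inr a)) (.inr b))
    have hs : ∀ k, β (supT ε₁ ε₀ ω a k) = β (ω k a) := fun k => by
      have h := hω k a
      rw [add_zero] at h
      exact map_sg_smul_of_odd β hβ h
    simpa [Matrix.mul_apply, Fintype.sum_sum_type, jacExt, Matrix.one_apply, Gm, Bz, Bp, hs,
      apply_ite β] using this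
  have h2 : (Z.map β)ᵀ * Gm = 0 := by
    ext k A
    have := congrArg (fun x => β (𝒟.DR (gVar A) x)) (hGZ k)
    simp only [map_sum, 𝒟.DR_mul, map_add, map_mul, hG, zero_mul, zero_add,
      map_twist_of_odd β hβ, map_zero] at this
    rw [Matrix.zero_apply, ← this]
    change ∑ a, β (Z a k) * β (𝒟.DR (gVar A) (G a)) = _
    exact sum_congr rfl fun a _ => mul_comm (β (Z a k)) _
  have h3 : ((ω * Z).map β)ᵀ * Bp = (Z.map β)ᵀ := by
    have := congrArg ((Z.map β)ᵀ * ·) h1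
    simp only [Matrix.mul_add, ← Matrix.mul_assoc, h2, Matrix.zero_mul, zero_add,
      Matrix.mul_one] at this
    rw [Matrix.map_mul, Matrix.transpose_mul, this]
  have h4 : Bp *ᵥ v = 0 := by
    refine Matrix.eq_zero_of_mulVec_eq_zero (M := ((ω * Z).map β)ᵀ) (by rwa [det_transpose]) ?_
    rw [mulVec_mulVec, h3]
    funext k
    rw [Pi.zero_apply, ← hv k]
    change ∑ a, β (Z a k) * v a = _
    exact sum_congr rfl fun a _ => mul_comm (β (Z a k)) _
  refine ⟨Bz *ᵥ v, fun a => congrFun (?_ : Gm *ᵥ (Bz *ᵥ v) = v) a⟩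
  conv_rhs => rw [← Matrix.one_mulVec v, ← h1, Matrix.add_mulVec, ← mulVec_mulVec _ _ Bp, h4,
    Matrix.mulVec_zero, add_zero, ← mulVec_mulVec]

end Abstract

theorem apply_eq_sum_single {m : ℕ} (L : (Fin m → ℝ) →L[ℝ] ℂ) (w : Fin m → ℝ) :
    L w = ∑ i, (w i : ℂ) * L (Pi.single i 1) := by
  conv_lhs => rw [← Finset.univ_sum_single w]
  rw [map_sum]
  refine sum_congr rfl fun i _ => ?_
  rw [show Pi.single i (w i) = w i • Pi.single i (1 : ℝ) by
    rw [← Pi.single_smul, smul_eq_mul, mul_one], map_smul, Complex.real_smul]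

section Abstract

variable {R : Type} [Ring R] [Algebra ℂ R] [SuperAlgebra R] {𝒟 : SuperCalculus R (vPar N ε₀ ε₁)}

theorem sbr_sub_left (E : Fin N ⊕ Fin N → Fin N ⊕ Fin N → R) (f h g : R) :
    sbr 𝒟 E (f - h) g = sbr 𝒟 E f g - sbr 𝒟 E h g := by
  simp only [sbr, map_sub, sub_mul, Finset.sum_sub_distrib]

theorem sbr_algebraMap_left (E : Fin N ⊕ Fin N → Fin N ⊕ Fin N → R) (c : ℂ) (g : R) :
    sbr 𝒟 E (algebraMap ℂ R c) g = 0 := by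
  have : ∀ A, 𝒟.DR (gVar A) (algebraMap ℂ R c) = 0 := fun A => by
    rw [Algebra.algebraMap_eq_smul_one, map_smul, 𝒟.DR_apply, 𝒟.D_one, map_zero, smul_zero]
  simp only [sbr, this, zero_mul, sum_const_zero]

/-- Coefficients of constraints may be chosen homogeneous and in the image of a projection. -/
theorem exists_homog_coeff {z : R →ₐ[ℂ] R} (hz : IsReduction 𝒟 z) {G : Fin N₀ → R}
    (hG : ∀ a, IsHomog (ε₀ a) (G a)) (hGz : ∀ a, z (G a) = G a) {f : R} (hf : IsHomog 0 f)
    (hfz : z f = f) {k : Fin N₀ → R} (h : f = ∑ a, G a * k a) :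
    ∃ k : Fin N₀ → R, (∀ a, IsHomog (ε₀ a) (k a)) ∧ (∀ a, z (k a) = k a) ∧ f = ∑ a, G a * k a := by
  have hp : ∀ e a, IsHomog e (z (homogPart e a)) := fun e a => hz.isHomog (isHomog_homogPart e a)
  refine ⟨fun a => z (homogPart (ε₀ a) (k a)), fun a => hp _ _, fun a => hz.idem _, ?_⟩
  have h1 : f = ∑ a, G a * homogPart (ε₀ a) (k a) := by
    rw [← hf.homogPart_eq, h, homogPart_sum]
    exact sum_congr rfl fun a _ => by rw [homogPart_mul (hG a), zero_add]
  calc f = z f := hfz.symm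
    _ = _ := by
      conv_lhs => rw [h1]
      rw [map_sum]
      exact sum_congr rfl fun a _ => by rw [map_mul, hGz]

end Abstract

theorem sexp_add_algebraMap {W : Type} [Fintype W] [DecidableEq W] {p : W → ZMod 2} (s : Ser p)
    (c : ℂ) : sexp (s + algebraMap ℂ (Ser p) c) = Complex.exp c • sexp s := by
  have h : body (s + algebraMap ℂ (Ser p) c) = body s + c := by
    rw [← bodyHom_apply, map_add, AlgHom.commutes, bodyHom_apply]
    rfl
  ext1 m
  rw [coeff_csmul, sexp, sexp, coeff_ofCoeff, coeff_ofCoeff, h, map_add, add_sub_add_right_eq_sub,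
    Complex.exp_add, mul_comm, mul_smul]

section Setting

open Matrix
variable {U : Set (Fin N → ℝ)}
  {E : Fin N ⊕ Fin N → Fin N ⊕ Fin N → Fun N ε₀ ε₁}
  {ρ : Fun N ε₀ ε₁} {X : ℕ → Fun N ε₀ ε₁} {ω : Fin N₁ → Fin N₀ → Fun N ε₀ ε₁}
  {F : Fin N₀ → Fun N ε₀ ε₁} {e : Fin N₀ ⊕ Fin N₀ ≃ (Fin N ⊕ Fin N) ⊕ (Fin N₁ ⊕ Fin N₁)}
  {V : Opens (Fin N → ℝ)}

namespace IsSetting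

variable (S : IsSetting U E ρ X ω F e) (hV : (V : Set (Fin N → ℝ)) ⊆ U)

theorem invol_zeroing (T : Set (Fld N N₀ N₁)) (a : SF ε₀ ε₁ V) :
    invol (zeroing T a) = zeroing T (invol a) := by
  rw [← twist_one, ← twist_one, zeroing_twist]

theorem invol_eval (x : V) (a : SF ε₀ ε₁ V) :
    invol (SuperFun.eval x a) = SuperFun.eval x (invol a) := rfl

theorem invol_setZeroHom (T : Set (Fld N N₀ N₁)) (a : Ser (par (N := N) ε₀ ε₁)) :
    invol (setZeroHom T a) = setZeroHom T (invol a) := by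
  rw [setZeroHom_apply, setZeroHom_apply, ← twist_one, ← twist_one, setZero_twist]

theorem bodyHom_setZeroHom (T : Set (Fld N N₀ N₁)) (a : Ser (par (N := N) ε₀ ε₁)) :
    bodyHom _ (setZeroHom T a) = bodyHom _ a := body_setZero T a

theorem mul_mul_eq_setZero {T : Set (Fld N N₀ N₁)} {j k s a b c : Ser (par (N := N) ε₀ ε₁)}
    (hj : j = setZero T a) (hk : k = setZero T b) (hs : s = c) (hz : setZero T s = s) :
    j * k * s = setZero T (a * b * c) := by
  rw [hj, hk, ← hs, ← setZeroHom_apply T (a * b * s), map_mul, map_mul]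
  congr 1
  exact hz.symm

theorem isMat_new {s : (Fin N ⊕ Fin N) ⊕ (Fin N₁ ⊕ Fin N₁)} (r : Fin N₀ ⊕ Fin N₀) :
    IsHomog (newPar ε₀ r + extPar ε₁ s + 0)
      ((SC ε₀ ε₁ V).DR (extVar s) (S.new hV r)) := by
  have h1 : IsHomog (newPar ε₀ r) (S.new hV r) := by
    rcases r with α | α
    · exact ((S.isFn_F α).of_subset hV).isHomog
    · exact S.isHomog_dfm hV α
  have h2 := (SC ε₀ ε₁ V).isHomog_DR h1 (extVar s)
  have h3 : vPar N ε₀ ε₁ (extVar s) = extPar ε₁ s := by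
    rcases s with (i | i) | a | a <;> rfl
  rwa [h3, ← add_zero (_ + _)] at h2

theorem isMat_jac : IsMat 0 (newPar ε₀) (newPar ε₀) ((S.jac hV).submatrix id e) := fun r s => by
  rw [submatrix_apply, id_eq, ← piVars_DR_new, ← S.parity s]
  exact IsHomog.zeroing (S.isMat_new hV r) _

theorem exists_bivector : ∃ r', (∀ x : V, r'.1 x = Ring.inverse (ρ x)) ∧
    IsBivector (gammaPart ε₀ ε₁ V) (S.biv hV) (S.compatible.density.of_subset hV).toSuperFun r' :=
  S.compatible.exists_isBivector hV

theorem isMat_brk : IsMat 0 ε₀ ε₀ (S.brk hV) := fun α β => by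
  obtain ⟨r', -, hE⟩ := S.exists_bivector hV
  have h1 := isHomog_sbr (SC ε₀ ε₁ V) hE (S.isHomog_fld₀ hV α)
    (S.isHomog_con hV β)
  have h2 : ε₀ α + 1 + ε₀ β + 1 = ε₀ α + ε₀ β + 0 := by
    generalize ε₀ α = x; generalize ε₀ β = y; clear * -; decide +revert
  rw [h2] at h1
  exact h1.sub ((S.isMat_fldS hV).mul (S.isMat_om hV) α β)

/-- The matrix of extended brackets. -/
def brkExt : Matrix (Fin N₀) (Fin N₀) (SF ε₀ ε₁ V) :=
  Matrix.of fun α β => sbr (SC ε₀ ε₁ V) (S.biv hV) (S.fld hV α)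
      (S.dfm hV β) + ∑ a,
        ((SC ε₀ ε₁ V).DR (.inr (.pi a)) (S.fld hV α) *
          (SC ε₀ ε₁ V).D (.inr (.piS a)) (S.dfm hV β) -
        (SC ε₀ ε₁ V).DR (.inr (.piS a)) (S.fld hV α) *
          (SC ε₀ ε₁ V).D (.inr (.pi a)) (S.dfm hV β))

theorem isMat_brkExt : IsMat 0 ε₀ ε₀ (S.brkExt hV) := fun α β => by
  obtain ⟨r', -, hE⟩ := S.exists_bivector hV
  have hF : IsHomog (ε₀ α + 1) (S.fld hV α) := ((S.isFn_F α).of_subset hV).isHomog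
  have hG := S.isHomog_dfm hV β
  have h1 := isHomog_sbr (SC ε₀ ε₁ V) hE hF hG
  have h2 : ε₀ α + 1 + ε₀ β + 1 = ε₀ α + ε₀ β + 0 := by
    generalize ε₀ α = x; generalize ε₀ β = y; clear * -; decide +revert
  rw [h2] at h1
  refine h1.add (IsHomog.sum fun a _ => ?_)
  have h3 := (SC ε₀ ε₁ V).isHomog_DR hF (.inr (.pi a))
  have h4 := (SC ε₀ ε₁ V).isHomog_DR hF (.inr (.piS a))
  have h5 := (SC ε₀ ε₁ V).isHomog_D hG (.inr (.pi a))
  have h6 := (SC ε₀ ε₁ V).isHomog_D hG (.inr (.piS a))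
  change IsHomog (ε₀ α + 1 + ε₁ a) _ at h3
  change IsHomog (ε₀ α + 1 + (ε₁ a + 1)) _ at h4
  change IsHomog (ε₀ β + ε₁ a) _ at h5
  change IsHomog (ε₀ β + (ε₁ a + 1)) _ at h6
  have h7 : ε₀ α + 1 + ε₁ a + (ε₀ β + (ε₁ a + 1)) = ε₀ α + ε₀ β + 0 := by
    generalize ε₀ α = x; generalize ε₀ β = y; generalize ε₁ a = z; clear * -; decide +revert
  have h8 : ε₀ α + 1 + (ε₁ a + 1) + (ε₀ β + ε₁ a) = ε₀ α + ε₀ β + 0 := by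
    generalize ε₀ α = x; generalize ε₀ β = y; generalize ε₁ a = z; clear * -; decide +revert
  exact (h3.mul_of_eq h6 h7).sub (h4.mul_of_eq h5 h8)

theorem brkExt_val (x : V) : (S.brkExt hV).map (SuperFun.eval x) = bracketMatrix E X ω F x := by
  ext1 α β
  have hE : ∀ A B, IsSmooth (V : Set (Fin N → ℝ)) (E A B) := fun A B =>
    ((S.compatible.isFn A B).of_subset hV).smooth
  have hF : IsSmooth (V : Set (Fin N → ℝ)) (F α) := ((S.isFn_F α).of_subset hV).smooth
  have h : IsSmooth (V : Set (Fin N → ℝ)) (deformed X ω β) :=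
    (S.dfm hV β).smooth.congr fun y hy => by
      rw [SuperFun.ext'_apply _ ⟨y, hy⟩]
      exact (S.dfm_val hV β ⟨y, hy⟩).symm
  have h1 : sRestrict V _ h = S.dfm hV β := SuperFun.ext fun y => (S.dfm_val hV β y).symm
  rw [map_apply, brkExt, of_apply, map_add, map_sum]
  simp only [map_sub, map_mul, SuperFun.eval_apply, bracketMatrix, of_apply, bracketExt,
    Pi.add_apply, Finset.sum_apply, Pi.sub_apply, Pi.mul_apply]
  rw [bracket_apply hE hF h, h1]
  congr 1
  refine sum_congr rfl fun a _ => ?_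
  rw [rD_apply _ _ hF, rD_apply _ _ hF, lD_apply _ _ h, lD_apply _ _ h, h1]
  rfl

theorem piVars_brkExt (α β : Fin N₀) :
    zeroing piVars (S.brkExt hV α β) = S.brk hV α β := by
  rw [brkExt, of_apply, map_add, sbr]
  simp only [map_sum, map_sub, map_mul, piVars_D_pi_dfm, piVars_D_piS_dfm, mul_zero, zero_sub,
    ← DR_zeroing (gVar_ne_piVars _), ← D_zeroing (gVar_ne_piVars _), piVars_dfm,
    zeroing_piVars_of_gammaPart (S.gammaPart_biv hV _ _)]
  rw [brk, brMat, Matrix.sub_apply, of_apply, Matrix.mul_apply, sub_eq_add_neg,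
    sum_neg_distrib]
  rfl

theorem brk_val (x : V) : (S.brk hV).map (SuperFun.eval x) =
    (bracketMatrix E X ω F x).map (setZeroHom piVars) := by
  rw [← S.brkExt_val hV]
  ext1 α β
  rw [map_apply, ← piVars_brkExt]
  rfl

theorem gammaPart_jac (r : Fin N₀ ⊕ Fin N₀) (s : (Fin N ⊕ Fin N) ⊕ (Fin N₁ ⊕ Fin N₁)) :
    gammaPart ε₀ ε₁ V (S.jac hV r s) = S.jac hV r s := by
  have hz := isReduction_gammaPart ε₀ ε₁ V
  rcases r with α | α <;> rcases s with A | a | a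
  · exact (hz.DR A _).trans (congrArg _ (S.gammaPart_fld₀ hV α))
  · exact S.gammaPart_fldP hV α a
  · exact S.gammaPart_fldS hV α a
  · exact (hz.DR A _).trans (congrArg _ (S.gammaPart_con hV α))
  · change gammaPart ε₀ ε₁ V (sg (ε₁ a * (ε₁ a + ε₀ α)) • S.om hV a α) =
      sg (ε₁ a * (ε₁ a + ε₀ α)) • S.om hV a α
    rw [map_smul, gammaPart_om]
  · exact map_zero _

theorem gammaPart_brk (α β : Fin N₀) : gammaPart ε₀ ε₁ V (S.brk hV α β) = S.brk hV α β := by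
  have hz := isReduction_gammaPart ε₀ ε₁ V
  rw [brk, brMat, Matrix.sub_apply, of_apply, Matrix.mul_apply, map_sub, sbr]
  simp only [map_sum, map_mul, hz.DR, hz.D, gammaPart_fld₀, gammaPart_con, gammaPart_biv,
    gammaPart_fldS, gammaPart_om]

theorem det_fp_ne_zero (x : V) : ((S.fp hV).map (bodyAt x)).det ≠ 0 := by
  have h1 := S.isUnit_faddeevPopov x (hV x.2)
  rw [← S.fp_val hV] at h1
  have h2 := (h1.map (bodyHom (par (N := N) ε₀ ε₁)).toRingHom.mapMatrix)
  exact ((Matrix.isUnit_iff_isUnit_det _).1 h2).ne_zero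

theorem jac_body (x : V) : ((S.jac hV).submatrix id e).map (bodyAt x) =
    (jacobian X ω F e x).map (bodyHom _) := by
  have h1 : ((S.jac hV).submatrix id e).map (bodyAt x) =
      (((S.jac hV).submatrix id e).map (SuperFun.eval x)).map (bodyHom _) := rfl
  rw [h1, jac_val]
  ext r s
  exact bodyHom_setZeroHom _ _

theorem det_jac_ne_zero (x : V) : (((S.jac hV).submatrix id e).map (bodyAt x)).det ≠ 0 := by
  rw [jac_body]
  have h2 := (S.isUnit_jacobian x (hV x.2)).map (bodyHom (par (N := N) ε₀ ε₁)).toRingHom.mapMatrix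
  exact ((Matrix.isUnit_iff_isUnit_det _).1 h2).ne_zero

theorem exists_fp_inverse : ∃ D, S.fp hV * D = 1 ∧ D * S.fp hV = 1 :=
  exists_matrix_inverse even_mem_compl_gammaVars (S.gammaPart_fp hV) (S.det_fp_ne_zero hV)

theorem exists_jac_inverse : ∃ J, (S.jac hV).submatrix id e * J = 1 ∧
    J * (S.jac hV).submatrix id e = 1 :=
  exists_matrix_inverse even_mem_compl_gammaVars (fun r s => S.gammaPart_jac hV r (e s))
    (S.det_jac_ne_zero hV)

theorem isUnit_fp_block (f : ZMod 2) : IsUnit (evenBlock (S.isMat_fp hV) f).det := by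
  obtain ⟨D, h1, -⟩ := S.exists_fp_inverse hV
  exact isUnit_det_evenBlock even_mem_compl_gammaVars _ (S.gammaPart_fp hV) h1 f

theorem isUnit_jac_block (f : ZMod 2) : IsUnit (evenBlock (S.isMat_jac hV) f).det := by
  obtain ⟨J, h1, -⟩ := S.exists_jac_inverse hV
  exact isUnit_det_evenBlock even_mem_compl_gammaVars _
    (fun r s => S.gammaPart_jac hV r (e s)) h1 f

theorem isUnit_brk_block {K : Matrix (Fin N₀) (Fin N₀) (SF ε₀ ε₁ V)}
    (h : S.brk hV * K = 1) (f : ZMod 2) : IsUnit (evenBlock (S.isMat_brk hV) f).det :=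
  isUnit_det_evenBlock even_mem_compl_gammaVars _ (S.gammaPart_brk hV) h f

theorem sdet_val {l : Type} [Fintype l] [DecidableEq l] {q : l → ZMod 2}
    {M : Matrix l l (SF ε₀ ε₁ V)} (hM : IsMat 0 q q M) (hD : IsUnit (evenBlock hM 1).det) (x : V) :
    (sdet q M).1 x = sdet q (M.map (SuperFun.eval x)) :=
  (sdet_map (SuperFun.eval x) (invol_eval x) hM hD).symm

theorem sdet_jac_val (x : V) : (sdet (newPar ε₀) ((S.jac hV).submatrix id e)).1 x =
    setZero piVars (sdet (newPar ε₀) (jacobian X ω F e x)) := by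
  have hM : IsMat 0 (newPar ε₀) (newPar ε₀) (jacobian X ω F e x) := fun r s => by
    have h : IsSmooth (V : Set (Fin N → ℝ)) (newCoord X ω F r) :=
      (S.new hV r).smooth.congr fun y hy => by
        rw [SuperFun.ext'_apply _ ⟨y, hy⟩]
        exact (S.new_val hV r ⟨y, hy⟩).symm
    have h1 : sRestrict V _ h = S.new hV r := SuperFun.ext fun y => (S.new_val hV r y).symm
    rw [jacobian, of_apply, rD_apply _ _ h, h1, ← S.parity s]
    exact isHomog_iff_val.1 (S.isMat_new hV r) x
  have h2 := sdet_val _ (S.isUnit_jac_block hV 1) x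
  rw [jac_val] at h2
  have h3 := sdet_map (setZeroHom piVars) (invol_setZeroHom piVars) hM
    (isUnit_det_evenBlock_ser hM (S.isUnit_jacobian x (hV x.2)) 1)
  exact h2.trans h3

theorem sdet_brk_val {K : Matrix (Fin N₀) (Fin N₀) (SF ε₀ ε₁ V)}
    (h : S.brk hV * K = 1) (x : V) : (sdet ε₀ (S.brk hV)).1 x =
      setZero piVars (sdet ε₀ (bracketMatrix E X ω F x)) := by
  have hM : IsMat 0 ε₀ ε₀ (bracketMatrix E X ω F x) := by
    rw [← S.brkExt_val hV]
    exact fun α β => isHomog_iff_val.1 (S.isMat_brkExt hV α β) x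
  have h2 := sdet_val _ (S.isUnit_brk_block hV h 1) x
  have h5 : (bracketMatrix E X ω F x).map (bodyHom _) = (S.brk hV).map (bodyAt x) := by
    have h6 : (S.brk hV).map (bodyAt x) = ((S.brk hV).map (SuperFun.eval x)).map (bodyHom _) := rfl
    rw [h6, brk_val]
    ext a b
    exact (bodyHom_setZeroHom _ _).symm
  have bo : ∀ a : SF ε₀ ε₁ V, IsHomog 1 a → bodyAt x a = 0 :=
    fun a ha => bodyAt_of_odd x ha
  have h4 : IsUnit (evenBlock hM 1).det := by
    have h7 := map_det_oddBlock_ne_zero (bodyAt x) bo (S.isMat_brk hV) h 1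
    have h8 := map_det_evenBlock_congr (bodyHom (par (N := N) ε₀ ε₁)) (bodyAt x) hM
      (S.isMat_brk hV) h5 1
    exact isUnit_det_evenBlock_of_ne_zero hM 1 (h8.trans_ne h7)
  have h3 := sdet_map (setZeroHom piVars) (invol_setZeroHom piVars) hM h4
  rw [brk_val] at h2
  exact h2.trans h3

theorem sdet_fp_val (x : V) : (sdet ε₁ (S.fp hV)).1 x = sdet ε₁ (faddeevPopov X ω x) := by
  have h2 := sdet_val _ (S.isUnit_fp_block hV 1) x
  rw [fp_val] at h2
  exact h2

/-- The radicand as a superfunction, where the matrix of brackets is invertible. -/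
theorem exists_radicand {K : Matrix (Fin N₀) (Fin N₀) (SF ε₀ ε₁ V)}
    (h : S.brk hV * K = 1) : ∃ s : SF ε₀ ε₁ V,
      (S.compatible.density.of_subset hV).toSuperFun * sdet ε₁ (S.fp hV) ^ 2 * s = 1 ∧
      IsHomog 0 (sdet (newPar ε₀) ((S.jac hV).submatrix id e) * sdet ε₀ (S.brk hV) * s) ∧
      gammaPart ε₀ ε₁ V (sdet (newPar ε₀) ((S.jac hV).submatrix id e) * sdet ε₀ (S.brk hV) * s) =
        sdet (newPar ε₀) ((S.jac hV).submatrix id e) * sdet ε₀ (S.brk hV) * s ∧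
      (∀ x : V, bodyAt x
        (sdet (newPar ε₀) ((S.jac hV).submatrix id e) * sdet ε₀ (S.brk hV) * s) ≠ 0) ∧
      ∀ x : V, (sdet (newPar ε₀) ((S.jac hV).submatrix id e) * sdet ε₀ (S.brk hV) * s).1 x =
        radicand E ρ X ω F e x := by
  have hD := S.isUnit_fp_block hV 1
  have hJ := S.isUnit_jac_block hV 1
  have hK := S.isUnit_brk_block hV h 1
  obtain ⟨Di, hDi, -⟩ := S.exists_fp_inverse hV
  obtain ⟨Ji, hJi, -⟩ := S.exists_jac_inverse hV
  have hd := map_sdet_eq_self (gammaPart ε₀ ε₁ V) (invol_zeroing _) (S.isMat_fp hV) hD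
    (S.gammaPart_fp hV)
  have hj := map_sdet_eq_self (gammaPart ε₀ ε₁ V) (invol_zeroing _) (S.isMat_jac hV) hJ
    (fun r s => S.gammaPart_jac hV r (e s))
  have hk := map_sdet_eq_self (gammaPart ε₀ ε₁ V) (invol_zeroing _) (S.isMat_brk hV) hK
    (S.gammaPart_brk hV)
  have hr := (S.compatible.density.of_subset hV).gammaPart
  have br : ∀ x : V, bodyAt x (S.compatible.density.of_subset hV).toSuperFun ≠ 0 := fun x =>
    ((S.compatible.density_isUnit x (hV x.2)).map (bodyHom _)).ne_zero
  have bo : ∀ (x : V) (a : SF ε₀ ε₁ V), IsHomog 1 a → bodyAt x a = 0 :=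
    fun x a ha => bodyAt_of_odd x ha
  obtain ⟨s, hs, hs', hsz, h1, h2, h3⟩ := exists_quotient (gammaPart ε₀ ε₁ V) bodyAt
    (fun f hf hb => exists_inverse even_mem_compl_gammaVars hf hb)
    (S.compatible.density.of_subset hV).isHomog (isHomog_sdet (S.isMat_fp hV) hD)
    (isHomog_sdet (S.isMat_jac hV) hJ) (isHomog_sdet (S.isMat_brk hV) hK) hr hd hj hk br
    (fun x => map_sdet_ne_zero (bodyAt x) (bo x) (S.isMat_fp hV) hDi hD)
    (fun x => map_sdet_ne_zero (bodyAt x) (bo x) (S.isMat_jac hV) hJi hJ)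
    (fun x => map_sdet_ne_zero (bodyAt x) (bo x) (S.isMat_brk hV) h hK)
  refine ⟨s, hs, h1, h2, h3, fun x => ?_⟩
  have h4 : s.1 x = Ring.inverse (ρ x * sdet ε₁ (faddeevPopov X ω x) ^ 2) := by
    rw [inverse_val hs hs' x, ← S.sdet_fp_val hV]
    rfl
  have h5 : setZero piVars (s.1 x) = s.1 x :=
    congrArg (fun f : SF ε₀ ε₁ V => f.1 x)
      (zeroing_piVars_of_gammaPart hsz)
  exact mul_mul_eq_setZero (S.sdet_jac_val hV x) (S.sdet_brk_val hV h x) h4 h5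

theorem continuous_bodyAt {n : ℕ} {W : Type} [Fintype W] [DecidableEq W] {p : W → ZMod 2}
    {V : Opens (Fin n → ℝ)} (f : SuperFun V p) : Continuous fun x : V => bodyAt x f := by
  have h := (contDiffOn_body f).continuousOn.domRestrict
  refine h.congr fun x => ?_
  rw [Set.domRestrict_apply, f.ext'_apply]
  rfl

theorem det_brk_ne_zero (x : V) (hx : ∀ α, body (constraint X α x) = 0) :
    ((S.brk hV).map (bodyAt x)).det ≠ 0 := by
  have hdet := S.det_jac_ne_zero hV x
  have bo : ∀ a : SF ε₀ ε₁ V, IsHomog 1 a → bodyAt x a = 0 :=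
    fun a ha => bodyAt_of_odd x ha
  have hc : ∀ α, bodyAt x (S.con hV α) = 0 := fun α => by
    rw [bodyAt_apply, S.con_val hV, hx]
  have hGG : ∀ a g, bodyAt x (sbr (SC ε₀ ε₁ V) (S.biv hV) (S.con hV a)
      (S.con hV g)) = 0 := by
    intro a g
    obtain ⟨r', f, -, hS⟩ := S.action.exists_isQuantumAction S.compatible hV S.master
    have h := congrArg (bodyAt x) (hS.sbr_constraint a g)
    rw [map_add, map_smul, map_sum, sum_eq_zero, add_zero, map_zero] at h
    · exact (smul_eq_zero.1 h).resolve_left (sg_ne_zero _)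
    · intro b _
      rw [map_mul]
      exact mul_eq_zero_of_left (hc b) _
  have hE : ∀ y, (Matrix.of (S.biv hV)).map (bodyAt x) *ᵥ y = 0 → y = 0 := by
    have h := (S.compatible.nondegenerate x (hV x.2)).map
      (bodyHom (par (N := N) ε₀ ε₁)).toRingHom.mapMatrix
    exact fun y hy => Matrix.eq_zero_of_mulVec_eq_zero
      ((Matrix.isUnit_iff_isUnit_det _).1 h).ne_zero hy
  intro h0
  obtain ⟨v, hv, hv'⟩ := Matrix.exists_mulVec_eq_zero_iff.2 h0
  refine hv (eq_zero_of_brMat_mulVec (SC ε₀ ε₁ V) (bodyAt x) bo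
    (Fp := S.fldP hV)
    (S.isHomog_con hV) (S.isMat_om hV) (fun y hy => ?_) (fun y hy => ?_) hE hGG hv')
  · have h1 : ((S.jac hV).submatrix id e).map (bodyAt x) *ᵥ (y ∘ e) = 0 := by
      funext r
      rw [← hy]
      exact Equiv.sum_comp e fun s => bodyAt x (S.jac hV r s) * y s
    have h2 := Matrix.eq_zero_of_mulVec_eq_zero hdet h1
    funext s
    have h3 := congrFun h2 (e.symm s)
    rwa [Function.comp_apply, e.apply_symm_apply] at h3
  · refine Matrix.eq_zero_of_vecMul_eq_zero hdet ?_
    funext s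
    exact congrFun hy (e s)

theorem isOpen_det_brk : IsOpen {x : V | ((S.brk hV).map (bodyAt x)).det ≠ 0} :=
  isOpen_ne_fun (Continuous.matrix_det (continuous_matrix fun _ _ => continuous_bodyAt _))
    continuous_const

theorem exists_jac_inverse' : ∃ J' : Matrix ((Fin N ⊕ Fin N) ⊕ (Fin N₁ ⊕ Fin N₁))
    (Fin N₀ ⊕ Fin N₀) (SF ε₀ ε₁ V), S.jac hV * J' = 1 ∧ J' * S.jac hV = 1 ∧
    (∀ v s, IsHomog (extPar ε₁ v + newPar ε₀ s) (J' v s)) ∧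
    ∀ v s, gammaPart ε₀ ε₁ V (J' v s) = J' v s := by
  obtain ⟨J, h1, h2⟩ := S.exists_jac_inverse hV
  have hJ : J = (J.submatrix e.symm id).submatrix e id := by
    rw [Matrix.submatrix_submatrix, e.symm_comp_self]
    rfl
  have hM : S.jac hV = ((S.jac hV).submatrix id e).submatrix id e.symm := by
    rw [Matrix.submatrix_submatrix, e.self_comp_symm]
    rfl
  have h3 : S.jac hV * J.submatrix e.symm id = 1 := by
    rw [hM, Matrix.submatrix_mul_equiv, h1, Matrix.submatrix_id_id]
  have h4 : J.submatrix e.symm id * S.jac hV = 1 := by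
    rw [hM, ← Matrix.submatrix_mul _ _ _ id _ Function.bijective_id, h2,
      Matrix.submatrix_one_equiv]
  refine ⟨J.submatrix e.symm id, h3, h4, fun v s => ?_,
    map_inverse_matrix _ (fun r s => S.gammaPart_jac hV r s) h3 h4⟩
  have := (S.isMat_jac hV).of_inverse h1 h2 (e.symm v) s
  rwa [← S.parity, Equiv.apply_symm_apply, add_zero] at this

theorem sum_con_mul_red (k : Fin N₁) : ∑ a, S.con hV a * S.red hV a k = 0 := by
  obtain ⟨r', f, -, hS⟩ := S.action.exists_isQuantumAction S.compatible hV S.master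
  exact hS.constraint_mul_reducibility k

theorem body_con_im (α : Fin N₀) (x : V) : (bodyAt x (S.con hV α)).im = 0 := by
  rw [bodyAt_apply, S.con_val hV]
  exact S.real α x (hV x.2)

theorem con_eq_ofReal (α : Fin N₀) (x : V) :
    (((bodyAt x (S.con hV α)).re : ℝ) : ℂ) = bodyAt x (S.con hV α) :=
  Complex.ext rfl (S.body_con_im hV α x).symm

open scoped ContDiff in
/-- Functions that are stationary on the constraint surface are constant up to constraints. -/
theorem exists_division (x₀ : V) (hx₀ : ∀ α, bodyAt x₀ (S.con hV α) = 0) :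
    ∃ V' : Set (Fin N → ℝ), IsOpen V' ∧ x₀.1 ∈ V' ∧ V' ⊆ V ∧ ∀ h : (Fin N → ℝ) → ℂ,
      ContDiffOn ℝ ∞ h V' →
      (∀ x : V, x.1 ∈ V' → (∀ α, bodyAt x (S.con hV α) = 0) → fderiv ℝ h x = 0) →
      ∃ (c : ℂ) (k : Fin N₀ → (Fin N → ℝ) → ℂ), (∀ α, ContDiffOn ℝ ∞ (k α) V') ∧
        ∀ x : V, x.1 ∈ V' → h x = c + ∑ α, bodyAt x (S.con hV α) * k α x := by
  set b : Fin N₀ → (Fin N → ℝ) → ℂ := fun α x => body ((S.con hV α).ext' x) with hb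
  have hbx : ∀ α (x : V), b α x = bodyAt x (S.con hV α) := fun α x => by
    rw [hb, bodyAt_apply, ← SuperFun.ext'_apply]
  have hbs : ∀ α, ContDiffOn ℝ ∞ (b α) V := fun α => contDiffOn_body _
  let g : (Fin N → ℝ) → Fin N₀ → ℝ := fun x α => (b α x).re
  have hg : ContDiffOn ℝ ∞ g V := contDiffOn_pi.2 fun α =>
    Complex.reCLM.contDiff.comp_contDiffOn (hbs α)
  have hgb : ∀ α (x : V), ((g x α : ℝ) : ℂ) = bodyAt x (S.con hV α) := fun α x => by
    rw [← S.con_eq_ofReal hV, ← hbx]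
  let Zb : Fin N₀ → Fin N₁ → (Fin N → ℝ) → ℂ := fun α k x => body ((S.red hV α k).ext' x)
  have hZx : ∀ α k (x : V), Zb α k x = bodyAt x (S.red hV α k) := fun α k x => by
    rw [bodyAt_apply, ← SuperFun.ext'_apply]
  let A : (Fin N → ℝ) → (Fin N₀ → ℝ) →L[ℝ] (Fin N₁ → ℂ) × (Fin N₀ → ℝ) := fun x =>
    LinearMap.toContinuousLinearMap
      { toFun := fun v => (fun k => ∑ α, (v α : ℂ) * Zb α k x,
          fun α => if ε₀ α = 1 then v α else 0)
        map_add' := fun v w => by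
          ext k
          · simp [add_mul, sum_add_distrib]
          · by_cases h : ε₀ k = 1 <;> simp [h]
        map_smul' := fun c v => by
          ext k
          · simp [mul_assoc, mul_sum]
          · by_cases h : ε₀ k = 1 <;> simp [h] }
  have hA : ContinuousOn A V := by
    refine continuousOn_clm_apply.2 fun v => ContinuousOn.prodMk ?_ continuousOn_const
    exact continuousOn_pi.2 fun k => continuousOn_finsetSum _ fun α _ =>
      continuousOn_const.mul (contDiffOn_body _).continuousOn
  have hodd : ∀ α, ε₀ α = 1 → ∀ x : V, bodyAt x (S.con hV α) = 0 := fun α hα x => by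
    have h := S.isHomog_con hV α
    rw [hα] at h
    exact bodyAt_of_odd x h
  have hAg : ∀ x ∈ (V : Set (Fin N → ℝ)), A x (g x) = 0 := by
    intro x hx
    refine Prod.ext (funext fun k => ?_) (funext fun α => ?_)
    · have h := congrArg (bodyAt ⟨x, hx⟩) (S.sum_con_mul_red hV k)
      rw [map_sum, map_zero] at h
      rw [Prod.fst_zero, Pi.zero_apply, ← h]
      change ∑ α, ((g x α : ℝ) : ℂ) * Zb α k x = _
      refine sum_congr rfl fun α _ => ?_
      rw [map_mul, ← hgb, ← hZx]
    · change (if ε₀ α = 1 then g x α else 0) = 0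
      split_ifs with hα
      · exact Complex.ofReal_eq_zero.1 ((hgb α ⟨x, hx⟩).trans (hodd α hα _))
      · rfl
  have hd : ∀ α, HasFDerivAt (b α) (fderiv ℝ (b α) x₀) x₀.1 := fun α =>
    (((hbs α).contDiffAt (V.isOpen.mem_nhds x₀.2)).differentiableAt (by simp)).hasFDerivAt
  have bo : ∀ a : SF ε₀ ε₁ V, IsHomog 1 a → bodyAt x₀ a = 0 := fun a ha => bodyAt_of_odd x₀ ha
  have hbd : ∀ α i, bodyAt x₀ ((SC ε₀ ε₁ V).DR (gVar (.inl i)) (S.con hV α)) =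
      fderiv ℝ (b α) x₀ (Pi.single i 1) := fun α i => by
    rw [(SC ε₀ ε₁ V).DR_apply, map_twist_of_odd _ bo]
    exact (fderiv_body (S.con hV α) i x₀).symm
  have him : ∀ α v, (fderiv ℝ (b α) x₀ v).im = 0 := fun α v => by
    have h1 : HasFDerivAt (fun x => (b α x).im) (Complex.imCLM.comp (fderiv ℝ (b α) x₀)) x₀.1 :=
      Complex.imCLM.hasFDerivAt.comp x₀.1 (hd α)
    have h2 : (fun x => (b α x).im) =ᶠ[nhds x₀.1] fun _ => 0 := by
      filter_upwards [V.isOpen.mem_nhds x₀.2] with x hx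
      rw [hbx α ⟨x, hx⟩, S.body_con_im hV]
    exact DFunLike.congr_fun (h1.unique ((hasFDerivAt_const 0 x₀.1).congr_of_eventuallyEq h2)) v
  have hfd : ∀ (w : Fin N → ℝ) α, fderiv ℝ g x₀ w α = (fderiv ℝ (b α) x₀ w).re := by
    intro w α
    have h1 : HasFDerivAt (fun x => g x α) (Complex.reCLM.comp (fderiv ℝ (b α) x₀)) x₀.1 :=
      Complex.reCLM.hasFDerivAt.comp x₀.1 (hd α)
    have h2 : HasFDerivAt g (fderiv ℝ g x₀) x₀.1 :=
      ((hg.contDiffAt (V.isOpen.mem_nhds x₀.2)).differentiableAt (by simp)).hasFDerivAt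
    exact DFunLike.congr_fun (((hasFDerivAt_pi' (Φ := g)).1 h2 α).unique h1) w
  obtain ⟨V', h1, h2, h3, h4⟩ := exists_smooth_division V.isOpen x₀.2 hg
    (funext fun α => Complex.ofReal_eq_zero.1 ((hgb α x₀).trans (hx₀ α))) hA hAg (by
      intro v hv
      have hv1 : ∀ k, ∑ α, (v α : ℂ) * bodyAt x₀ (S.red hV α k) = 0 := fun k => by
        simp only [← hZx]
        exact congrFun (congrArg Prod.fst hv) k
      have hv2 : ∀ α, ε₀ α = 1 → v α = 0 := fun α hα => by
        have : (if ε₀ α = 1 then v α else 0) = 0 := congrFun (congrArg Prod.snd hv) α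
        rwa [if_pos hα] at this
      obtain ⟨J', hJ, -, -, -⟩ := S.exists_jac_inverse' hV
      obtain ⟨w, hw⟩ := exists_sum_map_DR_eq (SC ε₀ ε₁ V) (bodyAt x₀) bo (S.isMat_om hV) hJ hx₀
        (S.sum_con_mul_red hV) (S.det_fp_ne_zero hV x₀) (v := fun α => (v α : ℂ)) hv1
      refine ⟨fun i => (w (.inl i)).re, funext fun α => ?_⟩
      refine (hfd _ α).trans ?_
      have h6 := congrArg Complex.re (hw α)
      rw [Fintype.sum_sum_type, Complex.add_re, Complex.re_sum, Complex.ofReal_re] at h6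
      have hpar : ∀ A, IsHomog (ε₀ α + gPar A) ((SC ε₀ ε₁ V).DR (gVar A) (S.con hV α)) := fun A => by
        have := (SC ε₀ ε₁ V).isHomog_DR (S.isHomog_con hV α) (gVar A)
        rwa [vPar_gVar] at this
      rw [apply_eq_sum_single, Complex.re_sum]
      rcases zmod2_cases (ε₀ α) with hα | hα
      · rw [← h6, sum_eq_zero (f := fun i => _ * w (.inr i)), Complex.zero_re, add_zero]
        · refine sum_congr rfl fun i _ => ?_
          rw [hbd, Complex.mul_re, Complex.mul_re, him, zero_mul, mul_zero, sub_zero, sub_zero,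
            Complex.ofReal_re, mul_comm]
        · intro i _
          have := hpar (.inr i)
          rw [hα] at this
          rw [bo _ this, zero_mul]
      · rw [hv2 α hα]
        refine sum_eq_zero fun i _ => ?_
        have := hpar (.inl i)
        rw [hα] at this
        rw [← hbd, bo _ this, mul_zero, Complex.zero_re])
  refine ⟨V', h1, h2, h3, fun h hh h0 => ?_⟩
  obtain ⟨c, k, hk, hk'⟩ := h4 h hh fun x hx hgx => h0 ⟨x, h3 hx⟩ hx fun α => by
    rw [← hgb, show g x = 0 from hgx]; rfl
  refine ⟨c, fun α x => k x (Pi.single α 1), fun α => hk.clm_apply contDiffOn_const, fun x hx => ?_⟩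
  rw [hk' x hx]
  congr 1
  rw [apply_eq_sum_single]
  exact sum_congr rfl fun α _ => by rw [hgb]

open scoped ContDiff in
set_option maxHeartbeats 1000000 in
/-- A function on `Γ` whose antibrackets with the constraints vanish on shell is constant on shell. -/
theorem eq_const_add_constraint
    (hdiv : ∀ h : (Fin N → ℝ) → ℂ, ContDiffOn ℝ ∞ h V →
      (∀ x : V, (∀ α, bodyAt x (S.con hV α) = 0) → fderiv ℝ h x = 0) →
      ∃ (c : ℂ) (k : Fin N₀ → (Fin N → ℝ) → ℂ), (∀ α, ContDiffOn ℝ ∞ (k α) V) ∧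
        ∀ x : V, h x = c + ∑ α, bodyAt x (S.con hV α) * k α x)
    {K : Matrix (Fin N₀) (Fin N₀) (SF ε₀ ε₁ V)} (hK : S.brk hV * K = 1) {f : SF ε₀ ε₁ V}
    (hf0 : IsHomog 0 f) (hfz : gammaPart ε₀ ε₁ V f = f)
    (hf : ∀ β, ∃ k : Fin N₀ → SF ε₀ ε₁ V,
      sbr (SC ε₀ ε₁ V) (S.biv hV) f (S.con hV β) = ∑ α, S.con hV α * k α) :
    ∃ (c : ℂ) (k : Fin N₀ → SF ε₀ ε₁ V), (∀ α, IsHomog (ε₀ α) (k α)) ∧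
      (∀ α, gammaPart ε₀ ε₁ V (k α) = k α) ∧
      f = algebraMap ℂ (SF ε₀ ε₁ V) c + ∑ α, S.con hV α * k α := by
  have hz := isReduction_gammaPart (N := N) ε₀ ε₁ V
  have hG := S.isHomog_con hV
  have hGz := S.gammaPart_con hV
  obtain ⟨Q, iQ, aQ, sQ, φ, hφ, hφ0⟩ := exists_superQuotient hG
  have hφG : ∀ a, φ (S.con hV a) = 0 := fun a => (hφ0 _).2 ⟨Pi.single a 1, by
    rw [sum_eq_single a (fun b _ hb => by rw [Pi.single_eq_of_ne hb, mul_zero]) (by simp),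
      Pi.single_eq_same, mul_one]⟩
  have hsum : ∀ u : Fin N₀ → SF ε₀ ε₁ V, φ (∑ a, S.con hV a * u a) = 0 :=
    fun u => (hφ0 _).2 ⟨u, rfl⟩
  have hGG : ∀ a g, φ (sbr (SC ε₀ ε₁ V) (S.biv hV) (S.con hV a) (S.con hV g)) = 0 := fun a g => by
    obtain ⟨r', f, -, hS⟩ := S.action.exists_isQuantumAction S.compatible hV S.master
    have := congrArg φ (eq_neg_of_add_eq_zero_left (hS.sbr_constraint a g))
    rw [map_smul, map_neg] at this
    refine (smul_eq_zero.1 (this.trans ?_)).resolve_left (sg_ne_zero _)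
    rw [neg_eq_zero, map_sum]
    exact sum_eq_zero fun b _ => by
      rw [map_mul]
      exact mul_eq_zero_of_left (hφG b) _
  have hφs : ∀ f, φ f = 0 → ∀ g, φ (sbr (SC ε₀ ε₁ V) (S.biv hV) f (S.con hV g)) = 0 :=
    fun f hf g => map_sbr_of_map_eq_zero (SC ε₀ ε₁ V) hG hφG hφ hφ0 hGG hf g
  obtain ⟨J', -, hJ, hJ0, hJz⟩ := S.exists_jac_inverse' hV
  have hP : ∀ f, (∀ g, φ (sbr (SC ε₀ ε₁ V) (S.biv hV) f (S.con hV g)) = 0) → ∀ A,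
      φ ((SC ε₀ ε₁ V).DR (gVar A) f) = ∑ g, φ (∑ C, (SC ε₀ ε₁ V).DR (gVar C) f *
        J' (.inl C) (.inr g)) * φ ((SC ε₀ ε₁ V).DR (gVar A) (S.con hV g)) :=
    fun f hf A => map_DR_of_sbr (SC ε₀ ε₁ V) hGG hJ hK hf A
  have hfG : ∀ g, φ (sbr (SC ε₀ ε₁ V) (S.biv hV) f (S.con hV g)) = 0 := fun g =>
    (hφ0 _).2 (hf g)
  set u : Fin N₀ → SF ε₀ ε₁ V := fun g => ∑ C, (SC ε₀ ε₁ V).DR (gVar C) f *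
    J' (.inl C) (.inr g) with hu
  set f1 : SF ε₀ ε₁ V := f - ∑ g, u g * S.con hV g with hf1
  have h1D : ∀ A, φ ((SC ε₀ ε₁ V).D (gVar A) f1) = 0 := fun A =>
    map_DR_sub_sum (SC ε₀ ε₁ V) hφG hφ A (hP f hfG A)
  have h1z : gammaPart ε₀ ε₁ V f1 = f1 := by
    simp only [hf1, hu, map_sub, map_sum, map_mul, hz.DR, hfz, hJz, hGz]
  have h1φ : φ f1 = φ f := by
    rw [hf1, map_sub, map_sum, sum_eq_zero, sub_zero]
    intro g _
    rw [map_mul, hφG, mul_zero]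
  have h10 : IsHomog 0 f1 := by
    refine hf0.sub (IsHomog.sum fun g _ => ?_)
    have hug : IsHomog (ε₀ g) (u g) := IsHomog.sum fun C _ => by
      refine ((SC ε₀ ε₁ V).isHomog_DR hf0 (gVar C)).mul_of_eq (hJ0 (.inl C) (.inr g)) ?_
      change 0 + vPar N ε₀ ε₁ (gVar C) + (gPar C + ε₀ g) = ε₀ g
      rw [vPar_gVar, zero_add, ← add_assoc, CharTwo.add_self_eq_zero, zero_add]
    exact hug.mul_of_eq (hG g) (CharTwo.add_self_eq_zero _)
  clear_value f1
  obtain ⟨c, k, hk, hck⟩ := hdiv (fun x => body (f1.ext' x)) (contDiffOn_body f1) (by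
    intro x hx
    ext v
    rw [apply_eq_sum_single, _root_.zero_apply]
    refine sum_eq_zero fun i _ => ?_
    obtain ⟨k, hk⟩ := (hφ0 _).1 (h1D (.inl i))
    have h2 := congrArg (bodyAt x) hk
    rw [map_sum, sum_eq_zero fun a _ => by rw [map_mul, hx, zero_mul]] at h2
    rw [fderiv_body]
    exact mul_eq_zero_of_right _ h2)
  set κ : Fin N₀ → SF ε₀ ε₁ V := fun α => if ε₀ α = 0 then scal (k α) (hk α) else 0 with hκ
  have hκ0 : ∀ α, IsHomog (ε₀ α) (κ α) := fun α => by
    rw [hκ]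
    dsimp only
    split_ifs with h
    · rw [h]; exact isHomog_scal _ _
    · exact IsHomog.zero _
  have hκz : ∀ α, gammaPart ε₀ ε₁ V (κ α) = κ α := fun α => by
    rw [hκ]
    dsimp only
    split_ifs with h
    · exact zeroing_scal _ _ _
    · exact map_zero _
  have hκb : ∀ α (x : V), bodyAt x (S.con hV α * κ α) = bodyAt x (S.con hV α) * k α x := by
    intro α x
    rw [map_mul, hκ]
    dsimp only
    split_ifs with h
    · rw [bodyAt_apply _ (scal _ _), scal_val, body_algebraMap]
    · have h1 := hG α
      rw [(zmod2_cases _).resolve_left h] at h1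
      rw [bodyAt_of_odd x h1, zero_mul, zero_mul]
  set f2 : SF ε₀ ε₁ V := f1 - algebraMap ℂ _ c - ∑ α, S.con hV α * κ α with hf2
  have h2 : f2 ∈ superGE V (par (N := N) ε₀ ε₁) (0 + 1) := mem_superGE_one_iff.2 fun x => by
    change bodyAt x f2 = 0
    have h3 : bodyAt x f1 = _ := (congrArg body (f1.ext'_apply x).symm).trans (hck x)
    rw [hf2, map_sub, map_sub, h3, AlgHom.commutes, map_sum, sum_congr rfl fun α _ => hκb α x]
    exact sub_eq_zero.2 (add_sub_cancel_left _ _)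
  have h2φ : φ f2 = φ (f - algebraMap ℂ _ c) := by
    rw [hf2, map_sub φ (f1 - _), hsum, sub_zero, map_sub φ f1, map_sub φ f, h1φ]
  have h2G : ∀ g, φ (sbr (SC ε₀ ε₁ V) (S.biv hV) f2 (S.con hV g)) = 0 := fun g => by
    have h3 := hφs (f2 - (f - algebraMap ℂ _ c)) (by rw [map_sub φ f2, h2φ, sub_self]) g
    rw [sbr_sub_left _ f2, sbr_sub_left _ f, sbr_algebraMap_left, sub_zero, map_sub, hfG,
      sub_zero] at h3
    exact h3
  have h20 : IsHomog 0 f2 := (h10.sub (IsHomog.algebraMap _)).sub (IsHomog.sum fun α _ =>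
    (hG α).mul_of_eq (hκ0 α) (CharTwo.add_self_eq_zero _))
  have h2z : gammaPart ε₀ ε₁ V f2 = f2 := by
    simp only [hf2, map_sub, map_sum, map_mul, h1z, hκz, hGz, AlgHom.commutes]
  have h3 := map_eq_zero_of_mem_superGE hG hGz (fun A g => hJ0 (.inl A) (.inr g))
    (fun A g => hJz (.inl A) (.inr g)) hφG hφ hφs hP (oddCard (par (N := N) ε₀ ε₁)) (by omega) h2 h20
    h2z h2G
  rw [h2φ] at h3
  obtain ⟨k, hk⟩ := (hφ0 _).1 h3
  obtain ⟨k, h4, h5, h6⟩ := exists_homog_coeff hz hG hGz (hf0.sub (IsHomog.algebraMap _))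
    (by rw [map_sub, hfz, AlgHom.commutes]) hk
  exact ⟨c, k, h4, h5, by rw [← h6, add_sub_cancel]⟩

theorem bodyAt_con (α : Fin N₀) (x : V) :
    bodyAt x (S.con hV α) = body (constraint X α x) := by
  rw [bodyAt_apply, S.con_val hV]

/-! ### The local formula -/

theorem jacobi_con (a g b : Fin N₀) :
    sg ((ε₀ a + 1 + 1) * (ε₀ b + 1)) • sbr (SC ε₀ ε₁ V) (S.biv hV) (S.fld₀ hV a)
        (sbr (SC ε₀ ε₁ V) (S.biv hV) (S.con hV g) (S.con hV b)) +
      sg ((ε₀ g + 1) * (ε₀ a + 1 + 1)) • sbr (SC ε₀ ε₁ V) (S.biv hV) (S.con hV g)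
        (sbr (SC ε₀ ε₁ V) (S.biv hV) (S.con hV b) (S.fld₀ hV a)) +
      sg ((ε₀ b + 1) * (ε₀ g + 1)) • sbr (SC ε₀ ε₁ V) (S.biv hV) (S.con hV b)
        (sbr (SC ε₀ ε₁ V) (S.biv hV) (S.fld₀ hV a) (S.con hV g)) = 0 := by
  let U₀ : Opens (Fin N → ℝ) := ⟨U, S.isOpen⟩
  have hU₀ : (U₀ : Set (Fin N → ℝ)) ⊆ U := subset_rfl
  have hG : ∀ α, IsFn U gammaVars (ε₀ α) (S.con hU₀ α).ext' := fun α =>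
    isFn_ext' (S.isHomog_con hU₀ α) (S.gammaPart_con hU₀ α)
  have hF : ∀ α, IsFn U gammaVars (ε₀ α + 1) (S.fld₀ hU₀ α).ext' := fun α =>
    isFn_ext' (S.isHomog_fld₀ hU₀ α) (S.gammaPart_fld₀ hU₀ α)
  have hGV : ∀ α, ((hG α).of_subset hV).toSuperFun = S.con hV α := fun α => SuperFun.ext fun x => by
    rw [IsFn.toSuperFun_val, SuperFun.ext'_apply _ (⟨x, hV x.2⟩ : U₀), S.con_val, S.con_val]
  have hFV : ∀ α, ((hF α).of_subset hV).toSuperFun = S.fld₀ hV α := fun α => SuperFun.ext fun x => by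
    rw [IsFn.toSuperFun_val, SuperFun.ext'_apply _ (⟨x, hV x.2⟩ : U₀)]
    rfl
  have h := S.compatible.jacobi_superFun hV (hF a) (hG g) (hG b)
  rw [hFV, hGV, hGV] at h
  exact h

set_option maxHeartbeats 1000000 in
theorem exists_sbr_eq {K : Matrix (Fin N₀) (Fin N₀) (SF ε₀ ε₁ V)}
    (hK1 : S.brk hV * K = 1) (hK2 : K * S.brk hV = 1) {s L : SF ε₀ ε₁ V}
    (hs : (S.compatible.density.of_subset hV).toSuperFun * sdet ε₁ (S.fp hV) ^ 2 * s = 1)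
    (hL0 : IsHomog 0 L) (hLz : gammaPart ε₀ ε₁ V L = L)
    (hL : superExp ((2 : ℂ) • L) =
      sdet (newPar ε₀) ((S.jac hV).submatrix id e) * sdet ε₀ (S.brk hV) * s)
    (hu : IsUnit (sdet (newPar ε₀) ((S.jac hV).submatrix id e) * sdet ε₀ (S.brk hV) * s))
    (b : Fin N₀) :
    ∃ k : Fin N₀ → SF ε₀ ε₁ V, sbr (SC ε₀ ε₁ V) (S.biv hV)
      (gammaPart ε₀ ε₁ V (S.act hV 1) + L) (S.con hV b) = ∑ a, S.con hV a * k a := by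
  obtain ⟨r', f, -, hS⟩ := S.action.exists_isQuantumAction S.compatible hV S.master
  obtain ⟨J', hJ1, hJ2, -, -⟩ := S.exists_jac_inverse' hV
  obtain ⟨D, hD1, hD2⟩ := S.exists_fp_inverse hV
  have hτg : ∀ A, (SC ε₀ ε₁ V).D (gVar A) (superVar V (par (N := N) ε₀ ε₁) (.lamS b)) = 0 :=
    fun A => by
      rw [D_superVar, if_neg (gVar_ne A _ (lamS_notMem b))]
  have hτ1 : (SC ε₀ ε₁ V).D (.inr (.lamS b)) (superVar V (par (N := N) ε₀ ε₁) (.lamS b)) = 1 := by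
    rw [D_superVar, if_pos rfl]
  obtain ⟨k, -, hk⟩ := hS.exists_sbr_eq hτg hτ1 (isHomog_superVar _)
    (fun a g => S.jacobi_con hV a g b) (S.isHomog_fld₀ hV) (S.isMat_fldS hV) (S.isMat_om hV)
    S.parity (J := S.jac hV) rfl (K := S.brk hV) rfl (D := S.fp hV) rfl (S.isMat_jac hV)
    (S.isMat_brk hV) (S.isMat_fp hV) (S.isUnit_jac_block hV 1) (S.isUnit_brk_block hV hK1 1)
    (S.isUnit_fp_block hV 1) hJ1 hJ2 hK1 hK2 hD1 hD2 hs hLz hu (fun A => by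
      rw [← hL]
      exact D_superExp (hL0.smul _) _)
  exact ⟨k, hk⟩

theorem brk_map_bodyAt (x : V) : (S.brk hV).map (bodyAt x) =
    ((bracketMatrix E X ω F x).map (setZeroHom piVars)).map (bodyHom _) :=
  congrArg (fun M => M.map (bodyHom _)) (S.brk_val hV x)

theorem exists_local (S : IsSetting U E ρ X ω F e) {x₀ : Fin N → ℝ} (hx₀ : x₀ ∈ onShell U X) :
    ∃ V : Opens (Fin N → ℝ), x₀ ∈ V ∧ (V : Set (Fin N → ℝ)) ⊆ U ∧
      ∃ (L : SF ε₀ ε₁ V) (c : ℂ) (k : Fin N₀ → SF ε₀ ε₁ V), IsHomog 0 L ∧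
        gammaPart ε₀ ε₁ V L = L ∧ (∀ α, IsHomog (ε₀ α) (k α)) ∧
        (∀ α, gammaPart ε₀ ε₁ V (k α) = k α) ∧ ∀ x : V,
          sexp ((2 : ℂ) • L.1 x) = radicand E ρ X ω F e x ∧
          quantumCorrection X x + L.1 x =
            algebraMap ℂ (Ser (par (N := N) ε₀ ε₁)) c + ∑ α, constraint X α x * (k α).1 x := by
  let U₀ : Opens (Fin N → ℝ) := ⟨U, S.isOpen⟩
  have hU₀ : (U₀ : Set (Fin N → ℝ)) ⊆ U := subset_rfl
  let V₁ : Opens (Fin N → ℝ) := ⟨Subtype.val '' {x : U₀ | ((S.brk hU₀).map (bodyAt x)).det ≠ 0},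
    U₀.isOpen.isOpenMap_subtype_val _ (S.isOpen_det_brk hU₀)⟩
  have hV₁ : (V₁ : Set (Fin N → ℝ)) ⊆ U := by
    rintro _ ⟨x, -, rfl⟩
    exact x.2
  have hdet : ∀ {V : Opens (Fin N → ℝ)} (hV : (V : Set (Fin N → ℝ)) ⊆ U),
      (V : Set (Fin N → ℝ)) ⊆ V₁ → ∃ K, S.brk hV * K = 1 ∧ K * S.brk hV = 1 := fun hV hV' =>
    exists_matrix_inverse even_mem_compl_gammaVars (S.gammaPart_brk hV) fun x => by
      obtain ⟨y, hy, hyx⟩ := hV' x.2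
      have h1 : ((S.brk hU₀).map (bodyAt y)).det ≠ 0 := hy
      rw [brk_map_bodyAt, hyx] at h1
      rwa [brk_map_bodyAt]
  have hx₁ : x₀ ∈ V₁ := ⟨⟨x₀, hx₀.1⟩, S.det_brk_ne_zero hU₀ _ hx₀.2, rfl⟩
  obtain ⟨K₁, hK₁, -⟩ := hdet hV₁ subset_rfl
  obtain ⟨s₁, -, -, -, hr₁, hr₁'⟩ := S.exists_radicand hV₁ hK₁
  set r₁ := sdet (newPar ε₀) ((S.jac hV₁).submatrix id e) * sdet ε₀ (S.brk hV₁) * s₁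
  clear_value r₁
  have hrc : Continuous fun x : V₁ => bodyAt x r₁ / bodyAt ⟨x₀, hx₁⟩ r₁ :=
    (continuous_bodyAt r₁).div_const _
  let V₂ : Opens (Fin N → ℝ) := ⟨Subtype.val ''
    {x : V₁ | bodyAt x r₁ / bodyAt ⟨x₀, hx₁⟩ r₁ ∈ Complex.slitPlane},
    V₁.isOpen.isOpenMap_subtype_val _ (Complex.isOpen_slitPlane.preimage hrc)⟩
  have hV₂₁ : (V₂ : Set (Fin N → ℝ)) ⊆ V₁ := by
    rintro _ ⟨x, -, rfl⟩
    exact x.2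
  have hx₂ : x₀ ∈ V₂ := ⟨⟨x₀, hx₁⟩, by
    rw [Set.mem_ofPred_eq, div_self (hr₁ _)]
    exact Complex.one_mem_slitPlane, rfl⟩
  have hV₂ := hV₂₁.trans hV₁
  obtain ⟨V', hV', hxV', hV'₂, hdiv⟩ := S.exists_division hV₂ ⟨x₀, hx₂⟩ fun α => by
    rw [bodyAt_con]
    exact hx₀.2 α
  let V : Opens (Fin N → ℝ) := ⟨V', hV'⟩
  have hV : (V : Set (Fin N → ℝ)) ⊆ U := hV'₂.trans hV₂
  obtain ⟨K, hK1, hK2⟩ := hdet hV (hV'₂.trans hV₂₁)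
  obtain ⟨s, hs, hr0, hrz, hrb, hrv⟩ := S.exists_radicand hV hK1
  have hlog : ∀ x : V, bodyAt x (sdet (newPar ε₀) ((S.jac hV).submatrix id e) *
      sdet ε₀ (S.brk hV) * s) / bodyAt ⟨x₀, hx₁⟩ r₁ ∈ Complex.slitPlane := fun x => by
    obtain ⟨y, hy, hyx⟩ := hV'₂ x.2
    have hy' : bodyAt y r₁ / bodyAt ⟨x₀, hx₁⟩ r₁ ∈ Complex.slitPlane := hy
    rwa [bodyAt_apply, hr₁', hyx, ← hrv, ← bodyAt_apply] at hy'
  obtain ⟨L₀, hL0, hLz, hL⟩ := exists_log even_mem_compl_gammaVars hr0 hrz (hr₁ _) hlog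
  obtain ⟨g, hg1, hg2⟩ := exists_inverse even_mem_compl_gammaVars hrz hrb
  have h2L : (2 : ℂ) • (2⁻¹ : ℂ) • L₀ = L₀ := by
    rw [smul_smul, mul_inv_cancel₀ two_ne_zero, one_smul]
  have hL' : gammaPart ε₀ ε₁ V ((2⁻¹ : ℂ) • L₀) = (2⁻¹ : ℂ) • L₀ := by
    rw [map_smul]
    exact congrArg _ hLz
  have hf := S.exists_sbr_eq hV hK1 hK2 hs (hL0.smul (2⁻¹ : ℂ)) hL' (by rw [h2L, hL])
    ⟨⟨_, g, hg1, hg2⟩, rfl⟩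
  have hH : IsHomog 0 (gammaPart ε₀ ε₁ V (S.act hV 1)) :=
    (isReduction_gammaPart ε₀ ε₁ V).isHomog (S.isHomog_act hV 1)
  obtain ⟨c, k, hk0, hkz, hfk⟩ := S.eq_const_add_constraint hV (fun h hh hh' => by
      obtain ⟨c, k, hk, hck⟩ := hdiv h hh fun x hx hxc => hh' ⟨x, hx⟩ fun α => by
        rw [bodyAt_con]
        exact (S.bodyAt_con hV₂ α x).symm.trans (hxc α)
      refine ⟨c, k, hk, fun x => (hck ⟨x, hV'₂ x.2⟩ x.2).trans ?_⟩
      simp only [bodyAt_con]) hK1 (hH.add (hL0.smul (2⁻¹ : ℂ)))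
    (by rw [map_add, hL', (isReduction_gammaPart ε₀ ε₁ V).idem]) hf
  refine ⟨V, hxV', hV, _, c, k, hL0.smul _, hL', hk0, hkz, fun x => ⟨?_, ?_⟩⟩
  · rw [← hrv, ← hL, superExp_val, ← congrArg (fun f : SF ε₀ ε₁ V => f.1 x) h2L]
    rfl
  · rw [← S.gammaPart_act_one_val hV]
    have h := congrArg (SuperFun.eval x) hfk
    simp only [map_add, map_sum, map_mul, AlgHom.commutes] at h
    simp only [SuperFun.eval_apply, S.con_val hV] at h
    exact h

theorem exists_isFn_local (S : IsSetting U E ρ X ω F e) {x₀ : Fin N → ℝ} (hx₀ : x₀ ∈ onShell U X) :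
    ∃ V : Set (Fin N → ℝ), IsOpen V ∧ x₀ ∈ V ∧ V ⊆ U ∧
      ∃ c₀ : ℂ, (∀ y ∈ V, y ∈ onShell U X →
        Complex.exp (2 * body (quantumCorrection X y)) * body (radicand E ρ X ω F e y) =
          Complex.exp (2 * c₀)) ∧
      ∀ c : ℂ, Complex.exp (2 * c) = Complex.exp (2 * c₀) →
        ∃ (L : Fun N ε₀ ε₁) (k : Fin N₀ → Fun N ε₀ ε₁),
        IsFn V gammaVars 0 L ∧ (∀ α, IsFn V gammaVars (ε₀ α) (k α)) ∧
        ∀ y ∈ V, sexp (2 * L y) = radicand E ρ X ω F e y ∧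
          quantumCorrection X y =
            algebraMap ℂ (Ser (par (N := N) ε₀ ε₁)) c - L y + ∑ α, constraint X α y * k α y := by
  obtain ⟨V, hxV, hV, L, c₀, k, hL0, hLz, hk0, hkz, h⟩ := S.exists_local hx₀
  refine ⟨V, V.isOpen, hxV, hV, c₀, fun y hy hys => ?_, fun c hc => ?_⟩
  · obtain ⟨h1, h2⟩ := h ⟨y, hy⟩
    have h3 := congrArg (bodyHom (par (N := N) ε₀ ε₁)) h2
    rw [map_add, map_add, AlgHom.commutes, map_sum, sum_eq_zero fun α _ => by
      rw [map_mul, bodyHom_apply, hys.2 α, zero_mul], add_zero] at h3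
    have h4 : body ((2 : ℂ) • L.1 ⟨y, hy⟩) = 2 * body (L.1 ⟨y, hy⟩) :=
      map_smul (bodyHom _) _ _
    rw [← h1, body_sexp, h4, ← Complex.exp_add, ← mul_add]
    exact congrArg (fun z => Complex.exp (2 * z)) h3
  · have hc' : Complex.exp (2 * (c - c₀)) = 1 := by
      rw [mul_sub, Complex.exp_sub, hc, div_self (Complex.exp_ne_zero _)]
    refine ⟨(L + algebraMap ℂ (SF ε₀ ε₁ V) (c - c₀)).ext', fun α => (k α).ext',
      isFn_ext' (hL0.add (isHomog_zero_iff.2 (AlgHom.commutes _ _))) ?_,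
      fun α => isFn_ext' (hk0 α) (hkz α), fun y hy => ?_⟩
    · rw [map_add, AlgHom.commutes]
      exact congrArg (· + _) hLz
    · have h5 : (L + algebraMap ℂ (SF ε₀ ε₁ V) (c - c₀)).ext' y =
          L.1 ⟨y, hy⟩ + algebraMap ℂ (Ser (par (N := N) ε₀ ε₁)) (c - c₀) :=
        SuperFun.ext'_apply _ ⟨y, hy⟩
      obtain ⟨h1, h2⟩ := h ⟨y, hy⟩
      constructor
      · have h6 : (2 : Ser (par (N := N) ε₀ ε₁)) * (L.1 ⟨y, hy⟩ +
            algebraMap ℂ (Ser (par (N := N) ε₀ ε₁)) (c - c₀)) =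
            (2 : ℂ) • L.1 ⟨y, hy⟩ +
              algebraMap ℂ (Ser (par (N := N) ε₀ ε₁)) (2 * (c - c₀)) := by
          rw [Algebra.smul_def, map_ofNat, map_mul, map_ofNat, mul_add]
        rw [h5, h6, sexp_add_algebraMap, hc', one_smul, h1]
      · have h7 : ∀ α, (k α).ext' y = (k α).1 ⟨y, hy⟩ := fun α =>
          SuperFun.ext'_apply _ ⟨y, hy⟩
        simp only [h7]
        rw [h5, eq_sub_of_add_eq h2, map_sub]
        abel

end IsSetting

end Setting

end

end BV

open BV in
theorem mainTheorem2 (N N₀ N₁ : ℕ) (ε₀ : Fin N₀ → ZMod 2) (ε₁ : Fin N₁ → ZMod 2)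
    (U : Set (Fin N → ℝ)) (hU : IsOpen U)
    (E : Fin N ⊕ Fin N → Fin N ⊕ Fin N → Fun N ε₀ ε₁) (ρ : Fun N ε₀ ε₁)
    (hE : IsCompatible U E ρ)
    (X : ℕ → Fun N ε₀ ε₁) (hX : IsMinAction U X) (hQME : QuantumMasterEquation U E ρ X)
    (hreal : ∀ α, ∀ x ∈ U, (body (constraint X α x)).im = 0)
    (ω : Fin N₁ → Fin N₀ → Fun N ε₀ ε₁)
    (hω : ∀ a α, IsFn U gammaVars (ε₀ α + ε₁ a) (ω a α))
    (hΔ : ∀ x ∈ U, IsUnit (faddeevPopov X ω x))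
    (F : Fin N₀ → Fun N ε₀ ε₁) (hF : ∀ α, IsFn U extVars (ε₀ α + 1) (F α))
    (e : Fin N₀ ⊕ Fin N₀ ≃ (Fin N ⊕ Fin N) ⊕ (Fin N₁ ⊕ Fin N₁))
    (he : ∀ r, extPar ε₁ (e r) = newPar ε₀ r)
    (hcoord : ∀ x ∈ U, IsUnit (jacobian X ω F e x)) :
    ∀ T ⊆ onShell U X, IsPreconnected T → ∃ c : ℂ, ∀ x ∈ T,
      ∃ V : Set (Fin N → ℝ), IsOpen V ∧ x ∈ V ∧ V ⊆ U ∧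
      ∃ (L : Fun N ε₀ ε₁) (k : Fin N₀ → Fun N ε₀ ε₁),
        IsFn V gammaVars 0 L ∧ (∀ α, IsFn V gammaVars (ε₀ α) (k α)) ∧
        ∀ y ∈ V, sexp (2 * L y) = radicand E ρ X ω F e y ∧
          quantumCorrection X y =
            algebraMap ℂ (Ser (par (N := N) ε₀ ε₁)) c - L y + ∑ α, constraint X α y * k α y := by

  have S : IsSetting U E ρ X ω F e :=
    ⟨hU, hE, hX, hQME, hreal, hω, hΔ, hF, he, hcoord⟩
  intro T hT hTc
  rcases T.eq_empty_or_nonempty with rfl | ⟨x₁, hx₁⟩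
  · exact ⟨0, fun x hx => hx.elim⟩
  have hloc : ∀ x ∈ T, ∃ V : Set (Fin N → ℝ), IsOpen V ∧ x ∈ V ∧ ∀ y ∈ V ∩ T,
      Complex.exp (2 * body (quantumCorrection X y)) * body (radicand E ρ X ω F e y) =
      Complex.exp (2 * body (quantumCorrection X x)) * body (radicand E ρ X ω F e x) := by
    intro x hx
    obtain ⟨V, hVo, hxV, -, c₀, h, -⟩ := S.exists_isFn_local (hT hx)
    exact ⟨V, hVo, hxV, fun y hy => (h y hy.1 (hT hy.2)).trans (h x hxV (hT hx)).symm⟩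
  have hconst : ∀ x ∈ T,
      Complex.exp (2 * body (quantumCorrection X x)) * body (radicand E ρ X ω F e x) =
      Complex.exp (2 * body (quantumCorrection X x₁)) * body (radicand E ρ X ω F e x₁) := by
    intro x hx
    have := isPreconnected_iff_preconnectedSpace.1 hTc
    refine (IsLocallyConstant.apply_eq_of_preconnectedSpace (f := fun x : T =>
      Complex.exp (2 * body (quantumCorrection X x)) * body (radicand E ρ X ω F e x))
      ((IsLocallyConstant.iff_exists_open _).2 fun y => ?_) ⟨x, hx⟩ ⟨x₁, hx₁⟩ :)
    obtain ⟨V, hVo, hyV, h⟩ := hloc y y.2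
    exact ⟨Subtype.val ⁻¹' V, hVo.preimage continuous_subtype_val, hyV,
      fun z hz => h z ⟨hz, z.2⟩⟩
  obtain ⟨V, -, hxV, -, c, hc, -⟩ := S.exists_isFn_local (hT hx₁)
  refine ⟨c, fun x hx => ?_⟩
  obtain ⟨V', hVo, hxV', hVU, c₀, h, hV'⟩ := S.exists_isFn_local (hT hx)
  refine ⟨V', hVo, hxV', hVU, hV' c ?_⟩
  rw [← hc x₁ hxV (hT hx₁), ← h x hxV' (hT hx), hconst x hx]
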